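/- **Setting.** Let $Y$ be a complex space (or the topological restriction of one to a subset, such as a Stein compact set), let $A$ be a partially ordered set (for instance the simplices of a simplicial scheme, ordered by inclusion), and let $W_*=(W_a)_{a\in A}$ be a system of spaces over $Y$, with transition maps $W_b\to W_a$ over $Y$ for $a\le b$, such that each $W_a$ is smooth over $Y$; that is, $W_a\to Y$ is locally the restriction to a subset of a projection $Y\times\mathbb C^d\to Y$ (the $W_a$ may be Stein compact sets). Let $\mathcal R_*$ be a free DG algebra over $\mathcal O_{W_*}$: a graded-commutative DG $\mathcal O_{W_*}$-algebra which as a graded algebra is the symmetric algebra of a graded free $\mathcal O_{W_*}$-module in degrees $<0$. This is the case for a free extended resolvent $(X_*,W_*,\mathcal R_*,\mathcal B_*)$ of a morphism of complex spaces $X\to Y$, in which $\mathcal R_*$ is moreover a resolution of $\mathcal O_{X_*}$. Let $\mathcal S_*=\mathcal R_*\tilde\otimes_{\mathcal O_Y}\mathcal R_*$ be the enveloping algebra, restricted topologically to the diagonal, i.e. $\mathcal S_*=\mathcal O_{W_*\times_YW_*}|_{W_*}\otimes_{\mathcal O_{W_*}\otimes\mathcal O_{W_*}}(\mathcal R_*\otimes\mathcal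 R_*)$, let $\mu:\mathcal S_*\to\mathcal R_*$ be the multiplication, $I=\ker\mu$, and let $\Omega^1=\Omega^1_{\mathcal R_*/Y}=I/I^2$ with $da=1\otimes a-a\otimes1$. Let $\nu:\mathcal B_*\to\mathcal R_*$ be a free DG algebra resolution of $\mathcal R_*$ as an $\mathcal S_*$-algebra: as a graded algebra, $\mathcal B_*$ is the symmetric algebra over $\mathcal S_*$ of a graded free $\mathcal S_*$-module in degrees $<0$, and $\nu$ is a quasi-isomorphism of DG $\mathcal S_*$-algebras. Let $$\nabla_{\mathcal B}:\mathcal B_*\to\mathcal B_*\otimes_{1\otimes\mathcal R_*}\Omega^1$$ be a universal connection: an $\mathcal R_*\otimes1$-linear derivation of degree $0$ that restricts to $d$ on $1\otimes\mathcal R_*$. Put $\mathrm{At}_{\mathcal B}=[\partial,\nabla_{\mathcal B}]=\partial\nabla_{\mathcal B}-\nabla_{\mathcal B}\partial:\mathcal B_*\to\mathcal B_*\otimes_{1\otimes\mathcal R_*}\Omega^1[1]$; it represents the universal Atiyah class $\mathrm{At}_u$. Let $D(\mathcal R_*)$ be the derived category of right DG $\mathcal R_*$-modules. For a DG module $\mathcal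 M$, an Atiyah class $\mathrm{At}_{\mathcal M}:\mathcal M\to\mathcal M\otimes_{\mathcal R_*}\Omega^1[1]$ in $D(\mathcal R_*)$ is the morphism given, for some quasi-isomorphism $\varphi:\mathcal P\to\mathcal M$ and some connection $\nabla:\mathcal P\to\mathcal P\otimes_{\mathcal R_*}\Omega^1$ (additive of degree $0$ with $\nabla(pa)=\nabla(p)a+p\otimes da$), by the class of $[\partial,\nabla]$: it satisfies $\mathrm{At}_{\mathcal M}\circ\varphi=(\varphi\otimes\mathrm{id})[1]\circ[\partial,\nabla]$ in $D(\mathcal R_*)$. (For $\mathcal M\in D^-_c(\mathcal R_*)$, i.e. bounded above with coherent cohomology, one takes for $\mathcal P$ a projective approximation of $\mathcal M$.) **Statement.** Let $\mathcal M$ be a right DG $\mathcal R_*$-module, for instance one in $D^-_c(\mathcal R_*)$. Form $\mathcal M\otimes_{\mathcal R_*\otimes1}\mathcal B_*$, a right DG module over $1\otimes\mathcal R_*$, and $$\mathrm{id}_{\mathcal M}\otimes\mathrm{At}_{\mathcal B}:\mathcal M\otimes_{\mathcal R_*\otimes1}\mathcal B_*\to\mathcal M\otimes_{\mathcal R_*\otimes1}\mathcal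 B_*\otimes_{1\otimes\mathcal R_*}\Omega^1[1],\qquad m\otimes b\mapsto(-1)^{|m|}m\otimes\mathrm{At}_{\mathcal B}(b).$$ As a morphism of right modules over $1\otimes\mathcal R_*$, it represents $\mathrm{At}_{\mathcal M}$ in $D(\mathcal R_*)$. That is, the morphisms $$\mathrm{id}_{\mathcal M}\otimes\nu:\mathcal M\otimes_{\mathcal R_*\otimes1}\mathcal B_*\to\mathcal M\quad\text{and}\quad(\mathrm{id}_{\mathcal M}\otimes\nu\otimes\mathrm{id})[1]:\mathcal M\otimes_{\mathcal R_*\otimes1}\mathcal B_*\otimes_{1\otimes\mathcal R_*}\Omega^1[1]\to\mathcal M\otimes_{\mathcal R_*}\Omega^1[1]$$ become isomorphisms in $D(\mathcal R_*)$, and every Atiyah class $\mathrm{At}_{\mathcal M}$ of $\mathcal M$ satisfies $$\mathrm{At}_{\mathcal M}\circ(\mathrm{id}_{\mathcal M}\otimes\nu)=(\mathrm{id}_{\mathcal M}\otimes\nu\otimes\mathrm{id})[1]\circ(\mathrm{id}_{\mathcal M}\otimes\mathrm{At}_{\mathcal B})$$ in $D(\mathcal R_*)$. Equivalently, $\mathrm{At}_{\mathcal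 M}=\mathrm{id}_{\mathcal M}\otimes_{\mathcal R_*\otimes1}\mathrm{At}_u$ as morphisms in $D(\mathcal R_*)$. -/

import Mathlib

open CategoryTheory TopologicalSpace Opposite AlgebraicGeometry
open scoped TensorProduct Manifold RightActions

noncomputable section

namespace AtiyahDG

/-- The Koszul sign `(-1)^n`. -/
def ksign (n : ℤ) : ℤ := ((n.negOnePow : ℤˣ) : ℤ)

lemma ksign_add (m n : ℤ) : ksign (m + n) = ksign m * ksign n := by
  simp [ksign, Int.negOnePow_add]

lemma ksign_one : ksign 1 = -1 := by simp [ksign]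

lemma ksign_zero : ksign 0 = 1 := by simp [ksign]

lemma ksign_mul_self (n : ℤ) : ksign n * ksign n = 1 := by
  rw [← ksign_add]; simp [ksign, Int.negOnePow_even _ (⟨n, rfl⟩ : Even (n + n))]

section Graded

variable {X : Type} [AddCommGroup X] {gr : ℤ → AddSubgroup X}

lemma gr_induction (h : DirectSum.IsInternal gr) {p : X → Prop}
    (hom : ∀ i, ∀ x ∈ gr i, p x) (zero : p 0) (add : ∀ x y, p x → p y → p (x + y)) (x : X) :
    p x := by
  obtain ⟨y, rfl⟩ := h.2 x
  induction y using DirectSum.induction_on with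
  | zero => simpa using zero
  | of i x => simpa using hom i x x.2
  | add x y hx hy => rw [map_add]; exact add _ _ hx hy

/-- The decomposition into homogeneous components. -/
def comps (h : DirectSum.IsInternal gr) : X ≃+ DirectSum ℤ fun i => gr i :=
  (AddEquiv.ofBijective (DirectSum.coeAddMonoidHom gr) h).symm

/-- The sign operator of a grading: multiplication by `(-1)^i` in degree `i`. -/
def sgn (h : DirectSum.IsInternal gr) : X →+ X :=
  (DirectSum.toAddMonoid fun i => ksign i • (gr i).subtype).comp
    (comps h).toAddMonoidHom

lemma symm_apply (h : DirectSum.IsInternal gr) {i : ℤ} {x : X} (hx : x ∈ gr i) :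
    comps h x = DirectSum.of (fun i => gr i) i ⟨x, hx⟩ := by
  refine (AddEquiv.symm_apply_eq _).2 ?_
  exact (DirectSum.coeAddMonoidHom_of gr i ⟨x, hx⟩).symm

lemma sgn_apply (h : DirectSum.IsInternal gr) {i : ℤ} {x : X} (hx : x ∈ gr i) :
    sgn h x = ksign i • x := by
  simp [sgn, symm_apply h hx]

lemma isInternal_of (D : X →+ DirectSum ℤ fun i => gr i)
    (h1 : ∀ i, ∀ x (hx : x ∈ gr i), D x = DirectSum.of (fun i => gr i) i ⟨x, hx⟩)
    (h2 : ∀ x, DirectSum.coeAddMonoidHom gr (D x) = x) : DirectSum.IsInternal gr := by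
  refine ⟨fun x y hxy => ?_, fun x => ⟨_, h2 x⟩⟩
  have : ∀ z, D (DirectSum.coeAddMonoidHom gr z) = z := by
    intro z
    induction z using DirectSum.induction_on with
    | zero => simp
    | of i x => simpa using h1 i x x.2
    | add x y hx hy => rw [map_add, map_add, hx, hy]
  rw [← this x, ← this y]; exact congrArg D hxy

lemma ofeq {i j : ℤ} (hij : i = j) {x y : X} (hxy : x = y) (hx : x ∈ gr i) (hy : y ∈ gr j) :
    DirectSum.of (fun i => gr i) i ⟨x, hx⟩ = DirectSum.of (fun i => gr i) j ⟨y, hy⟩ := by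
  subst hij hxy; rfl

lemma shift_internal (h : DirectSum.IsInternal gr) (k : ℤ) :
    DirectSum.IsInternal fun n => gr (n + k) := by
  refine isInternal_of ((DirectSum.toAddMonoid fun i =>
    (DirectSum.of (fun n => gr (n + k)) (i - k)).comp
      (AddSubgroup.inclusion (le_of_eq (by rw [sub_add_cancel])))).comp
    (comps h).toAddMonoidHom) ?_ ?_
  · intro i x hx
    simp only [AddMonoidHom.comp_apply, AddEquiv.coe_toAddMonoidHom, symm_apply h hx,
      DirectSum.toAddMonoid_of]
    exact ofeq (gr := fun n => gr (n + k)) (by ring) rfl _ _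
  · refine gr_induction h ?_ ?_ ?_
    · intro i x hx
      simp [symm_apply h hx]
    · simp
    · intro x y hx hy; rw [map_add, map_add, hx, hy]

/-- The grading of a quotient by a subgroup stable under taking homogeneous components. -/
lemma quotient_internal (h : DirectSum.IsInternal gr) (K : AddSubgroup X)
    (hK : ∀ x ∈ K, ∀ i, (((comps h) x i : gr i) : X)
      ∈ K) :
    DirectSum.IsInternal fun n => (gr n).map (QuotientAddGroup.mk' K) := by
  set π := QuotientAddGroup.mk' K
  let c := (comps h)
  let F : (DirectSum ℤ fun i => gr i) →+ DirectSum ℤ fun i => (gr i).map π :=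
    DirectSum.map fun i => π.addSubgroupMap (gr i)
  have hF : ∀ x ∈ K, F (c x) = 0 := by
    intro x hx
    refine DFinsupp.ext fun i => ?_
    refine Subtype.ext ?_
    change π _ = 0
    exact (QuotientAddGroup.eq_zero_iff _).2 (hK x hx i)
  refine isInternal_of (QuotientAddGroup.lift K (F.comp c.toAddMonoidHom) hF) ?_ ?_
  · rintro i _ ⟨x, hx, rfl⟩
    change F (c x) = _
    simp only [c, symm_apply h hx, F]
    erw [DirectSum.map_of]
    rfl
  · intro x
    obtain ⟨x, rfl⟩ := QuotientAddGroup.mk'_surjective K x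
    change DirectSum.coeAddMonoidHom _ (F (c x)) = π x
    refine gr_induction h (p := fun x => DirectSum.coeAddMonoidHom _ (F (c x)) = π x) ?_ ?_ ?_ x
    · intro i x hx
      simp only [c, symm_apply h hx, F]
      erw [DirectSum.map_of]
      simp
    · simp
    · intro x y hx hy; rw [map_add, map_add, map_add, map_add, hx, hy]

end Graded

section Tensor

variable {A : Type} [Ring A] (M : Type) [AddCommGroup M] [Module Aᵐᵒᵖ M]
  (L : Type) [AddCommGroup L] [Module A L]

/-- The relations `m a ⊗ l = m ⊗ a l`. -/
def TP.rel (A M L : Type) [Ring A] [AddCommGroup M] [Module Aᵐᵒᵖ M] [AddCommGroup L]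
    [Module A L] : AddSubgroup (M ⊗[ℤ] L) :=
  AddSubgroup.closure {x | ∃ (m : M) (a : A) (l : L), x = (m <• a) ⊗ₜ[ℤ] l - m ⊗ₜ[ℤ] (a • l)}

/-- The tensor product `M ⊗_A L` of a right module and a left module over a (not necessarily
commutative) ring. -/
def TP (A M L : Type) [Ring A] [AddCommGroup M] [Module Aᵐᵒᵖ M] [AddCommGroup L]
    [Module A L] : Type :=
  (M ⊗[ℤ] L) ⧸ TP.rel A M L

instance : AddCommGroup (TP A M L) := inferInstanceAs (AddCommGroup ((M ⊗[ℤ] L) ⧸ TP.rel A M L))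

variable {M L}

/-- The class of `m ⊗ l` in `M ⊗_A L`, as a biadditive map. -/
def TP.tmul (A : Type) {M L : Type} [Ring A] [AddCommGroup M] [Module Aᵐᵒᵖ M] [AddCommGroup L]
    [Module A L] : M →+ L →+ TP A M L where
  toFun m := (QuotientAddGroup.mk' (TP.rel A M L)).comp (TensorProduct.mk ℤ M L m).toAddMonoidHom
  map_zero' := by ext; simp; rfl
  map_add' m m' := by ext; simp; rfl

lemma TP.tmul_smul (m : M) (a : A) (l : L) : TP.tmul A (m <• a) l = TP.tmul A m (a • l) := by
  refine (QuotientAddGroup.eq_iff_sub_mem).2 ?_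
  exact AddSubgroup.subset_closure ⟨m, a, l, rfl⟩

/-- The additive map out of `M ⊗_A L` given by a balanced biadditive map. -/
def TP.lift {X : Type} [AddCommGroup X] (f : M →+ L →+ X)
    (hf : ∀ (m : M) (a : A) (l : L), f (m <• a) l = f m (a • l)) : TP A M L →+ X :=
  QuotientAddGroup.lift _ (TensorProduct.liftAddHom f (fun r m l => by simp)) (by
    rw [TP.rel, AddSubgroup.closure_le]
    rintro _ ⟨m, a, l, rfl⟩
    simp [AddMonoidHom.mem_ker, hf])

@[simp] lemma TP.lift_tmul {X : Type} [AddCommGroup X] (f : M →+ L →+ X)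
    (hf : ∀ (m : M) (a : A) (l : L), f (m <• a) l = f m (a • l)) (m : M) (l : L) :
    TP.lift f hf (TP.tmul A m l) = f m l := by
  rfl

@[elab_as_elim]
lemma TP.induction {A M L : Type} [Ring A] [AddCommGroup M] [Module Aᵐᵒᵖ M] [AddCommGroup L]
    [Module A L] {p : TP A M L → Prop} (zero : p 0)
    (tmul : ∀ m l, p (TP.tmul A m l)) (add : ∀ x y, p x → p y → p (x + y)) (x : TP A M L) : p x := by
  obtain ⟨x, rfl⟩ := QuotientAddGroup.mk'_surjective _ x
  induction x using TensorProduct.induction_on with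
  | zero => exact zero
  | tmul m l => exact tmul m l
  | add x y hx hy => rw [map_add]; exact add _ _ hx hy

/-- The grading of a tensor product: `m ⊗ l` has degree `|m| + |l|`. -/
def TP.gr (A : Type) {M L : Type} [Ring A] [AddCommGroup M] [Module Aᵐᵒᵖ M] [AddCommGroup L]
    [Module A L] (g : ℤ → AddSubgroup M) (g' : ℤ → AddSubgroup L) (n : ℤ) :
    AddSubgroup (TP A M L) :=
  AddSubgroup.closure {x | ∃ i j, i + j = n ∧ ∃ m ∈ g i, ∃ l ∈ g' j, x = TP.tmul A m l}

lemma TP.tmul_mem {g : ℤ → AddSubgroup M} {g' : ℤ → AddSubgroup L} {i j n : ℤ} (h : i + j = n)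
    {m : M} (hm : m ∈ g i) {l : L} (hl : l ∈ g' j) : TP.tmul A m l ∈ TP.gr A g g' n :=
  AddSubgroup.subset_closure ⟨i, j, h, m, hm, l, hl, rfl⟩

lemma TP.internal {g : ℤ → AddSubgroup M} {g' : ℤ → AddSubgroup L} {gA : ℤ → AddSubgroup A}
    (h : DirectSum.IsInternal g) (h' : DirectSum.IsInternal g') (hA : DirectSum.IsInternal gA)
    (hr : ∀ i j m a, m ∈ g i → a ∈ gA j → m <• a ∈ g (i + j))
    (hl : ∀ i j a l, a ∈ gA i → l ∈ g' j → a • l ∈ g' (i + j)) :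
    DirectSum.IsInternal (TP.gr A g g') := by
  let c := (comps h).toAddMonoidHom
  let c' := (comps h').toAddMonoidHom
  let T := DirectSum ℤ fun n => TP.gr A g g' n
  let b (i j : ℤ) : g i →+ g' j →+ T := AddMonoidHom.mk' (fun m => AddMonoidHom.mk'
      (fun l => DirectSum.of (fun n => TP.gr A g g' n) (i + j)
        ⟨TP.tmul A (m : M) (l : L), TP.tmul_mem rfl m.2 l.2⟩)
      (by intro l l'; rw [← map_add]; congr 1; ext; simp))
      (by
        intro m m'; ext l
        simp only [AddMonoidHom.mk'_apply, AddMonoidHom.add_apply]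
        rw [← map_add]; congr 1; ext; simp)
  let β : (DirectSum ℤ fun i => g i) →+ (DirectSum ℤ fun j => g' j) →+ T :=
    DirectSum.toAddMonoid fun i => AddMonoidHom.flip (DirectSum.toAddMonoid fun j =>
      AddMonoidHom.flip (b i j))
  let f : M →+ L →+ T := (AddMonoidHom.flip ((AddMonoidHom.flip (β.comp c)).comp c'))
  have hf : ∀ i j m l (hm : m ∈ g i) (hl : l ∈ g' j), f m l =
      DirectSum.of (fun n => TP.gr A g g' n) (i + j)
        ⟨TP.tmul A m l, TP.tmul_mem rfl hm hl⟩ := by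
    intro i j m l hm hl
    simp only [f, β, c, c', AddMonoidHom.flip_apply, AddMonoidHom.comp_apply,
      AddEquiv.coe_toAddMonoidHom, symm_apply h hm, symm_apply h' hl, DirectSum.toAddMonoid_of]
    rfl
  have bal : ∀ m (a : A) l, f (m <• a) l = f m (a • l) := by
    intro m a l
    refine gr_induction h (p := fun m => f (m <• a) l = f m (a • l)) ?_ (by simp) ?_ m
    · intro i m hm
      refine gr_induction hA (p := fun a => f (m <• a) l = f m (a • l)) ?_ (by simp) ?_ a
      · intro j a ha
        refine gr_induction h' (p := fun l => f (m <• a) l = f m (a • l)) ?_ (by simp) ?_ l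
        · intro k l hl'
          rw [hf _ _ _ _ (hr _ _ _ _ hm ha) hl', hf _ _ _ _ hm (hl _ _ _ _ ha hl')]
          exact ofeq (add_assoc _ _ _) (TP.tmul_smul _ _ _) _ _
        · intro x y hx hy; rw [smul_add, map_add, map_add, hx, hy]
      · intro x y hx hy
        rw [MulOpposite.op_add, add_smul, add_smul, map_add, map_add, AddMonoidHom.add_apply, hx, hy]
    · intro x y hx hy
      rw [smul_add, map_add, map_add, AddMonoidHom.add_apply, AddMonoidHom.add_apply, hx, hy]
  refine isInternal_of (TP.lift f bal) ?_ ?_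
  · intro n x hx
    induction hx using AddSubgroup.closure_induction with
    | mem x hx =>
      obtain ⟨i, j, rfl, m, hm, l, hl, rfl⟩ := hx
      rw [TP.lift_tmul, hf _ _ _ _ hm hl]
    | zero => rw [map_zero]; symm; exact map_zero _
    | add x y hx hy ex ey => rw [map_add, ex, ey, ← map_add]; rfl
    | neg x hx ex => rw [map_neg, ex, ← map_neg]; rfl
  · intro x
    induction x using TP.induction with
    | zero => simp
    | add x y hx hy => rw [map_add, map_add, hx, hy]
    | tmul m l =>
      rw [TP.lift_tmul]
      refine gr_induction h (p := fun m => DirectSum.coeAddMonoidHom _ (f m l) = TP.tmul A m l)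
        ?_ (by simp) ?_ m
      · intro i m hm
        refine gr_induction h' (p := fun l => DirectSum.coeAddMonoidHom _ (f m l) = TP.tmul A m l)
          ?_ (by simp) ?_ l
        · intro j l hl'
          rw [hf _ _ _ _ hm hl']; simp
        · intro x y hx hy; rw [map_add, map_add, map_add, hx, hy]
      · intro x y hx hy
        rw [map_add, map_add, AddMonoidHom.add_apply, AddMonoidHom.add_apply, map_add, hx, hy]

end Tensor
section DG

variable {T : Type} [Preorder T]

/-- A presheaf of graded-commutative differential graded rings on a preorder. -/
structure DGAlg (T : Type) [Preorder T] where
  obj : T → Type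
  [ring : ∀ t, Ring (obj t)]
  gr : ∀ t, ℤ → AddSubgroup (obj t)
  internal : ∀ t, DirectSum.IsInternal (gr t)
  one_mem : ∀ t, 1 ∈ gr t 0
  mul_mem : ∀ t {i j : ℤ} {a b : obj t}, a ∈ gr t i → b ∈ gr t j → a * b ∈ gr t (i + j)
  comm : ∀ t {i j : ℤ} {a b : obj t}, a ∈ gr t i → b ∈ gr t j → a * b = ksign (i * j) • (b * a)
  d : ∀ t, obj t →+ obj t
  d_mem : ∀ t {i : ℤ} {a : obj t}, a ∈ gr t i → d t a ∈ gr t (i + 1)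
  d_d : ∀ t (a : obj t), d t (d t a) = 0
  leibniz : ∀ t {i : ℤ} {a : obj t}, a ∈ gr t i → ∀ b : obj t,
    d t (a * b) = d t a * b + ksign i • (a * d t b)
  res : ∀ {s t : T}, s ≤ t → obj t →+* obj s
  res_refl : ∀ t (a : obj t), res (le_refl t) a = a
  res_trans : ∀ {r s t : T} (h : r ≤ s) (h' : s ≤ t) (a : obj t),
    res h (res h' a) = res (h.trans h') a
  res_mem : ∀ {s t : T} (h : s ≤ t) {i : ℤ} {a : obj t}, a ∈ gr t i → res h a ∈ gr s i
  res_d : ∀ {s t : T} (h : s ≤ t) (a : obj t), res h (d t a) = d s (res h a)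

attribute [instance] DGAlg.ring

/-- A morphism of presheaves of DG rings. -/
structure DGAlg.Hom (R S : DGAlg T) where
  map : ∀ t, R.obj t →+* S.obj t
  map_mem : ∀ t {i : ℤ} {a : R.obj t}, a ∈ R.gr t i → map t a ∈ S.gr t i
  map_d : ∀ t (a : R.obj t), map t (R.d t a) = S.d t (map t a)
  map_res : ∀ {s t : T} (h : s ≤ t) (a : R.obj t), map s (R.res h a) = S.res h (map t a)

/-- The identity morphism. -/
def DGAlg.Hom.id (R : DGAlg T) : DGAlg.Hom R R where
  map _ := RingHom.id _
  map_mem _ _ _ h := h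
  map_d _ _ := rfl
  map_res _ _ := rfl

/-- Composition of morphisms. -/
def DGAlg.Hom.comp {R S B : DGAlg T} (g : DGAlg.Hom S B) (f : DGAlg.Hom R S) :
    DGAlg.Hom R B where
  map t := (g.map t).comp (f.map t)
  map_mem t _ _ h := g.map_mem t (f.map_mem t h)
  map_d t a := by simp [f.map_d, g.map_d]
  map_res h a := by simp [f.map_res, g.map_res]

/-- A presheaf of right DG modules over a presheaf of DG rings. -/
structure DGMod (R : DGAlg T) where
  obj : T → Type
  [grp : ∀ t, AddCommGroup (obj t)]
  [mod : ∀ t, Module (R.obj t)ᵐᵒᵖ (obj t)]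
  gr : ∀ t, ℤ → AddSubgroup (obj t)
  internal : ∀ t, DirectSum.IsInternal (gr t)
  smul_mem : ∀ t {i j : ℤ} {m : obj t} {a : R.obj t}, m ∈ gr t i → a ∈ R.gr t j →
    m <• a ∈ gr t (i + j)
  d : ∀ t, obj t →+ obj t
  d_mem : ∀ t {i : ℤ} {m : obj t}, m ∈ gr t i → d t m ∈ gr t (i + 1)
  d_d : ∀ t (m : obj t), d t (d t m) = 0
  leibniz : ∀ t {i : ℤ} {m : obj t}, m ∈ gr t i → ∀ a : R.obj t,
    d t (m <• a) = d t m <• a + ksign i • (m <• R.d t a)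
  res : ∀ {s t : T}, s ≤ t → obj t →+ obj s
  res_refl : ∀ t (m : obj t), res (le_refl t) m = m
  res_trans : ∀ {r s t : T} (h : r ≤ s) (h' : s ≤ t) (m : obj t),
    res h (res h' m) = res (h.trans h') m
  res_mem : ∀ {s t : T} (h : s ≤ t) {i : ℤ} {m : obj t}, m ∈ gr t i → res h m ∈ gr s i
  res_d : ∀ {s t : T} (h : s ≤ t) (m : obj t), res h (d t m) = d s (res h m)
  res_smul : ∀ {s t : T} (h : s ≤ t) (m : obj t) (a : R.obj t),
    res h (m <• a) = res h m <• R.res h a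

attribute [instance] DGMod.grp DGMod.mod

variable {R : DGAlg T}

/-- A morphism of DG modules: a right linear map of degree zero that commutes with the
differentials and the restriction maps. -/
@[ext] structure DGMod.Hom (M N : DGMod R) where
  map : ∀ t, M.obj t →+ N.obj t
  map_smul : ∀ t (m : M.obj t) (a : R.obj t), map t (m <• a) = map t m <• a
  map_mem : ∀ t {i : ℤ} {m : M.obj t}, m ∈ M.gr t i → map t m ∈ N.gr t i
  map_d : ∀ t (m : M.obj t), map t (M.d t m) = N.d t (map t m)
  map_res : ∀ {s t : T} (h : s ≤ t) (m : M.obj t), map s (M.res h m) = N.res h (map t m)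

instance : Category (DGMod R) where
  Hom := DGMod.Hom
  id M :=
    { map := fun t => AddMonoidHom.id _
      map_smul := fun _ _ _ => rfl
      map_mem := fun _ _ _ h => h
      map_d := fun _ _ => rfl
      map_res := fun _ _ => rfl }
  comp f g :=
    { map := fun t => (g.map t).comp (f.map t)
      map_smul := fun t m a => by simp [f.map_smul, g.map_smul]
      map_mem := fun t _ _ h => g.map_mem t (f.map_mem t h)
      map_d := fun t m => by simp [f.map_d, g.map_d]
      map_res := fun h m => by simp [f.map_res, g.map_res] }

/-- The shift `M[1]` of a right DG module: `M[1]^n = M^{n+1}` with differential `-d`. -/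
def DGMod.shift (M : DGMod R) : DGMod R where
  obj := M.obj
  gr t n := M.gr t (n + 1)
  internal t := shift_internal (M.internal t) 1
  smul_mem t {i j m a} hm ha := by
    have := M.smul_mem t hm ha
    rwa [show i + 1 + j = i + j + 1 by ring] at this
  d t := -M.d t
  d_mem t _ _ hm := neg_mem (M.d_mem t hm)
  d_d t m := by simp [M.d_d]
  leibniz t {i m} hm a := by
    simp [M.leibniz t hm, ksign_add, ksign_one]
    abel
  res h := M.res h
  res_refl := M.res_refl
  res_trans h h' m := M.res_trans h h' m
  res_mem h _ _ hm := M.res_mem h hm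
  res_d h m := by simp [M.res_d]
  res_smul h m a := M.res_smul h m a

/-- The sign operator `m ↦ (-1)^{|m|} m`. -/
def DGMod.eps (M : DGMod R) (t : T) : M.obj t →+ M.obj t := sgn (M.internal t)

lemma DGMod.eps_apply (M : DGMod R) {t : T} {i : ℤ} {m : M.obj t} (h : m ∈ M.gr t i) :
    M.eps t m = ksign i • m := sgn_apply _ h

/-- The sign operator of a DG ring. -/
def DGAlg.eps (R : DGAlg T) (t : T) : R.obj t →+ R.obj t := sgn (R.internal t)

lemma DGAlg.eps_apply (R : DGAlg T) {t : T} {i : ℤ} {m : R.obj t} (h : m ∈ R.gr t i) :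
    R.eps t m = ksign i • m := sgn_apply _ h

lemma DGMod.leibniz' (M : DGMod R) (t : T) (m : M.obj t) (a : R.obj t) :
    M.d t (m <• a) = M.d t m <• a + M.eps t m <• R.d t a := by
  refine gr_induction (M.internal t)
    (p := fun m => M.d t (m <• a) = M.d t m <• a + M.eps t m <• R.d t a) ?_ (by simp) ?_ m
  · intro i m hm
    rw [M.leibniz t hm, M.eps_apply hm, smul_comm (ksign i)]
  · intro x y hx hy
    simp only [smul_add, map_add, hx, hy]; abel

lemma DGMod.eps_smul (M : DGMod R) (t : T) (m : M.obj t) (a : R.obj t) :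
    M.eps t (m <• a) = M.eps t m <• R.eps t a := by
  refine gr_induction (M.internal t)
    (p := fun m => M.eps t (m <• a) = M.eps t m <• R.eps t a) ?_ (by simp) ?_ m
  · intro i m hm
    refine gr_induction (R.internal t)
      (p := fun a => M.eps t (m <• a) = M.eps t m <• R.eps t a) ?_ (by simp) ?_ a
    · intro j a ha
      rw [M.eps_apply (M.smul_mem t hm ha), M.eps_apply hm, R.eps_apply ha, ksign_add,
        MulOpposite.op_smul, smul_assoc, mul_comm, mul_smul, smul_comm (MulOpposite.op a) (ksign i) m]
    · intro x y hx hy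
      simp only [MulOpposite.op_add, add_smul, map_add, hx, hy]
  · intro x y hx hy
    simp only [smul_add, map_add, hx, hy]

lemma DGMod.eps_map {M N : DGMod R} (t : T) (f : M.obj t →+ N.obj t)
    (hf : ∀ i, ∀ m ∈ M.gr t i, f m ∈ N.gr t i) (m : M.obj t) :
    N.eps t (f m) = f (M.eps t m) := by
  refine gr_induction (M.internal t) (p := fun m => N.eps t (f m) = f (M.eps t m)) ?_ (by simp) ?_ m
  · intro i m hm
    rw [N.eps_apply (hf i m hm), M.eps_apply hm, map_zsmul]
  · intro x y hx hy
    simp only [map_add, hx, hy]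

lemma DGMod.eps_d (M : DGMod R) (t : T) (m : M.obj t) :
    M.eps t (M.d t m) = - M.d t (M.eps t m) := by
  refine gr_induction (M.internal t) (p := fun m => M.eps t (M.d t m) = - M.d t (M.eps t m))
    ?_ (by simp) ?_ m
  · intro i m hm
    rw [M.eps_apply (M.d_mem t hm), M.eps_apply hm, map_zsmul, ksign_add, ksign_one]
    simp
  · intro x y hx hy
    simp only [map_add, hx, hy, neg_add]

lemma DGMod.eps_eps (M : DGMod R) (t : T) (m : M.obj t) : M.eps t (M.eps t m) = m := by
  refine gr_induction (M.internal t) (p := fun m => M.eps t (M.eps t m) = m) ?_ (by simp) ?_ m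
  · intro i m hm
    rw [M.eps_apply hm, map_zsmul, M.eps_apply hm, smul_smul, ksign_mul_self, one_smul]
  · intro x y hx hy
    simp only [map_add, hx, hy]

lemma DGMod.eps_res (M : DGMod R) {s t : T} (h : s ≤ t) (m : M.obj t) :
    M.res h (M.eps t m) = M.eps s (M.res h m) := by
  refine gr_induction (M.internal t) (p := fun m => M.res h (M.eps t m) = M.eps s (M.res h m))
    ?_ (by simp) ?_ m
  · intro i m hm
    rw [M.eps_apply hm, map_zsmul, M.eps_apply (M.res_mem h hm)]
  · intro x y hx hy
    simp only [map_add, hx, hy]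

/-- A presheaf of DG bimodules: a right DG module with a commuting left DG module structure. -/
structure BiMod (R : DGAlg T) extends DGMod R where
  [lmod : ∀ t, Module (R.obj t) (obj t)]
  assoc : ∀ t (a : R.obj t) (m : obj t) (b : R.obj t), (a • m) <• b = a • (m <• b)
  lsmul_mem : ∀ t {i j : ℤ} {a : R.obj t} {m : obj t}, a ∈ R.gr t i → m ∈ gr t j →
    a • m ∈ gr t (i + j)
  lleibniz : ∀ t {i : ℤ} {a : R.obj t}, a ∈ R.gr t i → ∀ m : obj t,
    d t (a • m) = R.d t a • m + ksign i • (a • d t m)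
  res_lsmul : ∀ {s t : T} (h : s ≤ t) (a : R.obj t) (m : obj t),
    res h (a • m) = R.res h a • res h m

attribute [instance] BiMod.lmod

lemma BiMod.lleibniz' (L : BiMod R) (t : T) (a : R.obj t) (m : L.obj t) :
    L.d t (a • m) = R.d t a • m + R.eps t a • L.d t m := by
  refine gr_induction (R.internal t)
    (p := fun a => L.d t (a • m) = R.d t a • m + R.eps t a • L.d t m) ?_ (by simp) ?_ a
  · intro i a ha
    rw [L.lleibniz t ha, R.eps_apply ha, smul_assoc]
  · intro x y hx hy
    simp only [add_smul, map_add, hx, hy]; abel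

/-- A DG ring `B` with two maps `l, r` from `R`, as a bimodule: `a • b = l(a) b`,
`b <• a = b r(a)`. -/
def DGAlg.Hom.bimod {B : DGAlg T} (l r : DGAlg.Hom R B) : BiMod R where
  obj := B.obj
  mod t := Module.compHom _ (r.map t).op
  gr := B.gr
  internal := B.internal
  smul_mem t _ _ _ _ hm ha := B.mul_mem t hm (r.map_mem t ha)
  d := B.d
  d_mem := B.d_mem
  d_d := B.d_d
  leibniz t i m hm a := by
    change B.d t (m * r.map t a) = B.d t m * r.map t a + ksign i • (m * r.map t (R.d t a))
    rw [B.leibniz t hm, r.map_d]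
  res h := (B.res h).toAddMonoidHom
  res_refl := B.res_refl
  res_trans := B.res_trans
  res_mem := B.res_mem
  res_d := B.res_d
  res_smul {s t} h m a := by
    change B.res h (m * r.map t a) = B.res h m * r.map s (R.res h a)
    rw [map_mul, r.map_res]
  lmod t := Module.compHom _ (l.map t)
  assoc t a m b := mul_assoc _ _ _
  lsmul_mem t _ _ _ _ ha hm := B.mul_mem t (l.map_mem t ha) hm
  lleibniz t i a ha m := by
    change B.d t (l.map t a * m) = l.map t (R.d t a) * m + ksign i • (l.map t a * B.d t m)
    rw [B.leibniz t (l.map_mem t ha), l.map_d]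
  res_lsmul {s t} h a m := by
    change B.res h (l.map t a * m) = l.map s (R.res h a) * B.res h m
    rw [map_mul, l.map_res]

/-- The sections of `M ⊗_R L`. -/
abbrev TObj (M : DGMod R) (L : BiMod R) (t : T) : Type := TP (R.obj t) (M.obj t) (L.obj t)

/-- `m ⊗ l`. -/
abbrev tm (M : DGMod R) (L : BiMod R) (t : T) : M.obj t →+ L.obj t →+ TObj M L t :=
  TP.tmul (R.obj t)

lemma TObj.hom_ext {M : DGMod R} {L : BiMod R} {t : T} {X : Type} [AddCommGroup X]
    {f g : TObj M L t →+ X} (h : ∀ m l, f (tm M L t m l) = g (tm M L t m l)) : f = g := by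
  ext x
  induction x using TP.induction with
  | zero => simp
  | tmul m l => exact h m l
  | add x y hx hy => rw [map_add, map_add, hx, hy]

/-- An endomorphism of the left module `L` acts on `M ⊗ L`. -/
def TObj.mapRight (M : DGMod R) (L : BiMod R) (t : T) (f : L.obj t →+ L.obj t)
    (hf : ∀ (a : R.obj t) l, f (a • l) = a • f l) : TObj M L t →+ TObj M L t :=
  TP.lift ((AddMonoidHom.flip ((tm M L t).flip.comp f)))
    (fun m a l => by
      simp only [AddMonoidHom.flip_apply, AddMonoidHom.comp_apply, hf]
      exact TP.tmul_smul m a (f l))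

/-- A right linear map `M → M'` acts on `M ⊗ L`. -/
def TObj.mapLeft {M M' : DGMod R} (L : BiMod R) (t : T) (f : M.obj t →+ M'.obj t)
    (hf : ∀ m (a : R.obj t), f (m <• a) = f m <• a) : TObj M L t →+ TObj M' L t :=
  TP.lift ((tm M' L t).comp f)
    (fun m a l => by
      simp only [AddMonoidHom.comp_apply, hf]
      exact TP.tmul_smul (f m) a l)

@[simp] lemma TObj.mapRight_tm (M : DGMod R) (L : BiMod R) (t : T) (f : L.obj t →+ L.obj t)
    (hf : ∀ (a : R.obj t) l, f (a • l) = a • f l) (m : M.obj t) (l : L.obj t) :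
    TObj.mapRight M L t f hf (tm M L t m l) = tm M L t m (f l) := rfl

@[simp] lemma TObj.mapLeft_tm {M M' : DGMod R} (L : BiMod R) (t : T) (f : M.obj t →+ M'.obj t)
    (hf : ∀ m (a : R.obj t), f (m <• a) = f m <• a) (m : M.obj t) (l : L.obj t) :
    TObj.mapLeft L t f hf (tm M L t m l) = tm M' L t (f m) l := rfl

/-- The right action of `R` on `M ⊗ L`, through `L`. -/
def TObj.rightAct (M : DGMod R) (L : BiMod R) (t : T) :
    (R.obj t)ᵐᵒᵖ →+* AddMonoid.End (TObj M L t) where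
  toFun a := TObj.mapRight M L t (DistribSMul.toAddMonoidHom _ a)
    (fun b l => by simpa using L.assoc t b l a.unop)
  map_one' := TObj.hom_ext fun m l => by
    change tm M L t m ((1 : (R.obj t)ᵐᵒᵖ) • l) = tm M L t m l
    rw [one_smul]
  map_zero' := TObj.hom_ext fun m l => by
    change tm M L t m ((0 : (R.obj t)ᵐᵒᵖ) • l) = 0
    rw [zero_smul, map_zero]
  map_mul' a b := TObj.hom_ext fun m l => by
    change tm M L t m ((a * b) • l) = tm M L t m (a • b • l)
    rw [mul_smul]
  map_add' a b := TObj.hom_ext fun m l => by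
    change tm M L t m ((a + b) • l) = tm M L t m (a • l) + tm M L t m (b • l)
    rw [add_smul, map_add]

/-- Right multiplication by an element as an additive map. -/
def TObj.rAct (M : DGMod R) (L : BiMod R) (t : T) (a : (R.obj t)ᵐᵒᵖ) :
    TObj M L t →+ TObj M L t := TObj.rightAct M L t a

instance (M : DGMod R) (L : BiMod R) (t : T) : Module (R.obj t)ᵐᵒᵖ (TObj M L t) :=
  Module.compHom _ (TObj.rightAct M L t)

@[simp] lemma TObj.tm_smul (M : DGMod R) (L : BiMod R) (t : T) (m : M.obj t) (l : L.obj t)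
    (a : R.obj t) : tm M L t m l <• a = tm M L t m (l <• a) := rfl

/-- The differential of `M ⊗ L`: `d(m ⊗ l) = dm ⊗ l + (-1)^{|m|} m ⊗ dl`. -/
def TObj.d (M : DGMod R) (L : BiMod R) (t : T) : TObj M L t →+ TObj M L t :=
  TP.lift ((tm M L t).comp (M.d t) +
      AddMonoidHom.flip (((tm M L t).comp (M.eps t)).flip.comp (L.d t)))
    (fun m a l => by
      have h1 := TP.tmul_smul (M.d t m) a l
      have h2 := TP.tmul_smul (M.eps t m) (R.d t a) l
      have h3 := TP.tmul_smul (M.eps t m) (R.eps t a) (L.d t l)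
      simp only [AddMonoidHom.add_apply, AddMonoidHom.comp_apply, AddMonoidHom.flip_apply,
        M.leibniz', L.lleibniz', M.eps_smul, map_add, h1, h2, h3]
      abel)

@[simp] lemma TObj.d_tm (M : DGMod R) (L : BiMod R) (t : T) (m : M.obj t) (l : L.obj t) :
    TObj.d M L t (tm M L t m l) = tm M L t (M.d t m) l + tm M L t (M.eps t m) (L.d t l) := rfl

/-- The restriction maps of `M ⊗ L`. -/
def TObj.res (M : DGMod R) (L : BiMod R) {s t : T} (h : s ≤ t) : TObj M L t →+ TObj M L s :=
  TP.lift (AddMonoidHom.flip (((tm M L s).comp (M.res h)).flip.comp (L.res h)))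
    (fun m a l => by
      simp only [AddMonoidHom.flip_apply, AddMonoidHom.comp_apply, M.res_smul, L.res_lsmul]
      exact TP.tmul_smul _ _ _)

@[simp] lemma TObj.res_tm (M : DGMod R) (L : BiMod R) {s t : T} (h : s ≤ t) (m : M.obj t)
    (l : L.obj t) : TObj.res M L h (tm M L t m l) = tm M L s (M.res h m) (L.res h l) := rfl

lemma TObj.gr_induction {M : DGMod R} {L : BiMod R} {t : T} {n : ℤ} {X : Type} [AddCommGroup X]
    {f : TObj M L t →+ X} {K : AddSubgroup X}
    (h : ∀ i j, i + j = n → ∀ m ∈ M.gr t i, ∀ l ∈ L.gr t j, f (tm M L t m l) ∈ K)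
    {x : TObj M L t} (hx : x ∈ TP.gr (R.obj t) (M.gr t) (L.gr t) n) : f x ∈ K := by
  have : TP.gr (R.obj t) (M.gr t) (L.gr t) n ≤ K.comap f := by
    rw [TP.gr, AddSubgroup.closure_le]
    rintro _ ⟨i, j, hij, m, hm, l, hl, rfl⟩
    exact h i j hij m hm l hl
  exact this hx

lemma TObj.gr_ext {M : DGMod R} {L : BiMod R} {t : T} {n : ℤ} {X : Type} [AddCommGroup X]
    {f g : TObj M L t →+ X}
    (h : ∀ i j, i + j = n → ∀ m ∈ M.gr t i, ∀ l ∈ L.gr t j, f (tm M L t m l) = g (tm M L t m l))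
    {x : TObj M L t} (hx : x ∈ TP.gr (R.obj t) (M.gr t) (L.gr t) n) : f x = g x := by
  have := TObj.gr_induction (f := f - g) (K := ⊥) (fun i j hij m hm l hl => by
    simp [h i j hij m hm l hl]) hx
  simpa [sub_eq_zero] using this

/-- The tensor product `M ⊗_R L` of a right DG module and a DG bimodule, a right DG module. -/
def tensor (M : DGMod R) (L : BiMod R) : DGMod R where
  obj t := TObj M L t
  gr t := TP.gr (R.obj t) (M.gr t) (L.gr t)
  internal t := TP.internal (M.internal t) (L.internal t) (R.internal t)
    (fun _ _ _ _ hm ha => M.smul_mem t hm ha) (fun _ _ _ _ ha hl => L.lsmul_mem t ha hl)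
  smul_mem t {n k x a} hx ha := by
    refine TObj.gr_induction (f := TObj.rAct M L t (MulOpposite.op a)) ?_ hx
    rintro i j rfl m hm l hl
    exact TP.tmul_mem (add_assoc _ _ _).symm hm (L.smul_mem t hl ha)
  d t := TObj.d M L t
  d_mem t {n x} hx := by
    refine TObj.gr_induction (f := TObj.d M L t) ?_ hx
    rintro i j rfl m hm l hl
    rw [TObj.d_tm, M.eps_apply hm]
    exact add_mem (TP.tmul_mem (by ring) (M.d_mem t hm) hl)
      (TP.tmul_mem (by ring) (zsmul_mem hm _) (L.d_mem t hl))
  d_d t x := by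
    refine DFunLike.congr_fun (TObj.hom_ext (f := (TObj.d M L t).comp (TObj.d M L t)) (g := 0)
      fun m l => ?_) x
    simp [M.d_d, L.d_d, M.eps_d]
  leibniz t {n x} hx a := by
    refine TObj.gr_ext (f := (TObj.d M L t).comp (TObj.rAct M L t (MulOpposite.op a)))
      (g := (TObj.rAct M L t (MulOpposite.op a)).comp (TObj.d M L t) +
        ksign n • TObj.rAct M L t (MulOpposite.op (R.d t a))) ?_ hx
    rintro i j rfl m hm l hl
    change TObj.d M L t (tm M L t m (l <• a)) =
      (tm M L t (M.d t m) l + tm M L t (M.eps t m) (L.d t l)) <• a +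
        ksign (i + j) • tm M L t m (l <• R.d t a)
    rw [TObj.d_tm, L.leibniz t hl, smul_add, TObj.tm_smul, TObj.tm_smul, M.eps_apply hm]
    simp only [map_add, map_zsmul, AddMonoidHom.smul_apply, ksign_add, mul_smul]
    rw [smul_comm (ksign j) (ksign i)]
    abel
  res h := TObj.res M L h
  res_refl t x := by
    refine DFunLike.congr_fun (TObj.hom_ext (f := TObj.res M L (le_refl t))
      (g := AddMonoidHom.id _) fun m l => ?_) x
    simp [M.res_refl, L.res_refl]
  res_trans {r s t} h h' x := by
    refine DFunLike.congr_fun (TObj.hom_ext (f := (TObj.res M L h).comp (TObj.res M L h'))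
      (g := TObj.res M L (h.trans h')) fun m l => ?_) x
    simp [M.res_trans, L.res_trans]
  res_mem {s t} h n x hx := by
    refine TObj.gr_induction (f := TObj.res M L h) ?_ hx
    rintro i j rfl m hm l hl
    exact TP.tmul_mem rfl (M.res_mem h hm) (L.res_mem h hl)
  res_d {s t} h x := by
    refine DFunLike.congr_fun (TObj.hom_ext (f := (TObj.res M L h).comp (TObj.d M L t))
      (g := (TObj.d M L s).comp (TObj.res M L h)) fun m l => ?_) x
    simp [M.res_d, L.res_d, M.eps_res]
  res_smul {s t} h x a := by
    refine DFunLike.congr_fun (TObj.hom_ext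
      (f := (TObj.res M L h).comp (TObj.rAct M L t (MulOpposite.op a)))
      (g := (TObj.rAct M L s (MulOpposite.op (R.res h a))).comp (TObj.res M L h))
      fun m l => ?_) x
    change tm M L s (M.res h m) (L.res h (l <• a)) =
      tm M L s (M.res h m) (L.res h l <• R.res h a)
    rw [L.res_smul]

/-- The left action of `R` on `L ⊗ L'`, through `L`. -/
def TObj.leftAct (L L' : BiMod R) (t : T) :
    R.obj t →+* AddMonoid.End (TObj L.toDGMod L' t) where
  toFun a := TObj.mapLeft L' t (DistribSMul.toAddMonoidHom _ a)
    (fun l b => (L.assoc t a l b).symm)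
  map_one' := TObj.hom_ext fun m l => by
    change tm L.toDGMod L' t ((1 : R.obj t) • m) l = tm L.toDGMod L' t m l
    rw [one_smul]
  map_zero' := TObj.hom_ext fun m l => by
    change tm L.toDGMod L' t ((0 : R.obj t) • m) l = 0
    rw [zero_smul, map_zero, AddMonoidHom.zero_apply]
  map_mul' a b := TObj.hom_ext fun m l => by
    change tm L.toDGMod L' t ((a * b) • m) l = tm L.toDGMod L' t (a • b • m) l
    rw [mul_smul]
  map_add' a b := TObj.hom_ext fun m l => by
    change tm L.toDGMod L' t ((a + b) • m) l =
      tm L.toDGMod L' t (a • m) l + tm L.toDGMod L' t (b • m) l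
    rw [add_smul, map_add, AddMonoidHom.add_apply]

/-- Left multiplication by an element as an additive map. -/
def TObj.lAct (L L' : BiMod R) (t : T) (a : R.obj t) :
    TObj L.toDGMod L' t →+ TObj L.toDGMod L' t := TObj.leftAct L L' t a

instance (L L' : BiMod R) (t : T) : Module (R.obj t) (TObj L.toDGMod L' t) :=
  Module.compHom _ (TObj.leftAct L L' t)

/-- The tensor product `L ⊗_R L'` of two DG bimodules, as a DG bimodule. -/
def tensorBi (L L' : BiMod R) : BiMod R where
  toDGMod := tensor L.toDGMod L'
  lmod t := inferInstanceAs (Module (R.obj t) (TObj L.toDGMod L' t))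
  assoc t a x b := by
    refine DFunLike.congr_fun (TObj.hom_ext
      (f := (TObj.rAct L.toDGMod L' t (MulOpposite.op b)).comp (TObj.lAct L L' t a))
      (g := (TObj.lAct L L' t a).comp (TObj.rAct L.toDGMod L' t (MulOpposite.op b)))
      fun m l => ?_) x
    rfl
  lsmul_mem t {k n a x} ha hx := by
    refine TObj.gr_induction (f := TObj.lAct L L' t a) ?_ hx
    rintro i j rfl m hm l hl
    exact TP.tmul_mem (add_assoc _ _ _) (L.lsmul_mem t ha hm) hl
  lleibniz t {k a} ha x := by
    refine DFunLike.congr_fun (TObj.hom_ext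
      (f := (TObj.d L.toDGMod L' t).comp (TObj.lAct L L' t a))
      (g := TObj.lAct L L' t (R.d t a) +
        ksign k • (TObj.lAct L L' t a).comp (TObj.d L.toDGMod L' t))
      fun m l => ?_) x
    change TObj.d L.toDGMod L' t (tm L.toDGMod L' t (a • m) l) =
      tm L.toDGMod L' t (R.d t a • m) l + ksign k • (tm L.toDGMod L' t (a • L.d t m) l +
        tm L.toDGMod L' t (a • L.eps t m) (L'.d t l))
    have he : L.eps t (a • m) = ksign k • (a • L.eps t m) := by
      refine AtiyahDG.gr_induction (L.internal t)
        (p := fun m => L.eps t (a • m) = ksign k • (a • L.eps t m)) ?_ (by simp) ?_ m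
      · intro i m hm
        rw [L.eps_apply (L.lsmul_mem t ha hm), L.eps_apply hm, ksign_add, mul_smul,
          smul_comm a (ksign i)]
      · intro x y hx hy
        simp only [smul_add, map_add, hx, hy]
    rw [TObj.d_tm, L.lleibniz t ha, he]
    simp only [map_add, map_zsmul, AddMonoidHom.add_apply, AddMonoidHom.coe_smul, Pi.smul_apply,
      smul_add]
    abel
  res_lsmul {s t} h a x := by
    refine DFunLike.congr_fun (TObj.hom_ext
      (f := (TObj.res L.toDGMod L' h).comp (TObj.lAct L L' t a))
      (g := (TObj.lAct L L' s (R.res h a)).comp (TObj.res L.toDGMod L' h)) fun m l => ?_) x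
    change tm L.toDGMod L' s (L.res h (a • m)) (L'.res h l) =
      tm L.toDGMod L' s (R.res h a • L.res h m) (L'.res h l)
    rw [L.res_lsmul]

/-- The morphism `M ⊗ L ⟶ N` given by a balanced family of biadditive maps. -/
def tensorHom (M : DGMod R) (L : BiMod R) (N : DGMod R)
    (β : ∀ t, M.obj t →+ L.obj t →+ N.obj t)
    (bal : ∀ t m (a : R.obj t) l, β t (m <• a) l = β t m (a • l))
    (smul : ∀ t m l (a : R.obj t), β t m (l <• a) = β t m l <• a)
    (mem : ∀ t i j, ∀ m ∈ M.gr t i, ∀ l ∈ L.gr t j, β t m l ∈ N.gr t (i + j))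
    (hd : ∀ t m l, β t (M.d t m) l + β t (M.eps t m) (L.d t l) = N.d t (β t m l))
    (hres : ∀ {s t : T} (h : s ≤ t) m l, β s (M.res h m) (L.res h l) = N.res h (β t m l)) :
    tensor M L ⟶ N where
  map t := TP.lift (β t) (bal t)
  map_smul t x a := by
    refine DFunLike.congr_fun (TObj.hom_ext
      (f := (TP.lift (β t) (bal t)).comp (TObj.rAct M L t (MulOpposite.op a)))
      (g := (DistribSMul.toAddMonoidHom (N.obj t) (MulOpposite.op a)).comp
        (TP.lift (β t) (bal t))) fun m l => ?_) x
    exact smul t m l a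
  map_mem t n x hx := by
    refine TObj.gr_induction (f := TP.lift (β t) (bal t)) ?_ hx
    rintro i j rfl m hm l hl
    exact mem t i j m hm l hl
  map_d t x := by
    refine DFunLike.congr_fun (TObj.hom_ext
      (f := (TP.lift (β t) (bal t)).comp (TObj.d M L t))
      (g := (N.d t).comp (TP.lift (β t) (bal t))) fun m l => ?_) x
    rw [AddMonoidHom.comp_apply, TObj.d_tm, map_add]
    exact hd t m l
  map_res {s t} h x := by
    refine DFunLike.congr_fun (TObj.hom_ext
      (f := (TP.lift (β s) (bal s)).comp (TObj.res M L h))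
      (g := (N.res h).comp (TP.lift (β t) (bal t))) fun m l => ?_) x
    exact hres h m l

section Homogeneous

variable {X Y : Type} [AddCommGroup X] [AddCommGroup Y] {gr : ℤ → AddSubgroup X}
  {gr' : ℤ → AddSubgroup Y}

lemma comps_map (h : DirectSum.IsInternal gr) (h' : DirectSum.IsInternal gr') (f : X →+ Y)
    (hf : ∀ i, ∀ x ∈ gr i, f x ∈ gr' i) (x : X) (i : ℤ) :
    ((comps h' (f x)) i : Y) = f ((comps h x) i : X) := by
  refine gr_induction h (p := fun x => ((comps h' (f x)) i : Y) = f ((comps h x) i : X))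
    ?_ (by simp) ?_ x
  · intro j x hx
    rw [symm_apply h hx, symm_apply h' (hf j x hx)]
    by_cases hij : j = i
    · subst hij; simp
    · rw [DirectSum.of_eq_of_ne _ _ _ (Ne.symm hij), DirectSum.of_eq_of_ne _ _ _ (Ne.symm hij)]
      simp
  · intro x y hx hy; simp [hx, hy]

lemma sub_internal (h : DirectSum.IsInternal gr) (K : AddSubgroup X)
    (hK : ∀ x ∈ K, ∀ i, ((comps h x i : gr i) : X) ∈ K) :
    DirectSum.IsInternal fun n => (gr n).addSubgroupOf K := by
  refine ⟨fun x y hxy => ?_, fun x => ?_⟩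
  · let F : (DirectSum ℤ fun n => (gr n).addSubgroupOf K) →+ DirectSum ℤ fun i => gr i :=
      DirectSum.map fun i => AddMonoidHom.codRestrict
        (K.subtype.comp ((gr i).addSubgroupOf K).subtype) (gr i) (fun x => x.2)
    have hF : ∀ z, DirectSum.coeAddMonoidHom gr (F z) =
        K.subtype (DirectSum.coeAddMonoidHom (fun n => (gr n).addSubgroupOf K) z) := by
      intro z
      induction z using DirectSum.induction_on with
      | zero => simp
      | of i x =>
        simp only [F]
        erw [DirectSum.map_of]
        simp
        rfl
      | add x y hx hy => simp only [map_add, hx, hy]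
    have : F x = F y := h.1 (by rw [hF, hF]; exact congrArg _ hxy)
    refine DFinsupp.ext fun i => Subtype.ext (Subtype.ext ?_)
    exact congrArg (fun z => ((z i : gr i) : X)) this
  · have key : ∀ z : DirectSum ℤ fun i => gr i, (∀ i, ((z i : gr i) : X) ∈ K) →
        ∃ w : DirectSum ℤ fun n => (gr n).addSubgroupOf K,
          ((DirectSum.coeAddMonoidHom (fun n => (gr n).addSubgroupOf K) w : K) : X) =
            DirectSum.coeAddMonoidHom gr z := by
      intro z hz
      classical
      have hs : ∀ s : Finset ℤ, ∃ w : DirectSum ℤ fun n => (gr n).addSubgroupOf K,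
          ((DirectSum.coeAddMonoidHom (fun n => (gr n).addSubgroupOf K) w : K) : X) =
            ∑ i ∈ s, ((z i : gr i) : X) := by
        intro s
        induction s using Finset.induction_on with
        | empty => exact ⟨0, by simp⟩
        | insert i s hi ih =>
          obtain ⟨w, hw⟩ := ih
          refine ⟨DirectSum.of (fun n => (gr n).addSubgroupOf K) i ⟨⟨z i, hz i⟩, (z i).2⟩ + w, ?_⟩
          rw [map_add, Finset.sum_insert hi, AddSubgroup.coe_add, hw]
          simp
      obtain ⟨w, hw⟩ := hs (DFinsupp.support z)
      refine ⟨w, hw.trans ?_⟩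
      rw [DirectSum.coeAddMonoidHom_eq_dfinsuppSum]
      rfl
    obtain ⟨w, hw⟩ := key (comps h x) (hK x x.2)
    refine ⟨w, Subtype.ext (hw.trans ?_)⟩
    exact (comps h).symm_apply_apply (x : X)

end Homogeneous

namespace Conormal

variable {S : DGAlg T} (j₁ j₂ : DGAlg.Hom R S) (μ : DGAlg.Hom S R)

/-- The kernel `I` of `μ`. -/
def ideal (μ : DGAlg.Hom S R) (t : T) : AddSubgroup (S.obj t) := (μ.map t).toAddMonoidHom.ker

lemma mem_ideal {μ : DGAlg.Hom S R} {t : T} {x : S.obj t} : x ∈ ideal μ t ↔ μ.map t x = 0 :=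
  Iff.rfl

/-- The square `I²` of the kernel `I` of `μ`. -/
def sq (μ : DGAlg.Hom S R) (t : T) : AddSubgroup (S.obj t) :=
  AddSubgroup.closure {x | ∃ a ∈ ideal μ t, ∃ b ∈ ideal μ t, x = a * b}

/-- The sections of `I/I²`. -/
def Obj (μ : DGAlg.Hom S R) (t : T) : Type := ideal μ t ⧸ (sq μ t).addSubgroupOf (ideal μ t)

instance (t : T) : AddCommGroup (Obj μ t) :=
  inferInstanceAs (AddCommGroup (ideal μ t ⧸ (sq μ t).addSubgroupOf (ideal μ t)))

/-- The class in `I/I²` of an element of `I`. -/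
def mk (t : T) : ideal μ t →+ Obj μ t := QuotientAddGroup.mk' _

lemma mk_surj (t : T) : Function.Surjective (mk μ t) := QuotientAddGroup.mk'_surjective _

lemma sub_int (t : T) : DirectSum.IsInternal fun n => (S.gr t n).addSubgroupOf (ideal μ t) :=
  sub_internal (S.internal t) _ fun x hx i => by
    have := comps_map (S.internal t) (R.internal t) (μ.map t).toAddMonoidHom
      (fun i x hx => μ.map_mem t hx) x i
    change (μ.map t).toAddMonoidHom _ = 0
    rw [← this]
    have h0 : (μ.map t).toAddMonoidHom x = 0 := hx
    rw [h0]; simp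

lemma int (t : T) : DirectSum.IsInternal fun n =>
    ((S.gr t n).addSubgroupOf (ideal μ t)).map (mk μ t) := by
  refine quotient_internal (sub_int μ t) _ ?_
  suffices H : ∀ x ∈ sq μ t, ∀ i, ((comps (S.internal t) x i : S.gr t i) : S.obj t) ∈ sq μ t by
    intro x hx i
    have := comps_map (sub_int μ t) (S.internal t) (ideal μ t).subtype (fun i x hx => hx) x i
    change ((ideal μ t).subtype _) ∈ sq μ t
    rw [← this]
    exact H _ hx i
  intro x hx i
  induction hx using AddSubgroup.closure_induction with
  | mem x hx =>
    obtain ⟨a, ha, b, hb, rfl⟩ := hx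
    refine gr_induction (sub_int μ t) (p := fun a : ideal μ t =>
      ((comps (S.internal t) (a * b) i : S.gr t i) : S.obj t) ∈ sq μ t) ?_
      (by simp [zero_mem]) ?_ ⟨a, ha⟩
    · intro j a haj
      refine gr_induction (sub_int μ t) (p := fun b : ideal μ t =>
        ((comps (S.internal t) (a * b) i : S.gr t i) : S.obj t) ∈ sq μ t) ?_
        (by simp [zero_mem]) ?_ ⟨b, hb⟩
      · intro k b hbk
        have hab : (a : S.obj t) * (b : S.obj t) ∈ S.gr t (j + k) := S.mul_mem t haj hbk
        rw [symm_apply (S.internal t) hab]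
        by_cases hi : j + k = i
        · subst hi
          rw [DirectSum.of_eq_same]
          exact AddSubgroup.subset_closure ⟨a, a.2, b, b.2, rfl⟩
        · rw [DirectSum.of_eq_of_ne _ _ _ (Ne.symm hi)]; exact zero_mem _
      · intro x y hx hy
        rw [AddSubgroup.coe_add, mul_add, map_add, DirectSum.add_apply, AddSubgroup.coe_add]
        exact add_mem hx hy
    · intro x y hx hy
      rw [AddSubgroup.coe_add, add_mul, map_add, DirectSum.add_apply, AddSubgroup.coe_add]
      exact add_mem hx hy
  | zero => simp [zero_mem]
  | add x y hx hy ex ey => rw [map_add, DirectSum.add_apply, AddSubgroup.coe_add]; exact add_mem ex ey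
  | neg x hx ex => rw [map_neg, DFinsupp.neg_apply, AddSubgroup.coe_neg]; exact neg_mem ex

/-- An additive map that preserves `I` and `I²` acts on `I/I²`. -/
def map {t s : T} (f : S.obj t →+ S.obj s) (h : ∀ x ∈ ideal μ t, f x ∈ ideal μ s)
    (h2 : ∀ a ∈ ideal μ t, ∀ b ∈ ideal μ t, f (a * b) ∈ sq μ s) : Obj μ t →+ Obj μ s :=
  QuotientAddGroup.map _ _ ((f.comp (ideal μ t).subtype).codRestrict (ideal μ s)
    (fun x => h x x.2)) (by
      have : sq μ t ≤ (sq μ s).comap f := by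
        rw [sq, AddSubgroup.closure_le]
        rintro _ ⟨a, ha, b, hb, rfl⟩
        exact h2 a ha b hb
      intro x hx
      exact this hx)

lemma map_mk {t s : T} (f : S.obj t →+ S.obj s) (h : ∀ x ∈ ideal μ t, f x ∈ ideal μ s)
    (h2 : ∀ a ∈ ideal μ t, ∀ b ∈ ideal μ t, f (a * b) ∈ sq μ s) (x : ideal μ t) :
    map μ f h h2 (mk μ t x) = mk μ s ⟨f x, h x x.2⟩ := rfl

lemma prod_mem {t : T} {a b : S.obj t} (ha : a ∈ ideal μ t) (hb : b ∈ ideal μ t) :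
    a * b ∈ sq μ t := AddSubgroup.subset_closure ⟨a, ha, b, hb, rfl⟩

lemma mul_ideal {t : T} (a : S.obj t) {b : S.obj t} (hb : b ∈ ideal μ t) :
    a * b ∈ ideal μ t := by
  rw [mem_ideal] at *; rw [map_mul, hb, mul_zero]

lemma ideal_mul {t : T} {a : S.obj t} (ha : a ∈ ideal μ t) (b : S.obj t) :
    a * b ∈ ideal μ t := by
  rw [mem_ideal] at *; rw [map_mul, ha, zero_mul]

lemma d_ideal {t : T} {a : S.obj t} (ha : a ∈ ideal μ t) : S.d t a ∈ ideal μ t := by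
  rw [mem_ideal] at *; rw [μ.map_d, ha, map_zero]

lemma mk_eq {t : T} {x y : S.obj t} (h : x = y) (hx : x ∈ ideal μ t) (hy : y ∈ ideal μ t) :
    mk μ t ⟨x, hx⟩ = mk μ t ⟨y, hy⟩ := by subst h; rfl

/-- Left multiplication by `j₁(a)` on `I/I²`. -/
def lAct (t : T) : R.obj t →+* AddMonoid.End (Obj μ t) where
  toFun a := map μ (AddMonoidHom.mulLeft (j₁.map t a)) (fun _ hx => mul_ideal μ _ hx)
    (fun x hx y hy => by
      rw [AddMonoidHom.coe_mulLeft, ← mul_assoc]; exact prod_mem μ (mul_ideal μ _ hx) hy)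
  map_one' := by
    ext x; obtain ⟨x, rfl⟩ := mk_surj μ t x
    exact mk_eq μ (by simp) _ _
  map_zero' := by
    ext x; obtain ⟨x, rfl⟩ := mk_surj μ t x
    exact (mk_eq μ (by simp) _ (zero_mem _)).trans (map_zero (mk μ t))
  map_mul' a b := by
    ext x; obtain ⟨x, rfl⟩ := mk_surj μ t x
    refine mk_eq μ ?_ (mul_ideal μ _ x.2) (mul_ideal μ _ (mul_ideal μ _ x.2))
    simp [mul_assoc]
  map_add' a b := by
    ext x; obtain ⟨x, rfl⟩ := mk_surj μ t x
    exact mk_eq μ (by simp [add_mul]) _ (add_mem (mul_ideal μ _ x.2) (mul_ideal μ _ x.2))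

/-- Right multiplication by `j₂(a)` on `I/I²`. -/
def rAct (t : T) : (R.obj t)ᵐᵒᵖ →+* AddMonoid.End (Obj μ t) where
  toFun a := map μ (AddMonoidHom.mulRight (j₂.map t a.unop)) (fun _ hx => ideal_mul μ hx _)
    (fun x hx y hy => by
      rw [AddMonoidHom.mulRight_apply, mul_assoc]; exact prod_mem μ hx (ideal_mul μ hy _))
  map_one' := by
    ext x; obtain ⟨x, rfl⟩ := mk_surj μ t x
    exact mk_eq μ (by simp) _ _
  map_zero' := by
    ext x; obtain ⟨x, rfl⟩ := mk_surj μ t x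
    exact (mk_eq μ (by simp) _ (zero_mem _)).trans (map_zero (mk μ t))
  map_mul' a b := by
    ext x; obtain ⟨x, rfl⟩ := mk_surj μ t x
    refine mk_eq μ ?_ (ideal_mul μ x.2 _) (ideal_mul μ (ideal_mul μ x.2 _) _)
    simp [mul_assoc]
  map_add' a b := by
    ext x; obtain ⟨x, rfl⟩ := mk_surj μ t x
    exact mk_eq μ (by simp [mul_add]) _ (add_mem (ideal_mul μ x.2 _) (ideal_mul μ x.2 _))

lemma mk_add {t : T} {x y : S.obj t} (hx : x ∈ ideal μ t) (hy : y ∈ ideal μ t) :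
    mk μ t ⟨x + y, add_mem hx hy⟩ = mk μ t ⟨x, hx⟩ + mk μ t ⟨y, hy⟩ :=
  map_add (mk μ t) ⟨x, hx⟩ ⟨y, hy⟩

lemma mk_zsmul {t : T} {x : S.obj t} (hx : x ∈ ideal μ t) (k : ℤ) :
    mk μ t ⟨k • x, zsmul_mem hx k⟩ = k • mk μ t ⟨x, hx⟩ :=
  map_zsmul (mk μ t) k ⟨x, hx⟩

lemma res_ideal {s t : T} (h : s ≤ t) {x : S.obj t} (hx : x ∈ ideal μ t) :
    S.res h x ∈ ideal μ s := by
  rw [mem_ideal] at *; rw [μ.map_res, hx, map_zero]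

/-- The DG bimodule `I/I²` of a map `μ`, where `R` acts from the left through `j₁` and from the
right through `j₂`. -/
def bimod : BiMod R where
  obj t := Obj μ t
  mod t := Module.compHom _ (rAct j₂ μ t)
  gr t n := ((S.gr t n).addSubgroupOf (ideal μ t)).map (mk μ t)
  internal := int μ
  smul_mem t i j m a := by
    rintro ⟨x, hx, rfl⟩ ha
    exact ⟨⟨x * j₂.map t a, ideal_mul μ x.2 _⟩, S.mul_mem t hx (j₂.map_mem t ha), rfl⟩
  d t := map μ (S.d t) (fun _ hx => d_ideal μ hx) (fun x hx y hy => by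
    refine gr_induction (sub_int μ t) (p := fun x : ideal μ t => S.d t (x * y) ∈ sq μ t) ?_
      (by simp [zero_mem]) ?_ ⟨x, hx⟩
    · intro i x hi
      have hi' : (x : S.obj t) ∈ S.gr t i := hi
      rw [S.leibniz t hi']
      exact add_mem (prod_mem μ (d_ideal μ x.2) hy)
        (zsmul_mem (prod_mem μ x.2 (d_ideal μ hy)) _)
    · intro a b ha hb
      rw [AddSubgroup.coe_add, add_mul, map_add]; exact add_mem ha hb)
  d_mem t i m := by
    rintro ⟨x, hx, rfl⟩
    exact ⟨⟨S.d t x, d_ideal μ x.2⟩, S.d_mem t hx, rfl⟩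
  d_d t m := by
    obtain ⟨x, rfl⟩ := mk_surj μ t m
    exact (mk_eq μ (S.d_d t x) _ (zero_mem _)).trans (map_zero (mk μ t))
  leibniz t i m := by
    rintro ⟨x, hx, rfl⟩ a
    refine (mk_eq μ ?_ _ (add_mem (ideal_mul μ (d_ideal μ x.2) (j₂.map t a))
      (zsmul_mem (ideal_mul μ x.2 (j₂.map t (R.d t a))) (ksign i)))).trans ?_
    · change S.d t (x * j₂.map t a) = _
      have hx' : (x : S.obj t) ∈ S.gr t i := hx
      rw [S.leibniz t hx', j₂.map_d]
    · rw [mk_add μ (ideal_mul μ (d_ideal μ x.2) (j₂.map t a))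
        (zsmul_mem (ideal_mul μ x.2 (j₂.map t (R.d t a))) (ksign i)), mk_zsmul]
      rfl
  res {s t} h := map μ (S.res h).toAddMonoidHom (fun _ hx => res_ideal μ h hx) (fun x hx y hy => by
    change S.res h (x * y) ∈ _
    rw [map_mul]; exact prod_mem μ (res_ideal μ h hx) (res_ideal μ h hy))
  res_refl t m := by
    obtain ⟨x, rfl⟩ := mk_surj μ t m
    exact mk_eq μ (S.res_refl t x) _ _
  res_trans h h' m := by
    obtain ⟨x, rfl⟩ := mk_surj μ _ m
    exact mk_eq μ (S.res_trans h h' (x : S.obj _)) _ _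
  res_mem {s t} h i m := by
    rintro ⟨x, hx, rfl⟩
    exact ⟨⟨S.res h x, res_ideal μ h x.2⟩, S.res_mem h hx, rfl⟩
  res_d h m := by
    obtain ⟨x, rfl⟩ := mk_surj μ _ m
    exact mk_eq μ (S.res_d h (x : S.obj _)) _ _
  res_smul {s t} h m a := by
    obtain ⟨x, rfl⟩ := mk_surj μ _ m
    refine mk_eq μ ?_ (res_ideal μ h (ideal_mul μ x.2 _)) (ideal_mul μ (res_ideal μ h x.2) _)
    simp [j₂.map_res]
  lmod t := Module.compHom _ (lAct j₁ μ t)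
  assoc t a m b := by
    obtain ⟨x, rfl⟩ := mk_surj μ _ m
    exact mk_eq μ (mul_assoc _ _ _) (ideal_mul μ (mul_ideal μ _ x.2) _)
      (mul_ideal μ _ (ideal_mul μ x.2 _))
  lsmul_mem t i j a m := by
    rintro ha ⟨x, hx, rfl⟩
    exact ⟨⟨j₁.map t a * x, mul_ideal μ _ x.2⟩, S.mul_mem t (j₁.map_mem t ha) hx, rfl⟩
  lleibniz t i a ha m := by
    obtain ⟨x, rfl⟩ := mk_surj μ _ m
    refine (mk_eq μ ?_ _ (add_mem (mul_ideal μ (j₁.map t (R.d t a)) x.2)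
      (zsmul_mem (mul_ideal μ (j₁.map t a) (d_ideal μ x.2)) (ksign i)))).trans ?_
    · change S.d t (j₁.map t a * x) = _
      rw [S.leibniz t (j₁.map_mem t ha), j₁.map_d]
    · rw [mk_add μ (mul_ideal μ (j₁.map t (R.d t a)) x.2)
        (zsmul_mem (mul_ideal μ (j₁.map t a) (d_ideal μ x.2)) (ksign i)), mk_zsmul]
      rfl
  res_lsmul {s t} h a m := by
    obtain ⟨x, rfl⟩ := mk_surj μ _ m
    refine mk_eq μ ?_ (res_ideal μ h (mul_ideal μ _ x.2)) (mul_ideal μ _ (res_ideal μ h x.2))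
    simp [j₁.map_res]

variable (h₁ : ∀ t a, μ.map t (j₁.map t a) = a) (h₂ : ∀ t a, μ.map t (j₂.map t a) = a)

/-- The derivation `a ↦ 1 ⊗ a - a ⊗ 1` with values in `I/I²`. -/
def der (t : T) : R.obj t →+ Obj μ t :=
  (mk μ t).comp (((j₂.map t).toAddMonoidHom - (j₁.map t).toAddMonoidHom).codRestrict
    (ideal μ t) (fun a => by
      change μ.map t (j₂.map t a - j₁.map t a) = 0
      rw [map_sub, h₁, h₂, sub_self]))

end Conormal


/-- `m ⊗ l`, as a section of the DG module `M ⊗ L`. -/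
def tensorMk (M : DGMod R) (L : BiMod R) (t : T) : M.obj t →+ L.obj t →+ (tensor M L).obj t :=
  tm M L t

lemma DGMod.comp_map {M N K : DGMod R} (f : M ⟶ N) (g : N ⟶ K) (t : T) :
    DGMod.Hom.map (f ≫ g) t = (DGMod.Hom.map g t).comp (DGMod.Hom.map f t) := rfl

/-- The shift of a morphism. -/
def shiftMap {M N : DGMod R} (f : M ⟶ N) : M.shift ⟶ N.shift where
  map t := f.map t
  map_smul t m a := f.map_smul t m a
  map_mem t _ _ h := f.map_mem t h
  map_d t (m : M.obj t) := (map_neg (f.map t) (M.d t m)).trans (congrArg Neg.neg (f.map_d t m))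
  map_res h m := f.map_res h m

/-- `φ ⊗ id : P ⊗ L ⟶ M ⊗ L`. -/
def tensorMapLeft {P M : DGMod R} (φ : P ⟶ M) (L : BiMod R) : tensor P L ⟶ tensor M L :=
  tensorHom P L (tensor M L) (fun t => (tm M L t).comp (φ.map t))
    (fun t m a l => by
      change tm M L t (φ.map t (m <• a)) l = tm M L t (φ.map t m) (a • l)
      rw [φ.map_smul]; exact TP.tmul_smul _ _ _)
    (fun t m l a => rfl)
    (fun t i j m hm l hl => TP.tmul_mem rfl (φ.map_mem t hm) hl)
    (fun t m l => by
      change tm M L t (φ.map t (P.d t m)) l + tm M L t (φ.map t (P.eps t m)) (L.d t l) =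
        TObj.d M L t (tm M L t (φ.map t m) l)
      rw [TObj.d_tm, φ.map_d, DGMod.eps_map t (φ.map t) (fun _ _ h => φ.map_mem t h)])
    (fun {s t} h m l => by
      change tm M L s (φ.map s (P.res h m)) (L.res h l) =
        TObj.res M L h (tm M L t (φ.map t m) l)
      rw [TObj.res_tm, φ.map_res])

/-- `id ⊗ f : M ⊗ L ⟶ M ⊗ L'` for a map of DG bimodules `f`. -/
def tensorMapRight (M : DGMod R) {L L' : BiMod R} (f : L.toDGMod ⟶ L'.toDGMod)
    (hf : ∀ t (a : R.obj t) (l : L.obj t), f.map t (a • l) = a • f.map t l) :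
    tensor M L ⟶ tensor M L' :=
  tensorHom M L (tensor M L')
    (fun t => AddMonoidHom.flip ((tm M L' t).flip.comp (f.map t)))
    (fun t m a l => by
      change tm M L' t (m <• a) (f.map t l) = tm M L' t m (f.map t (a • l))
      rw [hf]; exact TP.tmul_smul _ _ _)
    (fun t m l a => by
      change tm M L' t m (f.map t (l <• a)) = tm M L' t m (f.map t l <• a)
      rw [f.map_smul])
    (fun t i j m hm l hl => TP.tmul_mem rfl hm (f.map_mem t hl))
    (fun t m l => by
      change tm M L' t (M.d t m) (f.map t l) + tm M L' t (M.eps t m) (f.map t (L.d t l)) =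
        TObj.d M L' t (tm M L' t m (f.map t l))
      rw [TObj.d_tm, f.map_d])
    (fun {s t} h m l => by
      change tm M L' s (M.res h m) (f.map s (L.res h l)) =
        TObj.res M L' h (tm M L' t m (f.map t l))
      rw [TObj.res_tm, f.map_res])

/-- A derivation of degree zero on `R` with values in a DG bimodule that commutes with the
differentials. -/
structure Deriv (Ω : BiMod R) where
  map : ∀ t, R.obj t →+ Ω.obj t
  map_mem : ∀ t {i : ℤ} {a : R.obj t}, a ∈ R.gr t i → map t a ∈ Ω.gr t i
  map_mul : ∀ t (a b : R.obj t), map t (a * b) = map t a <• b + a • map t b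
  map_d : ∀ t (a : R.obj t), map t (R.d t a) = Ω.d t (map t a)
  map_res : ∀ {s t : T} (h : s ≤ t) (a : R.obj t), map s (R.res h a) = Ω.res h (map t a)

/-- The derivation `a ↦ 1 ⊗ a - a ⊗ 1` with values in `I/I²`. -/
def Conormal.deriv {S : DGAlg T} (j₁ j₂ : DGAlg.Hom R S) (μ : DGAlg.Hom S R)
    (h₁ : ∀ t a, μ.map t (j₁.map t a) = a) (h₂ : ∀ t a, μ.map t (j₂.map t a) = a) :
    Deriv (Conormal.bimod j₁ j₂ μ) where
  map t := Conormal.der j₁ j₂ μ h₁ h₂ t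
  map_mem t i a ha :=
    ⟨⟨j₂.map t a - j₁.map t a, by rw [Conormal.mem_ideal, map_sub, h₁, h₂, sub_self]⟩,
      sub_mem (j₂.map_mem t ha) (j₁.map_mem t ha), rfl⟩
  map_mul t a b := by
    have hx : ∀ a, j₂.map t a - j₁.map t a ∈ Conormal.ideal μ t := fun a => by
      rw [Conormal.mem_ideal, map_sub, h₁, h₂, sub_self]
    refine (Conormal.mk_eq μ ?_ (hx (a * b)) (add_mem (Conormal.ideal_mul μ (hx a) (j₂.map t b))
      (Conormal.mul_ideal μ (j₁.map t a) (hx b)))).trans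
      (Conormal.mk_add μ (Conormal.ideal_mul μ (hx a) (j₂.map t b))
        (Conormal.mul_ideal μ (j₁.map t a) (hx b)))
    simp only [map_mul]; noncomm_ring
  map_d t a := by
    have hx : ∀ a, j₂.map t a - j₁.map t a ∈ Conormal.ideal μ t := fun a => by
      rw [Conormal.mem_ideal, map_sub, h₁, h₂, sub_self]
    refine Conormal.mk_eq μ ?_ (hx _) (Conormal.d_ideal μ (hx a))
    simp [j₁.map_d, j₂.map_d]
  map_res {s t} h a := by
    have hx : ∀ t a, j₂.map t a - j₁.map t a ∈ Conormal.ideal μ t := fun t a => by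
      rw [Conormal.mem_ideal, map_sub, h₁, h₂, sub_self]
    refine Conormal.mk_eq μ ?_ (hx _ _) (Conormal.res_ideal μ h (hx _ a))
    simp [j₁.map_res, j₂.map_res]

/-- A connection `∇ : N → N ⊗_R Ω` on a right DG module, with respect to a derivation
`δ : R → Ω`: an additive map of degree zero with `∇(n a) = ∇(n) a + n ⊗ δ(a)`. It need not
commute with the differentials. -/
structure Connection (N : DGMod R) {Ω : BiMod R} (δ : Deriv Ω) where
  map : ∀ t, N.obj t →+ (tensor N Ω).obj t
  map_mem : ∀ t {i : ℤ} {n : N.obj t}, n ∈ N.gr t i → map t n ∈ (tensor N Ω).gr t i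
  map_smul : ∀ t (n : N.obj t) (a : R.obj t),
    map t (n <• a) = map t n <• a + tensorMk N Ω t n (δ.map t a)
  map_res : ∀ {s t : T} (h : s ≤ t) (n : N.obj t),
    map s (N.res h n) = (tensor N Ω).res h (map t n)

/-- The morphism `[∂, ∇] = ∂ ∇ - ∇ ∂ : N ⟶ (N ⊗ Ω)[1]` of a connection `∇`. -/
def Connection.atiyah {N : DGMod R} {Ω : BiMod R} {δ : Deriv Ω} (c : Connection N δ) :
    N ⟶ (tensor N Ω).shift where
  map t := ((tensor N Ω).d t).comp (c.map t) - (c.map t).comp (N.d t)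
  map_smul t n a := by
    change (tensor N Ω).d t (c.map t (n <• a)) - c.map t (N.d t (n <• a)) =
      ((tensor N Ω).d t (c.map t n) - c.map t (N.d t n)) <• a
    let τ := tensorMk N Ω t
    have e : ∀ n ω, (tensor N Ω).d t (τ n ω) = τ (N.d t n) ω + τ (N.eps t n) (Ω.d t ω) :=
      fun _ _ => rfl
    have hm : ∀ n a, c.map t (n <• a) = c.map t n <• a + τ n (δ.map t a) := c.map_smul t
    rw [hm, map_add, (tensor N Ω).leibniz', N.leibniz', map_add, hm, hm, e, δ.map_d, DGMod.eps_map t (c.map t) (fun _ _ h => c.map_mem t h), smul_sub]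
    abel
  map_mem t i n hn := by
    exact sub_mem ((tensor N Ω).d_mem t (c.map_mem t hn)) (c.map_mem t (N.d_mem t hn))
  map_d t n := by
    change (tensor N Ω).d t (c.map t (N.d t n)) - c.map t (N.d t (N.d t n)) =
      -((tensor N Ω).d t ((tensor N Ω).d t (c.map t n) - c.map t (N.d t n)))
    rw [map_sub, N.d_d, (tensor N Ω).d_d, map_zero]; abel
  map_res h n := by
    change (tensor N Ω).d _ (c.map _ (N.res h n)) - c.map _ (N.d _ (N.res h n)) =
      (tensor N Ω).res h ((tensor N Ω).d _ (c.map _ n) - c.map _ (N.d _ n))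
    rw [map_sub, c.map_res, ← N.res_d, c.map_res, (tensor N Ω).res_d]

/-- Left multiplication by an element of `B` on `B ⊗_R Ω`. -/
def mulLeftTensor {B : DGAlg T} (l r : DGAlg.Hom R B) (Ω : BiMod R) (t : T) (b : B.obj t) :
    TObj (l.bimod r).toDGMod Ω t →+ TObj (l.bimod r).toDGMod Ω t :=
  TObj.mapLeft Ω t (AddMonoidHom.mulLeft b) (fun m a => (mul_assoc b m (r.map t a)).symm)

/-- A universal connection: a derivation `∇ : B → B ⊗_R Ω` over `l` that restricts to `δ` along
`r`. Here `B` is a DG ring with two maps `l, r` from `R`, and `B ⊗_R Ω` is formed along `r`. -/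
structure UniversalConnection {B : DGAlg T} (l r : DGAlg.Hom R B) {Ω : BiMod R}
    (δ : Deriv Ω) extends Connection (l.bimod r).toDGMod δ where
  map_lsmul : ∀ t (a : R.obj t) (b : (l.bimod r).obj t),
    map t (a • b) = TObj.lAct (l.bimod r) Ω t a (map t b)
  map_mul : ∀ t {i j : ℤ} {b b' : B.obj t}, b ∈ B.gr t i → b' ∈ B.gr t j →
    map t (b * b') = mulLeftTensor l r Ω t b (map t b') +
      ksign (i * j) • mulLeftTensor l r Ω t b' (map t b)

/-- The sections of `At_B = [∂, ∇_B] : B → (B ⊗_R Ω)[1]`, with values in the bimodule `B ⊗_R Ω`. -/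
def UniversalConnection.atiyahBi {B : DGAlg T} {l r : DGAlg.Hom R B} {Ω : BiMod R}
    {δ : Deriv Ω} (c : UniversalConnection l r δ) (t : T) :
    (l.bimod r).obj t →+ (tensorBi (l.bimod r) Ω).obj t :=
  c.atiyah.map t

lemma UniversalConnection.atiyahBi_lsmul {B : DGAlg T} {l r : DGAlg.Hom R B} {Ω : BiMod R}
    {δ : Deriv Ω} (c : UniversalConnection l r δ) (t : T) (a : R.obj t) (b : (l.bimod r).obj t) :
    c.atiyahBi t (a • b) = R.eps t a • c.atiyahBi t b := by
  let n : (l.bimod r).obj t →+ (tensorBi (l.bimod r) Ω).obj t := c.map t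
  have hn : ∀ (a : R.obj t) b, n (a • b) = a • n b := c.map_lsmul t
  change (tensorBi (l.bimod r) Ω).d t (n (a • b)) - n ((l.bimod r).d t (a • b)) =
    R.eps t a • ((tensorBi (l.bimod r) Ω).d t (n b) - n ((l.bimod r).d t b))
  rw [hn, BiMod.lleibniz', BiMod.lleibniz', map_add, hn, hn, smul_sub]
  abel

/-- `id_M ⊗ At_B : M ⊗_R B ⟶ (M ⊗_R B ⊗_R Ω)[1]`, where `At_B = [∂, ∇_B]` for a universal
connection `∇_B`, `B` is a left module through `l`, and everything is a right module through `r`.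
As `At_B` has degree one, `id_M ⊗ At_B` maps `m ⊗ b` to `(-1)^{|m|} m ⊗ At_B(b)`. -/
def UniversalConnection.idTensor {B : DGAlg T} {l r : DGAlg.Hom R B} {Ω : BiMod R}
    {δ : Deriv Ω} (c : UniversalConnection l r δ) (M : DGMod R) :
    tensor M (l.bimod r) ⟶ (tensor M (tensorBi (l.bimod r) Ω)).shift :=
  tensorHom M (l.bimod r) _
    (fun t => AddMonoidHom.flip (((tm M (tensorBi (l.bimod r) Ω) t).comp (M.eps t)).flip.comp
      (c.atiyahBi t)))
    (fun t m a b => by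
      change tm M (tensorBi (l.bimod r) Ω) t (M.eps t (m <• a)) (c.atiyahBi t b) =
        tm M (tensorBi (l.bimod r) Ω) t (M.eps t m) (c.atiyahBi t (a • b))
      rw [c.atiyahBi_lsmul, M.eps_smul]
      exact TP.tmul_smul _ _ _)
    (fun t m b a => by
      change tm M (tensorBi (l.bimod r) Ω) t (M.eps t m) (c.atiyahBi t (b <• a)) =
        tm M (tensorBi (l.bimod r) Ω) t (M.eps t m) (c.atiyahBi t b <• a)
      exact congrArg _ (c.atiyah.map_smul t b a))
    (fun t i j m hm b hb => by
      have h1 : c.atiyahBi t b ∈ (tensorBi (l.bimod r) Ω).gr t (j + 1) := c.atiyah.map_mem t hb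
      change tm M (tensorBi (l.bimod r) Ω) t (M.eps t m) (c.atiyahBi t b) ∈ _
      rw [M.eps_apply hm]
      exact TP.tmul_mem (by ring) (zsmul_mem hm _) h1)
    (fun t m b => by
      have h1 : c.atiyahBi t ((l.bimod r).d t b) =
        -((tensorBi (l.bimod r) Ω).d t (c.atiyahBi t b)) := c.atiyah.map_d t b
      change tm M (tensorBi (l.bimod r) Ω) t (M.eps t (M.d t m)) (c.atiyahBi t b) +
        tm M (tensorBi (l.bimod r) Ω) t (M.eps t (M.eps t m)) (c.atiyahBi t ((l.bimod r).d t b)) =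
        -(TObj.d M (tensorBi (l.bimod r) Ω) t
          (tm M (tensorBi (l.bimod r) Ω) t (M.eps t m) (c.atiyahBi t b)))
      rw [TObj.d_tm, h1, M.eps_d, map_neg, map_neg, AddMonoidHom.neg_apply, neg_add])
    (fun {s t} h m b => by
      have h1 : c.atiyahBi s ((l.bimod r).res h b) =
        (tensorBi (l.bimod r) Ω).res h (c.atiyahBi t b) := c.atiyah.map_res h b
      change tm M (tensorBi (l.bimod r) Ω) s (M.eps s (M.res h m))
        (c.atiyahBi s ((l.bimod r).res h b)) =
        TObj.res M (tensorBi (l.bimod r) Ω) h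
          (tm M (tensorBi (l.bimod r) Ω) t (M.eps t m) (c.atiyahBi t b))
      rw [TObj.res_tm, h1, M.eps_res])

section Augmentation

variable {B : DGAlg T} (l r : DGAlg.Hom R B) (ν : DGAlg.Hom B R)
  (hl : ∀ t a, ν.map t (l.map t a) = a) (hr : ∀ t a, ν.map t (r.map t a) = a)

/-- A DG ring map `ν : B → R` with `ν r = id`, as a morphism of right DG modules. -/
def augHom (hr : ∀ t a, ν.map t (r.map t a) = a) :
    (l.bimod r).toDGMod ⟶ ((DGAlg.Hom.id R).bimod (DGAlg.Hom.id R)).toDGMod where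
  map t := (ν.map t).toAddMonoidHom
  map_smul t (b : B.obj t) a := by
    change ν.map t (b * r.map t a) = ν.map t b * a
    rw [map_mul, hr]
  map_mem t _ _ h := ν.map_mem t h
  map_d t b := ν.map_d t b
  map_res h b := ν.map_res h b

/-- The action `a ↦ m a` as an additive map. -/
def actHom (M : DGMod R) (t : T) : M.obj t →+ R.obj t →+ M.obj t where
  toFun m := AddMonoidHom.mk' (fun a => m <• a) (fun a b => by
    rw [MulOpposite.op_add, add_smul])
  map_zero' := by ext; simp
  map_add' m m' := by ext; simp

/-- `id_M ⊗ ν : M ⊗_R B ⟶ M ⊗_R R ≅ M`, the morphism `m ⊗ b ↦ m ν(b)`. -/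
def idTensorAug (M : DGMod R) : tensor M (l.bimod r) ⟶ M :=
  tensorHom M (l.bimod r) M
    (fun t => AddMonoidHom.flip ((actHom M t).flip.comp (ν.map t).toAddMonoidHom))
    (fun t m a (b : B.obj t) => by
      change (m <• a) <• ν.map t b = m <• ν.map t (l.map t a * b)
      rw [map_mul, hl, MulOpposite.op_mul, mul_smul])
    (fun t m (b : B.obj t) a => by
      change m <• ν.map t (b * r.map t a) = (m <• ν.map t b) <• a
      rw [map_mul, hr, MulOpposite.op_mul, mul_smul])
    (fun t i j m hm b hb => M.smul_mem t hm (ν.map_mem t hb))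
    (fun t m (b : B.obj t) => by
      change M.d t m <• ν.map t b + M.eps t m <• ν.map t (B.d t b) = M.d t (m <• ν.map t b)
      rw [M.leibniz', ν.map_d])
    (fun {s t} h m (b : B.obj t) => by
      change M.res h m <• ν.map s (B.res h b) = M.res h (m <• ν.map t b)
      rw [M.res_smul, ν.map_res])

/-- `ν ⊗ id : B ⊗_R Ω ⟶ R ⊗_R Ω ≅ Ω`, the morphism `b ⊗ ω ↦ ν(b) ω`. -/
def augTensor (hr : ∀ t a, ν.map t (r.map t a) = a) (Ω : BiMod R) :
    tensor (l.bimod r).toDGMod Ω ⟶ Ω.toDGMod :=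
  tensorHom (l.bimod r).toDGMod Ω Ω.toDGMod
    (fun t => (AddMonoidHom.mk' (fun a => DistribSMul.toAddMonoidHom (Ω.obj t) a) (fun a b => by
      ext; simp [add_smul]) : R.obj t →+ Ω.obj t →+ Ω.obj t).comp (ν.map t).toAddMonoidHom)
    (fun t (b : B.obj t) a ω => by
      change ν.map t (b * r.map t a) • ω = ν.map t b • a • ω
      rw [map_mul, hr, mul_smul])
    (fun t b ω a => (Ω.assoc t (ν.map t b) ω a).symm)
    (fun t i j b hb ω hω => Ω.lsmul_mem t (ν.map_mem t hb) hω)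
    (fun t (b : B.obj t) ω => by
      change ν.map t (B.d t b) • ω + ν.map t ((l.bimod r).eps t b) • Ω.d t ω =
        Ω.d t (ν.map t b • ω)
      have := DGMod.eps_map t ((augHom l r ν hr).map t)
        (fun _ _ h => (augHom l r ν hr).map_mem t h) b
      have h2 : R.eps t (ν.map t b) = ν.map t ((l.bimod r).eps t b) := this
      rw [Ω.lleibniz', ν.map_d, h2])
    (fun {s t} h (b : B.obj t) ω => by
      change ν.map s (B.res h b) • Ω.res h ω = Ω.res h (ν.map t b • ω)
      rw [Ω.res_lsmul, ν.map_res])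

/-- `id_M ⊗ ν ⊗ id : M ⊗_R B ⊗_R Ω ⟶ M ⊗_R Ω`. -/
def idTensorAugTensor (M : DGMod R) (Ω : BiMod R) :
    tensor M (tensorBi (l.bimod r) Ω) ⟶ tensor M Ω :=
  tensorMapRight M (L := tensorBi (l.bimod r) Ω) (L' := Ω) (augTensor l r ν hr Ω)
    (fun t a x => by
      refine DFunLike.congr_fun (TObj.hom_ext
        (f := ((augTensor l r ν hr Ω).map t).comp (TObj.lAct (l.bimod r) Ω t a))
        (g := (DistribSMul.toAddMonoidHom (Ω.obj t) a).comp ((augTensor l r ν hr Ω).map t))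
        fun (b : B.obj t) ω => ?_) x
      change ν.map t (l.map t a * b) • ω = a • ν.map t b • ω
      rw [map_mul, hl, mul_smul])

end Augmentation


end DG

section Geometry

open scoped ContDiff

/-- The complex affine space `ℂⁿ` with its sheaf of holomorphic functions. -/
def Aff (n : ℕ) : LocallyRingedSpace.{0} :=
  ChartedSpace.locallyRingedSpace 𝓘(ℂ, Fin n → ℂ) (Fin n → ℂ)

/-- The constants, as functions on `ℂⁿ`. -/
def affConst (n : ℕ) : ℂ →+* LocallyRingedSpace.Γ.obj (op (Aff n)) :=
  algebraMap ℂ C^∞⟮𝓘(ℂ, Fin n → ℂ), (⊤ : Opens (Fin n → ℂ)); 𝓘(ℂ), ℂ⟯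

/-- The map `ℂⁿ ⟶ ℂᵐ`, `x ↦ (x_{σ 1}, …, x_{σ m})`. -/
def affProj {m n : ℕ} (σ : Fin m → Fin n) : Aff n ⟶ Aff m :=
  ChartedSpace.locallyRingedSpaceMap (fun x => x ∘ σ)
    (contMDiff_iff_contDiff.2 (contDiff_pi.2 fun i => contDiff_apply ℂ ℂ (σ i)))

/-- The constants on the source of a morphism to a space with a fixed ring of constants. -/
def scal {X Y : LocallyRingedSpace.{0}} (f : X ⟶ Y)
    (sc : ℂ →+* LocallyRingedSpace.Γ.obj (op Y)) : ℂ →+* LocallyRingedSpace.Γ.obj (op X) :=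
  (LocallyRingedSpace.Γ.map f.op).hom.comp sc

/-- An analytic chart of a `ℂ`-ringed space `X`: an open part `dom` of `X` with an embedding into
some `ℂⁿ`, as a subset of the complex subspace of an open set `nbhd` that is cut out by finitely
many holomorphic functions. If the image is locally closed and is the whole zero locus, this is a
local model of a complex space; in general it is the topological restriction of a complex space to
a subset, such as a Stein compact set. -/
structure Chart (X : LocallyRingedSpace.{0}) (sc : ℂ →+* LocallyRingedSpace.Γ.obj (op X)) where
  dom : LocallyRingedSpace.{0}
  incl : dom ⟶ X
  [isOpen : LocallyRingedSpace.IsOpenImmersion incl]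
  dim : ℕ
  toAff : dom ⟶ Aff dim
  isEmbedding : Topology.IsEmbedding toAff.base
  linear : scal toAff (affConst dim) = scal incl sc
  nbhd : Opens (Aff dim)
  mem_nbhd : ∀ u : dom, toAff.base u ∈ nbhd
  num : ℕ
  eqn : Fin num → (Aff dim).presheaf.obj (op nbhd)
  surj : ∀ u : dom, Function.Surjective (toAff.stalkMap u).hom
  ker : ∀ u : dom, RingHom.ker (toAff.stalkMap u).hom = Ideal.span (Set.range fun i =>
    (Aff dim).presheaf.germ nbhd (toAff.base u) (mem_nbhd u) (eqn i))

/-- The ideal of the local ring of `ℂⁿ` at `v` generated by the equations of a chart, pulled back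
along the projection `ℂⁿ ⟶ ℂᵐ` given by `τ`. -/
def Chart.pullIdeal {Y : LocallyRingedSpace.{0}} {sc : ℂ →+* LocallyRingedSpace.Γ.obj (op Y)}
    (c : Chart Y sc) {n : ℕ} (τ : Fin c.dim → Fin n) (v : Aff n)
    (h : (affProj τ).base v ∈ c.nbhd) : Ideal ((Aff n).presheaf.stalk v) :=
  Ideal.span (Set.range fun i => ((affProj τ).stalkMap v).hom
    ((Aff c.dim).presheaf.germ c.nbhd ((affProj τ).base v) h (c.eqn i)))

/-- A chart of a morphism `f : W ⟶ Y` in which it is the projection `Y × ℂᵈ ⟶ Y`: the coordinates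
of `ℂᵐ ⊇ Y` are the coordinates with indices `σ 1, …, σ m` of `ℂⁿ ⊇ W`, and the equations of `W`
are those of `Y`. The remaining `d = n - m` coordinates are the relative coordinates. -/
structure SmoothChart {W Y : LocallyRingedSpace.{0}} (f : W ⟶ Y)
    (sc : ℂ →+* LocallyRingedSpace.Γ.obj (op Y)) where
  base : Chart Y sc
  top : Chart W (scal f sc)
  proj : top.dom ⟶ base.dom
  proj_incl : proj ≫ base.incl = top.incl ≫ f
  σ : Fin base.dim → Fin top.dim
  σ_inj : Function.Injective σ
  toAff_proj : top.toAff ≫ affProj σ = proj ≫ base.toAff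
  mem : ∀ u : top.dom, (affProj σ).base (top.toAff.base u) ∈ base.nbhd
  ker : ∀ u : top.dom, RingHom.ker (top.toAff.stalkMap u).hom =
    base.pullIdeal σ (top.toAff.base u) (mem u)

/-- A chart of `(E; p₁, p₂)` in which it is, with its two projections to `W`, the restriction of
`Y × ℂᵈ × ℂᵈ ⇉ Y × ℂᵈ`, that is, of the fibre product `W ×_Y W`. -/
structure FibreChart {E W Y : LocallyRingedSpace.{0}} (p₁ p₂ : E ⟶ W) (f : W ⟶ Y)
    (sc : ℂ →+* LocallyRingedSpace.Γ.obj (op Y)) where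
  factor : SmoothChart f sc
  top : Chart E (scal (p₁ ≫ f) sc)
  proj₁ : top.dom ⟶ factor.top.dom
  proj₂ : top.dom ⟶ factor.top.dom
  proj₁_incl : proj₁ ≫ factor.top.incl = top.incl ≫ p₁
  proj₂_incl : proj₂ ≫ factor.top.incl = top.incl ≫ p₂
  τ₁ : Fin factor.top.dim → Fin top.dim
  τ₂ : Fin factor.top.dim → Fin top.dim
  τ₁_inj : Function.Injective τ₁
  τ₂_inj : Function.Injective τ₂
  τ_σ : ∀ k, τ₁ (factor.σ k) = τ₂ (factor.σ k)
  τ_inter : ∀ i j, τ₁ i = τ₂ j → ∃ k, i = factor.σ k ∧ j = factor.σ k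
  τ_union : ∀ k, (∃ i, k = τ₁ i) ∨ ∃ j, k = τ₂ j
  toAff_proj₁ : top.toAff ≫ affProj τ₁ = proj₁ ≫ factor.top.toAff
  toAff_proj₂ : top.toAff ≫ affProj τ₂ = proj₂ ≫ factor.top.toAff
  mem : ∀ u : top.dom, (affProj (τ₁ ∘ factor.σ)).base (top.toAff.base u) ∈ factor.base.nbhd
  ker : ∀ u : top.dom, RingHom.ker (top.toAff.stalkMap u).hom =
    factor.base.pullIdeal (τ₁ ∘ factor.σ) (top.toAff.base u) (mem u)

/-- A system of spaces `W_a` indexed by a partially ordered set `A` (the simplices of a simplicial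
scheme, with `a ≤ b` if `a` is a face of `b`), with transition maps `W_b ⟶ W_a` for `a ≤ b`, that
are smooth over a complex space `Y`. -/
structure SmoothSystem (A : Type) [PartialOrder A] where
  Y : LocallyRingedSpace.{0}
  sc : ℂ →+* LocallyRingedSpace.Γ.obj (op Y)
  analytic : ∀ y : Y, ∃ c : Chart Y sc, y ∈ Set.range c.incl.base
  W : Aᵒᵖ ⥤ LocallyRingedSpace.{0}
  f : W ⟶ (Functor.const Aᵒᵖ).obj Y
  smooth : ∀ (a : A) (w : W.obj (op a)),
    ∃ c : SmoothChart (f.app (op a)) sc, w ∈ Set.range c.top.incl.base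

variable {A : Type} [PartialOrder A]

/-- The topological restriction of the fibre products `W_a ×_Y W_a` to their diagonals. -/
structure Diagonal (𝒲 : SmoothSystem A) where
  E : Aᵒᵖ ⥤ LocallyRingedSpace.{0}
  p₁ : E ⟶ 𝒲.W
  p₂ : E ⟶ 𝒲.W
  comp_eq : p₁ ≫ 𝒲.f = p₂ ≫ 𝒲.f
  base_eq : ∀ a, (p₁.app a).base = (p₂.app a).base
  homeo : ∀ a, IsIso (p₁.app a).base
  chart : ∀ (a : A) (e : E.obj (op a)),
    ∃ c : FibreChart (p₁.app (op a)) (p₂.app (op a)) (𝒲.f.app (op a)) 𝒲.sc,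
      e ∈ Set.range c.top.incl.base

/-- An index `a` with an open set of `W_a` on which relative coordinates exist. These open sets
form a base of the topology of `W_a`, and sheaves on the system `W` are determined by their
sections over them. -/
structure Site (𝒲 : SmoothSystem A) where
  idx : A
  opn : Opens (𝒲.W.obj (op idx))
  small : ∃ c : SmoothChart (𝒲.f.app (op idx)) 𝒲.sc, ∀ x ∈ opn, x ∈ Set.range c.top.incl.base

variable {𝒲 : SmoothSystem A}

/-- The transition map `W_b ⟶ W_a` for `a ≤ b`. -/
def SmoothSystem.tr (𝒲 : SmoothSystem A) {a b : A} (h : a ≤ b) :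
    𝒲.W.obj (op b) ⟶ 𝒲.W.obj (op a) := 𝒲.W.map (homOfLE h).op

/-- `(b, V) ≤ (a, U)` if `a ≤ b` and the transition map `W_b ⟶ W_a` maps `V` to `U`. A presheaf on
this preorder has restriction maps `F_a(U) → F_b(V)`. -/
instance : Preorder (Site 𝒲) where
  le s t := ∃ h : t.idx ≤ s.idx, s.opn ≤ (Opens.map (𝒲.tr h).base).obj t.opn
  le_refl t := ⟨le_refl _, by
    have : 𝒲.tr (le_refl t.idx) = 𝟙 _ := 𝒲.W.map_id _
    rw [this]; exact le_refl _⟩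
  le_trans r s t := by
    rintro ⟨h, hr⟩ ⟨h', hs⟩
    refine ⟨h'.trans h, ?_⟩
    have : 𝒲.tr (h'.trans h) = 𝒲.tr h ≫ 𝒲.tr h' := 𝒲.W.map_comp (homOfLE h).op (homOfLE h').op
    rw [this]
    exact fun x hx => hs (hr hx)

lemma Site.idx_le {s t : Site 𝒲} (h : s ≤ t) : t.idx ≤ s.idx := h.1

/-- The smaller open set `V ⊆ U` of the same `W_a`. -/
def Site.shrink (t : Site 𝒲) (V : Opens (𝒲.W.obj (op t.idx))) (h : V ≤ t.opn) : Site 𝒲 where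
  idx := t.idx
  opn := V
  small := by
    obtain ⟨c, hc⟩ := t.small
    exact ⟨c, fun x hx => hc x (h hx)⟩

lemma Site.shrink_le (t : Site 𝒲) (V : Opens (𝒲.W.obj (op t.idx))) (h : V ≤ t.opn) :
    t.shrink V h ≤ t := ⟨le_refl _, by
  have : 𝒲.tr (le_refl t.idx) = 𝟙 _ := 𝒲.W.map_id _
  change V ≤ (Opens.map (𝒲.tr (le_refl t.idx)).base).obj t.opn
  rw [this]; exact h⟩

/-- The sections of the structure sheaf of `W`. -/
abbrev OSec (t : Site 𝒲) : Type := (𝒲.W.obj (op t.idx)).presheaf.obj (op t.opn)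

/-- The restriction maps of the structure sheaf of `W`. -/
def ORes {s t : Site 𝒲} (h : s ≤ t) : OSec t →+* OSec s :=
  (((𝒲.W.obj (op s.idx)).presheaf.map (homOfLE h.2).op).hom).comp
    ((𝒲.tr h.1).c.app (op t.opn)).hom

namespace Diagonal

variable (D : Diagonal 𝒲)

/-- The open set of `W_a ×_Y W_a`, restricted to the diagonal, that corresponds to an open set
of `W_a`. -/
def opn (t : Site 𝒲) : Opens (D.E.obj (op t.idx)) :=
  (Opens.map (D.p₁.app (op t.idx)).base).obj t.opn

/-- The sections of the structure sheaf of the germ of `W ×_Y W` along the diagonal. -/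
abbrev Sec (t : Site 𝒲) : Type := (D.E.obj (op t.idx)).presheaf.obj (op (D.opn t))

lemma opn_eq (t : Site 𝒲) : D.opn t = (Opens.map (D.p₂.app (op t.idx)).base).obj t.opn := by
  rw [opn, D.base_eq]

lemma opn_le {s t : Site 𝒲} (h : s ≤ t) :
    D.opn s ≤ (Opens.map (D.E.map (homOfLE h.1).op).base).obj (D.opn t) := by
  intro x hx
  have e := D.p₁.naturality (homOfLE h.1).op
  have h2 := h.2 hx
  have e2 : (D.E.map (homOfLE h.1).op ≫ D.p₁.app (op t.idx)).base x =
    (D.p₁.app (op s.idx) ≫ 𝒲.W.map (homOfLE h.1).op).base x := by rw [e]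
  change (D.E.map (homOfLE h.1).op ≫ D.p₁.app (op t.idx)).base x ∈ t.opn
  rw [e2]
  exact h2

/-- The restriction maps. -/
def res {s t : Site 𝒲} (h : s ≤ t) : D.Sec t →+* D.Sec s :=
  (((D.E.obj (op s.idx)).presheaf.map (homOfLE (D.opn_le h)).op).hom).comp
    ((D.E.map (homOfLE h.1).op).c.app (op (D.opn t))).hom

/-- The pull-back of functions on `W` along the first projection. -/
def pull₁ (t : Site 𝒲) : OSec t →+* D.Sec t := ((D.p₁.app (op t.idx)).c.app (op t.opn)).hom

/-- The pull-back of functions on `W` along the second projection. -/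
def pull₂ (t : Site 𝒲) : OSec t →+* D.Sec t :=
  (((D.E.obj (op t.idx)).presheaf.map (homOfLE (D.opn_eq t).le).op).hom).comp
    ((D.p₂.app (op t.idx)).c.app (op t.opn)).hom

end Diagonal

end Geometry

section Derived

variable {A : Type} [PartialOrder A] {𝒲 : SmoothSystem A} {R : DGAlg (Site 𝒲)}

/-- A morphism of DG modules is a quasi-isomorphism if it induces isomorphisms of the cohomology
sheaves: locally on the spaces `W_a`, a cocycle that becomes a coboundary is a coboundary, and
every cocycle is cohomologous to the image of a cocycle. -/
def IsQuasiIso {M N : DGMod R} (f : M ⟶ N) : Prop :=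
  ∀ (t : Site 𝒲) (n : ℤ) (x : 𝒲.W.obj (op t.idx)), x ∈ t.opn →
    (∀ z ∈ M.gr t (n + 1), M.d t z = 0 → (∃ y ∈ N.gr t n, N.d t y = f.map t z) →
      ∃ (V : Opens (𝒲.W.obj (op t.idx))) (h : V ≤ t.opn), x ∈ V ∧
        ∃ y ∈ M.gr (t.shrink V h) n,
          M.d (t.shrink V h) y = M.res (t.shrink_le V h) z) ∧
    (∀ z ∈ N.gr t (n + 1), N.d t z = 0 →
      ∃ (V : Opens (𝒲.W.obj (op t.idx))) (h : V ≤ t.opn), x ∈ V ∧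
        ∃ w ∈ M.gr (t.shrink V h) (n + 1), M.d (t.shrink V h) w = 0 ∧
          ∃ y ∈ N.gr (t.shrink V h) n, N.d (t.shrink V h) y =
            f.map (t.shrink V h) w - N.res (t.shrink_le V h) z)

/-- The class of quasi-isomorphisms. -/
def quasiIso (R : DGAlg (Site 𝒲)) : MorphismProperty (DGMod R) := fun _ _ f => IsQuasiIso f

/-- The derived category `D(R)` of right DG modules over `R`: the localization at the
quasi-isomorphisms. (Inverting the maps that are isomorphisms on cohomology sheaves identifies a
presheaf of DG modules with its sheafification.) -/
abbrev D (R : DGAlg (Site 𝒲)) := (quasiIso R).Localization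

/-- The functor from DG modules to the derived category. -/
abbrev Q (R : DGAlg (Site 𝒲)) : DGMod R ⥤ D R := (quasiIso R).Q

/-- A morphism `M ⟶ (M ⊗ Ω)[1]` in `D(R)` is an Atiyah class of `M` if there is a quasi-isomorphism
`φ : P ⟶ M` and a connection `∇` on `P` such that it is the class of `[∂, ∇]`, under the
identification of `P` with `M`. -/
def IsAtiyahClass {Ω : BiMod R} (δ : Deriv Ω) (M : DGMod R)
    (α : (Q R).obj M ⟶ (Q R).obj (tensor M Ω).shift) : Prop :=
  ∃ (P : DGMod R) (φ : P ⟶ M) (_ : IsQuasiIso φ) (c : Connection P δ),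
    (Q R).map φ ≫ α = (Q R).map c.atiyah ≫ (Q R).map (shiftMap (tensorMapLeft φ Ω))

end Derived

section Resolvent

/-- `x` is a basis of the ring `B` as a left module over `A`, which acts through `φ`. -/
def IsLeftBasis {A B : Type} [Ring A] [Ring B] (φ : A →+* B) {κ : Type} (x : κ → B) : Prop :=
  ∀ b : B, ∃! c : κ →₀ A, b = c.sum fun k a => φ a * x k

variable {A : Type} [PartialOrder A] {𝒲 : SmoothSystem A}

/-- Families of homogeneous elements of negative degree of a DG algebra. The element `g` lives over
`W_a` with `a = simplex g`, and is given by its restrictions to the opens of `W_b` for `a ≤ b`. -/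
structure Generators (B : DGAlg (Site 𝒲)) where
  G : Type
  [order : LinearOrder G]
  simplex : G → A
  deg : G → ℤ
  deg_neg : ∀ g, deg g < 0
  elt : ∀ g (t : Site 𝒲), simplex g ≤ t.idx → B.obj t
  mem : ∀ g t h, elt g t h ∈ B.gr t (deg g)
  res : ∀ g {s t : Site 𝒲} (h : s ≤ t) (ht : simplex g ≤ t.idx),
    B.res h (elt g t ht) = elt g s (ht.trans (Site.idx_le h))

attribute [instance] Generators.order

/-- The monomials in generators: finite products of generators in weakly increasing order, in which
generators of odd degree are not repeated. -/
def Generators.Mon {B : DGAlg (Site 𝒲)} (gens : Generators B) (t : Site 𝒲) : Type :=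
  {l : List {g : gens.G // gens.simplex g ≤ t.idx} //
    l.Pairwise fun a b => a.1 < b.1 ∨ (a.1 = b.1 ∧ Even (gens.deg a.1))}

/-- The value of a monomial. -/
def Generators.val {B : DGAlg (Site 𝒲)} (gens : Generators B) (t : Site 𝒲) (l : gens.Mon t) :
    B.obj t :=
  (l.1.map fun g => gens.elt g.1 t g.2).prod

/-- A free DG algebra over the structure sheaf of `W`: a graded-commutative DG algebra that is, as a
graded algebra, the symmetric algebra of a graded free module in negative degrees. -/
structure FreeAlg (𝒲 : SmoothSystem A) where
  R : DGAlg (Site 𝒲)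
  o : ∀ t, OSec t →+* R.obj t
  o_mem : ∀ t x, o t x ∈ R.gr t 0
  o_res : ∀ {s t : Site 𝒲} (h : s ≤ t) x, R.res h (o t x) = o s (ORes h x)
  gens : Generators R
  free : ∀ t, IsLeftBasis (o t) (gens.val t)

/-- The enveloping algebra `S` of `R` over `Y`, restricted to the diagonal: the analytic tensor
product of `R` with itself over the structure sheaf of `Y`. With `O` and `O_E` the structure
sheaves of `W` and of `W ×_Y W` along the diagonal, it is `O_E ⊗_{O ⊗ O} (R ⊗ R)`. It comes with
the inclusions `j₁ = R ⊗ 1`, `j₂ = 1 ⊗ R` and the multiplication `μ : S → R`. -/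
structure Enveloping (ℛ : FreeAlg 𝒲) where
  diag : Diagonal 𝒲
  S : DGAlg (Site 𝒲)
  o : ∀ t, diag.Sec t →+* S.obj t
  o_mem : ∀ t x, o t x ∈ S.gr t 0
  o_res : ∀ {s t : Site 𝒲} (h : s ≤ t) x, S.res h (o t x) = o s (diag.res h x)
  j₁ : DGAlg.Hom ℛ.R S
  j₂ : DGAlg.Hom ℛ.R S
  j₁_o : ∀ t x, j₁.map t (ℛ.o t x) = o t (diag.pull₁ t x)
  j₂_o : ∀ t x, j₂.map t (ℛ.o t x) = o t (diag.pull₂ t x)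
  basis : ∀ t (κ : Type) (x : κ → ℛ.R.obj t), IsLeftBasis (ℛ.o t) x →
    IsLeftBasis (o t) fun k : κ × κ => j₁.map t (x k.1) * j₂.map t (x k.2)
  μ : DGAlg.Hom S ℛ.R
  μ_j₁ : ∀ t a, μ.map t (j₁.map t a) = a
  μ_j₂ : ∀ t a, μ.map t (j₂.map t a) = a

variable {ℛ : FreeAlg 𝒲}

/-- The bimodule `Ω¹` of differentials of `R` over `Y`, as `I/I²` with `I` the kernel of the
multiplication `S → R`. -/
def Enveloping.Ω (𝒮 : Enveloping ℛ) : BiMod ℛ.R := Conormal.bimod 𝒮.j₁ 𝒮.j₂ 𝒮.μ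

/-- The exterior differential `d : R → Ω¹`, `d a = 1 ⊗ a - a ⊗ 1`. -/
def Enveloping.δ (𝒮 : Enveloping ℛ) : Deriv 𝒮.Ω := Conormal.deriv 𝒮.j₁ 𝒮.j₂ 𝒮.μ 𝒮.μ_j₁ 𝒮.μ_j₂

/-- A free DG algebra resolution `ν : B → R` of `R` as an `S`-algebra. -/
structure FreeResolution (𝒮 : Enveloping ℛ) where
  B : DGAlg (Site 𝒲)
  φ : DGAlg.Hom 𝒮.S B
  gens : Generators B
  free : ∀ t, IsLeftBasis (φ.map t) (gens.val t)
  ν : DGAlg.Hom B ℛ.R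
  ν_φ : ∀ t x, ν.map t (φ.map t x) = 𝒮.μ.map t x
  quasiIso : IsQuasiIso (augHom (φ.comp 𝒮.j₁) (φ.comp 𝒮.j₂) ν
    (fun t a => (ν_φ t _).trans (𝒮.μ_j₂ t a)))

namespace FreeResolution

variable {𝒮 : Enveloping ℛ} (ℬ : FreeResolution 𝒮)

/-- The left structure `R ⊗ 1 → B`. -/
def l : DGAlg.Hom ℛ.R ℬ.B := ℬ.φ.comp 𝒮.j₁

/-- The right structure `1 ⊗ R → B`. -/
def r : DGAlg.Hom ℛ.R ℬ.B := ℬ.φ.comp 𝒮.j₂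

lemma ν_l (t : Site 𝒲) (a : ℛ.R.obj t) : ℬ.ν.map t (ℬ.l.map t a) = a :=
  (ℬ.ν_φ t _).trans (𝒮.μ_j₁ t a)

lemma ν_r (t : Site 𝒲) (a : ℛ.R.obj t) : ℬ.ν.map t (ℬ.r.map t a) = a :=
  (ℬ.ν_φ t _).trans (𝒮.μ_j₂ t a)

/-- `M ⊗_{R ⊗ 1} B` as a right DG module over `1 ⊗ R`. -/
abbrev MB (M : DGMod ℛ.R) : DGMod ℛ.R := tensor M (ℬ.l.bimod ℬ.r)

/-- `M ⊗_{R ⊗ 1} B ⊗_{1 ⊗ R} Ω¹` as a right DG module. -/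
abbrev MBΩ (M : DGMod ℛ.R) : DGMod ℛ.R := tensor M (tensorBi (ℬ.l.bimod ℬ.r) 𝒮.Ω)

/-- A universal connection `∇_B : B → B ⊗_{1 ⊗ R} Ω¹`: an `R ⊗ 1`-linear derivation that restricts
to the exterior differential on `1 ⊗ R`. -/
abbrev UnivConn := UniversalConnection ℬ.l ℬ.r 𝒮.δ

/-- `id_M ⊗ ν : M ⊗_{R ⊗ 1} B ⟶ M`. -/
abbrev idTensorNu (M : DGMod ℛ.R) : ℬ.MB M ⟶ M :=
  idTensorAug ℬ.l ℬ.r ℬ.ν (hl := ℬ.ν_l) (hr := ℬ.ν_r) M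

/-- `id_M ⊗ ν ⊗ id : M ⊗_{R ⊗ 1} B ⊗_{1 ⊗ R} Ω¹ ⟶ M ⊗_R Ω¹`. -/
abbrev idTensorNuTensor (M : DGMod ℛ.R) : ℬ.MBΩ M ⟶ tensor M 𝒮.Ω :=
  idTensorAugTensor ℬ.l ℬ.r ℬ.ν (hl := ℬ.ν_l) (hr := ℬ.ν_r) M 𝒮.Ω

end FreeResolution

end Resolvent

end AtiyahDG

end

noncomputable section

namespace AtiyahDG

/-! ### Path objects and homotopies of DG modules. -/

section PathObject

/-! The theorem combines an explicit homotopy with two invertibility statements.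

The homotopy. Let `P` carry a connection `∇`. The maps `∇ ∘ (id ⊗ ν)` and `(id ⊗ ν ⊗ id) ∘ (id ⊗
∇_B)` from `P ⊗ B` to `P ⊗ Ω` satisfy the same Leibniz rule for right multiplication by `R`, because
`∇_B` restricts to the exterior differential on `1 ⊗ R`. Their difference is therefore right linear,
and its commutator with the differentials is the difference of the two candidates for the Atiyah
class on `P ⊗ B`. The candidates are thus homotopic (`atiyahHomotopy`), and homotopic maps agree in
`D(R)` by means of a path object (`DGMod.Homotopy.Q_map_eq`). Everything is natural along a
quasi-isomorphism `P ⟶ M`, which carries the identity over to `M` (`FreeResolution.idTensor_comp`).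

Invertibility of `id_M ⊗ ν`. Quasi-isomorphisms are tested on stalks
(`isQuasiIso_iff_stalkAcyclic`). Since `M` is arbitrary, acyclicity of the kernel of `ν` is not
enough: a contraction of `B` onto `R` that is linear over `R ⊗ 1` is needed, and such a contraction
survives every tensor product (`coneAcyclic_of_contraction`). No basis of `B` over `R ⊗ 1` is at
hand, since the functions on the germ of `W ×_Y W` come with none over the functions on `W`. A
Koszul argument replaces it. The differences `t_i` of relative coordinates lie in the kernel of `ν`,
so `t_i = d τ_i` with `τ_i` of degree `-1`. Hadamard's lemma gives operators `δ_i` dividing by `t_i`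
(`exists_divisionData`). The homotopies `τ_i δ_i` combine to deform the identity of `B` into an
`R`-linear chain map that kills all multiples of the `t_i` (`KoszulData.exists_projection`). Modulo
the `t_i`, `B` is free over `R` on generators in degrees `≤ 0`, and the usual construction by
descending degree contracts maps into the acyclic kernel of `ν` (`KoszulData.exists_nullhomotopy`,
`KoszulData.exists_contraction`).

Invertibility of `id_M ⊗ ν ⊗ id`. Up to associativity this map is `(id_M ⊗ ν) ⊗ Ω¹`. The stalks of
`Ω¹` are free left `R`-modules on the differentials of the relative coordinates and of the
generators of `R`, in degrees `≤ 0`, so tensoring with `Ω¹` preserves quasi-isomorphisms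
(`BiBasis.coneAcyclic_tensorMapLeft`). These differentials span by Hadamard's lemma. They are
independent because each coordinate functional is the off-diagonal entry of a representation of `S`
by triangular `2 × 2` matrices, constructed from the universal property of `S`
(`EnvData.exists_functional`). -/

lemma prod_internal {X Y : Type} [AddCommGroup X] [AddCommGroup Y] {g : ℤ → AddSubgroup X}
    {g' : ℤ → AddSubgroup Y} (h : DirectSum.IsInternal g) (h' : DirectSum.IsInternal g') :
    DirectSum.IsInternal fun n => (g n).prod (g' n) := by
  let i₁ (n : ℤ) : g n →+ (g n).prod (g' n) :=
    ((AddMonoidHom.inl X Y).comp (g n).subtype).codRestrict _ fun x => ⟨x.2, zero_mem _⟩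
  let i₂ (n : ℤ) : g' n →+ (g n).prod (g' n) :=
    ((AddMonoidHom.inr X Y).comp (g' n).subtype).codRestrict _ fun x => ⟨zero_mem _, x.2⟩
  let F₁ := (DirectSum.map i₁).comp (comps h).toAddMonoidHom
  let F₂ := (DirectSum.map i₂).comp (comps h').toAddMonoidHom
  have e₁ : ∀ i x (hx : x ∈ g i), F₁ x =
      DirectSum.of (fun n => (g n).prod (g' n)) i ⟨(x, 0), hx, zero_mem _⟩ := by
    intro i x hx
    simp only [F₁, AddMonoidHom.comp_apply, AddEquiv.coe_toAddMonoidHom, symm_apply h hx]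
    erw [DirectSum.map_of]
    rfl
  have e₂ : ∀ i x (hx : x ∈ g' i), F₂ x =
      DirectSum.of (fun n => (g n).prod (g' n)) i ⟨(0, x), zero_mem _, hx⟩ := by
    intro i x hx
    simp only [F₂, AddMonoidHom.comp_apply, AddEquiv.coe_toAddMonoidHom, symm_apply h' hx]
    erw [DirectSum.map_of]
    rfl
  refine isInternal_of (F₁.coprod F₂) ?_ ?_
  · rintro i ⟨x, y⟩ ⟨hx, hy⟩
    rw [AddMonoidHom.coprod_apply, e₁ i x hx, e₂ i y hy, ← map_add]
    congr 1
    ext <;> simp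
  · rintro ⟨x, y⟩
    rw [AddMonoidHom.coprod_apply, map_add]
    have h1 : DirectSum.coeAddMonoidHom (fun n => (g n).prod (g' n)) (F₁ x) = (x, 0) := by
      refine gr_induction h (p := fun x =>
        DirectSum.coeAddMonoidHom (fun n => (g n).prod (g' n)) (F₁ x) = (x, 0)) ?_ ?_ ?_ x
      · intro i x hx
        rw [e₁ i x hx, DirectSum.coeAddMonoidHom_of]
      · rw [map_zero, map_zero]; rfl
      · intro x y hx hy; rw [map_add, map_add, hx, hy]; simp
    have h2 : DirectSum.coeAddMonoidHom (fun n => (g n).prod (g' n)) (F₂ y) = (0, y) := by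
      refine gr_induction h' (p := fun y =>
        DirectSum.coeAddMonoidHom (fun n => (g n).prod (g' n)) (F₂ y) = (0, y)) ?_ ?_ ?_ y
      · intro i x hx
        rw [e₂ i x hx, DirectSum.coeAddMonoidHom_of]
      · rw [map_zero, map_zero]; rfl
      · intro x y hx hy; rw [map_add, map_add, hx, hy]; simp
    rw [h1, h2]; simp

variable {T : Type} [Preorder T] {R : DGAlg T}

/-- The path object of a DG module `X`: triples `(x, y, z)` with differential
`(dx, dy, x - y - dz)`. -/
def DGMod.path (X : DGMod R) : DGMod R where
  obj t := X.obj t × X.obj t × X.obj t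
  gr t n := (X.gr t n).prod ((X.gr t n).prod (X.gr t (n + -1)))
  internal t := prod_internal (X.internal t)
    (prod_internal (X.internal t) (shift_internal (X.internal t) (-1)))
  smul_mem t {i j m a} hm ha := by
    refine ⟨X.smul_mem t hm.1 ha, X.smul_mem t hm.2.1 ha, ?_⟩
    have := X.smul_mem t hm.2.2 ha
    rwa [show i + -1 + j = i + j + -1 by ring] at this
  d t := ((X.d t).comp (AddMonoidHom.fst _ _)).prod
    (((X.d t).comp ((AddMonoidHom.fst _ _).comp (AddMonoidHom.snd _ _))).prod
      (AddMonoidHom.fst _ _ - (AddMonoidHom.fst _ _).comp (AddMonoidHom.snd _ _) -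
        (X.d t).comp ((AddMonoidHom.snd _ _).comp (AddMonoidHom.snd _ _))))
  d_mem t {i m} hm := by
    refine ⟨X.d_mem t hm.1, X.d_mem t hm.2.1, ?_⟩
    have h1 : m.1 ∈ X.gr t (i + 1 + -1) := by rw [add_neg_cancel_right]; exact hm.1
    have h2 : m.2.1 ∈ X.gr t (i + 1 + -1) := by rw [add_neg_cancel_right]; exact hm.2.1
    have h3 := X.d_mem t hm.2.2
    rw [show i + -1 + 1 = i + 1 + -1 by ring] at h3
    exact (X.gr t (i + 1 + -1)).sub_mem ((X.gr t (i + 1 + -1)).sub_mem h1 h2) h3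
  d_d t m := by
    ext <;> simp [X.d_d]
  leibniz t {i m} hm a := by
    -- The third component has degree `i - 1`; its sign `(-1)^(i-1)` is compensated by the minus
    -- sign in front of `dz`.
    have h3 := X.leibniz t hm.2.2 a
    rw [ksign_add, show ksign (-1) = -1 by simp [ksign]] at h3
    refine Prod.ext ?_ (Prod.ext ?_ ?_)
    · exact X.leibniz t hm.1 a
    · exact X.leibniz t hm.2.1 a
    · change m.1 <• a - m.2.1 <• a - X.d t (m.2.2 <• a) =
        (m.1 - m.2.1 - X.d t m.2.2) <• a + ksign i • (m.2.2 <• R.d t a)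
      rw [h3, smul_sub, smul_sub, mul_neg_one, neg_smul]
      abel
  res h := (X.res h).prodMap ((X.res h).prodMap (X.res h))
  res_refl t m := by ext <;> exact X.res_refl t _
  res_trans h h' m := by ext <;> exact X.res_trans h h' _
  res_mem h _ _ hm := ⟨X.res_mem h hm.1, X.res_mem h hm.2.1, X.res_mem h hm.2.2⟩
  res_d h m := by
    refine Prod.ext ?_ (Prod.ext ?_ ?_)
    · exact X.res_d h _
    · exact X.res_d h _
    · change X.res h (m.1 - m.2.1 - X.d _ m.2.2) =
        X.res h m.1 - X.res h m.2.1 - X.d _ (X.res h m.2.2)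
      rw [map_sub, map_sub, X.res_d]
  res_smul h m a := by
    refine Prod.ext ?_ (Prod.ext ?_ ?_) <;> exact X.res_smul h _ a

/-- The constant paths. -/
def DGMod.pathConst (X : DGMod R) : X ⟶ X.path where
  map t := (AddMonoidHom.id _).prod ((AddMonoidHom.id _).prod 0)
  map_smul t m a := Prod.ext rfl (Prod.ext rfl (smul_zero (MulOpposite.op a)).symm)
  map_mem t _ _ h := ⟨h, h, zero_mem _⟩
  map_d t m := by
    refine Prod.ext rfl (Prod.ext rfl ?_)
    change (0 : X.obj t) = m - m - X.d t 0
    simp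
  map_res h m := Prod.ext rfl (Prod.ext rfl (map_zero (X.res h)).symm)

/-- The start point of a path. -/
def DGMod.pathFst (X : DGMod R) : X.path ⟶ X where
  map _ := AddMonoidHom.fst _ _
  map_smul _ _ _ := rfl
  map_mem _ _ _ h := h.1
  map_d _ _ := rfl
  map_res _ _ := rfl

/-- The end point of a path. -/
def DGMod.pathSnd (X : DGMod R) : X.path ⟶ X where
  map _ := (AddMonoidHom.fst _ _).comp (AddMonoidHom.snd _ _)
  map_smul _ _ _ := rfl
  map_mem _ _ _ h := h.2.1
  map_d _ _ := rfl
  map_res _ _ := rfl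

/-- A homotopy between morphisms of DG modules: right linear maps `H` of degree `-1` with
`f - g = d H + H d`. -/
structure DGMod.Homotopy {N X : DGMod R} (f g : N ⟶ X) where
  map : ∀ t, N.obj t →+ X.obj t
  map_smul : ∀ t (n : N.obj t) (a : R.obj t), map t (n <• a) = map t n <• a
  map_mem : ∀ t {i : ℤ} {n : N.obj t}, n ∈ N.gr t i → map t n ∈ X.gr t (i + -1)
  map_res : ∀ {s t : T} (h : s ≤ t) (n : N.obj t), map s (N.res h n) = X.res h (map t n)
  comm : ∀ t (n : N.obj t), f.map t n - g.map t n = X.d t (map t n) + map t (N.d t n)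

/-- The map to the path object given by a homotopy. -/
def DGMod.Homotopy.toPath {N X : DGMod R} {f g : N ⟶ X} (H : DGMod.Homotopy f g) :
    N ⟶ X.path where
  map t := (f.map t).prod ((g.map t).prod (H.map t))
  map_smul t m a := Prod.ext (f.map_smul t m a) (Prod.ext (g.map_smul t m a) (H.map_smul t m a))
  map_mem t _ _ h := ⟨f.map_mem t h, g.map_mem t h, H.map_mem t h⟩
  map_d t n := by
    refine Prod.ext (f.map_d t n) (Prod.ext (g.map_d t n) ?_)
    change H.map t (N.d t n) = f.map t n - g.map t n - X.d t (H.map t n)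
    rw [H.comm]; abel
  map_res h n := Prod.ext (f.map_res h n) (Prod.ext (g.map_res h n) (H.map_res h n))

end PathObject

/-! ### Quasi-isomorphisms and homotopies in the derived category. -/

section Derived

variable {A : Type} [PartialOrder A] {𝒲 : SmoothSystem A} {R : DGAlg (Site 𝒲)}

lemma isQuasiIso_pathConst (X : DGMod R) : IsQuasiIso X.pathConst := by
  intro t n x hx
  refine ⟨?_, ?_⟩
  · rintro z hz hdz ⟨y, hy, hdy⟩
    refine ⟨t.opn, le_rfl, hx, X.res (t.shrink_le t.opn le_rfl) y.1, X.res_mem _ hy.1, ?_⟩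
    rw [← X.res_d]
    exact congrArg (X.res _) (congrArg Prod.fst hdy)
  · rintro ⟨a, b, c⟩ ⟨ha, hb, hc⟩ hd
    have h1 : X.d t a = 0 := congrArg Prod.fst hd
    have h3 : a - b - X.d t c = 0 := congrArg (fun z => z.2.2) hd
    have hc' : c ∈ X.gr t n := by rwa [add_neg_cancel_right] at hc
    have hs := t.shrink_le t.opn le_rfl
    -- For a cocycle, `a - b = dc`, so the constant path at `a` differs from `(a, b, c)` by the
    -- coboundary of `(0, c, 0)`.
    refine ⟨t.opn, le_rfl, hx, X.res hs a, X.res_mem _ ha, ?_, (0, X.res hs c, 0),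
      ⟨zero_mem _, X.res_mem _ hc', zero_mem _⟩, ?_⟩
    · rw [← X.res_d, h1, map_zero]
    · refine Prod.ext ?_ (Prod.ext ?_ ?_)
      · change X.d _ 0 = X.res hs a - X.res hs a
        simp
      · change X.d _ (X.res hs c) = X.res hs a - X.res hs b
        rw [← X.res_d, ← map_sub, ← sub_eq_zero.1 h3]
      · change (0 : X.obj _) - X.res hs c - X.d _ 0 = 0 - X.res hs c
        simp

lemma isIso_Q_map {M N : DGMod R} {f : M ⟶ N} (hf : IsQuasiIso f) : IsIso ((Q R).map f) :=
  MorphismProperty.Q_inverts (quasiIso R) f hf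

/-- Homotopic morphisms become equal in the derived category. -/
lemma DGMod.Homotopy.Q_map_eq {N X : DGMod R} {f g : N ⟶ X} (H : DGMod.Homotopy f g) :
    (Q R).map f = (Q R).map g := by
  have hf : f = H.toPath ≫ X.pathFst := rfl
  have hg : g = H.toPath ≫ X.pathSnd := rfl
  have := isIso_Q_map (isQuasiIso_pathConst X)
  -- Both end points are retractions of the constant paths, a map that becomes invertible.
  have key : (Q R).map X.pathFst = (Q R).map X.pathSnd := by
    rw [← cancel_epi ((Q R).map X.pathConst), ← Functor.map_comp, ← Functor.map_comp]
    rfl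
  exact (congrArg (Q R).map hf).trans <| (Functor.map_comp _ _ _).trans <|
    (congrArg ((Q R).map H.toPath ≫ ·) key).trans <| (Functor.map_comp _ _ _).symm.trans
    (congrArg (Q R).map hg).symm

/-- Shifting reindexes the degrees and negates the differential: cocycles stay the same and
primitives change sign. -/
lemma IsQuasiIso.shift {M N : DGMod R} {f : M ⟶ N} (hf : IsQuasiIso f) :
    IsQuasiIso (shiftMap f) := by
  intro t n x hx
  obtain ⟨h1, h2⟩ := hf t (n + 1) x hx
  refine ⟨?_, ?_⟩
  · rintro z hz hdz ⟨y, hy, hdy⟩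
    obtain ⟨V, h, hxV, w, hw, e⟩ := h1 z hz (neg_eq_zero.1 hdz)
      ⟨-y, neg_mem hy, (map_neg (N.d t) y).trans hdy⟩
    exact ⟨V, h, hxV, -w, neg_mem hw, (congrArg Neg.neg (map_neg (M.d _) w)).trans
      ((neg_neg _).trans e)⟩
  · intro z hz hdz
    obtain ⟨V, h, hxV, w, hw, hdw, y, hy, e⟩ := h2 z hz (neg_eq_zero.1 hdz)
    exact ⟨V, h, hxV, w, hw, neg_eq_zero.2 hdw, -y, neg_mem hy,
      (congrArg Neg.neg (map_neg (N.d _) y)).trans ((neg_neg _).trans e)⟩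

/-- A morphism of DG modules that is bijective on sections is a quasi-isomorphism. -/
lemma isQuasiIso_of_bijective {M N : DGMod R} (f : M ⟶ N)
    (hf : ∀ t, Function.Bijective (f.map t)) : IsQuasiIso f := by
  -- A preimage of a homogeneous element need not be known to be homogeneous; its component of
  -- degree `i` is again a preimage.
  have key : ∀ t i (y : N.obj t), y ∈ N.gr t i → ∃ x ∈ M.gr t i, f.map t x = y := by
    intro t i y hy
    obtain ⟨x, rfl⟩ := (hf t).2 y
    have h := comps_map (M.internal t) (N.internal t) (f.map t) (fun i x h => f.map_mem t h) x i
    refine ⟨_, (comps (M.internal t) x i).2, h.symm.trans ?_⟩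
    rw [symm_apply (N.internal t) hy, DirectSum.of_eq_same]
  intro t n x hx
  have hs := t.shrink_le t.opn le_rfl
  refine ⟨?_, ?_⟩
  · rintro z hz hdz ⟨y, hy, hdy⟩
    obtain ⟨w, hw, rfl⟩ := key t n y hy
    refine ⟨t.opn, le_rfl, hx, M.res hs w, M.res_mem _ hw, ?_⟩
    rw [← M.res_d, (hf t).1 ((f.map_d t w).trans hdy)]
  · intro z hz hdz
    obtain ⟨w, hw, rfl⟩ := key t _ z hz
    have hd : M.d t w = 0 := (hf t).1 (by rw [f.map_d, hdz, map_zero])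
    refine ⟨t.opn, le_rfl, hx, M.res hs w, M.res_mem _ hw, ?_, 0, zero_mem _, ?_⟩
    · rw [← M.res_d, hd, map_zero]
    · rw [map_zero, f.map_res]; exact (sub_self _).symm

end Derived

/-! ### Tensor products, with sections typed as sections of the DG module. -/

section TensorAPI

variable {T : Type} [Preorder T] {R : DGAlg T} {M N : DGMod R} {L : BiMod R} {t : T}

/-- The additive map out of `M ⊗ L` given by a balanced biadditive map. -/
def tensorLift {X : Type} [AddCommGroup X] (M : DGMod R) (L : BiMod R) (t : T)
    (f : M.obj t →+ L.obj t →+ X)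
    (hf : ∀ (m : M.obj t) (a : R.obj t) (l : L.obj t), f (m <• a) l = f m (a • l)) :
    (tensor M L).obj t →+ X :=
  TP.lift f hf

lemma tensor_addHom_ext {X : Type} [AddCommGroup X] {f g : (tensor M L).obj t →+ X}
    (h : ∀ m l, f (tensorMk M L t m l) = g (tensorMk M L t m l)) : f = g :=
  TObj.hom_ext h

@[elab_as_elim]
lemma tensor_induction {p : (tensor M L).obj t → Prop} (zero : p 0)
    (mk : ∀ m l, p (tensorMk M L t m l)) (add : ∀ x y, p x → p y → p (x + y))
    (x : (tensor M L).obj t) : p x :=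
  TP.induction zero mk add x

lemma tensor_hom_ext {f g : tensor M L ⟶ N}
    (h : ∀ t m x, f.map t (tensorMk M L t m x) = g.map t (tensorMk M L t m x)) : f = g :=
  DGMod.Hom.ext (funext fun t => tensor_addHom_ext (h t))

lemma tensorMk_smul_left (m : M.obj t) (a : R.obj t) (l : L.obj t) :
    tensorMk M L t (m <• a) l = tensorMk M L t m (a • l) := TP.tmul_smul m a l

lemma tensorMk_smul_right (m : M.obj t) (l : L.obj t) (a : R.obj t) :
    tensorMk M L t m l <• a = tensorMk M L t m (l <• a) := rfl

lemma tensor_d_mk (m : M.obj t) (l : L.obj t) : (tensor M L).d t (tensorMk M L t m l) =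
    tensorMk M L t (M.d t m) l + tensorMk M L t (M.eps t m) (L.d t l) := rfl

lemma tensor_res_mk {s t : T} (h : s ≤ t) (m : M.obj t) (l : L.obj t) :
    (tensor M L).res h (tensorMk M L t m l) = tensorMk M L s (M.res h m) (L.res h l) := rfl

lemma tensorMk_mem {i j n : ℤ} (h : i + j = n) {m : M.obj t} (hm : m ∈ M.gr t i)
    {l : L.obj t} (hl : l ∈ L.gr t j) : tensorMk M L t m l ∈ (tensor M L).gr t n :=
  TP.tmul_mem h hm hl

lemma tensor_gr_induction {n : ℤ} {X : Type} [AddCommGroup X]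
    {f : (tensor M L).obj t →+ X} {K : AddSubgroup X}
    (h : ∀ i j, i + j = n → ∀ m ∈ M.gr t i, ∀ l ∈ L.gr t j, f (tensorMk M L t m l) ∈ K)
    {x : (tensor M L).obj t} (hx : x ∈ (tensor M L).gr t n) : f x ∈ K :=
  TObj.gr_induction h hx

lemma tensor_eps_mk (m : M.obj t) (l : L.obj t) : (tensor M L).eps t (tensorMk M L t m l) =
    tensorMk M L t (M.eps t m) (L.eps t l) := by
  refine gr_induction (M.internal t) (p := fun m => (tensor M L).eps t (tensorMk M L t m l) =
    tensorMk M L t (M.eps t m) (L.eps t l)) ?_ (by simp) ?_ m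
  · intro i m hm
    refine gr_induction (L.internal t) (p := fun l => (tensor M L).eps t (tensorMk M L t m l) =
      tensorMk M L t (M.eps t m) (L.eps t l)) ?_ (by simp) ?_ l
    · intro j l hl
      rw [(tensor M L).eps_apply (tensorMk_mem rfl hm hl), M.eps_apply hm, L.eps_apply hl,
        map_zsmul, map_zsmul, ksign_add, mul_smul, AddMonoidHom.smul_apply, smul_comm]
    · intro x y hx hy; simp only [map_add, hx, hy]
  · intro x y hx hy; simp only [map_add, AddMonoidHom.add_apply, hx, hy]

/-- `l ⊗ l'` as a section of the bimodule `L ⊗ L'`. -/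
def tensorBiMk (L L' : BiMod R) (t : T) : L.obj t →+ L'.obj t →+ (tensorBi L L').obj t :=
  tensorMk L.toDGMod L' t

lemma tensorBiMk_smul_left {L' : BiMod R} (m : L.obj t) (a : R.obj t) (l : L'.obj t) :
    tensorBiMk L L' t (m <• a) l = tensorBiMk L L' t m (a • l) := TP.tmul_smul m a l

/-- The additive map out of the bimodule `L ⊗ L'` given by a balanced biadditive map. -/
def tensorBiLift {X : Type} [AddCommGroup X] (L L' : BiMod R) (t : T)
    (f : L.obj t →+ L'.obj t →+ X)
    (hf : ∀ (m : L.obj t) (a : R.obj t) (l : L'.obj t), f (m <• a) l = f m (a • l)) :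
    (tensorBi L L').obj t →+ X :=
  tensorLift L.toDGMod L' t f hf

@[elab_as_elim]
lemma tensorBi_induction {L' : BiMod R} {p : (tensorBi L L').obj t → Prop} (zero : p 0)
    (mk : ∀ m l, p (tensorBiMk L L' t m l)) (add : ∀ x y, p x → p y → p (x + y))
    (x : (tensorBi L L').obj t) : p x :=
  TP.induction zero mk add x

lemma tensorBi_addHom_ext {L' : BiMod R} {X : Type} [AddCommGroup X]
    {f g : (tensorBi L L').obj t →+ X}
    (h : ∀ m l, f (tensorBiMk L L' t m l) = g (tensorBiMk L L' t m l)) : f = g :=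
  TObj.hom_ext h

end TensorAPI

/-! ### The homotopy between the two representatives of the Atiyah class. -/

section ConnectionHomotopy

variable {T : Type} [Preorder T] {R B : DGAlg T} {l r : DGAlg.Hom R B} {Ω : BiMod R}
  {δ : Deriv Ω} (nablaB : UniversalConnection l r δ) (ν : DGAlg.Hom B R)
  (hl : ∀ t a, ν.map t (l.map t a) = a) (hr : ∀ t a, ν.map t (r.map t a) = a)
  {P : DGMod R} (c : Connection P δ)

/-- The universal connection with values in the bimodule `B ⊗ Ω`. -/
def UniversalConnection.biMap (t : T) : (l.bimod r).obj t →+ (tensorBi (l.bimod r) Ω).obj t :=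
  nablaB.map t

/-- The map `id_P ⊗ ∇_B : P ⊗ B → P ⊗ B ⊗ Ω`. -/
def UniversalConnection.idTensorNabla (P : DGMod R) (t : T) :
    (tensor P (l.bimod r)).obj t →+ (tensor P (tensorBi (l.bimod r) Ω)).obj t :=
  tensorLift P _ t
    (AddMonoidHom.flip ((tensorMk P (tensorBi (l.bimod r) Ω) t).flip.comp (nablaB.biMap t)))
    (fun m a b => by
      have h : nablaB.biMap t (a • b) = a • nablaB.biMap t b := nablaB.map_lsmul t a b
      simp only [AddMonoidHom.flip_apply, AddMonoidHom.comp_apply]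
      rw [h, tensorMk_smul_left])

lemma UniversalConnection.idTensorNabla_mk (t : T) (p : P.obj t) (b : (l.bimod r).obj t) :
    nablaB.idTensorNabla P t (tensorMk P (l.bimod r) t p b) =
      tensorMk P (tensorBi (l.bimod r) Ω) t p (nablaB.biMap t b) := rfl

/-- On `p ⊗ b` the two terms `dp ⊗ ∇b` cancel. What remains is `(-1)^{|p|} p ⊗ [∂, ∇](b)`, so the
Koszul sign in `idTensor` is the one produced by the differential of the tensor product. -/
lemma UniversalConnection.idTensorNabla_d (t : T) (x : (tensor P (l.bimod r)).obj t) :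
    (tensor P (tensorBi (l.bimod r) Ω)).d t (nablaB.idTensorNabla P t x) -
      nablaB.idTensorNabla P t ((tensor P (l.bimod r)).d t x) = (nablaB.idTensor P).map t x := by
  refine DFunLike.congr_fun (tensor_addHom_ext
    (f := ((tensor P (tensorBi (l.bimod r) Ω)).d t).comp (nablaB.idTensorNabla P t) -
      (nablaB.idTensorNabla P t).comp ((tensor P (l.bimod r)).d t))
    (g := (nablaB.idTensor P).map t) fun p b => ?_) x
  have h : (nablaB.idTensor P).map t (tensorMk P (l.bimod r) t p b) =
    tensorMk P (tensorBi (l.bimod r) Ω) t (P.eps t p) ((tensorBi (l.bimod r) Ω).d t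
      (nablaB.biMap t b) - nablaB.biMap t ((l.bimod r).d t b)) := rfl
  refine Eq.trans ?_ h.symm
  rw [AddMonoidHom.sub_apply, AddMonoidHom.comp_apply, AddMonoidHom.comp_apply, tensor_d_mk,
    nablaB.idTensorNabla_mk, tensor_d_mk, map_add, nablaB.idTensorNabla_mk,
    nablaB.idTensorNabla_mk, map_sub]
  abel

/-- The difference of the connections on `P ⊗ B` and on `P`, as a map `P ⊗ B → P ⊗ Ω`. -/
def connectionDiff (t : T) : (tensor P (l.bimod r)).obj t →+ (tensor P Ω).obj t :=
  (c.map t).comp ((idTensorAug l r ν hl hr P).map t) -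
    ((idTensorAugTensor l r ν hl hr P Ω).map t).comp (nablaB.idTensorNabla P t)

lemma connectionDiff_apply (t : T) (x : (tensor P (l.bimod r)).obj t) :
    connectionDiff nablaB ν hl hr c t x = c.map t ((idTensorAug l r ν hl hr P).map t x) -
      (idTensorAugTensor l r ν hl hr P Ω).map t (nablaB.idTensorNabla P t x) := rfl

/-- The Leibniz rule of `∇_B` along `r` produces the extra term `p ⊗ b ⊗ δa`, which `id ⊗ ν ⊗ id`
sends to `p ν(b) ⊗ δa`. This is the error term of a connection on `P` at `p ν(b)`, so it drops out
of `connectionDiff`. -/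
lemma UniversalConnection.idTensorNabla_smul (t : T) (x : (tensor P (l.bimod r)).obj t)
    (a : R.obj t) :
    (idTensorAugTensor l r ν hl hr P Ω).map t (nablaB.idTensorNabla P t (x <• a)) =
      (idTensorAugTensor l r ν hl hr P Ω).map t (nablaB.idTensorNabla P t x) <• a +
      tensorMk P Ω t ((idTensorAug l r ν hl hr P).map t x) (δ.map t a) := by
  induction x using tensor_induction with
  | zero => simp only [smul_zero, map_zero, AddMonoidHom.zero_apply, add_zero]
  | add x y hx hy =>
    simp only [smul_add, map_add, AddMonoidHom.add_apply, hx, hy]; abel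
  | mk p b =>
    have h1 : nablaB.biMap t (b <• a) = nablaB.biMap t b <• a +
      tensorBiMk (l.bimod r) Ω t b (δ.map t a) := nablaB.map_smul t b a
    have h2 : (idTensorAug l r ν hl hr P).map t (tensorMk P (l.bimod r) t p b) =
      p <• ν.map t b := rfl
    have h3 : (idTensorAugTensor l r ν hl hr P Ω).map t (tensorMk P (tensorBi (l.bimod r) Ω) t p
      (tensorBiMk (l.bimod r) Ω t b (δ.map t a))) =
      tensorMk P Ω t p (ν.map t b • δ.map t a) := rfl
    rw [tensorMk_smul_right, nablaB.idTensorNabla_mk, h1, map_add, map_add, h3,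
      ← tensorMk_smul_right, (idTensorAugTensor l r ν hl hr P Ω).map_smul,
      nablaB.idTensorNabla_mk, h2, tensorMk_smul_left]

lemma UniversalConnection.idTensorNabla_res {s t : T} (h : s ≤ t)
    (x : (tensor P (l.bimod r)).obj t) :
    nablaB.idTensorNabla P s ((tensor P (l.bimod r)).res h x) =
      (tensor P (tensorBi (l.bimod r) Ω)).res h (nablaB.idTensorNabla P t x) := by
  refine DFunLike.congr_fun (tensor_addHom_ext
    (f := (nablaB.idTensorNabla P s).comp ((tensor P (l.bimod r)).res h))
    (g := ((tensor P (tensorBi (l.bimod r) Ω)).res h).comp (nablaB.idTensorNabla P t))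
    fun p b => ?_) x
  have e : nablaB.biMap s ((l.bimod r).res h b) =
    (tensorBi (l.bimod r) Ω).res h (nablaB.biMap t b) := nablaB.map_res h b
  rw [AddMonoidHom.comp_apply, AddMonoidHom.comp_apply, tensor_res_mk, nablaB.idTensorNabla_mk,
    nablaB.idTensorNabla_mk, tensor_res_mk, e]

/-- The two representatives of the Atiyah class on `P ⊗ B` are homotopic. -/
def atiyahHomotopy : DGMod.Homotopy (idTensorAug l r ν hl hr P ≫ c.atiyah)
    (nablaB.idTensor P ≫ shiftMap (idTensorAugTensor l r ν hl hr P Ω)) where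
  -- The target is shifted and has differential `-d`; with this sign, `dH + Hd` in the shifted
  -- complex is `∂D - D∂` for the difference `D` of the connections.
  map t := -connectionDiff nablaB ν hl hr c t
  map_smul t x a := by
    have e : connectionDiff nablaB ν hl hr c t (x <• a) =
        connectionDiff nablaB ν hl hr c t x <• a := by
      rw [connectionDiff_apply, connectionDiff_apply, (idTensorAug l r ν hl hr P).map_smul,
        c.map_smul, nablaB.idTensorNabla_smul, smul_sub]
      abel
    exact (congrArg Neg.neg e).trans (smul_neg _ _).symm
  map_mem t i x hx := by
    change -connectionDiff nablaB ν hl hr c t x ∈ (tensor P Ω).gr t (i + -1 + 1)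
    rw [neg_add_cancel_right, connectionDiff_apply]
    refine (AddSubgroup.neg_mem_iff _).2 (sub_mem ?_ ?_)
    · exact c.map_mem t ((idTensorAug l r ν hl hr P).map_mem t hx)
    · refine (idTensorAugTensor l r ν hl hr P Ω).map_mem t ?_
      refine tensor_gr_induction (f := nablaB.idTensorNabla P t) ?_ hx
      rintro i j rfl p hp b hb
      exact tensorMk_mem rfl hp (nablaB.map_mem t hb)
  map_res {s t} h x := by
    refine (congrArg Neg.neg ?_).trans (map_neg ((tensor P Ω).res h) _).symm
    rw [connectionDiff_apply, connectionDiff_apply, nablaB.idTensorNabla_res,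
      (idTensorAug l r ν hl hr P).map_res, c.map_res,
      (idTensorAugTensor l r ν hl hr P Ω).map_res, map_sub]
  comm t x := by
    have h := congrArg ((idTensorAugTensor l r ν hl hr P Ω).map t) (nablaB.idTensorNabla_d t x)
    rw [map_sub, (idTensorAugTensor l r ν hl hr P Ω).map_d] at h
    change ((tensor P Ω).d t (c.map t ((idTensorAug l r ν hl hr P).map t x)) -
        c.map t (P.d t ((idTensorAug l r ν hl hr P).map t x))) -
      (idTensorAugTensor l r ν hl hr P Ω).map t ((nablaB.idTensor P).map t x) =
      -((tensor P Ω).d t (-connectionDiff nablaB ν hl hr c t x)) +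
      -connectionDiff nablaB ν hl hr c t ((tensor P (l.bimod r)).d t x)
    rw [← h, map_neg, connectionDiff_apply, connectionDiff_apply, map_sub,
      (idTensorAug l r ν hl hr P).map_d]
    abel

end ConnectionHomotopy

/-! ### Naturality in the module, and associativity of the tensor product. -/

section Naturality

variable {T : Type} [Preorder T] {R B : DGAlg T} {l r : DGAlg.Hom R B} {Ω : BiMod R}
  {δ : Deriv Ω} (ν : DGAlg.Hom B R)
  (hl : ∀ t a, ν.map t (l.map t a) = a) (hr : ∀ t a, ν.map t (r.map t a) = a)
  {P M : DGMod R} (φ : P ⟶ M)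

lemma idTensorAug_naturality :
    tensorMapLeft φ (l.bimod r) ≫ idTensorAug l r ν hl hr M = idTensorAug l r ν hl hr P ≫ φ :=
  tensor_hom_ext fun t p (b : B.obj t) => (φ.map_smul t p (ν.map t b)).symm

lemma idTensorAugTensor_naturality :
    tensorMapLeft φ (tensorBi (l.bimod r) Ω) ≫ idTensorAugTensor l r ν hl hr M Ω =
      idTensorAugTensor l r ν hl hr P Ω ≫ tensorMapLeft φ Ω :=
  tensor_hom_ext fun _ _ _ => rfl

lemma UniversalConnection.idTensor_naturality (nablaB : UniversalConnection l r δ) :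
    tensorMapLeft φ (l.bimod r) ≫ nablaB.idTensor M =
      nablaB.idTensor P ≫ shiftMap (tensorMapLeft φ (tensorBi (l.bimod r) Ω)) :=
  tensor_hom_ext fun t p b => by
    change tensorMk M (tensorBi (l.bimod r) Ω) t (M.eps t (φ.map t p)) (nablaB.atiyahBi t b) =
      tensorMk M (tensorBi (l.bimod r) Ω) t (φ.map t (P.eps t p)) (nablaB.atiyahBi t b)
    rw [DGMod.eps_map t (φ.map t) (fun _ _ h => φ.map_mem t h)]

/-- The map `m, l ⊗ ω ↦ (m ⊗ l) ⊗ ω`. -/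
def assocAux (M : DGMod R) (L Ω : BiMod R) (t : T) :
    M.obj t →+ (tensorBi L Ω).obj t →+ (tensor (tensor M L) Ω).obj t :=
  AddMonoidHom.mk' (fun m => tensorBiLift L Ω t
      ((tensorMk (tensor M L) Ω t).comp (tensorMk M L t m))
      (fun x a ω => tensorMk_smul_left (tensorMk M L t m x) a ω))
    (fun m m' => tensorBi_addHom_ext fun x ω => by
      change tensorMk (tensor M L) Ω t (tensorMk M L t (m + m') x) ω =
        tensorMk (tensor M L) Ω t (tensorMk M L t m x) ω +
          tensorMk (tensor M L) Ω t (tensorMk M L t m' x) ω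
      simp only [map_add, AddMonoidHom.add_apply])

lemma assocAux_mk (M : DGMod R) (L Ω : BiMod R) (t : T) (m : M.obj t) (x : L.obj t)
    (ω : Ω.obj t) : assocAux M L Ω t m (tensorBiMk L Ω t x ω) =
      tensorMk (tensor M L) Ω t (tensorMk M L t m x) ω := rfl

/-- The associativity map `M ⊗ (L ⊗ Ω) ⟶ (M ⊗ L) ⊗ Ω`. -/
def tensorAssoc (M : DGMod R) (L Ω : BiMod R) :
    tensor M (tensorBi L Ω) ⟶ tensor (tensor M L) Ω :=
  tensorHom M (tensorBi L Ω) (tensor (tensor M L) Ω)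
    (assocAux M L Ω)
    (fun t m a y => by
      induction y using tensorBi_induction with
      | zero => rw [smul_zero, map_zero, map_zero]
      | add x y hx hy => rw [smul_add, map_add, map_add, hx, hy]
      | mk x ω =>
        change _ = assocAux M L Ω t m (tensorBiMk L Ω t (a • x) ω)
        rw [assocAux_mk, assocAux_mk, tensorMk_smul_left])
    (fun t m y a => by
      induction y using tensorBi_induction with
      | zero => rw [smul_zero, map_zero, smul_zero]
      | add x y hx hy => rw [smul_add, map_add, map_add, hx, hy, smul_add]
      | mk x ω => rfl)
    (fun t i j m hm y hy => by
      refine TObj.gr_induction (M := L.toDGMod) (L := Ω) (f := assocAux M L Ω t m) ?_ hy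
      rintro p q rfl x hx ω hω
      exact tensorMk_mem (add_assoc _ _ _) (tensorMk_mem rfl hm hx) hω)
    (fun t m y => by
      induction y using tensorBi_induction with
      | zero => simp only [map_zero, add_zero]
      | add x y hx hy =>
        simp only [map_add] at hx hy ⊢
        rw [← hx, ← hy]; abel
      | mk x ω =>
        have e : (tensorBi L Ω).d t (tensorBiMk L Ω t x ω) =
          tensorBiMk L Ω t (L.d t x) ω + tensorBiMk L Ω t (L.eps t x) (Ω.d t ω) := rfl
        -- The signs match because the sign operator of `M ⊗ L` is the product of the sign operators
        -- of the factors.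
        rw [e, map_add, assocAux_mk, assocAux_mk, assocAux_mk, assocAux_mk, tensor_d_mk,
          tensor_d_mk, tensor_eps_mk, map_add, AddMonoidHom.add_apply, add_assoc])
    (fun {s t} h m y => by
      induction y using tensorBi_induction with
      | zero => simp only [map_zero]
      | add x y hx hy => simp only [map_add, hx, hy]
      | mk x ω => rfl)

/-- The inverse `(m ⊗ l) ⊗ ω ↦ m ⊗ (l ⊗ ω)` is needed only as an additive map: bijectivity on
sections already makes a morphism a quasi-isomorphism. -/
lemma tensorAssoc_bijective (M : DGMod R) (L Ω : BiMod R) (t : T) :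
    Function.Bijective ((tensorAssoc M L Ω).map t) := by
  let β : (tensor M L).obj t →+ Ω.obj t →+ (tensor M (tensorBi L Ω)).obj t :=
    AddMonoidHom.flip (AddMonoidHom.mk' (fun ω => tensorLift M L t
      (AddMonoidHom.flip ((tensorMk M (tensorBi L Ω) t).flip.comp ((tensorBiMk L Ω t).flip ω)))
      (fun m a l => by
        change tensorMk M (tensorBi L Ω) t (m <• a) (tensorBiMk L Ω t l ω) =
          tensorMk M (tensorBi L Ω) t m (tensorBiMk L Ω t (a • l) ω)
        rw [tensorMk_smul_left]
        rfl))
      (fun ω ω' => tensor_addHom_ext fun m l => by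
        change tensorMk M (tensorBi L Ω) t m (tensorBiMk L Ω t l (ω + ω')) =
          tensorMk M (tensorBi L Ω) t m (tensorBiMk L Ω t l ω) +
          tensorMk M (tensorBi L Ω) t m (tensorBiMk L Ω t l ω')
        rw [map_add, map_add]))
  have hβ : ∀ m l ω, β (tensorMk M L t m l) ω =
    tensorMk M (tensorBi L Ω) t m (tensorBiMk L Ω t l ω) := fun _ _ _ => rfl
  let inv : (tensor (tensor M L) Ω).obj t →+ (tensor M (tensorBi L Ω)).obj t :=
    tensorLift (tensor M L) Ω t β (fun x a ω => by
      induction x using tensor_induction with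
      | zero => simp only [smul_zero, map_zero, AddMonoidHom.zero_apply]
      | add x y hx hy => simp only [smul_add, map_add, AddMonoidHom.add_apply, hx, hy]
      | mk m l => rw [tensorMk_smul_right, hβ, hβ, tensorBiMk_smul_left])
  have hinv : ∀ x ω, inv (tensorMk (tensor M L) Ω t x ω) = β x ω := fun _ _ => rfl
  have hmap : ∀ m y, (tensorAssoc M L Ω).map t (tensorMk M (tensorBi L Ω) t m y) =
    assocAux M L Ω t m y := fun _ _ => rfl
  refine Function.bijective_iff_has_inverse.2 ⟨inv, fun x => ?_, fun x => ?_⟩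
  · induction x using tensor_induction with
    | zero => simp only [map_zero]
    | add x y hx hy => simp only [map_add, hx, hy]
    | mk m y =>
      induction y using tensorBi_induction with
      | zero => simp only [map_zero]
      | add x y hx hy => simp only [map_add, hx, hy]
      | mk l ω => rw [hmap, assocAux_mk, hinv, hβ]
  · induction x using tensor_induction with
    | zero => simp only [map_zero]
    | add x y hx hy => simp only [map_add, hx, hy]
    | mk x ω =>
      rw [hinv]
      induction x using tensor_induction with
      | zero => simp only [map_zero, AddMonoidHom.zero_apply]
      | add x y hx hy => simp only [map_add, AddMonoidHom.add_apply, hx, hy]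
      | mk m l => rw [hβ, hmap, assocAux_mk]

/-- Holds because `m ⊗ ν(b)ω = m ν(b) ⊗ ω`. It reduces the second comparison map to the first one
tensored with `Ω`. -/
lemma idTensorAugTensor_eq (M : DGMod R) : idTensorAugTensor l r ν hl hr M Ω =
    tensorAssoc M (l.bimod r) Ω ≫ tensorMapLeft (idTensorAug l r ν hl hr M) Ω :=
  tensor_hom_ext fun t m y => by
    induction y using tensorBi_induction with
    | zero => simp only [map_zero]
    | add x y hx hy => simp only [map_add, hx, hy]
    | mk b ω => exact (tensorMk_smul_left m (ν.map t b) ω).symm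

end Naturality

/-! ### Stalks of presheaves of DG rings and DG modules, as objects over a one-point preorder. -/

section Stalk

/-- A directed system in a preorder, along which the stalks of presheaves are formed. -/
structure DirSys (T : Type) [Preorder T] where
  ι : Type
  [preorder : Preorder ι]
  [directed : IsDirectedOrder ι]
  [nonempty : Nonempty ι]
  site : ι → T
  anti : ∀ {i j : ι}, i ≤ j → site j ≤ site i

attribute [instance] DirSys.preorder DirSys.directed DirSys.nonempty

variable {T : Type} [Preorder T] (σ : DirSys T)

instance (R : DGAlg T) : DirectedSystem (fun i => R.obj (σ.site i))
    (fun _ _ h => R.res (σ.anti h)) where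
  map_self _ x := R.res_refl _ x
  map_map _ _ _ h h' x := R.res_trans (σ.anti h') (σ.anti h) x

instance {R : DGAlg T} (M : DGMod R) : DirectedSystem (fun i => M.obj (σ.site i))
    (fun _ _ h => M.res (σ.anti h)) where
  map_self _ x := M.res_refl _ x
  map_map _ _ _ h h' x := M.res_trans (σ.anti h') (σ.anti h) x

/-- The stalk of a presheaf of DG rings. -/
def DGAlg.StalkObj (R : DGAlg T) : Type :=
  DirectLimit (fun i => R.obj (σ.site i)) (fun _ _ h => R.res (σ.anti h))

instance (R : DGAlg T) : Ring (R.StalkObj σ) :=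
  inferInstanceAs (Ring (DirectLimit (fun i => R.obj (σ.site i)) (fun _ _ h => R.res (σ.anti h))))

/-- The stalk of a presheaf of DG modules. -/
def DGMod.StalkObj {R : DGAlg T} (M : DGMod R) : Type :=
  DirectLimit (fun i => M.obj (σ.site i)) (fun _ _ h => M.res (σ.anti h))

instance {R : DGAlg T} (M : DGMod R) : AddCommGroup (M.StalkObj σ) :=
  inferInstanceAs (AddCommGroup
    (DirectLimit (fun i => M.obj (σ.site i)) (fun _ _ h => M.res (σ.anti h))))

/-- The germ of a section. -/
def DGAlg.germ (R : DGAlg T) (i : σ.ι) : R.obj (σ.site i) →+* R.StalkObj σ where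
  toFun x := Quotient.mk (DirectLimit.setoid fun _ _ h => R.res (σ.anti h)) ⟨i, x⟩
  map_one' := (DirectLimit.one_def (G := fun i => R.obj (σ.site i)) i).symm
  map_mul' x y := (DirectLimit.mul_def (G := fun i => R.obj (σ.site i))
    (f := fun i j (h : i ≤ j) => R.res (σ.anti h)) i x y).symm
  map_zero' := (DirectLimit.zero_def i).symm
  map_add' x y := (DirectLimit.add_def (G := fun i => R.obj (σ.site i))
    (f := fun i j (h : i ≤ j) => R.res (σ.anti h)) i x y).symm

/-- The germ of a section. -/
def DGMod.germ {R : DGAlg T} (M : DGMod R) (i : σ.ι) : M.obj (σ.site i) →+ M.StalkObj σ where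
  toFun x := Quotient.mk (DirectLimit.setoid fun _ _ h => M.res (σ.anti h)) ⟨i, x⟩
  map_zero' := (DirectLimit.zero_def i).symm
  map_add' x y := (DirectLimit.add_def (G := fun i => M.obj (σ.site i))
    (f := fun i j (h : i ≤ j) => M.res (σ.anti h)) i x y).symm

variable {σ}

section Germs

variable {R : DGAlg T} {M : DGMod R}

lemma DGAlg.germ_res {i j : σ.ι} (h : i ≤ j) (x : R.obj (σ.site i)) :
    R.germ σ j (R.res (σ.anti h) x) = R.germ σ i x :=
  (DirectLimit.mk_apply (F := fun i => R.obj (σ.site i))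
    (f := fun i j (h : i ≤ j) => R.res (σ.anti h)) i j x h)

lemma DGMod.germ_res {i j : σ.ι} (h : i ≤ j) (x : M.obj (σ.site i)) :
    M.germ σ j (M.res (σ.anti h) x) = M.germ σ i x :=
  (DirectLimit.mk_apply (F := fun i => M.obj (σ.site i))
    (f := fun i j (h : i ≤ j) => M.res (σ.anti h)) i j x h)

@[elab_as_elim]
lemma DGAlg.germ_induction {p : R.StalkObj σ → Prop} (h : ∀ i x, p (R.germ σ i x)) (x) : p x :=
  DirectLimit.induction _ h x

@[elab_as_elim]
lemma DGMod.germ_induction {p : M.StalkObj σ → Prop} (h : ∀ i x, p (M.germ σ i x)) (x) : p x :=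
  DirectLimit.induction _ h x

@[elab_as_elim]
lemma DGMod.germ_induction₂ {N : DGMod R} {p : M.StalkObj σ → N.StalkObj σ → Prop}
    (h : ∀ i x y, p (M.germ σ i x) (N.germ σ i y)) (x y) : p x y := by
  induction x using DGMod.germ_induction with
  | h i x =>
    induction y using DGMod.germ_induction with
    | h j y =>
      obtain ⟨k, hi, hj⟩ := exists_ge_ge i j
      rw [← DGMod.germ_res hi, ← DGMod.germ_res hj]
      exact h _ _ _

@[elab_as_elim]
lemma DGAlg.germ_induction₂ {S : DGAlg T} {p : R.StalkObj σ → S.StalkObj σ → Prop}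
    (h : ∀ i x y, p (R.germ σ i x) (S.germ σ i y)) (x y) : p x y := by
  induction x using DGAlg.germ_induction with
  | h i x =>
    induction y using DGAlg.germ_induction with
    | h j y =>
      obtain ⟨k, hi, hj⟩ := exists_ge_ge i j
      rw [← DGAlg.germ_res hi, ← DGAlg.germ_res hj]
      exact h _ _ _

@[elab_as_elim]
lemma DGMod.germ_induction_mod {p : M.StalkObj σ → R.StalkObj σ → Prop}
    (h : ∀ i x y, p (M.germ σ i x) (R.germ σ i y)) (x y) : p x y := by
  induction x using DGMod.germ_induction with
  | h i x =>
    induction y using DGAlg.germ_induction with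
    | h j y =>
      obtain ⟨k, hi, hj⟩ := exists_ge_ge i j
      rw [← DGMod.germ_res hi, ← DGAlg.germ_res hj]
      exact h _ _ _

lemma DGAlg.germ_eq_zero {i : σ.ι} {x : R.obj (σ.site i)} (h : R.germ σ i x = 0) :
    ∃ (j : σ.ι) (hij : i ≤ j), R.res (σ.anti hij) x = 0 :=
  (DirectLimit.exists_eq_zero (G := fun i => R.obj (σ.site i))
    (f := fun i j (h : i ≤ j) => R.res (σ.anti h)) ⟨i, x⟩).1 h

lemma DGMod.germ_eq_zero {i : σ.ι} {x : M.obj (σ.site i)} (h : M.germ σ i x = 0) :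
    ∃ (j : σ.ι) (hij : i ≤ j), M.res (σ.anti hij) x = 0 :=
  (DirectLimit.exists_eq_zero (G := fun i => M.obj (σ.site i))
    (f := fun i j (h : i ≤ j) => M.res (σ.anti h)) ⟨i, x⟩).1 h

/-- The map out of a stalk given by compatible maps. -/
def DGMod.stalkLift {X : Type} [AddCommGroup X] (f : ∀ i, M.obj (σ.site i) →+ X)
    (hf : ∀ i j (h : i ≤ j) x, f j (M.res (σ.anti h) x) = f i x) : M.StalkObj σ →+ X where
  toFun := DirectLimit.lift _ (fun i => f i) (fun i j h x => (hf i j h x).symm)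
  map_zero' := DirectLimit.lift_zero (G := fun i => M.obj (σ.site i))
    (f := fun i j (h : i ≤ j) => M.res (σ.anti h)) f _
  map_add' x y := DirectLimit.lift_add (G := fun i => M.obj (σ.site i))
    (f := fun i j (h : i ≤ j) => M.res (σ.anti h)) f _ x y

/-- The additive map out of a stalk given by compatible maps. -/
def DGAlg.stalkLift {X : Type} [AddCommGroup X] (f : ∀ i, R.obj (σ.site i) →+ X)
    (hf : ∀ i j (h : i ≤ j) x, f j (R.res (σ.anti h) x) = f i x) : R.StalkObj σ →+ X where
  toFun := DirectLimit.lift _ (fun i => f i) (fun i j h x => (hf i j h x).symm)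
  map_zero' := DirectLimit.lift_zero (G := fun i => R.obj (σ.site i))
    (f := fun i j (h : i ≤ j) => R.res (σ.anti h)) f _
  map_add' x y := DirectLimit.lift_add (G := fun i => R.obj (σ.site i))
    (f := fun i j (h : i ≤ j) => R.res (σ.anti h)) f _ x y

/-- The ring map out of a stalk given by compatible maps. -/
def DGAlg.stalkLiftRing {X : Type} [Ring X] (f : ∀ i, R.obj (σ.site i) →+* X)
    (hf : ∀ i j (h : i ≤ j) x, f j (R.res (σ.anti h) x) = f i x) : R.StalkObj σ →+* X where
  toFun := DirectLimit.lift _ (fun i => f i) (fun i j h x => (hf i j h x).symm)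
  map_zero' := DirectLimit.lift_zero (G := fun i => R.obj (σ.site i))
    (f := fun i j (h : i ≤ j) => R.res (σ.anti h)) f _
  map_add' x y := DirectLimit.lift_add (G := fun i => R.obj (σ.site i))
    (f := fun i j (h : i ≤ j) => R.res (σ.anti h)) f _ x y
  map_one' := DirectLimit.lift_one (G := fun i => R.obj (σ.site i))
    (f := fun i j (h : i ≤ j) => R.res (σ.anti h)) f _
  map_mul' x y := DirectLimit.lift_mul (G := fun i => R.obj (σ.site i))
    (f := fun i j (h : i ≤ j) => R.res (σ.anti h)) f _ x y

/-- The biadditive pairing of stalks given by compatible pairings. -/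
def DGMod.stalkLift₂ {R' : DGAlg T} {N : DGMod R'} {X : Type} [AddCommGroup X]
    (f : ∀ i, M.obj (σ.site i) →+ N.obj (σ.site i) →+ X)
    (hf : ∀ i j (h : i ≤ j) x y, f j (M.res (σ.anti h) x) (N.res (σ.anti h) y) = f i x y) :
    M.StalkObj σ →+ N.StalkObj σ →+ X :=
  let F : M.StalkObj σ → N.StalkObj σ → X := DirectLimit.lift₂ _ _ (fun i x y => f i x y)
    (fun i j h x y => (hf i j h x y).symm)
  have e : ∀ i x y, F (M.germ σ i x) (N.germ σ i y) = f i x y := fun i x y =>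
    DirectLimit.lift₂_def (F₁ := fun i => M.obj (σ.site i)) (F₂ := fun i => N.obj (σ.site i))
      (fun i j (h : i ≤ j) => M.res (σ.anti h)) (fun i j (h : i ≤ j) => N.res (σ.anti h))
      (fun i x y => f i x y) (fun i j h x y => (hf i j h x y).symm) i x y
  AddMonoidHom.mk' (fun x => AddMonoidHom.mk' (F x) (fun y y' => by
      induction x using DGMod.germ_induction with
      | h i x =>
        induction y using DGMod.germ_induction with
        | h j y =>
          induction y' using DGMod.germ_induction with
          | h k y' =>
            obtain ⟨m, hi, hj⟩ := exists_ge_ge i j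
            obtain ⟨n, hm, hk⟩ := exists_ge_ge m k
            rw [← DGMod.germ_res (hi.trans hm), ← DGMod.germ_res (hj.trans hm),
              ← DGMod.germ_res hk, ← map_add, e, e, e, map_add]))
    (fun x x' => by
      ext y
      change F (x + x') y = F x y + F x' y
      induction x using DGMod.germ_induction with
      | h i x =>
        induction y using DGMod.germ_induction with
        | h j y =>
          induction x' using DGMod.germ_induction with
          | h k x' =>
            obtain ⟨m, hi, hj⟩ := exists_ge_ge i j
            obtain ⟨n, hm, hk⟩ := exists_ge_ge m k
            rw [← DGMod.germ_res (hi.trans hm), ← DGMod.germ_res (hj.trans hm),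
              ← DGMod.germ_res hk, ← map_add, e, e, e, map_add, AddMonoidHom.add_apply])

lemma DGMod.stalkLift₂_germ {R' : DGAlg T} {N : DGMod R'} {X : Type} [AddCommGroup X]
    (f : ∀ i, M.obj (σ.site i) →+ N.obj (σ.site i) →+ X)
    (hf : ∀ i j (h : i ≤ j) x y, f j (M.res (σ.anti h) x) (N.res (σ.anti h) y) = f i x y)
    (i) (x : M.obj (σ.site i)) (y : N.obj (σ.site i)) :
    DGMod.stalkLift₂ f hf (M.germ σ i x) (N.germ σ i y) = f i x y :=
  DirectLimit.lift₂_def (F₁ := fun i => M.obj (σ.site i)) (F₂ := fun i => N.obj (σ.site i))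
      (fun i j (h : i ≤ j) => M.res (σ.anti h)) (fun i j (h : i ≤ j) => N.res (σ.anti h))
      (fun i x y => f i x y) (fun i j h x y => (hf i j h x y).symm) i x y

instance : SMul (R.StalkObj σ)ᵐᵒᵖ (M.StalkObj σ) where
  smul a m := DirectLimit.map₂ (F := fun i => M.obj (σ.site i))
    (fun i j (h : i ≤ j) => M.res (σ.anti h)) (fun i j (h : i ≤ j) => R.res (σ.anti h))
    (fun i j (h : i ≤ j) => M.res (σ.anti h)) (fun _ m (a : R.obj _) => m <• a)
    (fun _ _ h m a => M.res_smul (σ.anti h) m a) m a.unop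

lemma DGMod.germ_smul (i : σ.ι) (m : M.obj (σ.site i)) (a : R.obj (σ.site i)) :
    M.germ σ i m <• R.germ σ i a = M.germ σ i (m <• a) :=
  DirectLimit.map₂_def (F := fun i => M.obj (σ.site i))
    (fun i j (h : i ≤ j) => M.res (σ.anti h)) (fun i j (h : i ≤ j) => R.res (σ.anti h))
    (fun i j (h : i ≤ j) => M.res (σ.anti h)) (fun _ m (a : R.obj _) => m <• a)
    (fun _ _ h m a => M.res_smul (σ.anti h) m a) i m a

instance (priority := 1100) : Module (R.StalkObj σ)ᵐᵒᵖ (M.StalkObj σ) where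
  one_smul m := by
    induction m using DGMod.germ_induction with
    | h i m =>
      change M.germ σ i m <• (1 : R.StalkObj σ) = _
      rw [← map_one (R.germ σ i), DGMod.germ_smul, MulOpposite.op_one, one_smul]
  mul_smul a b m := by
    obtain ⟨a, rfl⟩ := MulOpposite.op_surjective a
    obtain ⟨b, rfl⟩ := MulOpposite.op_surjective b
    induction a, b using DGAlg.germ_induction₂ with
    | h i a b =>
      induction m using DGMod.germ_induction with
      | h j m =>
        obtain ⟨k, hi, hj⟩ := exists_ge_ge i j
        rw [← DGAlg.germ_res hi a, ← DGAlg.germ_res hi b, ← DGMod.germ_res hj,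
          ← MulOpposite.op_mul, ← map_mul, DGMod.germ_smul, DGMod.germ_smul, DGMod.germ_smul,
          MulOpposite.op_mul, mul_smul]
  smul_zero a := by
    obtain ⟨a, rfl⟩ := MulOpposite.op_surjective a
    induction a using DGAlg.germ_induction with
    | h i a => rw [← map_zero (M.germ σ i), DGMod.germ_smul, smul_zero]
  zero_smul m := by
    induction m using DGMod.germ_induction with
    | h i m =>
      change M.germ σ i m <• (0 : R.StalkObj σ) = _
      rw [← map_zero (R.germ σ i), DGMod.germ_smul, MulOpposite.op_zero, zero_smul, map_zero]
  smul_add a m m' := by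
    obtain ⟨a, rfl⟩ := MulOpposite.op_surjective a
    induction m, m' using DGMod.germ_induction₂ with
    | h i m m' =>
      induction a using DGAlg.germ_induction with
      | h j a =>
        obtain ⟨k, hi, hj⟩ := exists_ge_ge i j
        rw [← DGAlg.germ_res hj a, ← map_add, ← DGMod.germ_res hi (m + m'), ← DGMod.germ_res hi m,
          ← DGMod.germ_res hi m', DGMod.germ_smul, DGMod.germ_smul, DGMod.germ_smul, map_add,
          smul_add, map_add]
  add_smul a b m := by
    obtain ⟨a, rfl⟩ := MulOpposite.op_surjective a
    obtain ⟨b, rfl⟩ := MulOpposite.op_surjective b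
    induction a, b using DGAlg.germ_induction₂ with
    | h i a b =>
      induction m using DGMod.germ_induction with
      | h j m =>
        obtain ⟨k, hi, hj⟩ := exists_ge_ge i j
        rw [← DGAlg.germ_res hi a, ← DGAlg.germ_res hi b, ← DGMod.germ_res hj,
          ← MulOpposite.op_add, ← map_add, DGMod.germ_smul, DGMod.germ_smul, DGMod.germ_smul,
          MulOpposite.op_add, add_smul, map_add]

/-- The map of stalks induced by a compatible family of additive maps. -/
def DGMod.stalkMap {R' : DGAlg T} {N : DGMod R'} (f : ∀ t, M.obj t →+ N.obj t)
    (hf : ∀ {s t : T} (h : s ≤ t) x, f s (M.res h x) = N.res h (f t x)) :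
    M.StalkObj σ →+ N.StalkObj σ :=
  DGMod.stalkLift (fun i => (N.germ σ i).comp (f _)) (fun i j h x => by
    rw [AddMonoidHom.comp_apply, hf, DGMod.germ_res h]; rfl)

@[simp] lemma DGMod.stalkMap_germ {R' : DGAlg T} {N : DGMod R'} (f : ∀ t, M.obj t →+ N.obj t)
    (hf : ∀ {s t : T} (h : s ≤ t) x, f s (M.res h x) = N.res h (f t x)) (i) (x : M.obj (σ.site i)) :
    DGMod.stalkMap f hf (M.germ σ i x) = N.germ σ i (f _ x) := rfl

/-- The map of stalks induced by a compatible family of additive maps. -/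
def DGAlg.stalkMap {R' : DGAlg T} (f : ∀ t, R.obj t →+ R'.obj t)
    (hf : ∀ {s t : T} (h : s ≤ t) x, f s (R.res h x) = R'.res h (f t x)) :
    R.StalkObj σ →+ R'.StalkObj σ :=
  DGAlg.stalkLift (fun i => (R'.germ σ i).toAddMonoidHom.comp (f _)) (fun i j h x => by
    change R'.germ σ j (f _ (R.res _ x)) = _
    rw [hf, DGAlg.germ_res h]; rfl)

@[simp] lemma DGAlg.stalkMap_germ {R' : DGAlg T} (f : ∀ t, R.obj t →+ R'.obj t)
    (hf : ∀ {s t : T} (h : s ≤ t) x, f s (R.res h x) = R'.res h (f t x)) (i)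
    (x : R.obj (σ.site i)) :
    DGAlg.stalkMap f hf (R.germ σ i x) = R'.germ σ i (f _ x) := rfl

/-- The grading of a stalk. -/
def DGMod.stalkGr (σ : DirSys T) (M : DGMod R) (n : ℤ) : AddSubgroup (M.StalkObj σ) where
  carrier := {x | ∃ i, ∃ y ∈ M.gr (σ.site i) n, x = M.germ σ i y}
  zero_mem' := ⟨Classical.arbitrary _, 0, zero_mem _, (map_zero _).symm⟩
  add_mem' := by
    rintro _ _ ⟨i, x, hx, rfl⟩ ⟨j, y, hy, rfl⟩
    obtain ⟨k, hi, hj⟩ := exists_ge_ge i j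
    refine ⟨k, _, add_mem (M.res_mem (σ.anti hi) hx) (M.res_mem (σ.anti hj) hy), ?_⟩
    rw [map_add, DGMod.germ_res hi, DGMod.germ_res hj]
  neg_mem' := by
    rintro _ ⟨i, x, hx, rfl⟩
    exact ⟨i, -x, neg_mem hx, (map_neg _ _).symm⟩

lemma DGMod.germ_mem {n : ℤ} {i : σ.ι} {x : M.obj (σ.site i)} (hx : x ∈ M.gr (σ.site i) n) :
    M.germ σ i x ∈ M.stalkGr σ n := ⟨i, x, hx, rfl⟩

/-- The grading of a stalk. -/
def DGAlg.stalkGr (σ : DirSys T) (R : DGAlg T) (n : ℤ) : AddSubgroup (R.StalkObj σ) where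
  carrier := {x | ∃ i, ∃ y ∈ R.gr (σ.site i) n, x = R.germ σ i y}
  zero_mem' := ⟨Classical.arbitrary _, 0, zero_mem _, (map_zero _).symm⟩
  add_mem' := by
    rintro _ _ ⟨i, x, hx, rfl⟩ ⟨j, y, hy, rfl⟩
    obtain ⟨k, hi, hj⟩ := exists_ge_ge i j
    refine ⟨k, _, add_mem (R.res_mem (σ.anti hi) hx) (R.res_mem (σ.anti hj) hy), ?_⟩
    rw [map_add, DGAlg.germ_res hi, DGAlg.germ_res hj]
  neg_mem' := by
    rintro _ ⟨i, x, hx, rfl⟩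
    exact ⟨i, -x, neg_mem hx, (map_neg _ _).symm⟩

lemma DGAlg.germ_mem {n : ℤ} {i : σ.ι} {x : R.obj (σ.site i)} (hx : x ∈ R.gr (σ.site i) n) :
    R.germ σ i x ∈ R.stalkGr σ n := ⟨i, x, hx, rfl⟩

/-- For use with `f` a germ map: the grading of the stalk is not yet known to be a decomposition,
and `F` supplies the candidate for the components of a germ. -/
lemma comps_of_germ {X Y : Type} [AddCommGroup X] [AddCommGroup Y] {gr : ℤ → AddSubgroup X}
    {gr' : ℤ → AddSubgroup Y} (h : DirectSum.IsInternal gr) (f : X →+ Y)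
    (hf : ∀ i, ∀ x ∈ gr i, f x ∈ gr' i) :
    ∃ F : X →+ DirectSum ℤ fun i => gr' i,
      (∀ x, DirectSum.coeAddMonoidHom gr' (F x) = f x) ∧
      ∀ i x (hx : x ∈ gr i), F x = DirectSum.of (fun i => gr' i) i ⟨f x, hf i x hx⟩ := by
  refine ⟨(DirectSum.map fun i => (f.comp (gr i).subtype).codRestrict (gr' i)
    (fun x => hf i x x.2)).comp (comps h).toAddMonoidHom, ?_, ?_⟩
  · refine gr_induction h ?_ (by simp) ?_
    · intro i x hx
      simp only [AddMonoidHom.comp_apply, AddEquiv.coe_toAddMonoidHom, symm_apply h hx]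
      erw [DirectSum.map_of]
      simp only [DirectSum.coeAddMonoidHom_of]
      rfl
    · intro x y hx hy; simp only [map_add, hx, hy]
  · intro i x hx
    simp only [AddMonoidHom.comp_apply, AddEquiv.coe_toAddMonoidHom, symm_apply h hx]
    erw [DirectSum.map_of]
    rfl

lemma DGMod.stalk_internal (σ : DirSys T) (M : DGMod R) :
    DirectSum.IsInternal (M.stalkGr σ) := by
  choose F hF hF' using fun i => comps_of_germ (gr' := M.stalkGr σ) (M.internal (σ.site i))
    (M.germ σ i) (fun n x hx => DGMod.germ_mem hx)
  -- Compatibility with restriction lets the candidate decompositions descend to the stalk.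
  have hc : ∀ i j (h : i ≤ j) x, F j (M.res (σ.anti h) x) = F i x := by
    intro i j h x
    refine AtiyahDG.gr_induction (M.internal _)
      (p := fun x => F j (M.res (σ.anti h) x) = F i x) ?_ (by simp) ?_ x
    · intro n x hx
      rw [hF' _ _ _ hx, hF' _ _ _ (M.res_mem _ hx)]
      exact ofeq rfl (DGMod.germ_res h x) _ _
    · intro x y hx hy; simp only [map_add, hx, hy]
  refine isInternal_of (DGMod.stalkLift F hc) ?_ ?_
  · rintro n _ ⟨i, x, hx, rfl⟩
    exact hF' i n x hx
  · intro x
    induction x using DGMod.germ_induction with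
    | h i x => exact hF i x

lemma DGAlg.stalk_internal (σ : DirSys T) (R : DGAlg T) :
    DirectSum.IsInternal (R.stalkGr σ) := by
  choose F hF hF' using fun i => comps_of_germ (gr' := R.stalkGr σ) (R.internal (σ.site i))
    (R.germ σ i).toAddMonoidHom (fun n x hx => DGAlg.germ_mem hx)
  have hc : ∀ i j (h : i ≤ j) x, F j (R.res (σ.anti h) x) = F i x := by
    intro i j h x
    refine gr_induction (R.internal _)
      (p := fun x => F j (R.res (σ.anti h) x) = F i x) ?_ (by simp) ?_ x
    · intro n x hx
      rw [hF' _ _ _ hx, hF' _ _ _ (R.res_mem _ hx)]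
      exact ofeq rfl (DGAlg.germ_res h x) _ _
    · intro x y hx hy; simp only [map_add, hx, hy]
  refine isInternal_of (DGAlg.stalkLift F hc) ?_ ?_
  · rintro n _ ⟨i, x, hx, rfl⟩
    exact hF' i n x hx
  · intro x
    induction x using DGAlg.germ_induction with
    | h i x => exact hF i x

end Germs

/-- The stalk of a presheaf of DG rings, as a DG ring. -/
def DGAlg.stalk (R : DGAlg T) (σ : DirSys T) : DGAlg PUnit where
  obj _ := R.StalkObj σ
  gr _ := R.stalkGr σ
  internal _ := R.stalk_internal σ
  one_mem _ := ⟨Classical.arbitrary _, 1, R.one_mem _, (map_one _).symm⟩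
  mul_mem _ {i j a b} := by
    rintro ⟨k, a, ha, rfl⟩ ⟨l, b, hb, rfl⟩
    obtain ⟨m, hk, hl⟩ := exists_ge_ge k l
    rw [← DGAlg.germ_res hk, ← DGAlg.germ_res hl, ← map_mul]
    exact DGAlg.germ_mem (R.mul_mem _ (R.res_mem _ ha) (R.res_mem _ hb))
  comm _ {i j a b} := by
    rintro ⟨k, a, ha, rfl⟩ ⟨l, b, hb, rfl⟩
    obtain ⟨m, hk, hl⟩ := exists_ge_ge k l
    rw [← DGAlg.germ_res hk, ← DGAlg.germ_res hl, ← map_mul, ← map_mul, ← map_zsmul]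
    exact congrArg _ (R.comm _ (R.res_mem _ ha) (R.res_mem _ hb))
  d _ := DGAlg.stalkMap R.d (fun h x => (R.res_d h x).symm)
  d_mem _ {i a} := by
    rintro ⟨k, a, ha, rfl⟩
    exact DGAlg.germ_mem (R.d_mem _ ha)
  d_d _ a := by
    induction a using DGAlg.germ_induction with
    | h i a => rw [DGAlg.stalkMap_germ, DGAlg.stalkMap_germ, R.d_d, map_zero]
  leibniz _ {i a} := by
    rintro ⟨k, a, ha, rfl⟩ b
    induction b using DGAlg.germ_induction with
    | h l b =>
      obtain ⟨m, hk, hl⟩ := exists_ge_ge k l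
      rw [← DGAlg.germ_res hk, ← DGAlg.germ_res hl, ← map_mul, DGAlg.stalkMap_germ,
        DGAlg.stalkMap_germ, DGAlg.stalkMap_germ, ← map_mul, ← map_mul, ← map_zsmul, ← map_add,
        R.leibniz _ (R.res_mem _ ha)]
  res _ := RingHom.id _
  res_refl _ _ := rfl
  res_trans _ _ _ := rfl
  res_mem _ _ _ h := h
  res_d _ _ := rfl

/-- The stalk of a presheaf of DG modules, as a DG module over the stalk. -/
def DGMod.stalk {R : DGAlg T} (M : DGMod R) (σ : DirSys T) : DGMod (R.stalk σ) where
  obj _ := M.StalkObj σ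
  mod _ := inferInstanceAs (Module (R.StalkObj σ)ᵐᵒᵖ (M.StalkObj σ))
  gr _ := M.stalkGr σ
  internal _ := M.stalk_internal σ
  smul_mem _ {i j m a} := by
    rintro ⟨k, m, hm, rfl⟩ ⟨l, a, ha, rfl⟩
    obtain ⟨p, hk, hl⟩ := exists_ge_ge k l
    rw [← DGMod.germ_res hk, ← DGAlg.germ_res hl]
    exact ⟨p, _, M.smul_mem _ (M.res_mem _ hm) (R.res_mem _ ha), DGMod.germ_smul _ _ _⟩
  d _ := DGMod.stalkMap M.d (fun h x => (M.res_d h x).symm)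
  d_mem _ {i a} := by
    rintro ⟨k, a, ha, rfl⟩
    exact DGMod.germ_mem (M.d_mem _ ha)
  d_d _ a := by
    induction a using DGMod.germ_induction with
    | h i a => rw [DGMod.stalkMap_germ, DGMod.stalkMap_germ, M.d_d, map_zero]
  leibniz _ {i m} := by
    rintro ⟨k, m, hm, rfl⟩ a
    induction a using DGAlg.germ_induction with
    | h l a =>
      obtain ⟨p, hk, hl⟩ := exists_ge_ge k l
      rw [← DGMod.germ_res hk, ← DGAlg.germ_res hl]
      have key (m : M.obj (σ.site p)) (hm : m ∈ M.gr _ i) (a : R.obj (σ.site p)) :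
          DGMod.stalkMap M.d (fun h x => (M.res_d h x).symm) (M.germ σ p m <• R.germ σ p a) =
          DGMod.stalkMap M.d (fun h x => (M.res_d h x).symm) (M.germ σ p m) <• R.germ σ p a +
          ksign i • (M.germ σ p m <•
            DGAlg.stalkMap R.d (fun h x => (R.res_d h x).symm) (R.germ σ p a)) := by
        rw [DGMod.germ_smul, DGMod.stalkMap_germ, DGMod.stalkMap_germ, DGAlg.stalkMap_germ,
          DGMod.germ_smul, DGMod.germ_smul, ← map_zsmul, ← map_add, M.leibniz _ hm]
      exact key _ (M.res_mem _ hm) _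
  res _ := AddMonoidHom.id _
  res_refl _ _ := rfl
  res_trans _ _ _ := rfl
  res_mem _ _ _ h := h
  res_d _ _ := rfl
  res_smul _ _ _ := rfl

end Stalk

/-! ### Stalks of bimodules, and the stalk of a tensor product. -/

section BiStalk

variable {T : Type} [Preorder T] {σ : DirSys T} {R : DGAlg T} {L : BiMod R}

instance : SMul (R.StalkObj σ) (L.toDGMod.StalkObj σ) where
  smul a m := DirectLimit.map₂ (F := fun i => L.obj (σ.site i))
    (fun i j (h : i ≤ j) => R.res (σ.anti h)) (fun i j (h : i ≤ j) => L.res (σ.anti h))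
    (fun i j (h : i ≤ j) => L.res (σ.anti h)) (fun _ (a : R.obj _) m => a • m)
    (fun _ _ h a m => L.res_lsmul (σ.anti h) a m) a m

lemma BiMod.germ_lsmul (i : σ.ι) (a : R.obj (σ.site i)) (m : L.obj (σ.site i)) :
    R.germ σ i a • L.germ σ i m = L.germ σ i (a • m) :=
  DirectLimit.map₂_def (F := fun i => L.obj (σ.site i))
    (fun i j (h : i ≤ j) => R.res (σ.anti h)) (fun i j (h : i ≤ j) => L.res (σ.anti h))
    (fun i j (h : i ≤ j) => L.res (σ.anti h)) (fun _ (a : R.obj _) m => a • m)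
    (fun _ _ h a m => L.res_lsmul (σ.anti h) a m) i a m

instance (priority := 1100) : Module (R.StalkObj σ) (L.toDGMod.StalkObj σ) where
  one_smul m := by
    induction m using DGMod.germ_induction with
    | h i m => rw [← map_one (R.germ σ i), BiMod.germ_lsmul, one_smul]
  mul_smul a b m := by
    induction a, b using DGAlg.germ_induction₂ with
    | h i a b =>
      induction m using DGMod.germ_induction with
      | h j m =>
        obtain ⟨k, hi, hj⟩ := exists_ge_ge i j
        rw [← DGAlg.germ_res hi a, ← DGAlg.germ_res hi b, ← DGMod.germ_res hj,
          ← map_mul, BiMod.germ_lsmul, BiMod.germ_lsmul, BiMod.germ_lsmul, mul_smul]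
  smul_zero a := by
    induction a using DGAlg.germ_induction with
    | h i a => rw [← map_zero (L.germ σ i), BiMod.germ_lsmul, smul_zero]
  zero_smul m := by
    induction m using DGMod.germ_induction with
    | h i m => rw [← map_zero (R.germ σ i), BiMod.germ_lsmul, zero_smul, map_zero]
  smul_add a m m' := by
    induction m, m' using DGMod.germ_induction₂ with
    | h i m m' =>
      induction a using DGAlg.germ_induction with
      | h j a =>
        obtain ⟨k, hi, hj⟩ := exists_ge_ge i j
        rw [← DGAlg.germ_res hj a, ← map_add, ← DGMod.germ_res hi (m + m'), ← DGMod.germ_res hi m,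
          ← DGMod.germ_res hi m', BiMod.germ_lsmul, BiMod.germ_lsmul, BiMod.germ_lsmul, map_add,
          smul_add, map_add]
  add_smul a b m := by
    induction a, b using DGAlg.germ_induction₂ with
    | h i a b =>
      induction m using DGMod.germ_induction with
      | h j m =>
        obtain ⟨k, hi, hj⟩ := exists_ge_ge i j
        rw [← DGAlg.germ_res hi a, ← DGAlg.germ_res hi b, ← DGMod.germ_res hj, ← map_add,
          BiMod.germ_lsmul, BiMod.germ_lsmul, BiMod.germ_lsmul, add_smul, map_add]

/-- The stalk of a presheaf of DG bimodules. -/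
def BiMod.stalk (L : BiMod R) (σ : DirSys T) : BiMod (R.stalk σ) where
  toDGMod := L.toDGMod.stalk σ
  lmod _ := inferInstanceAs (Module (R.StalkObj σ) (L.toDGMod.StalkObj σ))
  assoc _ a m b := by
    have key (p : σ.ι) (a b : R.obj (σ.site p)) (m : L.obj (σ.site p)) :
        (R.germ σ p a • L.germ σ p m) <• R.germ σ p b =
          R.germ σ p a • (L.germ σ p m <• R.germ σ p b) := by
      rw [BiMod.germ_lsmul, DGMod.germ_smul, DGMod.germ_smul, BiMod.germ_lsmul, L.assoc]
    induction a, b using DGAlg.germ_induction₂ with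
    | h i a b =>
      induction m using DGMod.germ_induction with
      | h j m =>
        obtain ⟨k, hi, hj⟩ := exists_ge_ge i j
        rw [← DGAlg.germ_res hi a, ← DGAlg.germ_res hi b, ← DGMod.germ_res hj]
        exact key _ _ _ _
  lsmul_mem _ {i j a m} := by
    rintro ⟨l, a, ha, rfl⟩ ⟨k, m, hm, rfl⟩
    obtain ⟨p, hk, hl⟩ := exists_ge_ge k l
    rw [← DGMod.germ_res hk, ← DGAlg.germ_res hl]
    exact ⟨p, _, L.lsmul_mem _ (R.res_mem _ ha) (L.res_mem _ hm), BiMod.germ_lsmul _ _ _⟩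
  lleibniz _ {i a} := by
    rintro ⟨k, a, ha, rfl⟩ m
    induction m using DGMod.germ_induction with
    | h l m =>
      obtain ⟨p, hk, hl⟩ := exists_ge_ge k l
      rw [← DGAlg.germ_res hk, ← DGMod.germ_res hl]
      have key (m : L.obj (σ.site p)) (a : R.obj (σ.site p)) (ha : a ∈ R.gr _ i) :
          DGMod.stalkMap L.d (fun h x => (L.res_d h x).symm) (R.germ σ p a • L.germ σ p m) =
          DGAlg.stalkMap R.d (fun h x => (R.res_d h x).symm) (R.germ σ p a) • L.germ σ p m +
          ksign i • (R.germ σ p a •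
            DGMod.stalkMap L.d (fun h x => (L.res_d h x).symm) (L.germ σ p m)) := by
        rw [BiMod.germ_lsmul, DGMod.stalkMap_germ, DGMod.stalkMap_germ, DGAlg.stalkMap_germ,
          BiMod.germ_lsmul, BiMod.germ_lsmul, ← map_zsmul, ← map_add, L.lleibniz _ ha]
      exact key _ _ (R.res_mem _ ha)
  res_lsmul _ _ _ := rfl

/-- The map of stalks induced by a morphism of DG modules. -/
def DGMod.stalkHom {M N : DGMod R} (f : M ⟶ N) (σ : DirSys T) : M.stalk σ ⟶ N.stalk σ where
  map _ := DGMod.stalkMap f.map f.map_res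
  map_smul _ m a := by
    have key (p : σ.ι) (a : R.obj (σ.site p)) (m : M.obj (σ.site p)) :
        DGMod.stalkMap f.map f.map_res (M.germ σ p m <• R.germ σ p a) =
          DGMod.stalkMap f.map f.map_res (M.germ σ p m) <• R.germ σ p a := by
      rw [DGMod.germ_smul, DGMod.stalkMap_germ, DGMod.stalkMap_germ, DGMod.germ_smul, f.map_smul]
    induction m, a using DGMod.germ_induction_mod with
    | h i m a => exact key _ _ _
  map_mem _ i m := by
    rintro ⟨k, m, hm, rfl⟩
    exact DGMod.germ_mem (f.map_mem _ hm)
  map_d _ m := by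
    induction m using DGMod.germ_induction with
    | h i m => exact congrArg (N.germ σ i) (f.map_d _ m)
  map_res _ _ := rfl

/-- The map of stalks induced by a morphism of DG rings. -/
def DGAlg.stalkHom {R S : DGAlg T} (f : DGAlg.Hom R S) (σ : DirSys T) :
    DGAlg.Hom (R.stalk σ) (S.stalk σ) where
  map _ := DGAlg.stalkLiftRing (fun i => (S.germ σ i).comp (f.map _)) (fun i j h x => by
    change S.germ σ j (f.map _ (R.res _ x)) = S.germ σ i (f.map _ x)
    rw [f.map_res, DGAlg.germ_res h])
  map_mem _ {i a} := by
    rintro ⟨k, m, hm, rfl⟩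
    exact DGAlg.germ_mem (f.map_mem _ hm)
  map_d _ m := by
    induction m using DGAlg.germ_induction with
    | h i m => exact congrArg (S.germ σ i) (f.map_d _ m)
  map_res _ _ := rfl

lemma DGAlg.stalkHom_germ {R S : DGAlg T} (f : DGAlg.Hom R S) (i : σ.ι) (x : R.obj (σ.site i)) :
    (DGAlg.stalkHom f σ).map ⟨⟩ (R.germ σ i x) = S.germ σ i (f.map _ x) := rfl

/-- The germ of a section, as an element of the stalk module. -/
def DGMod.germS (M : DGMod R) (σ : DirSys T) (i : σ.ι) :
    M.obj (σ.site i) →+ (M.stalk σ).obj ⟨⟩ := M.germ σ i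

/-- The germ of a section, as an element of the stalk ring. -/
def DGAlg.germS (R : DGAlg T) (σ : DirSys T) (i : σ.ι) :
    R.obj (σ.site i) →+* (R.stalk σ).obj ⟨⟩ := R.germ σ i

variable (M : DGMod R) (L)

/-- The stalk of a tensor product maps to the tensor product of the stalks. -/
def stalkTensorTo (σ : DirSys T) :
    (tensor M L).StalkObj σ →+ (tensor (M.stalk σ) (L.stalk σ)).obj ⟨⟩ :=
  DGMod.stalkLift (fun i => tensorLift M L (σ.site i)
    (AddMonoidHom.flip (((tensorMk (M.stalk σ) (L.stalk σ) ⟨⟩).comp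
      (M.germS σ i)).flip.comp (L.germS σ i)))
    (fun m a l => by
      change tensorMk (M.stalk σ) (L.stalk σ) ⟨⟩ (M.germ σ i (m <• a)) (L.germ σ i l) =
        tensorMk (M.stalk σ) (L.stalk σ) ⟨⟩ (M.germ σ i m) (L.germ σ i (a • l))
      rw [← DGMod.germ_smul, ← BiMod.germ_lsmul]
      exact tensorMk_smul_left (R := R.stalk σ) (M := M.stalk σ) (L := L.stalk σ) (t := ⟨⟩)
        (M.germ σ i m) (R.germ σ i a) (L.germ σ i l)))
    (fun i j h x => by
      induction x using tensor_induction with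
      | zero => simp
      | add x y hx hy => simp only [map_add, hx, hy]
      | mk m l =>
        rw [tensor_res_mk]
        change tensorMk (M.stalk σ) (L.stalk σ) ⟨⟩ (M.germ σ j _) (L.germ σ j _) =
          tensorMk (M.stalk σ) (L.stalk σ) ⟨⟩ (M.germ σ i m) (L.germ σ i l)
        rw [DGMod.germ_res h, DGMod.germ_res h])

lemma stalkTensorTo_mk (i : σ.ι) (m : M.obj (σ.site i)) (l : L.obj (σ.site i)) :
    stalkTensorTo L M σ ((tensor M L).germ σ i (tensorMk M L _ m l)) =
      tensorMk (M.stalk σ) (L.stalk σ) ⟨⟩ (M.germS σ i m) (L.germS σ i l) := rfl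

/-- The pairing of the stalks with values in the stalk of the tensor product. -/
def stalkTensorPairing (σ : DirSys T) :
    M.StalkObj σ →+ L.toDGMod.StalkObj σ →+ (tensor M L).StalkObj σ :=
  DGMod.stalkLift₂ (fun i => AddMonoidHom.flip
      (AddMonoidHom.flip (((AddMonoidHom.compHom ((tensor M L).germ σ i))).comp (tensorMk M L _))))
    (fun i j h m l => by
      change (tensor M L).germ σ j (tensorMk M L _ (M.res _ m) (L.res _ l)) =
        (tensor M L).germ σ i (tensorMk M L _ m l)
      rw [← tensor_res_mk, DGMod.germ_res h])

lemma stalkTensorPairing_germ (i : σ.ι) (m : M.obj (σ.site i)) (l : L.obj (σ.site i)) :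
    stalkTensorPairing L M σ (M.germ σ i m) (L.germ σ i l) =
      (tensor M L).germ σ i (tensorMk M L _ m l) := DGMod.stalkLift₂_germ _ _ _ _ _

/-- The tensor product of the stalks maps to the stalk of the tensor product. -/
def stalkTensorFrom (σ : DirSys T) :
    (tensor (M.stalk σ) (L.stalk σ)).obj ⟨⟩ →+ (tensor M L).StalkObj σ :=
  tensorLift (M.stalk σ) (L.stalk σ) ⟨⟩ (stalkTensorPairing L M σ) (fun m a l => by
    have key (p : σ.ι) (a : R.obj (σ.site p)) (m : M.obj (σ.site p)) (l : L.obj (σ.site p)) :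
        stalkTensorPairing L M σ (M.germ σ p m <• R.germ σ p a) (L.germ σ p l) =
          stalkTensorPairing L M σ (M.germ σ p m) (R.germ σ p a • L.germ σ p l) := by
      rw [DGMod.germ_smul, BiMod.germ_lsmul, stalkTensorPairing_germ, stalkTensorPairing_germ,
        tensorMk_smul_left]
    induction m, l using DGMod.germ_induction₂ with
    | h i m l =>
      induction a using DGAlg.germ_induction with
      | h j a =>
        obtain ⟨k, hi, hj⟩ := exists_ge_ge i j
        rw [← DGAlg.germ_res hj a, ← DGMod.germ_res hi m, ← DGMod.germ_res hi l]
        exact key _ _ _ _)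

lemma stalkTensorFrom_to (x : (tensor M L).StalkObj σ) :
    stalkTensorFrom L M σ (stalkTensorTo L M σ x) = x := by
  induction x using DGMod.germ_induction with
  | h i x =>
    induction x using tensor_induction with
    | zero => simp
    | add x y hx hy => simp only [map_add, hx, hy]
    | mk m l =>
      rw [stalkTensorTo_mk]
      exact stalkTensorPairing_germ L M i m l

lemma stalkTensorTo_from (x : (tensor (M.stalk σ) (L.stalk σ)).obj ⟨⟩) :
    stalkTensorTo L M σ (stalkTensorFrom L M σ x) = x := by
  induction x using tensor_induction with
  | zero => simp
  | add x y hx hy => simp only [map_add, hx, hy]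
  | mk m l =>
    induction m, l using DGMod.germ_induction₂ with
    | h i m l =>
      change stalkTensorTo L M σ (stalkTensorPairing L M σ (M.germ σ i m) (L.germ σ i l)) = _
      rw [stalkTensorPairing_germ]
      rfl

/-- Germ maps commute with the sign operators, so the Koszul sign in the differential of a tensor is
unaffected by passing to stalks. -/
lemma stalkTensorTo_d (x : (tensor M L).StalkObj σ) :
    stalkTensorTo L M σ (((tensor M L).stalk σ).d ⟨⟩ x) =
      (tensor (M.stalk σ) (L.stalk σ)).d ⟨⟩ (stalkTensorTo L M σ x) := by
  induction x using DGMod.germ_induction with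
  | h i x =>
    refine DFunLike.congr_fun (tensor_addHom_ext
      (f := (stalkTensorTo L M σ).comp (((tensor M L).germ σ i).comp ((tensor M L).d _)))
      (g := ((tensor (M.stalk σ) (L.stalk σ)).d ⟨⟩).comp
        ((stalkTensorTo L M σ).comp ((tensor M L).germ σ i))) fun m l => ?_) x
    have he : (M.stalk σ).eps ⟨⟩ (M.germS σ i m) = M.germS σ i (M.eps _ m) := by
      refine gr_induction (M.internal _) (p := fun m => (M.stalk σ).eps ⟨⟩ (M.germS σ i m) =
        M.germS σ i (M.eps _ m)) ?_ (by simp) ?_ m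
      · intro n x hx
        rw [M.eps_apply hx, map_zsmul]
        exact (M.stalk σ).eps_apply (DGMod.germ_mem hx)
      · intro x y hx hy; simp only [map_add, hx, hy]
    change stalkTensorTo L M σ ((tensor M L).germ σ i ((tensor M L).d _ (tensorMk M L _ m l))) =
      (tensor (M.stalk σ) (L.stalk σ)).d ⟨⟩ (tensorMk (M.stalk σ) (L.stalk σ) ⟨⟩ (M.germS σ i m)
        (L.germS σ i l))
    rw [tensor_d_mk, map_add, map_add, stalkTensorTo_mk, stalkTensorTo_mk, ← he]
    rfl

end BiStalk

/-! ### Homogeneous components and graded subgroups. -/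

section Components

variable {X Y : Type} [AddCommGroup X] [AddCommGroup Y] {gr : ℤ → AddSubgroup X}
  {gr' : ℤ → AddSubgroup Y}

/-- The homogeneous component of degree `i`. -/
def hcomp (h : DirectSum.IsInternal gr) (i : ℤ) : X →+ X where
  toFun x := ((comps h x) i : X)
  map_zero' := by simp
  map_add' x y := by simp

lemma hcomp_mem (h : DirectSum.IsInternal gr) (i : ℤ) (x : X) : hcomp h i x ∈ gr i :=
  ((comps h x) i).2

lemma hcomp_of_mem (h : DirectSum.IsInternal gr) {i : ℤ} {x : X} (hx : x ∈ gr i) :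
    hcomp h i x = x := by
  change ((comps h x) i : X) = x
  rw [symm_apply h hx, DirectSum.of_eq_same]

lemma hcomp_of_ne (h : DirectSum.IsInternal gr) {i j : ℤ} (hij : i ≠ j) {x : X} (hx : x ∈ gr i) :
    hcomp h j x = 0 := by
  change ((comps h x) j : X) = 0
  rw [symm_apply h hx, DirectSum.of_eq_of_ne _ _ _ hij.symm]; rfl

lemma hcomp_map (h : DirectSum.IsInternal gr) (h' : DirectSum.IsInternal gr') (f : X →+ Y) (k : ℤ)
    (hf : ∀ i, ∀ x ∈ gr i, f x ∈ gr' (i + k)) (i : ℤ) (x : X) :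
    hcomp h' (i + k) (f x) = f (hcomp h i x) := by
  refine gr_induction h (p := fun x => hcomp h' (i + k) (f x) = f (hcomp h i x)) ?_ (by simp) ?_ x
  · intro j x hx
    by_cases hij : j = i
    · subst hij; rw [hcomp_of_mem h hx, hcomp_of_mem h' (hf j x hx)]
    · rw [hcomp_of_ne h hij hx, hcomp_of_ne h' (by omega) (hf j x hx), map_zero]
  · intro x y hx hy; simp only [map_add, hx, hy]

/-- Induction for the elements of a subgroup that is stable under taking components. -/
lemma sub_gr_induction (h : DirectSum.IsInternal gr) {K : AddSubgroup X}
    (hK : ∀ x ∈ K, ∀ i, hcomp h i x ∈ K) {p : X → Prop} (hom : ∀ i, ∀ x ∈ gr i, x ∈ K → p x)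
    (zero : p 0) (add : ∀ x y, p x → p y → p (x + y)) {x : X} (hx : x ∈ K) : p x :=
  gr_induction (sub_internal h K hK) (p := fun x : K => p x) (fun i x hx => hom i x hx x.2) zero
    (fun x y => add x y) ⟨x, hx⟩

end Components

/-- The mapping cone of a map of complexes is acyclic. -/
def ConeAcyclic {X Y : Type} [AddCommGroup X] [AddCommGroup Y] (dX : X →+ X) (dY : Y →+ Y)
    (f : X →+ Y) : Prop :=
  ∀ z y, dX z = 0 → f z = dY y → ∃ w v, dX w = z ∧ f w = y + dY v

/-! ### Quasi-isomorphisms are detected on stalks. -/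

section Neighbourhoods

variable {A : Type} [PartialOrder A] {𝒲 : SmoothSystem A} {R : DGAlg (Site 𝒲)}

/-- The open neighbourhoods of a point. -/
def nb (t : Site 𝒲) (x : 𝒲.W.obj (op t.idx)) (hx : x ∈ t.opn) : DirSys (Site 𝒲) where
  ι := {V : (Opens (𝒲.W.obj (op t.idx)))ᵒᵈ // x ∈ OrderDual.ofDual V ∧ OrderDual.ofDual V ≤ t.opn}
  directed := ⟨fun U V => ⟨⟨OrderDual.toDual (OrderDual.ofDual U.1 ⊓ OrderDual.ofDual V.1),
    ⟨⟨U.2.1, V.2.1⟩, inf_le_left.trans U.2.2⟩⟩, by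
      constructor
      · exact (inf_le_left : OrderDual.ofDual U.1 ⊓ OrderDual.ofDual V.1 ≤ OrderDual.ofDual U.1)
      · exact (inf_le_right : OrderDual.ofDual U.1 ⊓ OrderDual.ofDual V.1 ≤ OrderDual.ofDual V.1)⟩⟩
  nonempty := ⟨⟨OrderDual.toDual t.opn, hx, le_rfl⟩⟩
  site V := t.shrink (OrderDual.ofDual V.1) V.2.2
  anti {U V} h := (t.shrink (OrderDual.ofDual U.1) U.2.2).shrink_le (OrderDual.ofDual V.1) h

/-- The largest neighbourhood. -/
def nbTop (t : Site 𝒲) (x : 𝒲.W.obj (op t.idx)) (hx : x ∈ t.opn) : (nb t x hx).ι :=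
  ⟨OrderDual.toDual t.opn, hx, le_rfl⟩

lemma nb_le_top (t : Site 𝒲) (x : 𝒲.W.obj (op t.idx)) (hx : x ∈ t.opn) (V : (nb t x hx).ι) :
    nbTop t x hx ≤ V := V.2.2

variable {M N : DGMod R}

/-- A morphism has acyclic cone on all stalks. -/
def StalkAcyclic (f : M ⟶ N) : Prop := ∀ (t : Site 𝒲) (x : 𝒲.W.obj (op t.idx)) (hx : x ∈ t.opn),
  ConeAcyclic ((M.stalk (nb t x hx)).d ⟨⟩) ((N.stalk (nb t x hx)).d ⟨⟩)
    ((DGMod.stalkHom f (nb t x hx)).map ⟨⟩)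

/-- The injectivity half of the definition, applied over a neighbourhood `s`, with the shrunken open
set expressed as a later index of the directed system. -/
lemma IsQuasiIso.exists_primitive {f : M ⟶ N} (hf : IsQuasiIso f) {t : Site 𝒲}
    {x : 𝒲.W.obj (op t.idx)} {hx : x ∈ t.opn} (s : (nb t x hx).ι) {n : ℤ}
    {z : M.obj ((nb t x hx).site s)} (hz : z ∈ M.gr _ (n + 1)) (hdz : M.d _ z = 0)
    {y : N.obj ((nb t x hx).site s)} (hy : y ∈ N.gr _ n) (hdy : N.d _ y = f.map _ z) :
    ∃ (v : (nb t x hx).ι) (h : s ≤ v), ∃ u ∈ M.gr ((nb t x hx).site v) n,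
      M.d _ u = M.res ((nb t x hx).anti h) z := by
  obtain ⟨V, hV, hxV, u, hu, hu'⟩ := (hf ((nb t x hx).site s) n x s.2.1).1 z hz hdz ⟨y, hy, hdy⟩
  exact ⟨⟨OrderDual.toDual V, hxV, hV.trans s.2.2⟩, hV, u, hu, hu'⟩

lemma IsQuasiIso.exists_lift {f : M ⟶ N} (hf : IsQuasiIso f) {t : Site 𝒲}
    {x : 𝒲.W.obj (op t.idx)} {hx : x ∈ t.opn} (s : (nb t x hx).ι) {n : ℤ}
    {z : N.obj ((nb t x hx).site s)} (hz : z ∈ N.gr _ (n + 1)) (hdz : N.d _ z = 0) :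
    ∃ (v : (nb t x hx).ι) (h : s ≤ v), ∃ w ∈ M.gr ((nb t x hx).site v) (n + 1), M.d _ w = 0 ∧
      ∃ y ∈ N.gr ((nb t x hx).site v) n,
        N.d _ y = f.map _ w - N.res ((nb t x hx).anti h) z := by
  obtain ⟨V, hV, hxV, u, hu, hu', y, hy, hy'⟩ := (hf ((nb t x hx).site s) n x s.2.1).2 z hz hdz
  exact ⟨⟨OrderDual.toDual V, hxV, hV.trans s.2.2⟩, hV, u, hu, hu', y, hy, hy'⟩

/-- For homogeneous germs, injectivity on cohomology gives `u` with `du = z`. Then `f(u) - y` is a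
cocycle, and surjectivity corrects `u` by a cocycle `w'` so that `f(u - w')` agrees with `y` up to a
coboundary. General pairs are sums of homogeneous ones. -/
lemma IsQuasiIso.stalkAcyclic {f : M ⟶ N} (hf : IsQuasiIso f) : StalkAcyclic f := by
  intro t x hx
  set σ := nb t x hx
  let M' := M.stalk σ
  let N' := N.stalk σ
  let F : M'.obj ⟨⟩ →+ N'.obj ⟨⟩ := (DGMod.stalkHom f σ).map ⟨⟩
  have hom : ∀ n, ∀ z ∈ M'.gr ⟨⟩ (n + 1), ∀ y ∈ N'.gr ⟨⟩ n, M'.d ⟨⟩ z = 0 → F z = N'.d ⟨⟩ y →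
      ∃ w v, M'.d ⟨⟩ w = z ∧ F w = y + N'.d ⟨⟩ v := by
    rintro n _ ⟨i, z, hz, rfl⟩ _ ⟨j, y, hy, rfl⟩ h1 h2
    obtain ⟨k, hi, hj⟩ := exists_ge_ge i j
    rw [← DGMod.germ_res hi] at h1 h2 ⊢
    rw [← DGMod.germ_res hj] at h2 ⊢
    replace hz := M.res_mem (σ.anti hi) hz
    replace hy := N.res_mem (σ.anti hj) hy
    generalize M.res (σ.anti hi) z = z at *
    generalize N.res (σ.anti hj) y = y at *
    replace h1 : M.germ σ k (M.d _ z) = 0 := h1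
    replace h2 : N.germ σ k (f.map _ z) = N.germ σ k (N.d _ y) := h2
    rw [← sub_eq_zero, ← map_sub] at h2
    obtain ⟨p, hp, hp'⟩ := DGMod.germ_eq_zero h1
    obtain ⟨q, hq, hq'⟩ := DGMod.germ_eq_zero h2
    obtain ⟨s, hs, hs'⟩ := exists_ge_ge p q
    have e1 : M.d _ (M.res (σ.anti (hp.trans hs)) z) = 0 := by
      rw [← M.res_d, ← M.res_trans (σ.anti hs) (σ.anti hp), hp', map_zero]
    have e2 : N.d _ (N.res (σ.anti (hp.trans hs)) y) =
        f.map _ (M.res (σ.anti (hp.trans hs)) z) := by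
      have := congrArg (N.res (σ.anti hs')) hq'
      rw [N.res_trans, map_sub, map_zero, sub_eq_zero, N.res_d, ← f.map_res] at this
      exact this.symm
    obtain ⟨v, hsv, u, hu, hu2⟩ := hf.exists_primitive s
      (M.res_mem (σ.anti (hp.trans hs)) hz) e1 (N.res_mem (σ.anti (hp.trans hs)) hy) e2
    rw [M.res_trans] at hu2
    have hy' : N.d (σ.site v) (f.map (σ.site v) u -
        N.res (σ.anti (hp.trans (hs.trans hsv))) y) = 0 := by
      rw [map_sub, ← f.map_d, hu2, sub_eq_zero]
      have := congrArg (N.res (σ.anti hsv)) e2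
      rw [N.res_d, N.res_trans, ← f.map_res, M.res_trans] at this
      exact this.symm
    -- `exists_lift` applies in degrees written as a successor; every integer is one.
    obtain ⟨n, rfl⟩ : ∃ m, n = m + 1 := ⟨n - 1, by ring⟩
    obtain ⟨v', hvv, w', hw', hdw', y'', hy'', e⟩ := hf.exists_lift v
      (sub_mem (f.map_mem _ hu) (N.res_mem (σ.anti (hp.trans (hs.trans hsv))) hy)) hy'
    replace e : N.d (σ.site v') y'' = f.map (σ.site v') w' -
        (N.res (σ.anti hvv) (f.map (σ.site v) u) -
          N.res (σ.anti (hp.trans (hs.trans (hsv.trans hvv)))) y) := by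
      rw [map_sub, N.res_trans] at e
      exact e
    have hkv : k ≤ v' := hp.trans (hs.trans (hsv.trans hvv))
    refine ⟨M.germ σ v' (M.res (σ.anti hvv) u - w'), N.germ σ v' (-y''), ?_, ?_⟩
    · change M.germ σ v' (M.d _ (M.res (σ.anti hvv) u - w')) = _
      rw [map_sub, hdw', sub_zero, ← M.res_d, hu2, M.res_trans, DGMod.germ_res hkv]
    · change N.germ σ v' (f.map _ (M.res (σ.anti hvv) u - w')) = _ + N.germ σ v' (N.d _ (-y''))
      rw [← DGMod.germ_res hkv y, ← map_add, map_neg, e, map_sub (f.map _), f.map_res]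
      congr 1
      abel
  intro z y hz hy
  -- The grading of the cone: in degree `i`, `z` has degree `i + 1` and `y` has degree `i`. The
  -- conditions on the pair are kernels of maps of degree `2` and `1`, so they pass to components.
  let h := prod_internal (shift_internal (M'.internal ⟨⟩) 1) (N'.internal ⟨⟩)
  let G₁ : M'.obj ⟨⟩ × N'.obj ⟨⟩ →+ M'.obj ⟨⟩ := (M'.d ⟨⟩).comp (AddMonoidHom.fst _ _)
  let G₂ : M'.obj ⟨⟩ × N'.obj ⟨⟩ →+ N'.obj ⟨⟩ :=
    F.comp (AddMonoidHom.fst _ _) - (N'.d ⟨⟩).comp (AddMonoidHom.snd _ _)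
  let K : AddSubgroup (M'.obj ⟨⟩ × N'.obj ⟨⟩) := G₁.ker ⊓ G₂.ker
  have hK : ∀ q ∈ K, ∀ i, hcomp h i q ∈ K := by
    rintro q ⟨h1, h2⟩ i
    constructor
    · have := hcomp_map h (M'.internal ⟨⟩) G₁ 2
        (fun i q hq => by
          have := M'.d_mem ⟨⟩ hq.1
          rwa [add_assoc] at this) i q
      rw [show G₁ q = 0 from h1, map_zero] at this
      exact this.symm
    · have := hcomp_map h (N'.internal ⟨⟩) G₂ 1
        (fun i q hq => sub_mem ((DGMod.stalkHom f σ).map_mem ⟨⟩ hq.1) (N'.d_mem ⟨⟩ hq.2)) i q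
      rw [show G₂ q = 0 from h2, map_zero] at this
      exact this.symm
  refine sub_gr_induction h hK (x := (z, y)) (p := fun q => ∃ w v, M'.d ⟨⟩ w = q.1 ∧
    F w = q.2 + N'.d ⟨⟩ v) ?_ ?_ ?_ ⟨hz, sub_eq_zero.2 hy⟩
  · rintro i q hq ⟨h1, h2⟩
    exact hom i q.1 hq.1 q.2 hq.2 h1 (sub_eq_zero.1 h2)
  · exact ⟨0, 0, by simp, by simp⟩
  · rintro q q' ⟨w, v, h1, h2⟩ ⟨w', v', h1', h2'⟩
    refine ⟨w + w', v + v', by rw [map_add, h1, h1']; rfl, ?_⟩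
    rw [map_add, map_add, h2, h2', Prod.snd_add]; abel

/-- The opens allowed in `IsQuasiIso` are exactly the indices of `nb`, so the criterion can be
checked with germs. -/
lemma isQuasiIso_of_nb {f : M ⟶ N}
    (h1 : ∀ (t : Site 𝒲) (x : 𝒲.W.obj (op t.idx)) (hx : x ∈ t.opn) (n : ℤ)
      (z : M.obj ((nb t x hx).site (nbTop t x hx))), z ∈ M.gr _ (n + 1) → M.d _ z = 0 →
      ∀ (y : N.obj ((nb t x hx).site (nbTop t x hx))), N.d _ y = f.map _ z →
      ∃ v : (nb t x hx).ι, ∃ u ∈ M.gr ((nb t x hx).site v) n,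
        M.d _ u = M.res ((nb t x hx).anti (nb_le_top t x hx v)) z)
    (h2 : ∀ (t : Site 𝒲) (x : 𝒲.W.obj (op t.idx)) (hx : x ∈ t.opn) (n : ℤ)
      (z : N.obj ((nb t x hx).site (nbTop t x hx))), z ∈ N.gr _ (n + 1) → N.d _ z = 0 →
      ∃ v : (nb t x hx).ι, ∃ w ∈ M.gr ((nb t x hx).site v) (n + 1), M.d _ w = 0 ∧
        ∃ y ∈ N.gr ((nb t x hx).site v) n,
          N.d _ y = f.map _ w - N.res ((nb t x hx).anti (nb_le_top t x hx v)) z) :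
    IsQuasiIso f := by
  intro t n x hx
  constructor
  · rintro z hz hdz ⟨y, hy, hdy⟩
    -- The site at the index `nbTop` is `t` itself by eta for structures, so sections over `t` can
    -- be used without transport.
    obtain ⟨v, u, hu, hu'⟩ := h1 t x hx n z hz hdz y hdy
    exact ⟨OrderDual.ofDual v.1, v.2.2, v.2.1, u, hu, hu'⟩
  · intro z hz hdz
    obtain ⟨v, w, hw, hdw, y, hy, hdy⟩ := h2 t x hx n z hz hdz
    exact ⟨OrderDual.ofDual v.1, v.2.2, v.2.1, w, hw, hdw, y, hy, hdy⟩

lemma DGMod.stalk_hcomp_d (L : DGMod R) (σ : DirSys (Site 𝒲)) (n : ℤ) (w : (L.stalk σ).obj ⟨⟩) :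
    (L.stalk σ).d ⟨⟩ (hcomp ((L.stalk σ).internal ⟨⟩) n w) =
      hcomp ((L.stalk σ).internal ⟨⟩) (n + 1) ((L.stalk σ).d ⟨⟩ w) :=
  (hcomp_map _ _ _ 1 (fun _ _ hx => (L.stalk σ).d_mem ⟨⟩ hx) n w).symm

/-- Acyclicity of the cone gives germs that need not be homogeneous; their components of the right
degree satisfy the same equations. The equations between germs then hold between sections over a
smaller neighbourhood. -/
lemma StalkAcyclic.isQuasiIso {f : M ⟶ N} (hf : StalkAcyclic f) : IsQuasiIso f := by
  refine isQuasiIso_of_nb ?_ ?_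
  · intro t x hx n z hz hdz y hdy
    set σ := nb t x hx
    obtain ⟨w, -, hw, -⟩ := hf t x hx (M.germ σ _ z) (N.germ σ _ y)
      ((congrArg (M.germ σ _) hdz).trans (map_zero _)) (congrArg (N.germ σ _) hdy.symm)
    have hw' := M.stalk_hcomp_d σ n w
    rw [hw] at hw'
    obtain ⟨i, u, hu, hui⟩ := hcomp_mem ((M.stalk σ).internal ⟨⟩) n w
    rw [hui] at hw'
    have e : M.germ σ i (M.d _ u) = M.germ σ _ z :=
      hw'.trans (hcomp_of_mem _ (DGMod.germ_mem hz))
    rw [← DGMod.germ_res (nb_le_top t x hx i) z, ← sub_eq_zero, ← map_sub] at e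
    obtain ⟨j, hij, hj⟩ := DGMod.germ_eq_zero e
    refine ⟨j, _, M.res_mem (σ.anti hij) hu, ?_⟩
    rw [map_sub, sub_eq_zero, M.res_d, M.res_trans] at hj
    exact hj
  · intro t x hx n z hz hdz
    set σ := nb t x hx
    -- The pair `(0, z)` is a cocycle of the cone; its primitive is a cocycle `w` mapping to `z` up
    -- to a coboundary.
    obtain ⟨w, v, hw, hv⟩ := hf t x hx 0 (N.germ σ _ z) (map_zero _)
      ((map_zero _).trans ((congrArg (N.germ σ _) hdz).trans (map_zero _)).symm)
    obtain ⟨i, u, hu, hui⟩ := hcomp_mem ((M.stalk σ).internal ⟨⟩) (n + 1) w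
    obtain ⟨j, y, hy, hyj⟩ := hcomp_mem ((N.stalk σ).internal ⟨⟩) n v
    have e1 := M.stalk_hcomp_d σ (n + 1) w
    rw [hw, map_zero, hui] at e1
    replace e1 : M.germ σ i (M.d _ u) = 0 := e1
    have e2 := N.stalk_hcomp_d σ n v
    have e3 : (DGMod.stalkHom f σ).map ⟨⟩ (hcomp ((M.stalk σ).internal ⟨⟩) (n + 1) w) =
        N.germS σ _ z + (N.stalk σ).d ⟨⟩ (hcomp ((N.stalk σ).internal ⟨⟩) n v) := by
      rw [e2, ← (hcomp_of_mem ((N.stalk σ).internal ⟨⟩) (i := n + 1) (x := N.germS σ _ z)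
        (DGMod.germ_mem hz)), ← map_add]
      refine Eq.trans ?_ (congrArg (hcomp ((N.stalk σ).internal ⟨⟩) (n + 1)) hv)
      have := hcomp_map ((M.stalk σ).internal ⟨⟩) ((N.stalk σ).internal ⟨⟩)
        ((DGMod.stalkHom f σ).map ⟨⟩) 0 (fun i x hx => by
          rw [add_zero]; exact (DGMod.stalkHom f σ).map_mem ⟨⟩ hx) (n + 1) w
      rw [add_zero] at this
      exact this.symm
    rw [hui, hyj] at e3
    replace e3 : N.germ σ i (f.map _ u) = N.germ σ _ z + N.germ σ j (N.d _ y) := e3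
    obtain ⟨k, hi, hj⟩ := exists_ge_ge i j
    rw [← DGMod.germ_res hi, ← DGMod.germ_res hj, ← DGMod.germ_res (nb_le_top t x hx k) z,
      ← map_add, ← sub_eq_zero, ← map_sub] at e3
    obtain ⟨p, hp, hp'⟩ := DGMod.germ_eq_zero e1
    obtain ⟨q, hq, hq'⟩ := DGMod.germ_eq_zero e3
    obtain ⟨s, hs, hs'⟩ := exists_ge_ge p q
    have hd : M.d _ (M.res (σ.anti (hp.trans hs)) u) = 0 := by
      rw [← M.res_d, ← M.res_trans (σ.anti hs) (σ.anti hp), hp', map_zero]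
    refine ⟨s, _, M.res_mem (σ.anti (hp.trans hs)) hu, hd, _,
      N.res_mem (σ.anti (hj.trans (hq.trans hs'))) hy, ?_⟩
    have e4 := congrArg (N.res (σ.anti hs')) hq'
    rw [N.res_trans, map_sub, map_add, map_zero, N.res_trans, N.res_trans, N.res_trans,
      ← f.map_res, sub_eq_zero] at e4
    rw [← N.res_d]
    exact eq_sub_of_add_eq' e4.symm

lemma isQuasiIso_iff_stalkAcyclic {f : M ⟶ N} : IsQuasiIso f ↔ StalkAcyclic f :=
  ⟨IsQuasiIso.stalkAcyclic, StalkAcyclic.isQuasiIso⟩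

end Neighbourhoods

/-! ### Bases of a ring over a subring of coefficients. -/

section LeftBasis

variable {A B : Type} [Ring A] [Ring B] {φ : A →+* B} {κ : Type} {x : κ → B}

@[elab_as_elim]
lemma IsLeftBasis.induction (h : IsLeftBasis φ x) {p : B → Prop} (zero : p 0)
    (mul : ∀ a k, p (φ a * x k)) (add : ∀ b b', p b → p b' → p (b + b')) (b : B) : p b := by
  obtain ⟨c, rfl, -⟩ := h b
  exact Finset.sum_induction _ p (fun _ _ => add _ _) zero (fun k _ => mul _ _)

lemma IsLeftBasis.addHom_ext (h : IsLeftBasis φ x) {Y : Type} [AddCommGroup Y] {f g : B →+ Y}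
    (hfg : ∀ a k, f (φ a * x k) = g (φ a * x k)) : f = g := by
  ext b
  induction b using h.induction with
  | zero => simp
  | mul a k => exact hfg a k
  | add b b' hb hb' => rw [map_add, map_add, hb, hb']

/-- The coordinates with respect to a basis. -/
def IsLeftBasis.repr (h : IsLeftBasis φ x) : B →+ (κ →₀ A) where
  toFun b := (h b).choose
  map_zero' := ((h 0).choose_spec.2 0 (by simp)).symm
  map_add' b b' := by
    refine ((h (b + b')).choose_spec.2 _ ?_).symm
    change _ = _
    rw [Finsupp.sum_add_index' (by simp) (by simp [add_mul])]
    exact congrArg₂ _ (h b).choose_spec.1 (h b').choose_spec.1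

lemma IsLeftBasis.repr_mul (h : IsLeftBasis φ x) (a : A) (k : κ) :
    h.repr (φ a * x k) = Finsupp.single k a :=
  ((h _).choose_spec.2 _ (by simp)).symm

/-- The additive map with given values on multiples of the basis elements. -/
def IsLeftBasis.lift (h : IsLeftBasis φ x) {Y : Type} [AddCommGroup Y] (f : κ → A →+ Y) :
    B →+ Y := (Finsupp.liftAddHom f).comp h.repr

lemma IsLeftBasis.lift_mul (h : IsLeftBasis φ x) {Y : Type} [AddCommGroup Y] (f : κ → A →+ Y)
    (a : A) (k : κ) : h.lift f (φ a * x k) = f k a := by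
  rw [IsLeftBasis.lift, AddMonoidHom.comp_apply, h.repr_mul]; simp

/-- Generation gives existence of coordinates, and a left inverse `f` of the summation map gives
uniqueness; `f` need not be additive. -/
lemma isLeftBasis_of_lift (hs : ∀ b : B, b ∈ AddSubgroup.closure {y | ∃ a k, y = φ a * x k})
    (f : B → κ →₀ A) (hf : ∀ c : κ →₀ A, f (c.sum fun k a => φ a * x k) = c) :
    IsLeftBasis φ x := by
  intro b
  have : ∃ c : κ →₀ A, b = c.sum fun k a => φ a * x k := by
    induction hs b using AddSubgroup.closure_induction with
    | mem b hb =>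
      obtain ⟨a, k, rfl⟩ := hb
      exact ⟨Finsupp.single k a, by simp⟩
    | zero => exact ⟨0, by simp⟩
    | add b b' _ _ hb hb' =>
      obtain ⟨c, rfl⟩ := hb
      obtain ⟨c', rfl⟩ := hb'
      exact ⟨c + c', by rw [Finsupp.sum_add_index' (by simp) (by simp [add_mul])]⟩
    | neg b _ hb =>
      obtain ⟨c, rfl⟩ := hb
      exact ⟨-c, by rw [Finsupp.sum_neg_index (by simp), Finsupp.sum, Finsupp.sum]; simp⟩
  obtain ⟨c, hc⟩ := this
  refine ⟨c, hc, fun c' hc' => ?_⟩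
  rw [← hf c', ← hc', hc, hf]

end LeftBasis

/-! ### Sign rules in DG rings. -/

section DGRing

lemma DGMod.smul_one' {T : Type} [Preorder T] {R : DGAlg T} (M : DGMod R) {t : T} (m : M.obj t) :
    m <• (1 : R.obj t) = m := by
  rw [MulOpposite.op_one, one_smul]

variable {T : Type} [Preorder T] (B : DGAlg T) (t : T)

/-- A DG ring is a bimodule over itself through the identity, so the sign rules of modules apply. -/
lemma DGAlg.leibniz' (a b : B.obj t) : B.d t (a * b) = B.d t a * b + B.eps t a * B.d t b :=
  ((DGAlg.Hom.id B).bimod (DGAlg.Hom.id B)).leibniz' t a b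

lemma DGAlg.eps_mul (a b : B.obj t) : B.eps t (a * b) = B.eps t a * B.eps t b :=
  ((DGAlg.Hom.id B).bimod (DGAlg.Hom.id B)).eps_smul t a b

lemma DGAlg.eps_d (a : B.obj t) : B.eps t (B.d t a) = -B.d t (B.eps t a) :=
  ((DGAlg.Hom.id B).bimod (DGAlg.Hom.id B)).eps_d t a

lemma DGAlg.eps_eps (a : B.obj t) : B.eps t (B.eps t a) = a :=
  ((DGAlg.Hom.id B).bimod (DGAlg.Hom.id B)).eps_eps t a

lemma DGAlg.Hom.map_eps {R B : DGAlg T} (f : DGAlg.Hom R B) (a : R.obj t) :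
    f.map t (R.eps t a) = B.eps t (f.map t a) := by
  refine gr_induction (R.internal t) (p := fun a => f.map t (R.eps t a) = B.eps t (f.map t a))
    ?_ (by simp) ?_ a
  · intro i m hm
    rw [R.eps_apply hm, map_zsmul, B.eps_apply (f.map_mem t hm)]
  · intro x y hx hy; simp only [map_add, hx, hy]

variable {B t}

lemma DGAlg.mul_comm_zero {a : B.obj t} (ha : a ∈ B.gr t 0) (b : B.obj t) : a * b = b * a := by
  refine gr_induction (B.internal t) (p := fun b => a * b = b * a) ?_ (by simp) ?_ b
  · intro i b hb
    rw [B.comm t ha hb, zero_mul, ksign_zero, one_smul]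
  · intro x y hx hy; rw [mul_add, add_mul, hx, hy]

/-- Degree `-1` suffices because the rule is applied to the elements `τ_i` that bound the Koszul
sequence. -/
lemma DGAlg.mul_comm_odd {a : B.obj t} (ha : a ∈ B.gr t (-1)) (b : B.obj t) :
    a * b = B.eps t b * a := by
  refine gr_induction (B.internal t) (p := fun b => a * b = B.eps t b * a) ?_ (by simp) ?_ b
  · intro i b hb
    have : ksign (-1 * i) = ksign i := by simp [ksign, Int.negOnePow_neg]
    rw [B.comm t ha hb, B.eps_apply hb, this, smul_mul_assoc]
  · intro x y hx hy; rw [mul_add, map_add, add_mul, hx, hy]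

lemma DGAlg.d_one : B.d t 1 = 0 := by
  have h := B.leibniz t (B.one_mem t) 1
  rw [mul_one, ksign_zero, one_smul, one_mul, mul_one] at h
  exact left_eq_add.1 h

/-- A DG ring with a basis of elements of degree `≤ 0` over a ring in degree `0` is concentrated in
degrees `≤ 0`. -/
lemma DGAlg.eq_zero_of_pos {O κ : Type} [Ring O] {o : O →+* B.obj t} (ho : ∀ a, o a ∈ B.gr t 0)
    {x : κ → B.obj t} (hx : IsLeftBasis o x) {n : κ → ℤ} (hn : ∀ k, n k ≤ 0)
    (hxn : ∀ k, x k ∈ B.gr t (n k)) {m : ℤ} (hm : 0 < m) {b : B.obj t} (hb : b ∈ B.gr t m) :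
    b = 0 := by
  have : ∀ b, hcomp (B.internal t) m b = 0 := by
    intro b
    induction b using hx.induction with
    | zero => simp
    | mul a k => exact hcomp_of_ne _ (by have := hn k; omega) (B.mul_mem t (ho a) (hxn k))
    | add b b' hb hb' => rw [map_add, hb, hb', add_zero]
  rw [← hcomp_of_mem (B.internal t) hb, this]

end DGRing

/-! ### Linear contractions and arbitrary coefficients. -/

section Contraction

variable {R B : DGAlg PUnit} {l : DGAlg.Hom R B} {ν : DGAlg.Hom B R}

/-- An additive endomorphism of `B` that is linear over `R` up to the sign of an odd operator. -/
def OddLinear (l : DGAlg.Hom R B) (h : B.obj ⟨⟩ →+ B.obj ⟨⟩) : Prop :=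
  ∀ a b, h (l.map ⟨⟩ a * b) = l.map ⟨⟩ (R.eps ⟨⟩ a) * h b

/-- Of the two terms containing `da`, one carries `d(ε a)` and the other `ε(da) = -d(ε a)`; they
cancel. So commutators of `d` with odd linear operators are linear without a sign. -/
lemma OddLinear.anticomm {h : B.obj ⟨⟩ →+ B.obj ⟨⟩} (hh : OddLinear l h) (a : R.obj ⟨⟩)
    (b : B.obj ⟨⟩) : B.d ⟨⟩ (h (l.map ⟨⟩ a * b)) + h (B.d ⟨⟩ (l.map ⟨⟩ a * b)) =
      l.map ⟨⟩ a * (B.d ⟨⟩ (h b) + h (B.d ⟨⟩ b)) := by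
  rw [hh, B.leibniz', B.leibniz', map_add, ← l.map_d, ← l.map_d, ← l.map_eps, ← l.map_eps, hh, hh,
    R.eps_eps, R.eps_d, map_neg]
  noncomm_ring

/-- A contraction of `B` onto `R` that is compatible with the left structure over `R` makes
`M ⊗ B → M` have acyclic cone for all `M`. -/
lemma coneAcyclic_of_contraction {L : BiMod R} (M : DGMod R)
    {f : (tensor M L).obj ⟨⟩ →+ M.obj ⟨⟩}
    {u : L.obj ⟨⟩} {n : L.obj ⟨⟩ →+ R.obj ⟨⟩} {h : L.obj ⟨⟩ →+ L.obj ⟨⟩}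
    (hf : ∀ m x, f (tensorMk M L ⟨⟩ m x) = m <• n x) (hu : L.d ⟨⟩ u = 0) (hnu : n u = 1)
    (hh : ∀ (a : R.obj ⟨⟩) x, h (a • x) = R.eps ⟨⟩ a • h x)
    (hd : ∀ x, L.d ⟨⟩ (h x) + h (L.d ⟨⟩ x) = x - n x • u) (hn : ∀ x, n (h x) = 0) :
    ConeAcyclic ((tensor M L).d ⟨⟩) (M.d ⟨⟩) (f) := by
  -- The sign operator on `M` absorbs the sign in the linearity of `h`; this makes the formula
  -- balanced.
  let Φ : (tensor M L).obj ⟨⟩ →+ (tensor M L).obj ⟨⟩ := tensorLift M L ⟨⟩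
    (AddMonoidHom.flip (((tensorMk M L ⟨⟩).comp (M.eps ⟨⟩)).flip.comp h))
    (fun m a x => by
      simp only [AddMonoidHom.flip_apply, AddMonoidHom.comp_apply]
      rw [M.eps_smul, tensorMk_smul_left, hh])
  have hΦ : ∀ m x, Φ (tensorMk M L ⟨⟩ m x) = tensorMk M L ⟨⟩ (M.eps ⟨⟩ m) (h x) := fun m x => rfl
  have h1 : ∀ z, (tensor M L).d ⟨⟩ (Φ z) + Φ ((tensor M L).d ⟨⟩ z) =
      z - tensorMk M L ⟨⟩ (f z) u := by
    intro z
    induction z using tensor_induction with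
    | zero => simp
    | add x y hx hy =>
      simp only [map_add, AddMonoidHom.add_apply]
      rw [add_add_add_comm, hx, hy]; abel
    | mk m x =>
      rw [hΦ, tensor_d_mk, tensor_d_mk, map_add, hΦ, hΦ, M.eps_eps, M.eps_d, map_neg,
        AddMonoidHom.neg_apply, hf, tensorMk_smul_left]
      rw [show ∀ a b c : (tensor M L).obj ⟨⟩, a + b + (-a + c) = b + c by intros; abel, ← map_add,
        hd, map_sub]
  have h2 : ∀ z, f (Φ z) = 0 := by
    intro z
    induction z using tensor_induction with
    | zero => simp
    | add x y hx hy => rw [map_add, map_add, hx, hy, add_zero]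
    | mk m x => rw [hΦ, hf, hn, MulOpposite.op_zero, zero_smul]
  intro z y hz hy
  -- Since `dz = 0`, `d(Φ z) = z - f(z) ⊗ u`, and `f(z) ⊗ u = dy ⊗ u = d(y ⊗ u)`. As `f Φ = 0` and
  -- `n(u) = 1`, the image is `y` exactly.
  refine ⟨Φ z + tensorMk M L ⟨⟩ y u, 0, ?_, ?_⟩
  · have := h1 z
    rw [hz, map_zero, add_zero] at this
    rw [map_add, this, tensor_d_mk, hu, map_zero, add_zero, hy, sub_add_cancel]
  · rw [map_add, h2, zero_add, hf, hnu, map_zero, add_zero, M.smul_one']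

end Contraction

/-! ### The Koszul argument: a linear contraction of the resolution onto `R`. -/

section Koszul

/-- A DG ring `B` over `R` that is free over the extension of the degree zero part of `R` to a ring
`C`, in which a sequence `t` cuts out the degree zero part of `R`, with division operators `δ`. -/
structure KoszulData {R B : DGAlg PUnit} (l : DGAlg.Hom R B) (ν : DGAlg.Hom B R) where
  O : Type
  [ringO : Ring O]
  C : Type
  [ringC : Ring C]
  o : O →+* R.obj ⟨⟩
  p : O →+* C
  ι : C →+* B.obj ⟨⟩
  l_o : ∀ a, l.map ⟨⟩ (o a) = ι (p a)
  o_mem : ∀ a, o a ∈ R.gr ⟨⟩ 0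
  ι_mem : ∀ c, ι c ∈ B.gr ⟨⟩ 0
  X : Type
  x : X → R.obj ⟨⟩
  degX : X → ℤ
  degX_le : ∀ k, degX k ≤ 0
  x_mem : ∀ k, x k ∈ R.gr ⟨⟩ (degX k)
  basisX : IsLeftBasis o x
  J : Type
  e : J → B.obj ⟨⟩
  deg : J → ℤ
  deg_le : ∀ j, deg j ≤ 0
  e_mem : ∀ j, e j ∈ B.gr ⟨⟩ (deg j)
  basis : IsLeftBasis ι fun k : X × J => l.map ⟨⟩ (x k.1) * e k.2
  I : Type
  [fintypeI : Fintype I]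
  t : I → C
  δ : I → C →+ C
  δ_p : ∀ i a c, δ i (p a * c) = p a * δ i c
  δ_self : ∀ i c, δ i (t i * c) = c
  δ_ne : ∀ i j, i ≠ j → ∀ c, δ i (t j * c) = t j * δ i c
  gen : ∀ c, ∃ (a : O) (b : I → C), c = p a + ∑ i, t i * b i
  ν_t : ∀ i, ν.map ⟨⟩ (ι (t i)) = 0
  ν_l : ∀ a, ν.map ⟨⟩ (l.map ⟨⟩ a) = a
  acyclic : ConeAcyclic (B.d ⟨⟩) (R.d ⟨⟩) (ν.map ⟨⟩).toAddMonoidHom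

attribute [instance] KoszulData.ringO KoszulData.ringC KoszulData.fintypeI

namespace KoszulData

variable {R B : DGAlg PUnit} {l : DGAlg.Hom R B} {ν : DGAlg.Hom B R} (K : KoszulData l ν)

lemma pos_R (K : KoszulData l ν) {m : ℤ} (hm : 0 < m) {b : R.obj ⟨⟩} (hb : b ∈ R.gr ⟨⟩ m) : b = 0 :=
  DGAlg.eq_zero_of_pos K.o_mem K.basisX K.degX_le K.x_mem hm hb

/-- The differential of an element of degree `0` has degree `1`, where `B` vanishes. Hence the
differential of `B` is linear over `C`. -/
lemma d_ι (c : K.C) : B.d ⟨⟩ (K.ι c) = 0 := by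
  refine DGAlg.eq_zero_of_pos K.ι_mem K.basis (n := fun k => K.degX k.1 + K.deg k.2)
    (fun k => add_nonpos (K.degX_le _) (K.deg_le _))
    (fun k => B.mul_mem _ (l.map_mem _ (K.x_mem _)) (K.e_mem _)) (m := 0 + 1) (by norm_num)
    (B.d_mem _ (K.ι_mem c))

lemma ι_comm (c : K.C) (b : B.obj ⟨⟩) : K.ι c * b = b * K.ι c :=
  DGAlg.mul_comm_zero (K.ι_mem c) b

lemma d_ι_mul (c : K.C) (b : B.obj ⟨⟩) : B.d ⟨⟩ (K.ι c * b) = K.ι c * B.d ⟨⟩ b := by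
  rw [B.leibniz', K.d_ι, zero_mul, zero_add, B.eps_apply (K.ι_mem c), ksign_zero, one_smul]

/-- `t_i` is a cocycle in the kernel of `ν`, whose cone is acyclic, so it is a boundary; the
component of degree `-1` of a primitive is again a primitive. -/
lemma exists_τ (i : K.I) : ∃ τ ∈ B.gr ⟨⟩ (-1), B.d ⟨⟩ τ = K.ι (K.t i) := by
  obtain ⟨w, -, hw, -⟩ := K.acyclic (K.ι (K.t i)) 0 (K.d_ι _) ((K.ν_t i).trans (map_zero _).symm)
  refine ⟨hcomp (B.internal ⟨⟩) (-1) w, hcomp_mem _ _ _, ?_⟩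
  have := hcomp_map (B.internal ⟨⟩) (B.internal ⟨⟩) (B.d ⟨⟩) 1 (fun _ _ h => B.d_mem _ h) (-1) w
  rw [hw, neg_add_cancel, hcomp_of_mem _ (K.ι_mem _)] at this
  exact this.symm

@[elab_as_elim]
lemma ind {p : B.obj ⟨⟩ → Prop} (zero : p 0)
    (mul : ∀ c y j, p (K.ι c * (l.map ⟨⟩ y * K.e j))) (add : ∀ b b', p b → p b' → p (b + b'))
    (b : B.obj ⟨⟩) : p b :=
  K.basis.induction zero (fun c k => mul c _ k.2) add b

/-- The division operator on `B`. -/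
def δB (i : K.I) : B.obj ⟨⟩ →+ B.obj ⟨⟩ :=
  K.basis.lift fun k => (AddMonoidHom.mulRight (l.map ⟨⟩ (K.x k.1) * K.e k.2)).comp
    (K.ι.toAddMonoidHom.comp (K.δ i))

lemma o_mul_shift (c : K.C) (a : K.O) (y : R.obj ⟨⟩) (j : K.J) :
    K.ι c * (l.map ⟨⟩ (K.o a * y) * K.e j) = K.ι (K.p a * c) * (l.map ⟨⟩ y * K.e j) := by
  rw [map_mul, K.l_o, map_mul, mul_assoc, K.ι_comm (K.p a) (K.ι c), mul_assoc]

/-- `δB` is defined through the basis elements `x_k` of `R` over `O`. Since `δ_i` is linear along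
`p`, the formula extends from the `x_k` to all of `R`, and this yields the `R`-linearity of `δB`. -/
lemma δB_apply (i : K.I) (c : K.C) (y : R.obj ⟨⟩) (j : K.J) :
    K.δB i (K.ι c * (l.map ⟨⟩ y * K.e j)) = K.ι (K.δ i c) * (l.map ⟨⟩ y * K.e j) := by
  induction y using K.basisX.induction generalizing c with
  | zero => simp
  | add y y' h h' => simp only [map_add, add_mul, mul_add, h, h']
  | mul a k =>
    rw [o_mul_shift, o_mul_shift, ← K.δ_p]
    exact K.basis.lift_mul _ _ (k, j)

lemma l_mul_shift (a : R.obj ⟨⟩) (c : K.C) (y : R.obj ⟨⟩) (j : K.J) :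
    l.map ⟨⟩ a * (K.ι c * (l.map ⟨⟩ y * K.e j)) = K.ι c * (l.map ⟨⟩ (a * y) * K.e j) := by
  rw [← mul_assoc, ← K.ι_comm, mul_assoc, map_mul, mul_assoc]

lemma ι_mul_shift (a : K.C) (c : K.C) (y : R.obj ⟨⟩) (j : K.J) :
    K.ι a * (K.ι c * (l.map ⟨⟩ y * K.e j)) = K.ι (a * c) * (l.map ⟨⟩ y * K.e j) := by
  rw [← mul_assoc, map_mul]

lemma δB_l (i : K.I) (a : R.obj ⟨⟩) (b : B.obj ⟨⟩) :
    K.δB i (l.map ⟨⟩ a * b) = l.map ⟨⟩ a * K.δB i b := by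
  induction b using K.ind with
  | zero => simp
  | add b b' h h' => simp only [mul_add, map_add, h, h']
  | mul c y j => rw [l_mul_shift, δB_apply, δB_apply, l_mul_shift]

lemma δB_self (i : K.I) (b : B.obj ⟨⟩) : K.δB i (K.ι (K.t i) * b) = b := by
  induction b using K.ind with
  | zero => simp
  | add b b' h h' => simp only [mul_add, map_add, h, h']
  | mul c y j => rw [ι_mul_shift, δB_apply, K.δ_self]

lemma δB_ne {i j : K.I} (hij : i ≠ j) (b : B.obj ⟨⟩) :
    K.δB i (K.ι (K.t j) * b) = K.ι (K.t j) * K.δB i b := by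
  induction b using K.ind with
  | zero => simp
  | add b b' h h' => simp only [mul_add, map_add, h, h']
  | mul c y k => rw [ι_mul_shift, δB_apply, δB_apply, K.δ_ne i j hij, ι_mul_shift]

/-- The homotopy `τ_i δ_i`. -/
lemma exists_k (i : K.I) : ∃ k : B.obj ⟨⟩ →+ B.obj ⟨⟩, OddLinear l k ∧
    (∀ b, B.d ⟨⟩ (k (K.ι (K.t i) * b)) + k (B.d ⟨⟩ (K.ι (K.t i) * b)) = K.ι (K.t i) * b) ∧
    ∀ j, i ≠ j → ∀ b, k (K.ι (K.t j) * b) = K.ι (K.t j) * k b := by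
  obtain ⟨τ, hτ, hd⟩ := K.exists_τ i
  refine ⟨(AddMonoidHom.mulLeft τ).comp (K.δB i), ?_, ?_, ?_⟩
  · intro a b
    simp only [AddMonoidHom.comp_apply, AddMonoidHom.coe_mulLeft]
    rw [δB_l, ← mul_assoc, DGAlg.mul_comm_odd hτ, l.map_eps, mul_assoc]
  · intro b
    simp only [AddMonoidHom.comp_apply, AddMonoidHom.coe_mulLeft]
    -- `d(τ b) + τ δ(t db) = t b - τ db + τ db`.
    rw [d_ι_mul, δB_self, δB_self, B.leibniz', hd, B.eps_apply hτ]
    simp [ksign]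
  · intro j hij b
    simp only [AddMonoidHom.comp_apply, AddMonoidHom.coe_mulLeft]
    rw [K.δB_ne hij, ← mul_assoc, ← K.ι_comm, mul_assoc]

/-- An `R`-linear chain map homotopic to the identity that kills the multiples of all `t_i`. -/
lemma exists_projection (s : Finset K.I) : ∃ G : B.obj ⟨⟩ →+ B.obj ⟨⟩, OddLinear l G ∧
    (∀ i ∈ s, ∀ b, B.d ⟨⟩ (G (K.ι (K.t i) * b)) + G (B.d ⟨⟩ (K.ι (K.t i) * b)) =
      K.ι (K.t i) * b) ∧
    ∀ i ∉ s, ∀ b, G (K.ι (K.t i) * b) = K.ι (K.t i) * G b := by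
  classical
  induction s using Finset.induction_on with
  | empty => exact ⟨0, fun a b => (mul_zero _).symm, fun i hi => absurd hi (Finset.notMem_empty _),
      fun i _ b => (mul_zero _).symm⟩
  | insert i s hi ih =>
    obtain ⟨G, hG, h1, h2⟩ := ih
    obtain ⟨k, hk, k1, k2⟩ := K.exists_k i
    -- The chain map `P = 1 - [d, G]` kills the multiples of the `t_j` treated so far, and `1 - [d,
    -- k]` kills those of `t_i`.
    let P : B.obj ⟨⟩ →+ B.obj ⟨⟩ := AddMonoidHom.id _ - ((B.d ⟨⟩).comp G + G.comp (B.d ⟨⟩))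
    have hP (b) : P b = b - (B.d ⟨⟩ (G b) + G (B.d ⟨⟩ b)) := rfl
    have hPd (b) : B.d ⟨⟩ (P b) = P (B.d ⟨⟩ b) := by
      simp only [hP, map_sub, map_add, B.d_d, map_zero]; abel
    have hPl (a b) : P (l.map ⟨⟩ a * b) = l.map ⟨⟩ a * P b := by
      rw [hP, hG.anticomm, hP]; noncomm_ring
    let q : B.obj ⟨⟩ →+ B.obj ⟨⟩ := (B.d ⟨⟩).comp k + k.comp (B.d ⟨⟩)
    have hq (b) : q b = B.d ⟨⟩ (k b) + k (B.d ⟨⟩ b) := rfl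
    -- The homotopy `G + P k` is chosen so that `1 - [d, G + P k]` is the composite `P (1 - [d,
    -- k])`.
    have key (b) : B.d ⟨⟩ ((G + P.comp k) b) + (G + P.comp k) (B.d ⟨⟩ b) = b - P (b - q b) := by
      simp only [AddMonoidHom.add_apply, AddMonoidHom.comp_apply, map_add, hPd, map_sub, hq]
      rw [hP b]; abel
    have hqi (b) (j) (hij : i ≠ j) : q (K.ι (K.t j) * b) = K.ι (K.t j) * q b := by
      rw [hq, hq, k2 j hij, d_ι_mul, d_ι_mul, k2 j hij, mul_add]
    refine ⟨G + P.comp k, ?_, ?_, ?_⟩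
    · intro a b
      simp only [AddMonoidHom.add_apply, AddMonoidHom.comp_apply]
      rw [hG, hk, hPl, mul_add]
    · intro j hj b
      rw [key]
      by_cases hij : i = j
      · subst hij
        rw [show q (K.ι (K.t i) * b) = K.ι (K.t i) * b from k1 b, sub_self, map_zero, sub_zero]
      -- For an earlier `t_j`, the operator `1 - [d, k]` commutes with `t_j`, so its value is still
      -- a multiple of `t_j` and is killed by `P`.
      · rw [hqi _ _ hij, ← mul_sub, hP, h1 j (by simpa [Ne.symm hij] using hj), sub_self, sub_zero]
    · intro j hj b
      simp only [Finset.mem_insert, not_or] at hj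
      simp only [AddMonoidHom.add_apply, AddMonoidHom.comp_apply]
      rw [k2 j (Ne.symm hj.1), h2 j hj.2, hP, h2 j hj.2, d_ι_mul, d_ι_mul, h2 j hj.2, hP]
      noncomm_ring

/-- The coordinates over `R` of the classes modulo the multiples of the `t_i`. -/
def κ : B.obj ⟨⟩ →+ (K.J →₀ R.obj ⟨⟩) :=
  K.basis.lift fun k => (Finsupp.singleAddHom k.2).comp ((AddMonoidHom.mulRight (K.x k.1)).comp
    ((ν.map ⟨⟩).toAddMonoidHom.comp K.ι.toAddMonoidHom))

lemma κ_apply (c : K.C) (y : R.obj ⟨⟩) (j : K.J) :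
    K.κ (K.ι c * (l.map ⟨⟩ y * K.e j)) = Finsupp.single j (ν.map ⟨⟩ (K.ι c) * y) := by
  induction y using K.basisX.induction generalizing c with
  | zero => simp
  | add y y' h h' => simp only [map_add, add_mul, mul_add, h, h', Finsupp.single_add]
  | mul a k =>
    rw [o_mul_shift]
    refine (K.basis.lift_mul _ _ (k, j)).trans ?_
    simp only [AddMonoidHom.comp_apply, RingHom.toAddMonoidHom_eq_coe, AddMonoidHom.coe_coe,
      AddMonoidHom.mulRight_apply, Finsupp.singleAddHom_apply, map_mul]
    rw [← K.l_o, K.ν_l, DGAlg.mul_comm_zero (K.o_mem a), mul_assoc]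

lemma κ_l (a : R.obj ⟨⟩) (b : B.obj ⟨⟩) : K.κ (l.map ⟨⟩ a * b) = a • K.κ b := by
  induction b using K.ind with
  | zero => simp
  | add b b' h h' => simp only [mul_add, map_add, h, h', smul_add]
  | mul c y j =>
    rw [l_mul_shift, κ_apply, κ_apply, Finsupp.smul_single, smul_eq_mul, ← mul_assoc, ← mul_assoc,
      DGAlg.mul_comm_zero (ν.map_mem _ (K.ι_mem c))]

lemma κ_t (i : K.I) (b : B.obj ⟨⟩) : K.κ (K.ι (K.t i) * b) = 0 := by
  induction b using K.ind with
  | zero => simp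
  | add b b' h h' => simp only [mul_add, map_add, h, h', add_zero]
  | mul c y j => rw [ι_mul_shift, κ_apply, map_mul, map_mul, K.ν_t]; simp

lemma κ_e (j : K.J) : K.κ (K.e j) = Finsupp.single j 1 := by
  have := K.κ_apply 1 1 j
  simpa using this

/-- A linear map that kills the multiples of the `t_i` is determined by its values on the `e_j`. -/
lemma eq_sum {F : B.obj ⟨⟩ →+ B.obj ⟨⟩} (hF : ∀ a b, F (l.map ⟨⟩ a * b) = l.map ⟨⟩ a * F b)
    (ht : ∀ i b, F (K.ι (K.t i) * b) = 0) (b : B.obj ⟨⟩) :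
    F b = (K.κ b).sum fun j a => l.map ⟨⟩ a * F (K.e j) := by
  induction b using K.ind with
  | zero => simp
  | add b b' h h' =>
    rw [map_add, map_add, Finsupp.sum_add_index' (by simp) (by simp [add_mul]), h, h']
  | mul c y j =>
    rw [κ_apply, Finsupp.sum_single_index (by simp)]
    obtain ⟨a, u, rfl⟩ := K.gen c
    have e : ν.map ⟨⟩ (K.ι (K.p a + ∑ i, K.t i * u i)) = K.o a := by
      simp only [map_add, map_sum, map_mul, K.ν_t, zero_mul, Finset.sum_const_zero, add_zero]
      rw [← K.l_o, K.ν_l]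
    rw [e, map_add, add_mul, map_add, map_sum, Finset.sum_mul, map_sum]
    simp only [map_mul, mul_assoc, ht, Finset.sum_const_zero, add_zero]
    rw [← K.l_o, hF, hF]

lemma κ_deg {m : ℤ} {b : B.obj ⟨⟩} (hb : b ∈ B.gr ⟨⟩ m) (j : K.J) :
    K.κ b j ∈ R.gr ⟨⟩ (m - K.deg j) := by
  have : ∀ b, K.κ (hcomp (B.internal ⟨⟩) m b) j =
      hcomp (R.internal ⟨⟩) (m - K.deg j) (K.κ b j) := by
    intro b
    induction b using K.basis.induction with
    | zero => simp
    | add b b' h h' => simp only [map_add, Finsupp.add_apply, h, h']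
    | mul c k =>
      have h1 : K.ι c * (l.map ⟨⟩ (K.x k.1) * K.e k.2) ∈ B.gr ⟨⟩ (0 + (K.degX k.1 + K.deg k.2)) :=
        B.mul_mem _ (K.ι_mem c) (B.mul_mem _ (l.map_mem _ (K.x_mem _)) (K.e_mem _))
      have h2 : ν.map ⟨⟩ (K.ι c) * K.x k.1 ∈ R.gr ⟨⟩ (0 + K.degX k.1) :=
        R.mul_mem _ (ν.map_mem _ (K.ι_mem c)) (K.x_mem _)
      rw [κ_apply]
      by_cases hj : k.2 = j
      · subst hj
        rw [Finsupp.single_eq_same]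
        by_cases hm : 0 + (K.degX k.1 + K.deg k.2) = m
        · subst hm
          rw [hcomp_of_mem _ h1, κ_apply, Finsupp.single_eq_same]
          rw [show 0 + (K.degX k.1 + K.deg k.2) - K.deg k.2 = 0 + K.degX k.1 by ring,
            hcomp_of_mem _ h2]
        · rw [hcomp_of_ne _ hm h1, hcomp_of_ne _ (by omega) h2, map_zero, Finsupp.coe_zero,
            Pi.zero_apply]
      · rw [Finsupp.single_eq_of_ne (Ne.symm hj), map_zero]
        by_cases hm : 0 + (K.degX k.1 + K.deg k.2) = m
        · subst hm
          rw [hcomp_of_mem _ h1, κ_apply, Finsupp.single_eq_of_ne (Ne.symm hj)]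
        · rw [hcomp_of_ne _ hm h1, map_zero, Finsupp.coe_zero, Pi.zero_apply]
  rw [← hcomp_of_mem (B.internal ⟨⟩) hb, this]
  exact hcomp_mem _ _ _

/-- The coefficient of `e_k` has degree `deg j + 1 - deg k`, and `R` vanishes in positive degrees.
Thus modulo the `t_i`, `B` is semi-free over `R`, and constructions can proceed by descending degree
of the `e_j`. -/
lemma lt_deg {j k : K.J} (h : K.κ (B.d ⟨⟩ (K.e j)) k ≠ 0) : K.deg j < K.deg k := by
  by_contra hk
  refine h (K.pos_R (m := K.deg j + 1 - K.deg k) (by omega) ?_)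
  exact K.κ_deg (B.d_mem _ (K.e_mem j)) k

/-- The odd linear map with given values on the `e_j` that kills the multiples of the `t_i`. -/
def ext (η : K.J → B.obj ⟨⟩) : B.obj ⟨⟩ →+ B.obj ⟨⟩ :=
  (Finsupp.liftAddHom fun j => (AddMonoidHom.mulRight (η j)).comp
    ((l.map ⟨⟩).toAddMonoidHom.comp (R.eps ⟨⟩))).comp K.κ

lemma ext_apply (η : K.J → B.obj ⟨⟩) (b : B.obj ⟨⟩) :
    K.ext η b = (K.κ b).sum fun j a => l.map ⟨⟩ (R.eps ⟨⟩ a) * η j := rfl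

lemma ext_odd (η : K.J → B.obj ⟨⟩) : OddLinear l (K.ext η) := by
  intro a b
  rw [ext_apply, ext_apply, κ_l, Finsupp.sum_smul_index' (by simp), Finsupp.mul_sum]
  simp only [smul_eq_mul, R.eps_mul, map_mul, mul_assoc]

lemma ext_t (η : K.J → B.obj ⟨⟩) (i : K.I) (b : B.obj ⟨⟩) : K.ext η (K.ι (K.t i) * b) = 0 := by
  rw [ext_apply, κ_t, Finsupp.sum_zero_index]

lemma ext_e (η : K.J → B.obj ⟨⟩) (j : K.J) : K.ext η (K.e j) = η j := by
  rw [ext_apply, κ_e, Finsupp.sum_single_index (by simp), R.eps_apply (R.one_mem _), ksign_zero,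
    one_smul, map_one, one_mul]

/-- Only the values at indices occurring in `b` matter; together with `lt_deg`, changing `η` in
degree `-n` and below does not change `ext η` on `d e_j` for `e_j` of degree `-n`. -/
lemma ext_congr {η η' : K.J → B.obj ⟨⟩} {b : B.obj ⟨⟩} (h : ∀ j, K.κ b j ≠ 0 → η j = η' j) :
    K.ext η b = K.ext η' b := by
  rw [ext_apply, ext_apply]
  exact Finset.sum_congr rfl fun j hj => by
    change _ * η j = _ * η' j
    rw [h j (Finsupp.mem_support_iff.1 hj)]

lemma ν_ext {η : K.J → B.obj ⟨⟩} (hη : ∀ j, ν.map ⟨⟩ (η j) = 0) (b : B.obj ⟨⟩) :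
    ν.map ⟨⟩ (K.ext η b) = 0 := by
  rw [ext_apply, Finsupp.sum, map_sum]
  exact Finset.sum_eq_zero fun j _ => by rw [map_mul, hη, mul_zero]

lemma exists_primitive (K : KoszulData l ν) {b : B.obj ⟨⟩} (h : ν.map ⟨⟩ b = 0) (hd : B.d ⟨⟩ b = 0) :
    ∃ w, ν.map ⟨⟩ w = 0 ∧ B.d ⟨⟩ w = b := by
  obtain ⟨w, v, hw, hv⟩ := K.acyclic b 0 hd (h.trans (map_zero _).symm)
  -- The cone only gives `ν(w) = dv`; subtracting the boundary of `l(v)` moves `w` into the kernel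
  -- of `ν` without changing `dw`.
  refine ⟨w - B.d ⟨⟩ (l.map ⟨⟩ v), ?_, ?_⟩
  · rw [map_sub, ν.map_d, K.ν_l, show ν.map ⟨⟩ w = 0 + R.d ⟨⟩ v from hv, zero_add, sub_self]
  · rw [map_sub, B.d_d, sub_zero, hw]

/-- A linear chain map into the kernel of `ν` that kills the multiples of the `t_i` is
contractible. -/
lemma exists_nullhomotopy {F : B.obj ⟨⟩ →+ B.obj ⟨⟩}
    (hF : ∀ a b, F (l.map ⟨⟩ a * b) = l.map ⟨⟩ a * F b) (ht : ∀ i b, F (K.ι (K.t i) * b) = 0)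
    (hd : ∀ b, B.d ⟨⟩ (F b) = F (B.d ⟨⟩ b)) (hν : ∀ b, ν.map ⟨⟩ (F b) = 0) :
    ∃ η : K.J → B.obj ⟨⟩, (∀ j, ν.map ⟨⟩ (η j) = 0) ∧
      ∀ b, B.d ⟨⟩ (K.ext η b) + K.ext η (B.d ⟨⟩ b) = F b := by
  -- The commutator of `d` with `ext η` is linear and kills the multiples of the `t_i`, as does `F`,
  -- so the two need only be compared on the `e_j`.
  let E (η : K.J → B.obj ⟨⟩) : B.obj ⟨⟩ →+ B.obj ⟨⟩ :=
    (B.d ⟨⟩).comp (K.ext η) + (K.ext η).comp (B.d ⟨⟩)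
  have hE (η b) : E η b = B.d ⟨⟩ (K.ext η b) + K.ext η (B.d ⟨⟩ b) := rfl
  have hEl (η a b) : E η (l.map ⟨⟩ a * b) = l.map ⟨⟩ a * E η b := (K.ext_odd η).anticomm a b
  have hEt (η i b) : E η (K.ι (K.t i) * b) = 0 := by
    rw [hE, ext_t, d_ι_mul, ext_t, map_zero, add_zero]
  have hEF {η} {b} (h : ∀ j, K.κ b j ≠ 0 → E η (K.e j) = F (K.e j)) : E η b = F b := by
    rw [K.eq_sum (hEl η) (hEt η), K.eq_sum hF ht]
    exact Finset.sum_congr rfl fun j hj => by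
      change _ * E η (K.e j) = _ * F (K.e j)
      rw [h j (Finsupp.mem_support_iff.1 hj)]
  -- One stage of the induction: if `η` is correct on the `e_j` of degree greater than `-n`, it can
  -- be redefined in degree `-n` alone so as to be correct there too.
  have step (n : ℕ) (η : K.J → B.obj ⟨⟩) (h1 : ∀ j, ν.map ⟨⟩ (η j) = 0)
      (h2 : ∀ j, -K.deg j < n → E η (K.e j) = F (K.e j)) :
      ∃ η' : K.J → B.obj ⟨⟩, (∀ j, ν.map ⟨⟩ (η' j) = 0) ∧
        (∀ j, -K.deg j < (n + 1 : ℕ) → E η' (K.e j) = F (K.e j)) ∧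
        ∀ j, -K.deg j < n → η' j = η j := by
    have hz (j) (hj : -K.deg j = n) : ∃ w, ν.map ⟨⟩ w = 0 ∧
        B.d ⟨⟩ w = F (K.e j) - K.ext η (B.d ⟨⟩ (K.e j)) := by
      refine K.exists_primitive ?_ ?_
      · rw [map_sub, hν, K.ν_ext h1, sub_self]
      -- The equation `dw = F(e_j) - ext η (d e_j)` is solvable because its right side is a cocycle:
      -- `d e_j` involves only generators of higher degree, on which `E η` already equals `F`.
      · have := hEF (η := η) (b := B.d ⟨⟩ (K.e j)) fun k hk => h2 k (by
          have := K.lt_deg hk; omega)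
        rw [hE, B.d_d, map_zero, add_zero] at this
        rw [map_sub, this, hd, sub_self]
    choose w hw1 hw2 using hz
    classical
    let η' : K.J → B.obj ⟨⟩ := fun j => if hj : -K.deg j = n then w j hj else η j
    have hη' (j) (hj : -K.deg j < n) : η' j = η j := dif_neg hj.ne
    have hext (j) (hj : -K.deg j ≤ n) :
        K.ext η' (B.d ⟨⟩ (K.e j)) = K.ext η (B.d ⟨⟩ (K.e j)) :=
      K.ext_congr fun k hk => hη' k (by have := K.lt_deg hk; omega)
    refine ⟨η', ?_, ?_, hη'⟩
    · intro j
      by_cases hj : -K.deg j = n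
      · simp only [η', dif_pos hj]; exact hw1 j hj
      · simp only [η', dif_neg hj]; exact h1 j
    · intro j hj
      rw [hE, ext_e, hext j (by push_cast at hj; omega)]
      by_cases hj' : -K.deg j = n
      · simp only [η', dif_pos hj']; rw [hw2 j hj']; abel
      · rw [hη' j (by push_cast at hj; omega), ← K.ext_e η, ← hE, h2 j (by push_cast at hj; omega)]
  -- The choice is made total, so that the stages can be iterated before their hypotheses are
  -- verified.
  choose! next hn1 hn2 hn3 using step
  let seq (n : ℕ) : K.J → B.obj ⟨⟩ := Nat.rec 0 next n
  have hseq (n : ℕ) : (∀ j, ν.map ⟨⟩ (seq n j) = 0) ∧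
      ∀ j, -K.deg j < n → E (seq n) (K.e j) = F (K.e j) := by
    induction n with
    | zero =>
      refine ⟨fun j => map_zero _, fun j hj => ?_⟩
      have := K.deg_le j
      push_cast at hj; omega
    | succ n ih => exact ⟨hn1 n _ ih.1 ih.2, hn2 n _ ih.1 ih.2⟩
  have hstab (j : K.J) (n : ℕ) (hn : -K.deg j < n) (m : ℕ) : seq (n + m) j = seq n j := by
    induction m with
    | zero => rfl
    | succ m ih =>
      rw [← ih]
      exact hn3 (n + m) _ (hseq _).1 (hseq _).2 j (by push_cast; omega)
  -- The value at `j` is final from stage `-deg j + 1` on: stage `n` settles exactly the degrees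
  -- greater than `-n`.
  let η : K.J → B.obj ⟨⟩ := fun j => seq ((-K.deg j).toNat + 1) j
  have hη (j) (n : ℕ) (hn : -K.deg j < n) : η j = seq n j := by
    obtain ⟨m, hm⟩ := Nat.exists_eq_add_of_le (show (-K.deg j).toNat + 1 ≤ n by
      have := K.deg_le j; omega)
    rw [hm]
    exact (hstab j ((-K.deg j).toNat + 1) (by push_cast; omega) m).symm
  refine ⟨η, fun j => (hseq ((-K.deg j).toNat + 1)).1 j, fun b => hEF fun j _ => ?_⟩
  rw [← (hseq ((-K.deg j).toNat + 1)).2 j (by push_cast; omega), hE, hE, ext_e, ext_e]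
  congr 1
  exact K.ext_congr fun k hk => hη k ((-K.deg j).toNat + 1)
    (by have := K.lt_deg hk; push_cast; omega)

/-- The contraction of `B` onto `R`. -/
lemma exists_contraction (K : KoszulData l ν) : ∃ h : B.obj ⟨⟩ →+ B.obj ⟨⟩, OddLinear l h ∧
    (∀ b, B.d ⟨⟩ (h b) + h (B.d ⟨⟩ b) = b - l.map ⟨⟩ (ν.map ⟨⟩ b)) ∧
    ∀ b, ν.map ⟨⟩ (h b) = 0 := by
  obtain ⟨G, hG, h1, -⟩ := K.exists_projection Finset.univ
  let P : B.obj ⟨⟩ →+ B.obj ⟨⟩ := AddMonoidHom.id _ - ((B.d ⟨⟩).comp G + G.comp (B.d ⟨⟩))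
  have hP (b) : P b = b - (B.d ⟨⟩ (G b) + G (B.d ⟨⟩ b)) := rfl
  have hPd (b) : B.d ⟨⟩ (P b) = P (B.d ⟨⟩ b) := by
    simp only [hP, map_sub, map_add, B.d_d, map_zero]; abel
  have hPl (a b) : P (l.map ⟨⟩ a * b) = l.map ⟨⟩ a * P b := by
    rw [hP, hG.anticomm, hP]; noncomm_ring
  have hPt (i b) : P (K.ι (K.t i) * b) = 0 := by rw [hP, h1 i (Finset.mem_univ _), sub_self]
  -- `N = 1 - l ν` is the linear projection of `B` onto the kernel of `ν`, and commutes with `d`.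
  let N : B.obj ⟨⟩ →+ B.obj ⟨⟩ := AddMonoidHom.id _ -
    (l.map ⟨⟩).toAddMonoidHom.comp (ν.map ⟨⟩).toAddMonoidHom
  have hN (b) : N b = b - l.map ⟨⟩ (ν.map ⟨⟩ b) := rfl
  have hNd (b) : B.d ⟨⟩ (N b) = N (B.d ⟨⟩ b) := by
    simp only [hN, map_sub, ν.map_d, l.map_d]
  have hNl (a b) : N (l.map ⟨⟩ a * b) = l.map ⟨⟩ a * N b := by
    rw [hN, hN, map_mul, K.ν_l, map_mul, mul_sub]
  have hNν (b) : ν.map ⟨⟩ (N b) = 0 := by rw [hN, map_sub, K.ν_l, sub_self]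
  obtain ⟨η, hη, hH⟩ := K.exists_nullhomotopy (F := N.comp P)
    (fun a b => by simp only [AddMonoidHom.comp_apply, hPl, hNl])
    (fun i b => by simp only [AddMonoidHom.comp_apply, hPt, map_zero])
    (fun b => by simp only [AddMonoidHom.comp_apply, hPd, hNd])
    (fun b => hNν _)
  -- The commutator of `d` with this sum is `N P + N [d, G] = N`, as `P = 1 - [d, G]`.
  refine ⟨K.ext η + N.comp G, ?_, ?_, ?_⟩
  · intro a b
    simp only [AddMonoidHom.add_apply, AddMonoidHom.comp_apply]
    rw [K.ext_odd η, hG, hNl, mul_add]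
  · intro b
    simp only [AddMonoidHom.add_apply, AddMonoidHom.comp_apply, map_add, hNd]
    rw [add_add_add_comm, hH, AddMonoidHom.comp_apply, hP, ← map_add, ← map_add, sub_add_cancel, hN]
  · intro b
    simp only [AddMonoidHom.add_apply, AddMonoidHom.comp_apply, map_add, hNν, K.ν_ext hη, add_zero]

end KoszulData

end Koszul

/-! ### Tensoring with a free bimodule in degrees at most zero. -/

section FreeTensor

lemma DGMod.mul_smul' {T : Type} [Preorder T] {R : DGAlg T} (M : DGMod R) {t : T} (m : M.obj t)
    (a b : R.obj t) : m <• (a * b) = (m <• a) <• b := by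
  rw [MulOpposite.op_mul, mul_smul]

/-- A basis of a DG bimodule as a left module, in degrees `≤ 0`. -/
structure BiBasis {R : DGAlg PUnit} (L : BiMod R) where
  κ : Type
  e : κ → L.obj ⟨⟩
  deg : κ → ℤ
  deg_le : ∀ k, deg k ≤ 0
  e_mem : ∀ k, e k ∈ L.gr ⟨⟩ (deg k)
  repr : L.obj ⟨⟩ →+ (κ →₀ R.obj ⟨⟩)
  repr_smul : ∀ (a : R.obj ⟨⟩) x, repr (a • x) = a • repr x
  repr_e : ∀ k, repr (e k) = Finsupp.single k 1
  sum_repr : ∀ x, ((repr x).sum fun k a => a • e k) = x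

namespace BiBasis

variable {R : DGAlg PUnit} {L : BiMod R} (b : BiBasis L) (M : DGMod R)

@[elab_as_elim]
lemma ind {p : L.obj ⟨⟩ → Prop} (zero : p 0) (smul : ∀ (a : R.obj ⟨⟩) k, p (a • b.e k))
    (add : ∀ x y, p x → p y → p (x + y)) (x : L.obj ⟨⟩) : p x := by
  rw [← b.sum_repr x]
  exact Finset.sum_induction _ p (fun _ _ => add _ _) zero (fun k _ => smul _ _)

lemma repr_deg {m : ℤ} {x : L.obj ⟨⟩} (hx : x ∈ L.gr ⟨⟩ m) (j : b.κ) :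
    b.repr x j ∈ R.gr ⟨⟩ (m - b.deg j) := by
  have : ∀ x, b.repr (hcomp (L.internal ⟨⟩) m x) j =
      hcomp (R.internal ⟨⟩) (m - b.deg j) (b.repr x j) := by
    intro x
    induction x using b.ind with
    | zero => simp
    | add x y hx hy => simp only [map_add, Finsupp.add_apply, hx, hy]
    | smul a k =>
      refine gr_induction (R.internal ⟨⟩) (p := fun a => b.repr (hcomp (L.internal ⟨⟩) m
        (a • b.e k)) j = hcomp (R.internal ⟨⟩) (m - b.deg j) (b.repr (a • b.e k) j)) ?_ (by simp)
        (fun x y hx hy => by simp only [map_add, Finsupp.add_apply, hx, hy, add_smul]) a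
      intro i a ha
      have h1 := L.lsmul_mem ⟨⟩ ha (b.e_mem k)
      by_cases hm : i + b.deg k = m
      · subst hm
        rw [hcomp_of_mem _ h1, b.repr_smul, b.repr_e, Finsupp.smul_single, smul_eq_mul, mul_one]
        by_cases hj : k = j
        · subst hj
          rw [Finsupp.single_eq_same, hcomp_of_mem]
          simpa using ha
        · rw [Finsupp.single_eq_of_ne (Ne.symm hj), map_zero]
      · rw [hcomp_of_ne _ hm h1, b.repr_smul, b.repr_e, Finsupp.smul_single, smul_eq_mul, mul_one,
          map_zero, Finsupp.coe_zero, Pi.zero_apply]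
        by_cases hj : k = j
        · subst hj
          rw [Finsupp.single_eq_same, hcomp_of_ne _ _ ha]
          omega
        · rw [Finsupp.single_eq_of_ne (Ne.symm hj), map_zero]
  rw [← hcomp_of_mem (L.internal ⟨⟩) hx, this]
  exact hcomp_mem _ _ _

/-- The coordinates of a tensor with respect to a basis of the second factor. -/
def coord : (tensor M L).obj ⟨⟩ →+ (b.κ →₀ M.obj ⟨⟩) :=
  tensorLift M L ⟨⟩ ((AddMonoidHom.mk' (fun m => (Finsupp.mapRange.addMonoidHom (actHom M ⟨⟩ m)))
    (fun m m' => by ext; simp)).compl₂ b.repr) (fun m a x => by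
      ext k
      simp only [AddMonoidHom.compl₂_apply, AddMonoidHom.mk'_apply, b.repr_smul,
        Finsupp.mapRange.addMonoidHom_apply, Finsupp.mapRange_apply, Finsupp.smul_apply]
      change (m <• a) <• b.repr x k = m <• (a * b.repr x k)
      exact (M.mul_smul' m a _).symm)

lemma coord_mk (m : M.obj ⟨⟩) (x : L.obj ⟨⟩) (k : b.κ) :
    b.coord M (tensorMk M L ⟨⟩ m x) k = m <• b.repr x k := rfl

lemma coord_mk_e (m : M.obj ⟨⟩) (k : b.κ) :
    b.coord M (tensorMk M L ⟨⟩ m (b.e k)) = Finsupp.single k m := by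
  classical
  ext j
  rw [coord_mk, b.repr_e, Finsupp.single_apply, Finsupp.single_apply]
  split_ifs
  · exact M.smul_one' m
  · rw [MulOpposite.op_zero, zero_smul]

lemma sum_coord (x : (tensor M L).obj ⟨⟩) :
    ((b.coord M x).sum fun k m => tensorMk M L ⟨⟩ m (b.e k)) = x := by
  induction x using tensor_induction with
  | zero => simp
  | add x y hx hy =>
    rw [map_add, Finsupp.sum_add_index' (by simp) (by simp), hx, hy]
  | mk m x =>
    induction x using b.ind with
    | zero => simp
    | add x y hx hy =>
      rw [map_add, map_add, Finsupp.sum_add_index' (by simp) (by simp), hx, hy]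
    | smul a k =>
      rw [← tensorMk_smul_left, coord_mk_e, Finsupp.sum_single_index (by simp)]

lemma coord_injective {x y : (tensor M L).obj ⟨⟩} (h : ∀ k, b.coord M x k = b.coord M y k) :
    x = y := by
  rw [← b.sum_coord M x, ← b.sum_coord M y, Finsupp.ext h]

lemma coord_map {N : DGMod R} (f : M ⟶ N) (x : (tensor M L).obj ⟨⟩) (k : b.κ) :
    b.coord N ((tensorMapLeft f L).map ⟨⟩ x) k = f.map ⟨⟩ (b.coord M x k) := by
  induction x using tensor_induction with
  | zero => simp
  | add x y hx hy => simp only [map_add, Finsupp.add_apply, hx, hy]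
  | mk m x =>
    rw [coord_mk, f.map_smul]
    rfl

/-- An `e_j` contributes to the coefficient of `e_k` in the differential, apart from `j = k`, only
if `deg j < deg k`. If those coordinates vanish, the coordinate at `k` behaves like a cochain of
`M`: this is the filtration by the degree of the basis elements. -/
lemma coord_d (hR : ∀ m : ℤ, 0 < m → ∀ a ∈ R.gr ⟨⟩ m, a = 0) {x : (tensor M L).obj ⟨⟩} {k : b.κ}
    (h : ∀ j, b.deg j < b.deg k → b.coord M x j = 0) :
    b.coord M ((tensor M L).d ⟨⟩ x) k = M.d ⟨⟩ (b.coord M x k) := by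
  classical
  conv_lhs => rw [← b.sum_coord M x]
  rw [Finsupp.sum, map_sum, map_sum, Finset.sum_apply']
  have e : ∀ j ∈ (b.coord M x).support, b.coord M ((tensor M L).d ⟨⟩
      (tensorMk M L ⟨⟩ (b.coord M x j) (b.e j))) k =
      Finsupp.single j (M.d ⟨⟩ (b.coord M x j)) k := by
    intro j hj
    rw [tensor_d_mk, map_add, coord_mk_e, Finsupp.add_apply, coord_mk]
    have : b.repr (L.d ⟨⟩ (b.e j)) k = 0 := by
      refine hR (b.deg j + 1 - b.deg k) ?_ _ (b.repr_deg (L.d_mem ⟨⟩ (b.e_mem j)) k)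
      by_contra hlt
      exact Finsupp.mem_support_iff.1 hj (h j (by omega))
    rw [this, MulOpposite.op_zero, zero_smul, add_zero]
  rw [Finset.sum_congr rfl e]
  simp only [Finsupp.single_apply]
  rw [Finset.sum_ite_eq']
  split_ifs with hk
  · rfl
  · rw [Finsupp.notMem_support_iff.1 hk, map_zero]

/-- Tensoring with a free bimodule preserves acyclicity of the cone. -/
lemma coneAcyclic_tensorMapLeft (b : BiBasis L) (hR : ∀ m : ℤ, 0 < m → ∀ a ∈ R.gr ⟨⟩ m, a = 0)
    {M N : DGMod R}
    {f : M ⟶ N} (hf : ConeAcyclic (M.d ⟨⟩) (N.d ⟨⟩) (f.map ⟨⟩)) :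
    ConeAcyclic ((tensor M L).d ⟨⟩) ((tensor N L).d ⟨⟩) ((tensorMapLeft f L).map ⟨⟩) := by
  classical
  set F := (tensorMapLeft f L).map ⟨⟩
  -- Induction on the length of the filtration: all coordinates lie at basis elements of degree
  -- greater than `-n`. For `n = 0` there are none.
  have main : ∀ (n : ℕ) (z : (tensor M L).obj ⟨⟩) (y : (tensor N L).obj ⟨⟩),
      (∀ k, b.deg k ≤ -n → b.coord M z k = 0 ∧ b.coord N y k = 0) → (tensor M L).d ⟨⟩ z = 0 →
      F z = (tensor N L).d ⟨⟩ y →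
      ∃ w v, (tensor M L).d ⟨⟩ w = z ∧ F w = y + (tensor N L).d ⟨⟩ v := by
    intro n
    induction n with
    | zero =>
      intro z y h _ _
      have hz : z = 0 := b.coord_injective M fun k => by
        rw [(h k (by have := b.deg_le k; simpa using this)).1]; simp
      have hy : y = 0 := b.coord_injective N fun k => by
        rw [(h k (by have := b.deg_le k; simpa using this)).2]; simp
      exact ⟨0, 0, by rw [hz, map_zero], by rw [hy, map_zero, map_zero, add_zero]⟩
    | succ n ih =>
      intro z y h hz hy
      -- The lowest coordinates form cocycles of the cone of `f`, one for each basis element of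
      -- degree `-n`.
      have low : ∀ k, b.deg k = -n → ∃ w v, M.d ⟨⟩ w = b.coord M z k ∧
          f.map ⟨⟩ w = b.coord N y k + N.d ⟨⟩ v := by
        intro k hk
        refine hf _ _ ?_ ?_
        · rw [← b.coord_d M hR (fun j hj => (h j (by push_cast; omega)).1), hz]; simp
        · rw [← b.coord_d N hR (fun j hj => (h j (by push_cast; omega)).2), ← hy, b.coord_map]
      choose w v hw hv using low
      let s := ((b.coord M z).support ∪ (b.coord N y).support).filter fun k => b.deg k = -n
      let w' : b.κ → M.obj ⟨⟩ := fun k => if hk : b.deg k = -n then w k hk else 0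
      let v' : b.κ → N.obj ⟨⟩ := fun k => if hk : b.deg k = -n then v k hk else 0
      let W := ∑ k ∈ s, tensorMk M L ⟨⟩ (w' k) (b.e k)
      let V := ∑ k ∈ s, tensorMk N L ⟨⟩ (v' k) (b.e k)
      have cW (k) : b.coord M W k = if k ∈ s then w' k else 0 := by
        simp only [W, map_sum, Finset.sum_apply', coord_mk_e, Finsupp.single_apply,
          Finset.sum_ite_eq']
      have cV (k) : b.coord N V k = if k ∈ s then v' k else 0 := by
        simp only [V, map_sum, Finset.sum_apply', coord_mk_e, Finsupp.single_apply,
          Finset.sum_ite_eq']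
      have hs (k) (hk : b.deg k ≠ -n) : k ∉ s := fun hks => hk (Finset.mem_filter.1 hks).2
      -- Subtracting the coboundary given by the primitives `W`, `V` of the lowest coordinates
      -- removes degree `-n` and leaves a cocycle of the cone with a shorter filtration.
      obtain ⟨w₁, v₁, e1, e2⟩ := ih (z - (tensor M L).d ⟨⟩ W) (y + (tensor N L).d ⟨⟩ V - F W)
        (fun k hk => by
          have eM := b.coord_d M hR (x := W) (k := k) fun j hj => by
            rw [cW, if_neg (hs j (by omega))]
          have eN := b.coord_d N hR (x := V) (k := k) fun j hj => by
            rw [cV, if_neg (hs j (by omega))]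
          simp only [map_sub, map_add, Finsupp.sub_apply, Finsupp.add_apply, eM, eN]
          rw [b.coord_map, cW, cV]
          by_cases hkn : b.deg k = -n
          · by_cases hks : k ∈ s
            · rw [if_pos hks, if_pos hks]
              simp only [w', v', dif_pos hkn, hw, hv, sub_self, and_self]
            · have h0 : b.coord M z k = 0 ∧ b.coord N y k = 0 := by
                simp only [s, Finset.mem_filter, hkn, and_true, Finset.mem_union,
                  Finsupp.mem_support_iff, not_or, not_not] at hks
                exact hks
              rw [if_neg hks, if_neg hks, h0.1, h0.2]; simp
          · rw [if_neg (hs k hkn), if_neg (hs k hkn), (h k (by push_cast; omega)).1,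
              (h k (by push_cast; omega)).2]
            simp)
        (by rw [map_sub, hz, (tensor M L).d_d, sub_self])
        (by
          rw [map_sub, hy, map_sub, map_add, (tensor N L).d_d, add_zero]
          exact congrArg _ ((tensorMapLeft f L).map_d ⟨⟩ W))
      refine ⟨W + w₁, V + v₁, by rw [map_add, e1]; abel, ?_⟩
      rw [map_add, e2, map_add]; abel
  intro z y hz hy
  -- The supports are finite, so the degrees that occur are bounded below.
  obtain ⟨n, hn⟩ : ∃ n : ℕ, ∀ k ∈ (b.coord M z).support ∪ (b.coord N y).support,
      -(n : ℤ) < b.deg k := by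
    refine ⟨((b.coord M z).support ∪ (b.coord N y).support).sup (fun k => (-b.deg k).toNat) + 1, ?_⟩
    intro k hk
    have : (-b.deg k).toNat ≤ _ := Finset.le_sup (f := fun k => (-b.deg k).toNat) hk
    omega
  refine main n z y (fun k hk => ?_) hz hy
  have : k ∉ (b.coord M z).support ∪ (b.coord N y).support := fun h => by
    have := hn k h; omega
  rw [Finset.mem_union, not_or, Finsupp.notMem_support_iff, Finsupp.notMem_support_iff] at this
  exact this

end BiBasis

end FreeTensor

/-! ### Acyclicity criteria for stalks of tensor products. -/

section StalkCriteria

variable {T : Type} [Preorder T] {σ : DirSys T} {R : DGAlg T}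

/-- Acyclicity of the cone of a map out of a tensor product can be tested on the tensor product of
the stalks. -/
lemma coneAcyclic_stalk_of_tensor {M N : DGMod R} {L : BiMod R} {f : tensor M L ⟶ N}
    {f' : (tensor (M.stalk σ) (L.stalk σ)).obj ⟨⟩ →+ (N.stalk σ).obj ⟨⟩}
    (h : ConeAcyclic ((tensor (M.stalk σ) (L.stalk σ)).d ⟨⟩) ((N.stalk σ).d ⟨⟩) f')
    (hf : ∀ x, f' (stalkTensorTo L M σ x) = (DGMod.stalkHom f σ).map ⟨⟩ x) :
    ConeAcyclic (((tensor M L).stalk σ).d ⟨⟩) ((N.stalk σ).d ⟨⟩) ((DGMod.stalkHom f σ).map ⟨⟩) := by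
  intro z y hz hy
  obtain ⟨w, v, hw, hv⟩ := h (stalkTensorTo L M σ z) y
    ((stalkTensorTo_d L M z).symm.trans ((congrArg _ hz).trans (map_zero _))) ((hf z).trans hy)
  obtain ⟨w, rfl⟩ : ∃ w', stalkTensorTo L M σ w' = w := ⟨_, stalkTensorTo_from L M w⟩
  refine ⟨w, v, ?_, (hf w).symm.trans hv⟩
  have := (stalkTensorTo_d L M w).trans hw
  exact (stalkTensorFrom_to L M _).symm.trans
    ((congrArg (stalkTensorFrom L M σ) this).trans (stalkTensorFrom_to L M _))

/-- Tensoring with a bimodule with free stalk preserves acyclicity of the cone. -/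
lemma coneAcyclic_stalk_tensorMapLeft {M N : DGMod R} {L : BiMod R} {f : M ⟶ N}
    (b : BiBasis (L.stalk σ)) (hR : ∀ m : ℤ, 0 < m → ∀ a ∈ (R.stalk σ).gr ⟨⟩ m, a = 0)
    (hf : ConeAcyclic ((M.stalk σ).d ⟨⟩) ((N.stalk σ).d ⟨⟩) ((DGMod.stalkHom f σ).map ⟨⟩)) :
    ConeAcyclic (((tensor M L).stalk σ).d ⟨⟩) (((tensor N L).stalk σ).d ⟨⟩)
      ((DGMod.stalkHom (tensorMapLeft f L) σ).map ⟨⟩) := by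
  have hmap : ∀ x, stalkTensorTo L N σ ((DGMod.stalkHom (tensorMapLeft f L) σ).map ⟨⟩ x) =
      (tensorMapLeft (DGMod.stalkHom f σ) (L.stalk σ)).map ⟨⟩ (stalkTensorTo L M σ x) := by
    intro x
    induction x using DGMod.germ_induction with
    | h i x =>
      refine DFunLike.congr_fun (tensor_addHom_ext
        (f := (stalkTensorTo L N σ).comp (((tensor N L).germ σ i).comp
          ((tensorMapLeft f L).map _)))
        (g := ((tensorMapLeft (DGMod.stalkHom f σ) (L.stalk σ)).map ⟨⟩).comp
          ((stalkTensorTo L M σ).comp ((tensor M L).germ σ i))) fun m l => ?_) x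
      rfl
  intro z y hz hy
  obtain ⟨w, v, hw, hv⟩ := b.coneAcyclic_tensorMapLeft hR hf (stalkTensorTo L M σ z)
    (stalkTensorTo L N σ y)
    ((stalkTensorTo_d L M z).symm.trans ((congrArg _ hz).trans (map_zero _)))
    ((hmap z).symm.trans ((congrArg _ hy).trans (stalkTensorTo_d L N y)))
  obtain ⟨w, rfl⟩ : ∃ w', stalkTensorTo L M σ w' = w := ⟨_, stalkTensorTo_from L M w⟩
  obtain ⟨v, rfl⟩ : ∃ v', stalkTensorTo L N σ v' = v := ⟨_, stalkTensorTo_from L N v⟩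
  refine ⟨w, v, ?_, ?_⟩
  · have := (stalkTensorTo_d L M w).trans hw
    exact (stalkTensorFrom_to L M _).symm.trans
      ((congrArg (stalkTensorFrom L M σ) this).trans (stalkTensorFrom_to L M _))
  · have := (hmap w).trans (hv.trans ((congrArg _ (stalkTensorTo_d L N v).symm).trans
      (map_add (stalkTensorTo L N σ) _ _).symm))
    exact (stalkTensorFrom_to L N _).symm.trans
      ((congrArg (stalkTensorFrom L N σ) this).trans (stalkTensorFrom_to L N _))

end StalkCriteria

/-! ### The statements on the derived category, given the structure of the stalks. -/

section Main

variable {A : Type} [PartialOrder A] {𝒲 : SmoothSystem A} {ℛ : FreeAlg 𝒲} {𝒮 : Enveloping ℛ}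
  (ℬ : FreeResolution 𝒮) (M : DGMod ℛ.R)

/-- On each stalk the Koszul data yield a contraction of `B` that is linear over `R ⊗ 1`. It extends
to `M ⊗ B` for every `M`, with no flatness or finiteness of `M`. -/
lemma FreeResolution.isQuasiIso_idTensorNu
    (hK : ∀ (t : Site 𝒲) (x : 𝒲.W.obj (op t.idx)) (hx : x ∈ t.opn),
      Nonempty (KoszulData (DGAlg.stalkHom ℬ.l (nb t x hx)) (DGAlg.stalkHom ℬ.ν (nb t x hx)))) :
    IsQuasiIso (ℬ.idTensorNu M) := by
  rw [isQuasiIso_iff_stalkAcyclic]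
  intro t x hx
  set σ := nb t x hx
  obtain ⟨K⟩ := hK t x hx
  obtain ⟨h, h1, h2, h3⟩ := K.exists_contraction
  let L := (ℬ.l.bimod ℬ.r)
  let ν' := DGAlg.stalkHom ℬ.ν σ
  have d_one : (L.stalk σ).d ⟨⟩ (1 : (ℬ.B.stalk σ).obj ⟨⟩) = 0 :=
    DGAlg.d_one (B := ℬ.B.stalk σ)
  -- The left action on the stalk of the bimodule `B` is a direct limit of actions, while the
  -- contraction is linear for products in the stalk of the ring `B`; the two agree on germs.
  have hsmul (a : (ℛ.R.stalk σ).obj ⟨⟩) (b : (L.stalk σ).obj ⟨⟩) :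
      a • b = HMul.hMul (α := (ℬ.B.stalk σ).obj ⟨⟩) (β := (ℬ.B.stalk σ).obj ⟨⟩)
        ((DGAlg.stalkHom ℬ.l σ).map ⟨⟩ a) b := by
    have key (p : σ.ι) (a : ℛ.R.obj (σ.site p)) (b : L.obj (σ.site p)) :
        ℛ.R.germ σ p a • L.germ σ p b =
          HMul.hMul (α := ℬ.B.StalkObj σ) (β := ℬ.B.StalkObj σ)
            (ℬ.B.germ σ p (ℬ.l.map _ a)) (ℬ.B.germ σ p b) :=
      (BiMod.germ_lsmul p a b).trans (map_mul (ℬ.B.germ σ p) _ _)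
    induction b using DGMod.germ_induction with
    | h i b =>
      induction a using DGAlg.germ_induction with
      | h j a =>
        obtain ⟨k, hi, hj⟩ := exists_ge_ge i j
        rw [← DGMod.germ_res hi b, ← DGAlg.germ_res hj a]
        exact key k _ _
  refine coneAcyclic_stalk_of_tensor (M := M) (L := L)
    (f' := ((DGMod.stalkHom (ℬ.idTensorNu M) σ).map ⟨⟩).comp (stalkTensorFrom L M σ))
    (coneAcyclic_of_contraction (L := L.stalk σ) (M.stalk σ) (u := (1 : (ℬ.B.stalk σ).obj ⟨⟩))
      (n := (ν'.map ⟨⟩).toAddMonoidHom) (h := h) ?_ d_one (map_one (ν'.map ⟨⟩)) ?_ ?_ h3)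
    (fun x => congrArg ((DGMod.stalkHom (ℬ.idTensorNu M) σ).map ⟨⟩) (stalkTensorFrom_to L M x))
  · intro m b
    have key (p : σ.ι) (m : M.obj (σ.site p)) (b : ℬ.B.obj (σ.site p)) :
        M.germ σ p (m <• ℬ.ν.map _ b) = M.germ σ p m <• ℛ.R.germ σ p (ℬ.ν.map _ b) :=
      (DGMod.germ_smul _ _ _).symm
    induction m, b using DGMod.germ_induction₂ with
    | h i m b =>
      have e : stalkTensorFrom L M σ (tensorMk (M.stalk σ) (L.stalk σ) ⟨⟩ (M.germ σ i m)
          (L.germ σ i b)) = (tensor M L).germ σ i (tensorMk M L _ m b) :=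
        stalkTensorPairing_germ L M i m b
      exact (congrArg ((DGMod.stalkHom (ℬ.idTensorNu M) σ).map ⟨⟩) e).trans (key i m b)
  · intro a b
    have e1 := hsmul a b
    have e2 := hsmul ((ℛ.R.stalk σ).eps ⟨⟩ a) (h b)
    exact (congrArg h e1).trans ((h1 a b).trans e2.symm)
  · intro b
    refine (h2 b).trans ?_
    have e := hsmul (ν'.map ⟨⟩ b) (1 : (ℬ.B.stalk σ).obj ⟨⟩)
    have e' : HMul.hMul (α := (ℬ.B.stalk σ).obj ⟨⟩) (β := (ℬ.B.stalk σ).obj ⟨⟩)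
        ((DGAlg.stalkHom ℬ.l σ).map ⟨⟩ (ν'.map ⟨⟩ b)) 1 =
          (DGAlg.stalkHom ℬ.l σ).map ⟨⟩ (ν'.map ⟨⟩ b) := mul_one (M := (ℬ.B.stalk σ).obj ⟨⟩) _
    exact congrArg (fun y : (L.stalk σ).obj ⟨⟩ => (show (L.stalk σ).obj ⟨⟩ from b) - y)
      (e.trans e').symm

/-- The degree of a monomial. -/
def Generators.degree {B : DGAlg (Site 𝒲)} (gens : Generators B) {t : Site 𝒲} (l : gens.Mon t) : ℤ :=
  (l.1.map fun g => gens.deg g.1).sum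

lemma Generators.degree_nonpos {B : DGAlg (Site 𝒲)} (gens : Generators B) {t : Site 𝒲}
    (l : gens.Mon t) : gens.degree l ≤ 0 := by
  obtain ⟨l, hl⟩ := l
  change (l.map _).sum ≤ 0
  clear hl
  induction l with
  | nil => exact le_rfl
  | cons g l ih =>
    simp only [List.map_cons, List.sum_cons]
    have := gens.deg_neg g.1
    omega

lemma Generators.val_mem {B : DGAlg (Site 𝒲)} (gens : Generators B) {t : Site 𝒲} (l : gens.Mon t) :
    gens.val t l ∈ B.gr t (gens.degree l) := by
  obtain ⟨l, hl⟩ := l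
  change (l.map _).prod ∈ B.gr t (l.map _).sum
  clear hl
  induction l with
  | nil => exact B.one_mem t
  | cons g l ih =>
    simp only [List.map_cons, List.prod_cons, List.sum_cons]
    exact B.mul_mem t (gens.mem _ _ _) ih

lemma FreeAlg.stalk_pos (ℛ : FreeAlg 𝒲) (σ : DirSys (Site 𝒲)) (m : ℤ) (hm : 0 < m)
    (a : (ℛ.R.stalk σ).obj ⟨⟩) (ha : a ∈ (ℛ.R.stalk σ).gr ⟨⟩ m) : a = 0 := by
  obtain ⟨i, a, ha, rfl⟩ := ha
  rw [DGAlg.eq_zero_of_pos (ℛ.o_mem _) (ℛ.free _) ℛ.gens.degree_nonpos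
    ℛ.gens.val_mem hm ha]
  exact map_zero _

/-- The map factors as associativity followed by `(id ⊗ ν) ⊗ Ω`. The first is bijective on sections;
the second is a quasi-isomorphism because the stalks of `Ω` are free in degrees `≤ 0`. -/
lemma FreeResolution.isIso_idTensorNuTensor (hN : IsQuasiIso (ℬ.idTensorNu M))
    (hΩ : ∀ (t : Site 𝒲) (x : 𝒲.W.obj (op t.idx)) (hx : x ∈ t.opn),
      Nonempty (BiBasis (𝒮.Ω.stalk (nb t x hx)))) :
    IsIso ((Q ℛ.R).map (shiftMap (ℬ.idTensorNuTensor M))) := by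
  have h1 : IsQuasiIso (tensorMapLeft (ℬ.idTensorNu M) 𝒮.Ω) := by
    rw [isQuasiIso_iff_stalkAcyclic] at hN ⊢
    intro t x hx
    obtain ⟨b⟩ := hΩ t x hx
    exact coneAcyclic_stalk_tensorMapLeft b (ℛ.stalk_pos _) (hN t x hx)
  have h2 := isQuasiIso_of_bijective (tensorAssoc M (ℬ.l.bimod ℬ.r) 𝒮.Ω)
    (tensorAssoc_bijective M (ℬ.l.bimod ℬ.r) 𝒮.Ω)
  have e : shiftMap (ℬ.idTensorNuTensor M) = shiftMap (tensorAssoc M (ℬ.l.bimod ℬ.r) 𝒮.Ω) ≫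
      shiftMap (tensorMapLeft (ℬ.idTensorNu M) 𝒮.Ω) := by
    rw [FreeResolution.idTensorNuTensor, idTensorAugTensor_eq]; rfl
  have := isIso_Q_map h1.shift
  have := isIso_Q_map h2.shift
  rw [e, Functor.map_comp]
  infer_instance

/-- An Atiyah class of `M` is defined through some `φ : P ⟶ M` with a connection on `P`. The
identity holds for `P` by the homotopy, and precomposing with the isomorphism `φ ⊗ B` of `D(R)`
transports it to `M`. -/
lemma FreeResolution.idTensor_comp (nablaB : ℬ.UnivConn)
    (hN : ∀ M : DGMod ℛ.R, IsQuasiIso (ℬ.idTensorNu M))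
    (α : (Q ℛ.R).obj M ⟶ (Q ℛ.R).obj (tensor M 𝒮.Ω).shift) (hα : IsAtiyahClass 𝒮.δ M α) :
    (Q ℛ.R).map (ℬ.idTensorNu M) ≫ α =
      (Q ℛ.R).map (nablaB.idTensor M) ≫ (Q ℛ.R).map (shiftMap (ℬ.idTensorNuTensor M)) := by
  obtain ⟨P, φ, hφ, c, e⟩ := hα
  have i1 := isIso_Q_map hφ
  have i2 := isIso_Q_map (hN M)
  have i3 := isIso_Q_map (hN P)
  have n1 : (Q ℛ.R).map (tensorMapLeft φ (ℬ.l.bimod ℬ.r)) ≫ (Q ℛ.R).map (ℬ.idTensorNu M) =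
      (Q ℛ.R).map (ℬ.idTensorNu P) ≫ (Q ℛ.R).map φ := by
    rw [← Functor.map_comp, ← Functor.map_comp]
    exact congrArg _ (idTensorAug_naturality ..)
  -- Two out of three in the naturality square of `id ⊗ ν`; flatness of `B` is not needed.
  have i4 : IsIso ((Q ℛ.R).map (tensorMapLeft φ (ℬ.l.bimod ℬ.r))) := by
    have : IsIso ((Q ℛ.R).map (tensorMapLeft φ (ℬ.l.bimod ℬ.r)) ≫
      (Q ℛ.R).map (ℬ.idTensorNu M)) := by rw [n1]; infer_instance
    exact IsIso.of_isIso_comp_right _ ((Q ℛ.R).map (ℬ.idTensorNu M))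
  rw [← cancel_epi ((Q ℛ.R).map (tensorMapLeft φ (ℬ.l.bimod ℬ.r))), ← Category.assoc, n1,
    Category.assoc, e]
  have n2 : tensorMapLeft φ (ℬ.l.bimod ℬ.r) ≫ nablaB.idTensor M ≫
      shiftMap (ℬ.idTensorNuTensor M) = (nablaB.idTensor P ≫ shiftMap (ℬ.idTensorNuTensor P)) ≫
        shiftMap (tensorMapLeft φ 𝒮.Ω) := by
    rw [← Category.assoc, UniversalConnection.idTensor_naturality, Category.assoc, Category.assoc]
    congr 1
    exact congrArg shiftMap (idTensorAugTensor_naturality ℬ.ν ℬ.ν_l ℬ.ν_r φ)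
  have n3 := (atiyahHomotopy nablaB ℬ.ν ℬ.ν_l ℬ.ν_r c).Q_map_eq
  rw [← Functor.map_comp, ← Functor.map_comp, ← Functor.map_comp,
    ← Functor.map_comp, n2, Functor.map_comp _ (_ ≫ _), ← n3, ← Functor.map_comp, Category.assoc]

end Main

/-! ### Holomorphic dependence of integrals on parameters. -/

section ParametricIntegral

open scoped ContDiff

variable {E F : Type} [NormedAddCommGroup E] [NormedAddCommGroup F] {W : Set (ℂ × E)} {V : Set E}

/-- A continuous function is bounded on the compact segment over `x₀`, and the tube lemma extends
the bound, enlarged by one, to all nearby `x`. This provides the dominating constants for continuity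
and differentiation under the integral. -/
lemma exists_bound_segment (hW : IsOpen W) {G : ℂ × E → F} (hG : ContinuousOn G W) {x₀ : E}
    (h : ∀ θ : ℝ, θ ∈ Set.uIcc (0 : ℝ) 1 → ((θ : ℂ), x₀) ∈ W) :
    ∃ C : ℝ, ∃ s ∈ nhds x₀, ∀ x ∈ s, ∀ θ : ℝ, θ ∈ Set.uIcc (0 : ℝ) 1 → ‖G (θ, x)‖ ≤ C := by
  let S : Set ℂ := (fun θ : ℝ => (θ : ℂ)) '' Set.uIcc (0 : ℝ) 1
  have hS : IsCompact S := isCompact_uIcc.image Complex.continuous_ofReal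
  have hSW : S ×ˢ {x₀} ⊆ W := by
    rintro ⟨_, x⟩ ⟨⟨θ, hθ, rfl⟩, hx⟩
    obtain rfl : x = x₀ := hx
    exact h θ hθ
  obtain ⟨C, hC⟩ := (hS.prod isCompact_singleton).exists_bound_of_continuousOn (hG.mono hSW)
  have ho : IsOpen (W ∩ G ⁻¹' Metric.ball 0 (C + 1)) := hG.isOpen_inter_preimage hW Metric.isOpen_ball
  obtain ⟨u, s, -, hs, hu, hxs, hus⟩ := generalized_tube_lemma hS (isCompact_singleton (x := x₀)) ho
    (fun p hp => ⟨hSW hp, by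
      rw [Set.mem_preimage, mem_ball_zero_iff]; linarith [hC p hp]⟩)
  refine ⟨C + 1, s, hs.mem_nhds (hxs rfl), fun x hx θ hθ => ?_⟩
  have := (hus (Set.mk_mem_prod (hu ⟨θ, hθ, rfl⟩) hx)).2
  exact (mem_ball_zero_iff.1 this).le

lemma continuousOn_segment {G : ℂ × E → F} (hG : ContinuousOn G W) {x : E}
    (h : ∀ θ : ℝ, θ ∈ Set.uIcc (0 : ℝ) 1 → ((θ : ℂ), x) ∈ W) :
    ContinuousOn (fun θ : ℝ => G (θ, x)) (Set.uIcc 0 1) :=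
  hG.comp (Continuous.continuousOn (by fun_prop)) (fun θ hθ => h θ hθ)

lemma aestronglyMeasurable_segment {G : ℂ × E → F} (hG : ContinuousOn G W) {x : E}
    (h : ∀ θ : ℝ, θ ∈ Set.uIcc (0 : ℝ) 1 → ((θ : ℂ), x) ∈ W) :
    MeasureTheory.AEStronglyMeasurable (fun θ : ℝ => G (θ, x))
      (MeasureTheory.volume.restrict (Set.uIoc 0 1)) :=
  (continuousOn_segment hG h).aestronglyMeasurable_of_subset_isCompact
    isCompact_uIcc measurableSet_uIoc Set.uIoc_subset_uIcc

variable [NormedSpace ℂ E] [NormedSpace ℂ F]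

/-- A parametric integral over a segment of a function that is `n` times complex differentiable is
`n` times complex differentiable. -/
lemma contDiffOn_integral_segment (hW : IsOpen W) (hV : IsOpen V)
    (h : ∀ θ : ℝ, θ ∈ Set.uIcc (0 : ℝ) 1 → ∀ x ∈ V, ((θ : ℂ), x) ∈ W) (n : ℕ)
    {G : ℂ × E → F} (hG : ContDiffOn ℂ n G W) :
    ContDiffOn ℂ n (fun x => ∫ θ in (0 : ℝ)..1, G (θ, x)) V := by
  induction n generalizing F with
  | zero =>
    have hc := hG.continuousOn
    refine contDiffOn_zero.2 fun x₀ hx₀ => ContinuousAt.continuousWithinAt ?_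
    obtain ⟨C, s, hs, hC⟩ := exists_bound_segment hW hc (fun θ hθ => h θ hθ x₀ hx₀)
    refine intervalIntegral.continuousAt_of_dominated_interval (bound := fun _ => C) ?_ ?_
      (by simp) ?_
    · filter_upwards [hV.mem_nhds hx₀] with x hx
      exact aestronglyMeasurable_segment hc (fun θ hθ => h θ hθ x hx)
    · filter_upwards [hs] with x hx
      exact Filter.Eventually.of_forall fun θ hθ => hC x hx θ (Set.uIoc_subset_uIcc hθ)
    · refine Filter.Eventually.of_forall fun θ hθ => ?_
      exact (hc.continuousAt (hW.mem_nhds (h θ (Set.uIoc_subset_uIcc hθ) x₀ hx₀))).comp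
        (f := fun x : E => ((θ : ℂ), x)) (by fun_prop)
  | succ n ih =>
    have hc := hG.continuousOn
    -- The partial derivative in the parameter: the derivative of the integral is the integral of
    -- `G'`, to which the induction hypothesis applies with one derivative fewer.
    let G' : ℂ × E → (E →L[ℂ] F) := fun p => (fderiv ℂ G p).comp (ContinuousLinearMap.inr ℂ ℂ E)
    have hG' : ContDiffOn ℂ n G' W := by
      have := hG.fderiv_of_isOpen (m := n) hW (by push_cast; exact le_rfl)
      exact this.clm_comp contDiffOn_const
    have hd : ∀ x₀ ∈ V, HasFDerivAt (fun x => ∫ θ in (0 : ℝ)..1, G (θ, x))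
        (∫ θ in (0 : ℝ)..1, G' (θ, x₀)) x₀ := by
      intro x₀ hx₀
      obtain ⟨C, s, hs, hC⟩ := exists_bound_segment hW hG'.continuousOn (fun θ hθ => h θ hθ x₀ hx₀)
      refine intervalIntegral.hasFDerivAt_integral_of_dominated_of_fderiv_le
        (s := s ∩ V) (bound := fun _ => C) (F' := fun x θ => G' (θ, x))
        (Filter.inter_mem hs (hV.mem_nhds hx₀)) ?_ ?_ ?_ ?_ (by simp) ?_
      · filter_upwards [hV.mem_nhds hx₀] with x hx
        exact aestronglyMeasurable_segment hc (fun θ hθ => h θ hθ x hx)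
      · exact (continuousOn_segment hc (fun θ hθ => h θ hθ x₀ hx₀)).intervalIntegrable
      · exact aestronglyMeasurable_segment hG'.continuousOn (fun θ hθ => h θ hθ x₀ hx₀)
      · exact Filter.Eventually.of_forall fun θ hθ x hx => hC x hx.1 θ (Set.uIoc_subset_uIcc hθ)
      · refine Filter.Eventually.of_forall fun θ hθ x hx => ?_
        have hp := h θ (Set.uIoc_subset_uIcc hθ) x hx.2
        have h1 : HasFDerivAt G (fderiv ℂ G (θ, x)) (θ, x) :=
          ((hG.differentiableOn (by simp)).differentiableAt (hW.mem_nhds hp)).hasFDerivAt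
        exact h1.comp (f := fun x : E => ((θ : ℂ), x)) x (hasFDerivAt_prodMk_right _ _)
    push_cast
    rw [contDiffOn_succ_iff_fderiv_of_isOpen hV]
    refine ⟨fun x hx => (hd x hx).differentiableAt.differentiableWithinAt, by simp, ?_⟩
    exact (ih hG').congr fun x hx => (hd x hx).fderiv

end ParametricIntegral

/-! ### Hadamard's lemma for holomorphic functions. -/

section Division

open scoped ContDiff

variable {N : ℕ}

/-- Precomposition with `update id a b` is the substitution `x_a ↦ x_b`. -/
lemma update_comp {a b : Fin N} (v : Fin N → ℂ) :
    v ∘ Function.update id a b = Function.update v a (v b) := by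
  ext i
  by_cases hi : i = a
  · subst hi; simp
  · simp [hi]

/-- Hadamard's lemma: the difference between a holomorphic function and its restriction to the
hyperplane `x_a = x_b` is divisible by `x_a - x_b`. -/
lemma exists_division {f : (Fin N → ℂ) → ℂ} {U : Set (Fin N → ℂ)} (hU : IsOpen U)
    (hf : ContDiffOn ℂ ∞ f U) {v : Fin N → ℂ} (hv : v ∈ U) {a b : Fin N} (hab : v a = v b) :
    ∃ (V : Set (Fin N → ℂ)) (g : (Fin N → ℂ) → ℂ), IsOpen V ∧ v ∈ V ∧ ContDiffOn ℂ ∞ g V ∧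
      ∀ x ∈ V, f x - f (x ∘ Function.update id a b) = (x a - x b) * g x := by
  obtain ⟨ε, hε, hB⟩ := Metric.isOpen_iff.1 hU v hv
  let s : Fin N → Fin N := Function.update id a b
  have hvs : v ∘ s = v := by rw [update_comp, ← hab, Function.update_eq_self]
  -- The segment from the substituted point, at parameter `0`, to `x`, at parameter `1`.
  let ℓ : ℂ × (Fin N → ℂ) → (Fin N → ℂ) := fun p => p.2 ∘ s + p.1 • (p.2 - p.2 ∘ s)
  have hcs : ContDiff ℂ ∞ (fun p : ℂ × (Fin N → ℂ) => p.2 ∘ s) :=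
    contDiff_pi.2 fun i => by
      change ContDiff ℂ ∞ fun p : ℂ × (Fin N → ℂ) => p.2 (s i)
      fun_prop
  have hℓ : ContDiff ℂ ∞ ℓ := hcs.add (contDiff_fst.smul (contDiff_snd.sub hcs))
  -- The ball is a polydisc centred at a point fixed by the substitution, so each coordinate of `x ∘
  -- s` obeys a bound already known for a coordinate of `x`.
  have hball : ∀ x ∈ Metric.ball v ε, x ∘ s ∈ Metric.ball v ε := by
    intro x hx
    rw [Metric.mem_ball, dist_pi_lt_iff hε] at hx ⊢
    intro i
    have : v i = v (s i) := (congrFun hvs i).symm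
    rw [this]; exact hx (s i)
  have hseg : ∀ θ : ℝ, θ ∈ Set.uIcc (0 : ℝ) 1 → ∀ x ∈ Metric.ball v ε,
      ((θ : ℂ), x) ∈ ℓ ⁻¹' U := by
    intro θ hθ x hx
    rw [Set.uIcc_of_le zero_le_one] at hθ
    refine hB ?_
    have := (convex_ball v ε).add_smul_sub_mem (hball x hx) hx hθ
    simpa [ℓ] using this
  let G : ℂ × (Fin N → ℂ) → ℂ := fun p => fderiv ℂ f (ℓ p) (Pi.single a 1)
  have hG : ContDiffOn ℂ ∞ G (ℓ ⁻¹' U) :=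
    ((hf.fderiv_of_isOpen hU (m := ∞) (by simp)).comp hℓ.contDiffOn (fun _ h => h)).clm_apply
      contDiffOn_const
  have hWo : IsOpen (ℓ ⁻¹' U) := hU.preimage hℓ.continuous
  refine ⟨Metric.ball v ε, fun x => ∫ θ in (0 : ℝ)..1, G (θ, x), Metric.isOpen_ball,
    Metric.mem_ball_self hε, contDiffOn_infty.2 fun n => contDiffOn_integral_segment hWo
      Metric.isOpen_ball hseg n (hG.of_le (by exact_mod_cast le_top)), fun x hx => ?_⟩
  -- The segment runs in the direction of the coordinate `a`, so the factor `x_a - x_b` comes out of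
  -- the derivative along it.
  have hdir : x - x ∘ s = (x a - x b) • Pi.single a (1 : ℂ) := by
    ext i
    by_cases hi : i = a
    · subst hi; simp [s]
    · simp [s, hi]
  have hder : ∀ θ ∈ Set.uIcc (0 : ℝ) 1, HasDerivAt (fun θ : ℝ => f (ℓ (θ, x)))
      ((x a - x b) * G (θ, x)) θ := by
    intro θ hθ
    have h1 : HasFDerivAt f (fderiv ℂ f (ℓ (θ, x))) (ℓ (θ, x)) :=
      ((hf.differentiableOn (by simp)).differentiableAt
        (hU.mem_nhds (hseg θ hθ x hx))).hasFDerivAt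
    have h2 : HasDerivAt (fun z : ℂ => ℓ (z, x)) (x - x ∘ s) (θ : ℂ) := by
      have := ((hasDerivAt_id (θ : ℂ)).smul_const (x - x ∘ s)).const_add (x ∘ s)
      simpa [ℓ] using this
    have h3 := (h1.comp_hasDerivAt (θ : ℂ) h2).comp_ofReal
    rw [hdir, map_smul, smul_eq_mul] at h3
    exact h3
  have hint : IntervalIntegrable (fun θ : ℝ => (x a - x b) * G (θ, x)) MeasureTheory.volume 0 1 :=
    ((continuousOn_segment hG.continuousOn (fun θ hθ => hseg θ hθ x hx)).intervalIntegrable).const_mul _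
  have := intervalIntegral.integral_eq_sub_of_hasDerivAt hder hint
  rw [intervalIntegral.integral_const_mul] at this
  rw [this]
  simp [ℓ, s]

/-- The function `x_a - x_b` is not a zero divisor. -/
lemma eventually_eq_zero_of_mul {g : (Fin N → ℂ) → ℂ} {U : Set (Fin N → ℂ)} (hU : IsOpen U)
    (hg : ContinuousOn g U) {v : Fin N → ℂ} (hv : v ∈ U) {a b : Fin N} (hab : a ≠ b)
    (h : ∀ᶠ x in nhds v, (x a - x b) * g x = 0) : ∀ᶠ x in nhds v, g x = 0 := by
  obtain ⟨O, hO, hOo, hvO⟩ := eventually_nhds_iff.1 (h.and (hU.mem_nhds hv))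
  refine eventually_nhds_iff.2 ⟨O, fun x hx => ?_, hOo, hvO⟩
  have hc : ContinuousAt g x := hg.continuousAt (hU.mem_nhds (hO x hx).2)
  -- On the line through `x` in direction `a`, the factor `x_a - x_b` vanishes at one point only; so
  -- `g` vanishes on a punctured neighbourhood, and at `x` by continuity.
  have hp : Filter.Tendsto (fun z : ℂ => x + z • (Pi.single a 1 : Fin N → ℂ)) (nhds 0) (nhds x) := by
    have : Continuous (fun z : ℂ => x + z • (Pi.single a 1 : Fin N → ℂ)) := by fun_prop
    simpa using this.tendsto 0
  have h1 : Filter.Tendsto (fun z : ℂ => g (x + z • (Pi.single a 1 : Fin N → ℂ)))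
      (nhdsWithin 0 {0}ᶜ) (nhds (g x)) := (hc.tendsto.comp hp).mono_left nhdsWithin_le_nhds
  have hne : ∀ᶠ z : ℂ in nhdsWithin 0 {0}ᶜ, z ≠ x b - x a := by
    by_cases e : x b - x a = 0
    · rw [e]; exact self_mem_nhdsWithin
    · exact nhdsWithin_le_nhds (isOpen_ne.mem_nhds (Ne.symm e))
  have h2 : ∀ᶠ z : ℂ in nhdsWithin 0 {0}ᶜ, g (x + z • (Pi.single a 1 : Fin N → ℂ)) = 0 := by
    filter_upwards [hne, (hp.mono_left nhdsWithin_le_nhds) (hOo.mem_nhds hx)] with z hz hzO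
    refine (mul_eq_zero.1 (hO _ hzO).1).resolve_left ?_
    simp only [Pi.add_apply, Pi.smul_apply, Pi.single_eq_same, smul_eq_mul, mul_one,
      Pi.single_eq_of_ne (Ne.symm hab), mul_zero, add_zero]
    intro h0
    exact hz (by linear_combination h0)
  exact tendsto_nhds_unique h1 (tendsto_const_nhds.congr' (h2.mono fun _ h => h.symm))

end Division

/-! ### Pull-back of germs along morphisms of locally ringed spaces. -/

section StalkMaps

/-- The map on stalks of a morphism that sends the point `x` to `y`. -/
def pullAt {X Y : LocallyRingedSpace.{0}} (f : X ⟶ Y) {x : X} {y : Y} (h : f.base x = y) :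
    Y.presheaf.stalk y →+* X.presheaf.stalk x := by
  subst h; exact (f.stalkMap x).hom

variable {X Y Z : LocallyRingedSpace.{0}}

lemma pullAt_germ (f : X ⟶ Y) {x : X} {y : Y} (h : f.base x = y) (U : Opens Y) (hy : y ∈ U)
    (hx : x ∈ (Opens.map f.base).obj U) (s : Y.presheaf.obj (op U)) :
    pullAt f h (Y.presheaf.germ U y hy s) =
      X.presheaf.germ ((Opens.map f.base).obj U) x hx ((f.c.app (op U)).hom s) := by
  subst h
  exact LocallyRingedSpace.stalkMap_germ_apply f U x hy s

lemma pullAt_comp (f : X ⟶ Y) (g : Y ⟶ Z) {x : X} {y : Y} {z : Z} (h : f.base x = y)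
    (h' : g.base y = z) (h'' : (f ≫ g).base x = z) (a : Z.presheaf.stalk z) :
    pullAt (f ≫ g) h'' a = pullAt f h (pullAt g h' a) := by
  subst h h'
  exact congrArg (fun φ => φ.hom a) (LocallyRingedSpace.stalkMap_comp f g x)

lemma pullAt_congr {f g : X ⟶ Y} (e : f = g) {x : X} {y : Y} (h : f.base x = y)
    (h' : g.base x = y) (a : Y.presheaf.stalk y) : pullAt f h a = pullAt g h' a := by
  subst e; rfl

/-- Naming the image points by equations allows a commutative square to be used on stalks without
transport along equalities of points. -/
lemma pullAt_comp_eq {Y' : LocallyRingedSpace.{0}} {f : X ⟶ Y} {g : Y ⟶ Z} {f' : X ⟶ Y'}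
    {g' : Y' ⟶ Z} (e : f ≫ g = f' ≫ g') {x : X} {y : Y} {y' : Y'} {z : Z} (h : f.base x = y)
    (h' : g.base y = z) (k : f'.base x = y') (k' : g'.base y' = z) (a : Z.presheaf.stalk z) :
    pullAt f h (pullAt g h' a) = pullAt f' k (pullAt g' k' a) := by
  subst h h' k
  have h'' : (f' ≫ g').base x = (f ≫ g).base x := by rw [e]
  exact ((pullAt_comp f g rfl rfl rfl a).symm.trans (pullAt_congr e rfl h'' a)).trans
    (pullAt_comp f' g' rfl k' h'' a)

lemma pullAt_bijective (f : X ⟶ Y) [LocallyRingedSpace.IsOpenImmersion f] {x : X} {y : Y}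
    (h : f.base x = y) : Function.Bijective (pullAt f h) := by
  subst h
  have : IsIso (f.stalkMap x) := inferInstance
  exact ConcreteCategory.bijective_of_isIso (f.stalkMap x)

end StalkMaps

/-! ### Germs over a cofinal family of neighbourhoods. -/

section CofinalGerms

variable {X : TopCat.{0}} (F : X.Presheaf CommRingCat.{0}) (x : X) {ι : Type} {U : ι → Opens X}
  (hx : ∀ i, x ∈ U i)

/-- A family of opens that is cofinal among the neighbourhoods of a point suffices to represent
germs. -/
lemma exists_germ_cofinal (cof : ∀ V : Opens X, x ∈ V → ∃ i, U i ≤ V) (s : F.stalk x) :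
    ∃ i, ∃ a : F.obj (op (U i)), F.germ (U i) x (hx i) a = s := by
  obtain ⟨V, hV, a, rfl⟩ := F.exists_germ_eq s
  obtain ⟨i, hi⟩ := cof V hV
  exact ⟨i, (F.map (homOfLE hi).op).hom a, F.germ_res_apply (homOfLE hi) x (hx i) a⟩

lemma germ_eq_cofinal (cof : ∀ V : Opens X, x ∈ V → ∃ i, U i ≤ V) {i j : ι}
    {a : F.obj (op (U i))} {b : F.obj (op (U j))}
    (h : F.germ (U i) x (hx i) a = F.germ (U j) x (hx j) b) :
    ∃ (k : ι) (hi : U k ≤ U i) (hj : U k ≤ U j),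
      (F.map (homOfLE hi).op).hom a = (F.map (homOfLE hj).op).hom b := by
  obtain ⟨W, hW, iU, iV, e⟩ := F.germ_eq x (hx i) (hx j) a b h
  obtain ⟨k, hk⟩ := cof W hW
  refine ⟨k, hk.trans iU.le, hk.trans iV.le, ?_⟩
  have e' := congrArg (F.map (homOfLE hk).op).hom e
  change (F.map iU.op ≫ F.map (homOfLE hk).op).hom a =
    (F.map iV.op ≫ F.map (homOfLE hk).op).hom b at e'
  rw [← F.map_comp, ← F.map_comp] at e'
  exact e'

end CofinalGerms

/-! ### Germs of holomorphic functions on affine space, represented by functions. -/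

section AffGerm

open scoped ContDiff

variable {N : ℕ}

/-- An open subset of `ℂⁿ`, as an open set of vectors. -/
abbrev affOpen (U : Opens (Aff N)) : Opens (Fin N → ℂ) := U

/-- The sections of the structure sheaf of `ℂⁿ` are functions. -/
def affFun {U : Opens (Aff N)} (s : (Aff N).presheaf.obj (op U)) : (Fin N → ℂ) → ℂ := by
  classical
  -- The value `0` outside `U` is arbitrary: representatives are only ever compared on `U`.
  exact fun x => if h : x ∈ affOpen U then s.1 ⟨x, h⟩ else 0

lemma affFun_of_mem {U : Opens (Aff N)} (s : (Aff N).presheaf.obj (op U)) {x : Fin N → ℂ}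
    (h : x ∈ affOpen U) : affFun s x = s.1 ⟨x, h⟩ := by
  simp only [affFun, dif_pos h]

lemma contDiffOn_affFun {U : Opens (Aff N)} (s : (Aff N).presheaf.obj (op U)) :
    ContDiffOn ℂ ∞ (affFun s) (affOpen U : Set (Fin N → ℂ)) := by
  intro x hx
  have h0 : ContMDiff (M := affOpen U) 𝓘(ℂ, Fin N → ℂ) 𝓘(ℂ) ∞ s.1 := s.2
  have h1 := h0 ⟨x, hx⟩
  have h2 : (fun y : affOpen U => affFun s y) = s.1 := by
    ext y; exact affFun_of_mem s y.2
  rw [← h2] at h1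
  have h3 := (contMDiffAt_subtype_iff (f := affFun s)).1 h1
  exact h3.contDiffAt.contDiffWithinAt

/-- The section given by a holomorphic function. -/
def affSec (U : Opens (Aff N)) (f : (Fin N → ℂ) → ℂ)
    (hf : ContDiffOn ℂ ∞ f (affOpen U : Set (Fin N → ℂ))) : (Aff N).presheaf.obj (op U) :=
  show C^∞⟮𝓘(ℂ, Fin N → ℂ), affOpen U; 𝓘(ℂ), ℂ⟯ from
    ⟨fun x => f x, fun x => (contMDiffAt_subtype_iff (f := f)).2
      ((hf.contDiffAt ((affOpen U).2.mem_nhds x.2)).contMDiffAt)⟩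

lemma affFun_affSec (U : Opens (Aff N)) (f : (Fin N → ℂ) → ℂ)
    (hf : ContDiffOn ℂ ∞ f (affOpen U : Set (Fin N → ℂ))) {x : Fin N → ℂ} (h : x ∈ affOpen U) :
    affFun (affSec U f hf) x = f x := affFun_of_mem _ h

/-- The holomorphic function `f`, defined near `v`, represents the element `φ` of the local ring. -/
def IsGerm {v : Aff N} (φ : (Aff N).presheaf.stalk v) (f : (Fin N → ℂ) → ℂ) : Prop :=
  ∃ (U : Opens (Aff N)) (hv : v ∈ U) (s : (Aff N).presheaf.obj (op U)),
    (Aff N).presheaf.germ U v hv s = φ ∧ ∀ x ∈ affOpen U, affFun s x = f x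

namespace IsGerm

variable {v : Aff N} {φ ψ : (Aff N).presheaf.stalk v} {f g : (Fin N → ℂ) → ℂ}

lemma exists_fun (φ : (Aff N).presheaf.stalk v) : ∃ f, IsGerm φ f := by
  obtain ⟨U, hv, s, rfl⟩ := (Aff N).presheaf.exists_germ_eq φ
  exact ⟨affFun s, U, hv, s, rfl, fun _ _ => rfl⟩

lemma exists_stalk (U : Opens (Aff N)) (hv : v ∈ U) (hf : ContDiffOn ℂ ∞ f (affOpen U : Set (Fin N → ℂ))) :
    ∃ φ : (Aff N).presheaf.stalk v, IsGerm φ f :=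
  ⟨_, U, hv, affSec U f hf, rfl, fun _ hx => affFun_affSec U f hf hx⟩

lemma contDiffOn (h : IsGerm φ f) : ∃ U : Set (Fin N → ℂ), IsOpen U ∧ v ∈ U ∧ ContDiffOn ℂ ∞ f U := by
  obtain ⟨U, hv, s, -, h⟩ := h
  exact ⟨affOpen U, U.2, hv, (contDiffOn_affFun s).congr fun x hx => (h x hx).symm⟩

lemma affFun_res {U V : Opens (Aff N)} (h : V ≤ U) (s : (Aff N).presheaf.obj (op U))
    {x : Fin N → ℂ} (hx : x ∈ affOpen V) :
    affFun (((Aff N).presheaf.map (homOfLE h).op).hom s) x = affFun s x := by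
  exact (affFun_of_mem _ hx).trans (affFun_of_mem _ (h hx)).symm

lemma sec_ext {U : Opens (Aff N)} {s t : (Aff N).presheaf.obj (op U)}
    (h : ∀ x ∈ affOpen U, affFun s x = affFun t x) : s = t := by
  refine Subtype.ext (funext fun x => ?_)
  exact (affFun_of_mem s x.2).symm.trans ((h x.1 x.2).trans (affFun_of_mem t x.2))

lemma eventuallyEq (hf : IsGerm φ f) (hg : IsGerm φ g) :
    ∀ᶠ x in nhds (show Fin N → ℂ from v), f x = g x := by
  obtain ⟨U, hv, s, rfl, h⟩ := hf
  obtain ⟨U', hv', s', e, h'⟩ := hg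
  obtain ⟨W, hW, i, i', e'⟩ := (Aff N).presheaf.germ_eq v hv' hv s' s e
  refine eventually_nhds_iff.2 ⟨affOpen W, fun x hx => ?_, W.2, hW⟩
  rw [← h x (i'.le hx), ← h' x (i.le hx)]
  exact (affFun_res i'.le s hx).symm.trans ((congrArg (fun s => affFun s x) e'.symm).trans
    (affFun_res i.le s' hx))

lemma shrink (hf : IsGerm φ f) (W : Opens (Aff N)) (hW : v ∈ W) :
    ∃ (U : Opens (Aff N)) (hv : v ∈ U) (s : (Aff N).presheaf.obj (op U)),
      U ≤ W ∧ (Aff N).presheaf.germ U v hv s = φ ∧ ∀ x ∈ affOpen U, affFun s x = f x := by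
  obtain ⟨U, hv, s, rfl, h⟩ := hf
  refine ⟨U ⊓ W, ⟨hv, hW⟩, ((Aff N).presheaf.map (homOfLE inf_le_left).op).hom s, inf_le_right,
    (Aff N).presheaf.germ_res_apply (homOfLE inf_le_left) v ⟨hv, hW⟩ s, fun x hx => ?_⟩
  rw [affFun_res inf_le_left s hx, h x hx.1]

lemma congr (hf : IsGerm φ f) (h : ∀ᶠ x in nhds (show Fin N → ℂ from v), f x = g x) :
    IsGerm φ g := by
  obtain ⟨W, hW, hWo, hvW⟩ := eventually_nhds_iff.1 h
  obtain ⟨U, hv, s, hU, e, h⟩ := hf.shrink ⟨W, hWo⟩ hvW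
  exact ⟨U, hv, s, e, fun x hx => (h x hx).trans (hW x (hU hx))⟩

/-- This turns identities between elements of the local ring into identities between functions. -/
lemma unique (hf : IsGerm φ f) (hg : IsGerm ψ f) : φ = ψ := by
  obtain ⟨U, hv, s, rfl, h⟩ := hf
  obtain ⟨U', hv', s', hU, rfl, h'⟩ := hg.shrink U hv
  rw [← (Aff N).presheaf.germ_res_apply (homOfLE hU) v hv' s]
  refine congrArg _ (sec_ext fun x hx => ?_)
  exact (affFun_res hU s hx).trans ((h x (hU hx)).trans (h' x hx).symm)

lemma add (hf : IsGerm φ f) (hg : IsGerm ψ g) : IsGerm (φ + ψ) (fun x => f x + g x) := by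
  obtain ⟨U, hv, s, rfl, h⟩ := hf
  obtain ⟨U', hv', s', hU, rfl, h'⟩ := hg.shrink U hv
  refine ⟨U', hv', ((Aff N).presheaf.map (homOfLE hU).op).hom s + s', ?_, fun x hx => ?_⟩
  · rw [map_add]
    exact congrArg (· + _) ((Aff N).presheaf.germ_res_apply (homOfLE hU) v hv' s)
  · exact (affFun_of_mem _ hx).trans (congrArg₂ (· + ·)
      ((affFun_of_mem _ hx).symm.trans ((affFun_res hU s hx).trans (h x (hU hx))))
      ((affFun_of_mem _ hx).symm.trans (h' x hx)))

lemma mul (hf : IsGerm φ f) (hg : IsGerm ψ g) : IsGerm (φ * ψ) (fun x => f x * g x) := by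
  obtain ⟨U, hv, s, rfl, h⟩ := hf
  obtain ⟨U', hv', s', hU, rfl, h'⟩ := hg.shrink U hv
  refine ⟨U', hv', ((Aff N).presheaf.map (homOfLE hU).op).hom s * s', ?_, fun x hx => ?_⟩
  · rw [map_mul]
    exact congrArg (· * _) ((Aff N).presheaf.germ_res_apply (homOfLE hU) v hv' s)
  · exact (affFun_of_mem _ hx).trans (congrArg₂ (· * ·)
      ((affFun_of_mem _ hx).symm.trans ((affFun_res hU s hx).trans (h x (hU hx))))
      ((affFun_of_mem _ hx).symm.trans (h' x hx)))

lemma neg (hf : IsGerm φ f) : IsGerm (-φ) (fun x => - f x) := by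
  obtain ⟨U, hv, s, rfl, h⟩ := hf
  refine ⟨U, hv, -s, map_neg _ _, fun x hx => ?_⟩
  exact (affFun_of_mem _ hx).trans (congrArg (- ·) ((affFun_of_mem _ hx).symm.trans (h x hx)))

lemma sub (hf : IsGerm φ f) (hg : IsGerm ψ g) : IsGerm (φ - ψ) (fun x => f x - g x) := by
  simpa only [sub_eq_add_neg] using hf.add hg.neg

lemma const (v : Aff N) (c : ℂ) : ∃ φ : (Aff N).presheaf.stalk v, IsGerm φ (fun _ => c) :=
  exists_stalk ⊤ trivial contDiffOn_const

lemma one : IsGerm (1 : (Aff N).presheaf.stalk v) (fun _ => 1) := by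
  refine ⟨⊤, trivial, 1, map_one _, fun x hx => ?_⟩
  exact affFun_of_mem _ hx

lemma zero : IsGerm (0 : (Aff N).presheaf.stalk v) (fun _ => 0) := by
  refine ⟨⊤, trivial, 0, map_zero _, fun x hx => ?_⟩
  exact affFun_of_mem _ hx

lemma pullAt {n : ℕ} (τ : Fin N → Fin n) {w : Aff n} (hw : (affProj τ).base w = v)
    (hf : IsGerm φ f) : IsGerm (pullAt (affProj τ) hw φ) (fun x => f (x ∘ τ)) := by
  subst hw
  obtain ⟨U, hv, s, rfl, h⟩ := hf
  refine ⟨(Opens.map (affProj τ).base).obj U, hv, ((affProj τ).c.app (op U)).hom s,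
    (pullAt_germ _ rfl U hv hv s).symm, fun x hx => ?_⟩
  have hx' : x ∘ τ ∈ affOpen U := hx
  exact (affFun_of_mem _ hx).trans ((affFun_of_mem s hx').symm.trans (h _ hx'))

end IsGerm

end AffGerm

/-! ### Division operators on the local rings of affine space. -/

section Division

open scoped ContDiff

variable {N : ℕ} {v : Aff N}

lemma exists_coord (v : Aff N) (a : Fin N) :
    ∃ φ : (Aff N).presheaf.stalk v, IsGerm φ (fun x => x a) :=
  IsGerm.exists_stalk ⊤ trivial (contDiff_apply ℂ ℂ a).contDiffOn

/-- The germ of a coordinate function. -/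
def coord (v : Aff N) (a : Fin N) : (Aff N).presheaf.stalk v := (exists_coord v a).choose

lemma isGerm_coord (v : Aff N) (a : Fin N) : IsGerm (coord v a) (fun x => x a) :=
  (exists_coord v a).choose_spec

/-- Both sides are represented by precomposition with `τ ∘ ρ`. -/
lemma pullAt_affProj_comp {m n : ℕ} {w : Aff n} {u : Aff m} {τ : Fin n → Fin N} {ρ : Fin m → Fin n}
    (hw : (affProj τ).base v = w) (hu : (affProj ρ).base w = u) {κ : Fin m → Fin N}
    (hκ : (affProj κ).base v = u) (e : τ ∘ ρ = κ) (g : (Aff m).presheaf.stalk u) :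
    pullAt (affProj τ) hw (pullAt (affProj ρ) hu g) = pullAt (affProj κ) hκ g := by
  obtain ⟨f, hf⟩ := IsGerm.exists_fun g
  have h1 := (hf.pullAt ρ hu).pullAt τ hw
  subst e
  exact h1.unique (hf.pullAt _ hκ)

lemma pullAt_coord {n : ℕ} {w : Aff n} {τ : Fin n → Fin N} (hw : (affProj τ).base v = w)
    (i : Fin n) : pullAt (affProj τ) hw (coord w i) = coord v (τ i) :=
  ((isGerm_coord w i).pullAt τ hw).unique (isGerm_coord v (τ i))

variable {a b : Fin N} (hs : (affProj (Function.update id a b)).base v = v)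

/-- The substitution `x_a ↦ x_b`, at a point with `x_a = x_b`. -/
abbrev affSubst (hs : (affProj (Function.update id a b)).base v = v) :
    (Aff N).presheaf.stalk v →+* (Aff N).presheaf.stalk v :=
  pullAt (affProj (Function.update id a b)) hs

lemma affSubst_of_ne {n : ℕ} {w : Aff n} {τ : Fin n → Fin N} (hw : (affProj τ).base v = w)
    (hτ : ∀ i, τ i ≠ a) (g : (Aff n).presheaf.stalk w) :
    affSubst hs (pullAt (affProj τ) hw g) = pullAt (affProj τ) hw g := by
  refine pullAt_affProj_comp hs hw hw (funext fun i => ?_) g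
  simp [hτ i]

lemma affSubst_coord_of_ne {c : Fin N} (hc : c ≠ a) : affSubst hs (coord v c) = coord v c := by
  rw [affSubst, pullAt_coord, Function.update_of_ne hc]; rfl

lemma affSubst_coord_self : affSubst hs (coord v a) = coord v b := by
  rw [affSubst, pullAt_coord, Function.update_self]

/-- Existence is Hadamard's lemma; uniqueness holds because `x_a - x_b` is not a zero divisor. -/
lemma exists_affDiv (hab : a ≠ b) (φ : (Aff N).presheaf.stalk v) :
    ∃! ψ, φ - affSubst hs φ = (coord v a - coord v b) * ψ := by
  obtain ⟨f, hf⟩ := IsGerm.exists_fun φ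
  obtain ⟨U, hU, hv, hd⟩ := hf.contDiffOn
  have hab' : (show Fin N → ℂ from v) a = (show Fin N → ℂ from v) b := by
    have : (show Fin N → ℂ from v) ((Function.update id a b : Fin N → Fin N) a) =
      (show Fin N → ℂ from v) a := congrFun hs a
    rw [Function.update_self] at this
    exact this.symm
  obtain ⟨V, g, hV, hvV, hg, e⟩ := exists_division hU hd (v := v) hv hab'
  have ht := (isGerm_coord v a).sub (isGerm_coord v b)
  obtain ⟨ψ, hψ⟩ := IsGerm.exists_stalk (v := v) ⟨V, hV⟩ hvV hg
  refine ⟨ψ, ?_, fun ψ' h => ?_⟩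
  · refine ((hf.sub (hf.pullAt _ hs)).congr ?_).unique (ht.mul hψ)
    exact eventually_nhds_iff.2 ⟨V, e, hV, hvV⟩
  · obtain ⟨g', hg'⟩ := IsGerm.exists_fun ψ'
    have h0 : (coord v a - coord v b) * (ψ' - ψ) = 0 := by
      rw [mul_sub, ← h, sub_eq_zero]
      refine ((hf.sub (hf.pullAt _ hs)).congr ?_).unique (ht.mul hψ)
      exact eventually_nhds_iff.2 ⟨V, e, hV, hvV⟩
    have h1 := ht.mul (hg'.sub hψ)
    rw [h0] at h1
    obtain ⟨U', hU', hv', hd'⟩ := (hg'.sub hψ).contDiffOn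
    have h2 := eventually_eq_zero_of_mul hU' hd'.continuousOn hv' hab (h1.eventuallyEq IsGerm.zero)
    exact sub_eq_zero.1 (((hg'.sub hψ).congr h2).unique IsGerm.zero)

/-- The substitution kills `(x_a - x_b) ψ`, so both `ψ` and `ψ'` are the unique quotient of the same
element. -/
lemma affDiv_ext (hs : (affProj (Function.update id a b)).base v = v) (hab : a ≠ b)
    {ψ ψ' : (Aff N).presheaf.stalk v}
    (h : (coord v a - coord v b) * ψ = (coord v a - coord v b) * ψ') : ψ = ψ' := by
  have h0 : (coord v a - coord v b) * ψ - affSubst hs ((coord v a - coord v b) * ψ) =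
      (coord v a - coord v b) * ψ := by
    rw [map_mul, map_sub, affSubst_coord_self, affSubst_coord_of_ne hs hab.symm, sub_self, zero_mul,
      sub_zero]
  exact (exists_affDiv hs hab _).unique h0 (h0.trans h)

/-- The division operator `φ ↦ (φ - φ(x_a ↦ x_b)) / (x_a - x_b)`. -/
def affDiv (hab : a ≠ b) : (Aff N).presheaf.stalk v →+ (Aff N).presheaf.stalk v :=
  AddMonoidHom.mk' (fun φ => (exists_affDiv hs hab φ).choose) (fun φ ψ => by
    refine affDiv_ext hs hab ?_
    rw [mul_add, ← (exists_affDiv hs hab (φ + ψ)).choose_spec.1,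
      ← (exists_affDiv hs hab φ).choose_spec.1, ← (exists_affDiv hs hab ψ).choose_spec.1, map_add]
    ring)

lemma affDiv_spec (hab : a ≠ b) (φ : (Aff N).presheaf.stalk v) :
    φ - affSubst hs φ = (coord v a - coord v b) * affDiv hs hab φ :=
  (exists_affDiv hs hab φ).choose_spec.1

/-- The Leibniz rule of a divided difference, twisted by the substitution. Multiplication by an
element fixed by the substitution therefore commutes with the division. -/
lemma affDiv_mul (hab : a ≠ b) (φ ψ : (Aff N).presheaf.stalk v) :
    affDiv hs hab (φ * ψ) = affDiv hs hab φ * ψ + affSubst hs φ * affDiv hs hab ψ := by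
  refine affDiv_ext hs hab ?_
  rw [← affDiv_spec]
  have h1 := affDiv_spec hs hab φ
  have h2 := affDiv_spec hs hab ψ
  rw [map_mul]
  linear_combination ψ * h1 + affSubst hs φ * h2

lemma affDiv_of_fixed (hab : a ≠ b) {φ : (Aff N).presheaf.stalk v} (h : affSubst hs φ = φ) :
    affDiv hs hab φ = 0 := by
  refine affDiv_ext hs hab ?_
  rw [← affDiv_spec, h, sub_self, mul_zero]

lemma affDiv_self_mul (hab : a ≠ b) (φ : (Aff N).presheaf.stalk v) :
    affDiv hs hab ((coord v a - coord v b) * φ) = φ := by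
  refine affDiv_ext hs hab ?_
  rw [← affDiv_spec, map_mul, map_sub, affSubst_coord_self, affSubst_coord_of_ne hs hab.symm,
    sub_self, zero_mul, sub_zero]

/-- By the twisted Leibniz rule, an ideal generated by functions independent of `x_a` is preserved.
This applies to the equations of `Y`, so the division descends to the quotient. -/
lemma affDiv_mem_span (hab : a ≠ b) {S : Set ((Aff N).presheaf.stalk v)}
    (hS : ∀ k ∈ S, affSubst hs k = k) {φ : (Aff N).presheaf.stalk v} (hφ : φ ∈ Ideal.span S) :
    affDiv hs hab φ ∈ Ideal.span S := by
  induction hφ using Submodule.span_induction with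
  | mem k hk => rw [affDiv_of_fixed hs hab (hS k hk)]; exact zero_mem _
  | zero => rw [map_zero]; exact zero_mem _
  | add x y _ _ hx hy => rw [map_add]; exact add_mem hx hy
  | smul c x hx h =>
    rw [smul_eq_mul, affDiv_mul]
    exact add_mem (Ideal.mul_mem_left _ _ hx) (Ideal.mul_mem_left _ _ h)

end Division

/-- Division operators for two ring homomorphisms `p, p₂ : O → C` such that `C` is generated, up to
completion, by `p(O)` and finitely many elements `p₂(z) - p(z)`. -/
structure DivisionData {O C : Type} [CommRing O] [CommRing C] (p p₂ : O →+* C) where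
  I : Type
  [fintype : Fintype I]
  z : I → O
  δ : I → C →+ C
  δ_p : ∀ i a c, δ i (p a * c) = p a * δ i c
  δ_one : ∀ i, δ i 1 = 0
  δ_self : ∀ i c, δ i ((p₂ (z i) - p (z i)) * c) = c
  δ_ne : ∀ i j, i ≠ j → ∀ c, δ i ((p₂ (z j) - p (z j)) * c) = (p₂ (z j) - p (z j)) * δ i c
  gen : ∀ c, ∃ (a : O) (b : I → C), c = p a + ∑ i, (p₂ (z i) - p (z i)) * b i

attribute [instance] DivisionData.fintype

/-! ### Division operators along the diagonal of the fibre product. -/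

section FibreDivision

variable {O C : Type} [CommRing O] [CommRing C] {p p₂ : O →+* C} {N n m : ℕ} {v : Aff N} {w : Aff n}
  {τ₁ τ₂ : Fin n → Fin N} {σ : Fin m → Fin n}

/-- The germs of functions on the fibre product of `Y × ℂᵈ ⟶ Y` with itself at a point of the
diagonal have division operators. -/
lemma exists_divisionData (h₁ : (affProj τ₁).base v = w) (h₂ : (affProj τ₂).base v = w)
    (τ₂_inj : Function.Injective τ₂)
    (τ_σ : ∀ k, τ₁ (σ k) = τ₂ (σ k)) (τ_inter : ∀ i j, τ₁ i = τ₂ j → ∃ k, i = σ k ∧ j = σ k)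
    (τ_union : ∀ k, (∃ i, k = τ₁ i) ∨ ∃ j, k = τ₂ j)
    (Θ : (Aff N).presheaf.stalk v →+* C) (hΘ : Function.Surjective Θ)
    (θ : (Aff n).presheaf.stalk w →+* O) (hθ : Function.Surjective θ)
    (hp : ∀ g, p (θ g) = Θ (pullAt (affProj τ₁) h₁ g))
    (hp₂ : ∀ g, p₂ (θ g) = Θ (pullAt (affProj τ₂) h₂ g))
    (S : Set ((Aff N).presheaf.stalk v)) (hker : RingHom.ker Θ = Ideal.span S)
    {u : Aff m} (hu : (affProj (τ₁ ∘ σ)).base v = u)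
    (hS : ∀ k ∈ S, ∃ k', k = pullAt (affProj (τ₁ ∘ σ)) hu k') :
    Nonempty (DivisionData p p₂) := by
  classical
  -- The relative coordinates: those of `W` that do not come from `Y`.
  let I := {i : Fin n // i ∉ Set.range σ}
  have hne : ∀ (i : I) j, τ₁ j ≠ τ₂ i := by
    intro i j e
    obtain ⟨k, -, hk⟩ := τ_inter j i e
    exact i.2 ⟨k, hk.symm⟩
  -- Both projections map `v` to `w`, so its coordinates `τ₁ i` and `τ₂ i` agree and the
  -- substitution fixes `v`.
  have hs : ∀ i : I, (affProj (Function.update id (τ₂ i) (τ₁ i))).base v = v := by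
    intro i
    refine (update_comp (show Fin N → ℂ from v)).trans ?_
    have e1 : (show Fin N → ℂ from v) (τ₁ i) = (show Fin N → ℂ from v) (τ₂ i) :=
      congrFun (h₁.trans h₂.symm) i.1
    rw [e1, Function.update_eq_self]
  have hab : ∀ i : I, τ₂ i ≠ τ₁ i := fun i => (hne i i).symm
  let t : I → (Aff N).presheaf.stalk v := fun i => coord v (τ₂ i) - coord v (τ₁ i)
  have ht : ∀ i : I, p₂ (θ (coord w i)) - p (θ (coord w i)) = Θ (t i) := by
    intro i
    rw [hp, hp₂, pullAt_coord, pullAt_coord, map_sub]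
  -- The kernel of `Θ` is generated by functions pulled back from `Y`, which do not involve the
  -- coordinate `τ₂ i`.
  have hK : ∀ (i : I) x, Θ x = 0 → Θ (affDiv (hs i) (hab i) x) = 0 := by
    intro i x hx
    rw [← RingHom.mem_ker, hker] at hx ⊢
    refine affDiv_mem_span (hs i) (hab i) (fun k hk => ?_) hx
    obtain ⟨k', rfl⟩ := hS k hk
    exact affSubst_of_ne (hs i) hu (fun j => hne i _) k'
  have hsec := Function.surjInv_eq hΘ
  have hwd : ∀ (i : I) x y, Θ x = Θ y →
      Θ (affDiv (hs i) (hab i) x) = Θ (affDiv (hs i) (hab i) y) := by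
    intro i x y h
    have := hK i (x - y) (by rw [map_sub, h, sub_self])
    rwa [map_sub, map_sub, sub_eq_zero] at this
  -- Division on arbitrarily chosen lifts; the result, and hence additivity, does not depend on the
  -- lifts by `hwd`.
  let δ : I → C →+ C := fun i => AddMonoidHom.mk'
    (fun c => Θ (affDiv (hs i) (hab i) (Function.surjInv hΘ c))) (fun c c' => by
      rw [← map_add, ← map_add]
      exact hwd i _ _ (by rw [map_add, hsec, hsec, hsec]))
  have hδ : ∀ i x, δ i (Θ x) = Θ (affDiv (hs i) (hab i) x) := fun i x => hwd i _ _ (hsec _)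
  have hδm : ∀ i k x, affSubst (hs i) k = k → δ i (Θ k * Θ x) = Θ k * δ i (Θ x) := by
    intro i k x hk
    rw [← map_mul, hδ, hδ, affDiv_mul, affDiv_of_fixed _ _ hk, hk, zero_mul, zero_add, map_mul]
  refine ⟨⟨I, fun i => θ (coord w i), δ, fun i a c => ?_, fun i => ?_, fun i c => ?_,
    fun i j hij c => ?_, fun c => ?_⟩⟩
  · obtain ⟨g, rfl⟩ := hθ a
    obtain ⟨x, rfl⟩ := hΘ c
    rw [hp]
    exact hδm i _ x (affSubst_of_ne (hs i) h₁ (hne i) g)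
  · rw [← map_one Θ, hδ, affDiv_of_fixed _ _ (map_one _), map_zero]
  · obtain ⟨x, rfl⟩ := hΘ c
    rw [ht, ← map_mul, hδ, affDiv_self_mul]
  · obtain ⟨x, rfl⟩ := hΘ c
    rw [ht]
    refine hδm i _ x ?_
    rw [map_sub, affSubst_coord_of_ne (hs i) (hne i j),
      affSubst_coord_of_ne (hs i) (fun e => hij (Subtype.ext (τ₂_inj e)).symm)]
  · obtain ⟨φ, rfl⟩ := hΘ c
    -- The substitutions `x_{τ₂ i} ↦ x_{τ₁ i}` are made one at a time, each at the cost of a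
    -- multiple of `t_i`; `s` is the composite substitution.
    have key : ∀ (F : Finset I) (φ : (Aff N).presheaf.stalk v) (f : (Fin N → ℂ) → ℂ), IsGerm φ f →
        ∃ (s : Fin N → Fin N) (ψ : (Aff N).presheaf.stalk v) (b : I → (Aff N).presheaf.stalk v),
          (∀ i ∈ F, s (τ₂ i) = τ₁ i) ∧ (∀ j, s (τ₁ j) = τ₁ j) ∧ (affProj s).base v = v ∧
          IsGerm ψ (fun x => f (x ∘ s)) ∧ φ = ψ + ∑ i, t i * b i := by
      intro F
      induction F using Finset.induction_on with
      | empty =>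
        intro φ f hf
        exact ⟨id, φ, 0, by simp, fun _ => rfl, rfl, hf, by simp⟩
      | insert i F _ ih =>
        intro φ f hf
        obtain ⟨s, ψ, b, h1, h2, h3, h4, h5⟩ := ih _ _ (hf.pullAt _ (hs i))
        refine ⟨s ∘ Function.update id (τ₂ i) (τ₁ i), ψ,
          b + Pi.single i (affDiv (hs i) (hab i) φ), ?_, ?_, ?_, h4, ?_⟩
        · intro j hj
          by_cases e : j = i
          · subst e; simp [h2]
          · have : τ₂ j.1 ≠ τ₂ i.1 := fun h => e (Subtype.ext (τ₂_inj h))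
            simp [this, h1 j ((Finset.mem_insert.1 hj).resolve_left e)]
        · intro j
          simp [hne i j, h2]
        · have h6 := congrArg (affProj (Function.update id (τ₂ i) (τ₁ i))).base h3
          exact h6.trans (hs i)
        · have h6 := affDiv_spec (hs i) (hab i) φ
          have h7 : ∑ j, t j * (b + Pi.single i (affDiv (hs i) (hab i) φ) :
              I → (Aff N).presheaf.stalk v) j =
              ∑ j, t j * b j + t i * affDiv (hs i) (hab i) φ := by
            simp only [Pi.add_apply, mul_add, Finset.sum_add_distrib]
            congr 1
            rw [Finset.sum_eq_single i (fun j _ hj => by simp [hj]) (by simp), Pi.single_eq_same]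
          rw [h7]
          change φ - affSubst (hs i) φ = t i * _ at h6
          change affSubst (hs i) φ = _ at h5
          rw [h5] at h6
          linear_combination h6
    obtain ⟨f, hf⟩ := IsGerm.exists_fun φ
    obtain ⟨s, ψ, b, h1, h2, h3, h4, h5⟩ := key Finset.univ φ f hf
    -- After all substitutions only coordinates of the first factor remain, because every coordinate
    -- belongs to one of the two factors. So `ψ` is the pull-back along the first projection of a
    -- germ on `W`, the restriction of `φ` to the diagonal.
    have hρ : ∀ k, ∃ j, s k = τ₁ j := by
      intro k
      obtain ⟨i, rfl⟩ | ⟨j, rfl⟩ := τ_union k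
      · exact ⟨i, h2 i⟩
      · by_cases hj : j ∈ Set.range σ
        · obtain ⟨l, rfl⟩ := hj
          exact ⟨σ l, by rw [← τ_σ, h2]⟩
        · exact ⟨j, h1 ⟨j, hj⟩ (Finset.mem_univ _)⟩
    choose ρ hρ using hρ
    have e : τ₁ ∘ ρ = s := funext fun k => (hρ k).symm
    have hw : (affProj ρ).base w = v := by
      subst h₁
      subst e
      exact h3
    refine ⟨θ (pullAt (affProj ρ) hw φ), fun i => Θ (b i), ?_⟩
    rw [hp]
    have e2 : ψ = pullAt (affProj τ₁) h₁ (pullAt (affProj ρ) hw φ) := by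
      rw [pullAt_affProj_comp h₁ hw h3 e]
      exact h4.unique (hf.pullAt s h3)
    rw [← e2]
    conv_lhs => rw [h5]
    rw [map_add, map_sum]
    congr 1
    exact Finset.sum_congr rfl fun i _ => by rw [ht, map_mul]

end FibreDivision

/-! ### Transport of the division operators to the fibre product. -/

section FibreChart

variable {E W Y : LocallyRingedSpace.{0}}

/-- In a fibre chart, there are division operators for the two projections at diagonal points. -/
lemma FibreChart.exists_divisionData {p₁ p₂ : E ⟶ W} {f : W ⟶ Y}
    {sc : ℂ →+* LocallyRingedSpace.Γ.obj (op Y)} (c : FibreChart p₁ p₂ f sc) (u : c.top.dom)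
    {e : E} (hu : c.top.incl.base u = e) {x : W} (h₁ : p₁.base e = x) (h₂ : p₂.base e = x) :
    Nonempty (DivisionData (pullAt p₁ h₁) (pullAt p₂ h₂)) := by
  have := c.factor.top.isOpen
  have := c.top.isOpen
  let u' := c.proj₁.base u
  have e₁ : c.factor.top.incl.base u' = x := by
    have := congrArg (fun φ => φ.base u) c.proj₁_incl
    change c.factor.top.incl.base u' = p₁.base (c.top.incl.base u) at this
    rw [this, hu, h₁]
  have e₂' : c.factor.top.incl.base (c.proj₂.base u) = x := by
    have := congrArg (fun φ => φ.base u) c.proj₂_incl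
    change c.factor.top.incl.base (c.proj₂.base u) = p₂.base (c.top.incl.base u) at this
    rw [this, hu, h₂]
  -- Both projections of the point have the same image `x` in `W`, and the chart of `W` is
  -- injective.
  have e₂ : c.proj₂.base u = u' :=
    (PresheafedSpace.IsOpenImmersion.base_open (f := c.factor.top.incl.toHom)).injective
      (e₂'.trans e₁.symm)
  let v := c.top.toAff.base u
  let w := c.factor.top.toAff.base u'
  have k₁ : (affProj c.τ₁).base v = w := congrArg (fun φ => φ.base u) c.toAff_proj₁
  have k₂ : (affProj c.τ₂).base v = w := by
    have := congrArg (fun φ => φ.base u) c.toAff_proj₂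
    change (affProj c.τ₂).base v = c.factor.top.toAff.base (c.proj₂.base u) at this
    rw [this, e₂]
  let iE := RingEquiv.ofBijective (pullAt c.top.incl hu) (pullAt_bijective _ hu)
  let iW := RingEquiv.ofBijective (pullAt c.factor.top.incl e₁) (pullAt_bijective _ e₁)
  let qE : (Aff c.top.dim).presheaf.stalk v →+* c.top.dom.presheaf.stalk u :=
    pullAt c.top.toAff rfl
  let qW : (Aff c.factor.top.dim).presheaf.stalk w →+* c.factor.top.dom.presheaf.stalk u' :=
    pullAt c.factor.top.toAff rfl
  -- The square relating `p` to the chart projection and the square relating that to the coordinate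
  -- projection, pasted together on stalks; both factors are instances.
  have hp : ∀ (p : E ⟶ W) (pr : c.top.dom ⟶ c.factor.top.dom) (τ : Fin c.factor.top.dim → Fin c.top.dim)
      (h : p.base e = x) (k : (affProj τ).base v = w) (hpr : pr.base u = u')
      (_ : pr ≫ c.factor.top.incl = c.top.incl ≫ p)
      (_ : c.top.toAff ≫ affProj τ = pr ≫ c.factor.top.toAff) (g),
      pullAt p h (iW.symm (qW g)) = iE.symm (qE (pullAt (affProj τ) k g)) := by
    intro p pr τ h k hpr E1 E2 g
    rw [RingEquiv.eq_symm_apply]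
    have s1 := pullAt_comp_eq E1 hpr e₁ hu h (iW.symm (qW g))
    have s2 : pullAt c.factor.top.incl e₁ (iW.symm (qW g)) = qW g := iW.apply_symm_apply _
    rw [s2] at s1
    exact s1.symm.trans (pullAt_comp_eq E2 rfl k hpr rfl g).symm
  have hqE : Function.Surjective qE := c.top.surj u
  have hqW : Function.Surjective qW := c.factor.top.surj u'
  refine AtiyahDG.exists_divisionData k₁ k₂ c.τ₂_inj c.τ_σ c.τ_inter c.τ_union
    (iE.symm.toRingHom.comp qE) (iE.symm.surjective.comp hqE) (iW.symm.toRingHom.comp qW)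
    (iW.symm.surjective.comp hqW) (hp p₁ c.proj₁ c.τ₁ h₁ k₁ rfl c.proj₁_incl c.toAff_proj₁)
    (hp p₂ c.proj₂ c.τ₂ h₂ k₂ e₂ c.proj₂_incl c.toAff_proj₂) (Set.range fun i =>
      ((affProj (c.τ₁ ∘ c.factor.σ)).stalkMap v).hom ((Aff c.factor.base.dim).presheaf.germ
        c.factor.base.nbhd ((affProj (c.τ₁ ∘ c.factor.σ)).base v) (c.mem u) (c.factor.base.eqn i)))
    ?_ (u := (affProj (c.τ₁ ∘ c.factor.σ)).base v) rfl ?_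
  · refine Eq.trans ?_ (c.ker u)
    ext z
    change iE.symm (qE z) = 0 ↔ qE z = 0
    exact EmbeddingLike.map_eq_zero_iff
  · rintro _ ⟨i, rfl⟩
    exact ⟨_, rfl⟩

end FibreChart

variable {A : Type} [PartialOrder A] {𝒲 : SmoothSystem A}

lemma Diagonal.exists_divisionData (D : Diagonal 𝒲) (a : A) (e : D.E.obj (op a))
    {x : 𝒲.W.obj (op a)} (h₁ : (D.p₁.app (op a)).base e = x) (h₂ : (D.p₂.app (op a)).base e = x) :
    Nonempty (DivisionData (pullAt (D.p₁.app (op a)) h₁) (pullAt (D.p₂.app (op a)) h₂)) := by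
  obtain ⟨c, u, hu⟩ := D.chart a e
  exact c.exists_divisionData u hu h₁ h₂

/-! ### Filtered systems of rings and bases of their limits. -/

section RingSystems

variable {T : Type} [Preorder T]

/-- A directed system of rings over a directed system of objects, together with its limit. -/
structure RingSys (σ : DirSys T) (S : σ.ι → Type) [∀ i, Ring (S i)] (O : Type) [Ring O] where
  ρ : ∀ {i j : σ.ι}, i ≤ j → S i →+* S j
  g : ∀ i, S i →+* O
  g_ρ : ∀ {i j : σ.ι} (h : i ≤ j) a, g j (ρ h a) = g i a
  surj : ∀ a, ∃ i b, g i b = a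
  inj : ∀ {i j : σ.ι} (a : S i) (b : S j), g i a = g j b →
    ∃ (k : σ.ι) (hi : i ≤ k) (hj : j ≤ k), ρ hi a = ρ hj b

variable {σ : DirSys T} {S : σ.ι → Type} [∀ i, Ring (S i)] {O : Type} [Ring O]

lemma RingSys.exists_common (s : RingSys σ S O) (a b : O) :
    ∃ i, ∃ a' b', s.g i a' = a ∧ s.g i b' = b := by
  obtain ⟨i, a, rfl⟩ := s.surj a
  obtain ⟨j, b, rfl⟩ := s.surj b
  obtain ⟨k, hi, hj⟩ := exists_ge_ge i j
  exact ⟨k, s.ρ hi a, s.ρ hj b, s.g_ρ hi a, s.g_ρ hj b⟩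

/-- The limit is known only through the properties of its structure maps, which lets stalks of
sheaves and direct limits be treated alike. The map is defined by choosing representatives and shown
independent of them by `inj`. -/
lemma RingSys.exists_desc (s : RingSys σ S O) {R : Type} [Ring R] (φ : ∀ i, S i →+* R)
    (hφ : ∀ i j (h : i ≤ j) a, φ j (s.ρ h a) = φ i a) :
    ∃ f : O →+* R, ∀ i a, f (s.g i a) = φ i a := by
  choose k a ha using s.surj
  have key : ∀ i b, φ (k (s.g i b)) (a (s.g i b)) = φ i b := by
    intro i b
    obtain ⟨l, h1, h2, e⟩ := s.inj _ _ (ha (s.g i b))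
    rw [← hφ _ l h1, e, hφ]
  obtain ⟨i₀⟩ := σ.nonempty
  refine ⟨
    { toFun := fun b => φ (k b) (a b)
      map_one' := ?_
      map_zero' := ?_
      map_mul' := fun b c => ?_
      map_add' := fun b c => ?_ }, key⟩
  · have := key i₀ 1
    rwa [map_one, map_one] at this
  · obtain ⟨i, b, c, rfl, rfl⟩ := s.exists_common b c
    rw [← map_mul, key, key, key, map_mul]
  · have := key i₀ 0
    rwa [map_zero, map_zero] at this
  · obtain ⟨i, b, c, rfl, rfl⟩ := s.exists_common b c
    rw [← map_add, key, key, key, map_add]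

variable {B : DGAlg T}

lemma RingSys.exists_toStalk (s : RingSys σ S O) (φ : ∀ i, S i →+* B.obj (σ.site i))
    (hφ : ∀ i j (h : i ≤ j) a, φ j (s.ρ h a) = B.res (σ.anti h) (φ i a)) :
    ∃ f : O →+* B.StalkObj σ, ∀ i a, f (s.g i a) = B.germ σ i (φ i a) :=
  s.exists_desc (fun i => (B.germ σ i).comp (φ i)) (fun i j h a => by
    change B.germ σ j (φ j (s.ρ h a)) = B.germ σ i (φ i a)
    rw [hφ, DGAlg.germ_res h])

/-- A compatible system of bases induces a basis of the stalk. -/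
lemma RingSys.isLeftBasis (s : RingSys σ S O) {φ : ∀ i, S i →+* B.obj (σ.site i)}
    (hφ : ∀ i j (h : i ≤ j) a, φ j (s.ρ h a) = B.res (σ.anti h) (φ i a))
    {f : O →+* B.StalkObj σ} (hf : ∀ i a, f (s.g i a) = B.germ σ i (φ i a)) {κ : Type}
    {x : ∀ i, κ → B.obj (σ.site i)} (hb : ∀ i, IsLeftBasis (φ i) (x i))
    (hx : ∀ i j (h : i ≤ j) k, x j k = B.res (σ.anti h) (x i k)) {y : κ → B.StalkObj σ}
    (hy : ∀ i k, y k = B.germ σ i (x i k)) : IsLeftBasis f y := by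
  let F : ∀ i, B.obj (σ.site i) →+ (κ →₀ O) := fun i =>
    (Finsupp.mapRange.addMonoidHom (s.g i).toAddMonoidHom).comp (hb i).repr
  have hF : ∀ i a k, F i (φ i a * x i k) = Finsupp.single k (s.g i a) := by
    intro i a k
    change Finsupp.mapRange.addMonoidHom _ ((hb i).repr (φ i a * x i k)) = _
    rw [(hb i).repr_mul]
    exact Finsupp.mapRange_single (hf := map_zero _)
  -- The coordinates over each index are compatible, so they descend to coordinates on the stalk.
  have hc : ∀ i j (h : i ≤ j) b, F j (B.res (σ.anti h) b) = F i b := by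
    intro i j h b
    refine DFunLike.congr_fun ((hb i).addHom_ext
      (f := (F j).comp (B.res (σ.anti h)).toAddMonoidHom) (g := F i) fun a k => ?_) b
    change F j (B.res _ (φ i a * x i k)) = _
    rw [map_mul, ← hφ i j h, ← hx i j h, hF, hF, s.g_ρ]
  refine isLeftBasis_of_lift (fun b => ?_) (DGAlg.stalkLift F hc) (fun c => ?_)
  · induction b using DGAlg.germ_induction with
    | h i b =>
      induction b using (hb i).induction with
      | zero => rw [map_zero]; exact zero_mem _
      | add b b' h h' => rw [map_add]; exact add_mem h h'
      | mul a k =>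
        refine AddSubgroup.subset_closure ⟨s.g i a, k, ?_⟩
        rw [map_mul, hf, ← hy]
  · have key : ∀ a k, DGAlg.stalkLift F hc (f a * y k) = Finsupp.single k a := by
      intro a k
      obtain ⟨i, a, rfl⟩ := s.surj a
      rw [hf, hy i, ← map_mul]
      exact hF i a k
    rw [Finsupp.sum, map_sum]
    simp only [key]
    exact Finsupp.sum_single c

lemma IsLeftBasis.trans {A₁ A₂ A₃ : Type} [Ring A₁] [Ring A₂] [Ring A₃] {φ : A₁ →+* A₂}
    {ψ : A₂ →+* A₃} {κ lam : Type} {x : κ → A₂} {y : lam → A₃} (hx : IsLeftBasis φ x)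
    (hy : IsLeftBasis ψ y) : IsLeftBasis (ψ.comp φ) fun k : κ × lam => ψ (x k.1) * y k.2 := by
  let F : A₃ →+ (κ × lam →₀ A₁) := hy.lift fun l => hx.lift fun k => Finsupp.singleAddHom (k, l)
  have hF : ∀ a k, F (ψ.comp φ a * (ψ (x k.1) * y k.2)) = Finsupp.single k a := by
    intro a k
    rw [RingHom.comp_apply, ← mul_assoc, ← map_mul, hy.lift_mul, hx.lift_mul]
    rfl
  refine isLeftBasis_of_lift (fun b => ?_) F (fun c => ?_)
  · induction b using hy.induction with
    | zero => exact zero_mem _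
    | add b b' h h' => exact add_mem h h'
    | mul a l =>
      induction a using hx.induction with
      | zero => rw [map_zero, zero_mul]; exact zero_mem _
      | add b b' h h' => rw [map_add, add_mul]; exact add_mem h h'
      | mul a k =>
        exact AddSubgroup.subset_closure ⟨a, (k, l), by rw [map_mul, mul_assoc]; rfl⟩
  · rw [Finsupp.sum, map_sum]
    simp only [hF]
    exact Finsupp.sum_single c

lemma IsLeftBasis.reindex {A₁ A₂ : Type} [Ring A₁] [Ring A₂] {φ : A₁ →+* A₂} {κ lam : Type}
    {x : κ → A₂} (hx : IsLeftBasis φ x) (e : lam ≃ κ) {y : lam → A₂} (hy : ∀ k, y k = x (e k)) :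
    IsLeftBasis φ y := by
  refine isLeftBasis_of_lift (fun b => ?_)
    (hx.lift fun k => Finsupp.singleAddHom (e.symm k)) (fun c => ?_)
  · induction b using hx.induction with
    | zero => exact zero_mem _
    | add b b' h h' => exact add_mem h h'
    | mul a k => exact AddSubgroup.subset_closure ⟨a, e.symm k, by rw [hy, e.apply_symm_apply]⟩
  · rw [Finsupp.sum, map_sum]
    simp only [hy, hx.lift_mul, e.symm_apply_apply, Finsupp.singleAddHom_apply]
    exact Finsupp.sum_single c

end RingSystems

/-! ### Sections near a point of `W` and near the corresponding point of the diagonal. -/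

section SectionSystems

/-- The transition map of `W_a` to itself equals the identity only propositionally; this lemma
removes it from the restriction maps. -/
lemma res_c_app_of_eq_id {X : LocallyRingedSpace.{0}} {f : X ⟶ X} (hf : f = 𝟙 X) {U V : Opens X}
    (h : V ≤ (Opens.map f.base).obj U) (h' : V ≤ U) (s : X.presheaf.obj (op U)) :
    (X.presheaf.map (homOfLE h).op).hom ((f.c.app (op U)).hom s) =
      (X.presheaf.map (homOfLE h').op).hom s := by
  subst hf
  have e : (𝟙 X : X ⟶ X).c.app (op U) = 𝟙 _ := rfl
  rw [e]
  rfl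

variable {A : Type} [PartialOrder A] {𝒲 : SmoothSystem A}

lemma SmoothSystem.tr_refl (𝒲 : SmoothSystem A) {a : A} (h : a ≤ a) : 𝒲.tr h = 𝟙 _ :=
  𝒲.W.map_id (op a)

variable {t : Site 𝒲} {x : 𝒲.W.obj (op t.idx)}

/-- The sections of the structure sheaf near a point and their germs. -/
def oSys (hx : x ∈ t.opn) : RingSys (nb t x hx) (fun i => OSec ((nb t x hx).site i))
    ((𝒲.W.obj (op t.idx)).presheaf.stalk x) where
  ρ h := ORes ((nb t x hx).anti h)
  g i := ((𝒲.W.obj (op t.idx)).presheaf.germ (OrderDual.ofDual i.1) x i.2.1).hom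
  g_ρ {i j} h a :=
    (congrArg (((𝒲.W.obj (op t.idx)).presheaf.germ (OrderDual.ofDual j.1) x j.2.1).hom)
      (res_c_app_of_eq_id (𝒲.tr_refl le_rfl) _ h a)).trans
      ((𝒲.W.obj (op t.idx)).presheaf.germ_res_apply (homOfLE h) x j.2.1 a)
  surj a := exists_germ_cofinal (ι := (nb t x hx).ι) (U := fun i => OrderDual.ofDual i.1)
    (𝒲.W.obj (op t.idx)).presheaf x (fun i => i.2.1)
    (fun V hV => ⟨⟨OrderDual.toDual (V ⊓ t.opn), ⟨hV, hx⟩, inf_le_right⟩, inf_le_left⟩) a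
  inj {i j} a b e := by
    obtain ⟨k, hi, hj, e'⟩ := germ_eq_cofinal (ι := (nb t x hx).ι)
      (U := fun i => OrderDual.ofDual i.1)
      (𝒲.W.obj (op t.idx)).presheaf x (fun i => i.2.1)
      (fun V hV => ⟨⟨OrderDual.toDual (V ⊓ t.opn), ⟨hV, hx⟩, inf_le_right⟩, inf_le_left⟩) e
    exact ⟨k, hi, hj, (res_c_app_of_eq_id (𝒲.tr_refl le_rfl) _ hi a).trans
      (e'.trans (res_c_app_of_eq_id (𝒲.tr_refl le_rfl) _ hj b).symm)⟩

lemma Diagonal.map_refl (D : Diagonal 𝒲) {a : A} (h : a ≤ a) : D.E.map (homOfLE h).op = 𝟙 _ :=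
  D.E.map_id (op a)

lemma Diagonal.exists_point (D : Diagonal 𝒲) (a : A) (x : 𝒲.W.obj (op a)) :
    ∃ e : D.E.obj (op a), (D.p₁.app (op a)).base e = x := by
  have := D.homeo (op a)
  exact ((TopCat.homeoOfIso (asIso (D.p₁.app (op a)).base)).surjective x)

/-- The first projection is a homeomorphism, so the preimages of neighbourhoods of `x` are cofinal
among the neighbourhoods of `e`. -/
lemma Diagonal.cofinal (D : Diagonal 𝒲) (hx : x ∈ t.opn) {e : D.E.obj (op t.idx)}
    (he : (D.p₁.app (op t.idx)).base e = x) (V : Opens (D.E.obj (op t.idx))) (hV : e ∈ V) :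
    ∃ i : (nb t x hx).ι, D.opn ((nb t x hx).site i) ≤ V := by
  have := D.homeo (op t.idx)
  let h := TopCat.homeoOfIso (asIso (D.p₁.app (op t.idx)).base)
  let V' : Set (D.E.obj (op t.idx)) := V
  refine ⟨⟨OrderDual.toDual ((⟨h.symm ⁻¹' V', V.2.preimage h.symm.continuous⟩ :
    Opens (𝒲.W.obj (op t.idx))) ⊓ t.opn), ⟨?_, hx⟩, inf_le_right⟩,
    fun (y : D.E.obj (op t.idx)) hy => ?_⟩
  · change h.symm x ∈ V'
    have e1 : h.symm x = e := by rw [Homeomorph.symm_apply_eq]; exact he.symm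
    rw [e1]; exact hV
  · have h1 : h.symm (h y) ∈ V' := hy.1
    have e1 : h.symm (h y) = y := h.symm_apply_apply y
    rw [e1] at h1
    exact h1

/-- The sections of the germ of the fibre product near a point of the diagonal and their germs. -/
def Diagonal.secSys (D : Diagonal 𝒲) (hx : x ∈ t.opn) {e : D.E.obj (op t.idx)}
    (he : (D.p₁.app (op t.idx)).base e = x) :
    RingSys (nb t x hx) (fun i => D.Sec ((nb t x hx).site i))
      ((D.E.obj (op t.idx)).presheaf.stalk e) where
  ρ h := D.res ((nb t x hx).anti h)
  g i := ((D.E.obj (op t.idx)).presheaf.germ (D.opn ((nb t x hx).site i)) e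
    (show (D.p₁.app (op t.idx)).base e ∈ OrderDual.ofDual i.1 from he ▸ i.2.1)).hom
  g_ρ {i j} h a :=
    (congrArg (((D.E.obj (op t.idx)).presheaf.germ (D.opn ((nb t x hx).site j)) e _).hom)
      (res_c_app_of_eq_id (D.map_refl le_rfl) _ (fun y hy => h hy) a)).trans
      ((D.E.obj (op t.idx)).presheaf.germ_res_apply (homOfLE (fun y hy => h hy)) e _ a)
  surj a := exists_germ_cofinal (ι := (nb t x hx).ι) (U := fun i => D.opn ((nb t x hx).site i))
    (D.E.obj (op t.idx)).presheaf e _ (D.cofinal hx he) a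
  inj {i j} a b e' := by
    obtain ⟨k, hi, hj, e'⟩ := germ_eq_cofinal (ι := (nb t x hx).ι)
      (U := fun i => D.opn ((nb t x hx).site i))
      (D.E.obj (op t.idx)).presheaf e
      (fun i => show (D.p₁.app (op t.idx)).base e ∈ OrderDual.ofDual i.1 from he ▸ i.2.1)
      (D.cofinal hx he) e'
    -- Inclusions between preimages come from inclusions in `W_a`, as the first projection is
    -- surjective.
    have mono : ∀ l : (nb t x hx).ι, D.opn ((nb t x hx).site k) ≤ D.opn ((nb t x hx).site l) →
        l ≤ k := by
      intro l hl y hy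
      obtain ⟨e₁, rfl⟩ := D.exists_point t.idx y
      exact hl hy
    exact ⟨k, mono i hi, mono j hj, (res_c_app_of_eq_id (D.map_refl le_rfl) _ hi a).trans
      (e'.trans (res_c_app_of_eq_id (D.map_refl le_rfl) _ hj b).symm)⟩

end SectionSystems

/-- Finite sequences of generators in weakly increasing order, in which generators of odd degree
are not repeated. -/
def SortedMon {K : Type} [LinearOrder K] (P : K → Prop) (deg : K → ℤ) : Type :=
  {l : List {g : K // P g} // l.Pairwise fun a b => a.1 < b.1 ∨ (a.1 = b.1 ∧ Even (deg a.1))}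

/-- The structure of the stalk of the enveloping algebra of a free DG algebra at a point. -/
structure EnvData {R S : DGAlg PUnit} (j₁ j₂ : DGAlg.Hom R S) where
  O : Type
  [ringO : CommRing O]
  C : Type
  [ringC : CommRing C]
  o : O →+* R.obj ⟨⟩
  p : O →+* C
  p₂ : O →+* C
  ι : C →+* S.obj ⟨⟩
  j₁_o : ∀ a, j₁.map ⟨⟩ (o a) = ι (p a)
  j₂_o : ∀ a, j₂.map ⟨⟩ (o a) = ι (p₂ a)
  o_mem : ∀ a, o a ∈ R.gr ⟨⟩ 0
  ι_mem : ∀ c, ι c ∈ S.gr ⟨⟩ 0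
  isUnit_two : IsUnit (2 : O)
  division : DivisionData p p₂
  K : Type
  [order : LinearOrder K]
  P : K → Prop
  deg : K → ℤ
  deg_neg : ∀ g, deg g < 0
  x : {g // P g} → R.obj ⟨⟩
  x_mem : ∀ g, x g ∈ R.gr ⟨⟩ (deg g.1)
  free : IsLeftBasis o fun l : SortedMon P deg => (l.1.map x).prod
  basis : IsLeftBasis ι fun l : SortedMon P deg × SortedMon P deg =>
    j₁.map ⟨⟩ (l.1.1.map x).prod * j₂.map ⟨⟩ (l.2.1.map x).prod

attribute [instance] EnvData.ringO EnvData.ringC EnvData.order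

/-! ### The structure of the stalks of the enveloping algebra. -/

section EnvelopingStalk

variable {A : Type} [PartialOrder A] {𝒲 : SmoothSystem A}

/-- Graded commutativity only gives `2 x² = 0` for `x` of odd degree; `x² = 0` requires `2` to be
invertible. -/
lemma Aff.isUnit_two {N : ℕ} (v : Aff N) : IsUnit (2 : (Aff N).presheaf.stalk v) := by
  obtain ⟨φ, hφ⟩ := IsGerm.const v (1 / 2)
  refine IsUnit.of_mul_eq_one φ ?_
  rw [two_mul]
  refine (hφ.add hφ).unique ((IsGerm.one).congr (Filter.Eventually.of_forall fun _ => ?_))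
  norm_num

lemma SmoothSystem.isUnit_two (a : A) (w : 𝒲.W.obj (op a)) :
    IsUnit (2 : (𝒲.W.obj (op a)).presheaf.stalk w) := by
  obtain ⟨c, u, hu⟩ := 𝒲.smooth a w
  have := c.top.isOpen
  have h1 := (Aff.isUnit_two (c.top.toAff.base u)).map (pullAt c.top.toAff rfl)
  have h2 := h1.map (RingEquiv.ofBijective (pullAt c.top.incl hu)
    (pullAt_bijective c.top.incl hu)).symm
  rwa [map_ofNat, map_ofNat] at h2

variable {ℛ : FreeAlg 𝒲} (𝒮 : Enveloping ℛ) {t : Site 𝒲} {x : 𝒲.W.obj (op t.idx)}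
  (hx : x ∈ t.opn)

lemma Diagonal.base_eq_apply (D : Diagonal 𝒲) (a : A) (e : D.E.obj (op a)) :
    (D.p₂.app (op a)).base e = (D.p₁.app (op a)).base e := by
  rw [D.base_eq]

/-- Which generators are defined over an open set depends only on the index `a`, not on the open
set, so one set of monomials serves all neighbourhoods of the point. -/
lemma Generators.germ_val {B : DGAlg (Site 𝒲)} (gens : Generators B) (i : (nb t x hx).ι)
    (l : gens.Mon t) :
    B.germ (nb t x hx) i (gens.val ((nb t x hx).site i) l) =
      (l.1.map fun g => B.germ (nb t x hx) (nbTop t x hx) (gens.elt g.1 _ g.2)).prod := by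
  change B.germ (nb t x hx) i ((l.1.map fun g => gens.elt g.1 ((nb t x hx).site i) g.2).prod) = _
  rw [map_list_prod, List.map_map]
  congr 1
  refine List.map_congr_left fun g _ => ?_
  exact (congrArg (B.germ (nb t x hx) i)
    (gens.res g.1 ((nb t x hx).anti (nb_le_top t x hx i)) g.2).symm).trans
    (DGAlg.germ_res (R := B) (nb_le_top t x hx i)
      (gens.elt g.1 ((nb t x hx).site (nbTop t x hx)) g.2))

lemma Generators.res_val {B : DGAlg (Site 𝒲)} (gens : Generators B) {i j : (nb t x hx).ι}
    (h : i ≤ j) (l : gens.Mon t) :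
    gens.val ((nb t x hx).site j) l =
      B.res ((nb t x hx).anti h) (gens.val ((nb t x hx).site i) l) := by
  change (l.1.map fun g => gens.elt g.1 ((nb t x hx).site j) g.2).prod =
    B.res ((nb t x hx).anti h) ((l.1.map fun g => gens.elt g.1 ((nb t x hx).site i) g.2).prod)
  rw [map_list_prod, List.map_map]
  congr 1
  refine List.map_congr_left fun g _ => ?_
  exact (gens.res g.1 ((nb t x hx).anti h) g.2).symm

/-- The system of rings underlying a presheaf of DG rings. -/
def DGAlg.ringSys {T : Type} [Preorder T] (B : DGAlg T) (σ : DirSys T) :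
    RingSys σ (fun i => B.obj (σ.site i)) (B.StalkObj σ) where
  ρ h := B.res (σ.anti h)
  g := B.germ σ
  g_ρ h a := DGAlg.germ_res h a
  surj a := by
    induction a using DGAlg.germ_induction with
    | h i a => exact ⟨i, a, rfl⟩
  inj {i j} a b e := by
    obtain ⟨k, hi, hj⟩ := exists_ge_ge i j
    rw [← DGAlg.germ_res hi, ← DGAlg.germ_res hj, ← sub_eq_zero, ← map_sub] at e
    obtain ⟨l, hl, e⟩ := DGAlg.germ_eq_zero e
    rw [map_sub, B.res_trans, B.res_trans, sub_eq_zero] at e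
    exact ⟨l, hi.trans hl, hj.trans hl, e⟩

/-- The coefficient rings are the local rings of `W_a` at `x` and of the fibre product at the point
`e` above it. Freeness of sections over each neighbourhood passes to the limit, and the division
operators come from a fibre chart at `e`. -/
lemma Enveloping.exists_envData :
    Nonempty (EnvData (DGAlg.stalkHom 𝒮.j₁ (nb t x hx)) (DGAlg.stalkHom 𝒮.j₂ (nb t x hx))) := by
  obtain ⟨e, he⟩ := 𝒮.diag.exists_point t.idx x
  have he₂ := (𝒮.diag.base_eq_apply t.idx e).trans he
  obtain ⟨D⟩ := 𝒮.diag.exists_divisionData t.idx e he he₂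
  have hφ : ∀ i j (h : i ≤ j) a, ℛ.o _ ((oSys hx).ρ h a) =
    ℛ.R.res ((nb t x hx).anti h) (ℛ.o _ a) := fun i j h a => (ℛ.o_res _ a).symm
  obtain ⟨o, ho⟩ := (oSys hx).exists_toStalk (B := ℛ.R) (fun i => ℛ.o _) hφ
  have hψ : ∀ i j (h : i ≤ j) a, 𝒮.o _ ((𝒮.diag.secSys hx he).ρ h a) =
    𝒮.S.res ((nb t x hx).anti h) (𝒮.o _ a) := fun i j h a => (𝒮.o_res _ a).symm
  obtain ⟨ι, hι⟩ := (𝒮.diag.secSys hx he).exists_toStalk (B := 𝒮.S) (fun i => 𝒮.o _) hψ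
  refine ⟨
    { O := (𝒲.W.obj (op t.idx)).presheaf.stalk x
      C := (𝒮.diag.E.obj (op t.idx)).presheaf.stalk e
      o := o
      p := pullAt _ he
      p₂ := pullAt _ he₂
      ι := ι
      j₁_o := fun a => ?_
      j₂_o := fun a => ?_
      o_mem := fun a => ?_
      ι_mem := fun c => ?_
      isUnit_two := SmoothSystem.isUnit_two t.idx x
      division := D
      K := ℛ.gens.G
      P := fun g => ℛ.gens.simplex g ≤ t.idx
      deg := ℛ.gens.deg
      deg_neg := ℛ.gens.deg_neg
      x := fun g => ℛ.R.germ _ (nbTop t x hx) (ℛ.gens.elt g.1 _ g.2)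
      x_mem := fun g => DGAlg.germ_mem (ℛ.gens.mem _ _ _)
      free := (oSys hx).isLeftBasis hφ ho (x := fun i (k : ℛ.gens.Mon t) =>
          ℛ.gens.val ((nb t x hx).site i) k) (fun i => ℛ.free _)
        (fun i j h k => ℛ.gens.res_val hx h k) (fun i k => (ℛ.gens.germ_val hx i k).symm)
      basis := (𝒮.diag.secSys hx he).isLeftBasis hψ hι
        (x := fun i (k : ℛ.gens.Mon t × ℛ.gens.Mon t) =>
          𝒮.j₁.map ((nb t x hx).site i) (ℛ.gens.val ((nb t x hx).site i) k.1) *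
            𝒮.j₂.map ((nb t x hx).site i) (ℛ.gens.val ((nb t x hx).site i) k.2))
        (fun i => 𝒮.basis _ _ _ (ℛ.free _)) (fun i j h k => ?_) (fun i k => ?_) }⟩
  · obtain ⟨i, a, rfl⟩ := (oSys hx).surj a
    refine (congrArg ((DGAlg.stalkHom 𝒮.j₁ (nb t x hx)).map ⟨⟩) (ho i a)).trans ?_
    refine (congrArg (𝒮.S.germ _ i) (𝒮.j₁_o _ a)).trans ((hι i _).symm.trans (congrArg ι ?_))
    exact (pullAt_germ _ he _ i.2.1 _ a).symm
  · obtain ⟨i, a, rfl⟩ := (oSys hx).surj a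
    refine (congrArg ((DGAlg.stalkHom 𝒮.j₂ (nb t x hx)).map ⟨⟩) (ho i a)).trans ?_
    refine (congrArg (𝒮.S.germ _ i) (𝒮.j₂_o _ a)).trans ((hι i _).symm.trans (congrArg ι ?_))
    refine Eq.trans ?_ (pullAt_germ _ he₂ _ i.2.1 (by
      change (𝒮.diag.p₂.app (op t.idx)).base e ∈ OrderDual.ofDual i.1
      rw [he₂]; exact i.2.1) a).symm
    exact (𝒮.diag.E.obj (op t.idx)).presheaf.germ_res_apply
      (homOfLE (𝒮.diag.opn_eq ((nb t x hx).site i)).le) e _ _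
  · obtain ⟨i, a, rfl⟩ := (oSys hx).surj a
    exact ⟨i, _, ℛ.o_mem _ a, ho i a⟩
  · obtain ⟨i, a, rfl⟩ := (𝒮.diag.secSys hx he).surj c
    exact ⟨i, _, 𝒮.o_mem _ a, hι i a⟩
  · rw [ℛ.gens.res_val hx h, ℛ.gens.res_val hx h, 𝒮.j₁.map_res, 𝒮.j₂.map_res, map_mul]
  · rw [map_mul]
    exact congrArg₂ (· * ·)
      (congrArg ((DGAlg.stalkHom 𝒮.j₁ (nb t x hx)).map ⟨⟩) (ℛ.gens.germ_val hx i k.1).symm)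
      (congrArg ((DGAlg.stalkHom 𝒮.j₂ (nb t x hx)).map ⟨⟩) (ℛ.gens.germ_val hx i k.2).symm)

end EnvelopingStalk

/-! ### Degrees of monomials. -/

section SortedMonomials

lemma DGAlg.list_prod_mem {T : Type} [Preorder T] (R : DGAlg T) {t : T} {G : Type} {x : G → R.obj t}
    {w : G → ℤ} (hx : ∀ g, x g ∈ R.gr t (w g)) (l : List G) :
    (l.map x).prod ∈ R.gr t (l.map w).sum := by
  induction l with
  | nil => exact R.one_mem t
  | cons g l ih =>
    simp only [List.map_cons, List.prod_cons, List.sum_cons]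
    exact R.mul_mem t (hx g) ih

lemma list_sum_nonpos {G : Type} {w : G → ℤ} (hw : ∀ g, w g < 0) (l : List G) :
    (l.map w).sum ≤ 0 := by
  induction l with
  | nil => exact le_rfl
  | cons g l ih =>
    simp only [List.map_cons, List.sum_cons]
    have := hw g
    omega

end SortedMonomials

/-! ### Koszul data on the stalks of the resolution. -/

section KoszulStalk

variable {A : Type} [PartialOrder A] {𝒲 : SmoothSystem A} {ℛ : FreeAlg 𝒲} {𝒮 : Enveloping ℛ}
  (ℬ : FreeResolution 𝒮) {t : Site 𝒲} {x : 𝒲.W.obj (op t.idx)} (hx : x ∈ t.opn)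

lemma FreeResolution.isLeftBasis_stalk :
    IsLeftBasis ((DGAlg.stalkHom ℬ.φ (nb t x hx)).map ⟨⟩) fun k : ℬ.gens.Mon t =>
      (show (ℬ.B.stalk (nb t x hx)).obj ⟨⟩ from
        ℬ.B.germ (nb t x hx) (nbTop t x hx) (ℬ.gens.val ((nb t x hx).site (nbTop t x hx)) k)) :=
  (𝒮.S.ringSys (nb t x hx)).isLeftBasis (B := ℬ.B) (φ := fun i => ℬ.φ.map ((nb t x hx).site i))
    (fun i j h a => ℬ.φ.map_res _ a) (fun i a => DGAlg.stalkHom_germ ℬ.φ i a)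
    (x := fun i (k : ℬ.gens.Mon t) => ℬ.gens.val ((nb t x hx).site i) k)
    (fun i => ℬ.free _) (fun i j h k => ℬ.gens.res_val hx h k)
    (fun i k => by
      have h1 := DGAlg.germ_res (R := ℬ.B) (nb_le_top t x hx i)
        (ℬ.gens.val ((nb t x hx).site (nbTop t x hx)) k)
      have h2 := ℬ.gens.res_val hx (nb_le_top t x hx i) k
      exact h1.symm.trans (congrArg (ℬ.B.germ (nb t x hx) i) h2.symm))

/-- `B` is free over `S`, and `S` is free over `C` on products of left and right monomials.
Splitting off the left monomials exhibits `B` as free over `R ⊗ 1` extended to `C`, with the right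
monomials times those of `B` as the `e_j`. -/
lemma FreeResolution.exists_koszulData :
    Nonempty (KoszulData (DGAlg.stalkHom ℬ.l (nb t x hx)) (DGAlg.stalkHom ℬ.ν (nb t x hx))) := by
  obtain ⟨D⟩ := 𝒮.exists_envData hx
  set σ := nb t x hx with hσ
  let Φ := (DGAlg.stalkHom ℬ.φ σ).map ⟨⟩
  have l_eq : ∀ a, (DGAlg.stalkHom ℬ.l σ).map ⟨⟩ a = Φ ((DGAlg.stalkHom 𝒮.j₁ σ).map ⟨⟩ a) := by
    intro a
    induction a using DGAlg.germ_induction with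
    | h i a => rfl
  have ν_eq₁ : ∀ a, (DGAlg.stalkHom ℬ.ν σ).map ⟨⟩ (Φ ((DGAlg.stalkHom 𝒮.j₁ σ).map ⟨⟩ a)) = a := by
    intro a
    induction a using DGAlg.germ_induction with
    | h i a => exact congrArg (ℛ.R.germ σ i) (ℬ.ν_l _ a)
  have ν_eq₂ : ∀ a, (DGAlg.stalkHom ℬ.ν σ).map ⟨⟩ (Φ ((DGAlg.stalkHom 𝒮.j₂ σ).map ⟨⟩ a)) = a := by
    intro a
    induction a using DGAlg.germ_induction with
    | h i a => exact congrArg (ℛ.R.germ σ i) (ℬ.ν_r _ a)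
  refine ⟨
    { O := D.O
      C := D.C
      o := D.o
      p := D.p
      ι := Φ.comp D.ι
      l_o := fun a => (l_eq _).trans (congrArg Φ (D.j₁_o a))
      o_mem := D.o_mem
      ι_mem := fun c => (DGAlg.stalkHom ℬ.φ σ).map_mem ⟨⟩ (D.ι_mem c)
      X := SortedMon D.P D.deg
      x := fun l => (l.1.map D.x).prod
      degX := fun l => (l.1.map fun g => D.deg g.1).sum
      degX_le := fun l => list_sum_nonpos (fun g : {g // D.P g} => D.deg_neg g.1) _
      x_mem := fun l => DGAlg.list_prod_mem _ D.x_mem _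
      basisX := D.free
      J := SortedMon D.P D.deg × ℬ.gens.Mon t
      e := fun k => Φ ((DGAlg.stalkHom 𝒮.j₂ σ).map ⟨⟩ (k.1.1.map D.x).prod) *
        (show (ℬ.B.stalk σ).obj ⟨⟩ from
          ℬ.B.germ σ (nbTop t x hx) (ℬ.gens.val (σ.site (nbTop t x hx)) k.2))
      deg := fun k => (k.1.1.map fun g => D.deg g.1).sum + ℬ.gens.degree k.2
      deg_le := fun k => add_nonpos (list_sum_nonpos (fun g : {g // D.P g} => D.deg_neg g.1) _)
        (ℬ.gens.degree_nonpos _)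
      e_mem := fun k => (ℬ.B.stalk σ).mul_mem ⟨⟩ ((DGAlg.stalkHom ℬ.φ σ).map_mem ⟨⟩
        ((DGAlg.stalkHom 𝒮.j₂ σ).map_mem ⟨⟩ (DGAlg.list_prod_mem _ D.x_mem _)))
        ⟨nbTop t x hx, _, ℬ.gens.val_mem _, rfl⟩
      -- Reassociates the index: (left, right) monomial and monomial of `B` becomes left monomial
      -- and (right, monomial of `B`).
      basis := (D.basis.trans (ℬ.isLeftBasis_stalk hx)).reindex
        (Equiv.prodAssoc _ _ _).symm (fun k => ?_)
      I := D.division.I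
      fintypeI := D.division.fintype
      t := fun i => D.p₂ (D.division.z i) - D.p (D.division.z i)
      δ := D.division.δ
      δ_p := D.division.δ_p
      δ_self := D.division.δ_self
      δ_ne := D.division.δ_ne
      gen := D.division.gen
      ν_t := fun i => ?_
      ν_l := fun a => (congrArg _ (l_eq a)).trans (ν_eq₁ a)
      acyclic := (isQuasiIso_iff_stalkAcyclic.1 ℬ.quasiIso) t x hx }⟩
  · refine (congrArg₂ (· * ·) (l_eq _) rfl).trans ?_
    refine (mul_assoc _ _ _).symm.trans (congrArg₂ (· * ·) (map_mul Φ _ _).symm rfl)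
  · change (DGAlg.stalkHom ℬ.ν σ).map ⟨⟩ (Φ (D.ι (_ - _))) = 0
    rw [map_sub, ← D.j₁_o, ← D.j₂_o, map_sub, map_sub, ν_eq₁, ν_eq₂, sub_self]

end KoszulStalk

/-! ### Normal forms of words in graded-commuting elements. -/

section NormalForm

variable {G : Type} {w : G → ℤ}

/-- The relations between the generators of a graded-commutative ring. -/
structure GradedCommuting {T : Type} [Ring T] (w : G → ℤ) (t : G → T) : Prop where
  comm : ∀ g h, t g * t h = ksign (w g * w h) • (t h * t g)
  sq : ∀ g, ¬ Even (w g) → t g * t g = 0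

variable [LinearOrder G]

/-- Insertion of one letter into a sorted word. The coefficient and the sorted word are chosen
before the ring: the same normal form then holds in the source and in the target of a homomorphism
to be constructed. -/
lemma exists_sorted_insert (g : G) (m : List G)
    (hm : m.Pairwise fun a b => a < b ∨ (a = b ∧ Even (w a))) :
    ∃ (ε : ℤ) (m' : List G), m'.Pairwise (fun a b => a < b ∨ (a = b ∧ Even (w a))) ∧
      (∀ a ∈ m', a = g ∨ a ∈ m) ∧ ∀ (T : Type) [Ring T] (t : G → T), GradedCommuting w t →
        t g * (m.map t).prod = ε • (m'.map t).prod := by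
  induction m with
  | nil => exact ⟨1, [g], by simp, by simp, by simp⟩
  | cons h m ih =>
    obtain ⟨hh, hm'⟩ := List.pairwise_cons.1 hm
    have hle : ∀ a ∈ h :: m, h ≤ a := by
      intro a ha
      rcases List.mem_cons.1 ha with rfl | ha
      · exact le_rfl
      · rcases hh a ha with h1 | h1
        · exact h1.le
        · exact h1.1.le
    rcases lt_trichotomy g h with hg | rfl | hg
    · refine ⟨1, g :: h :: m, List.pairwise_cons.2 ⟨fun a ha => Or.inl (hg.trans_le (hle a ha)),
        hm⟩, fun a ha => List.mem_cons.1 ha, fun T _ t _ => by simp⟩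
    · by_cases he : Even (w g)
      · refine ⟨1, g :: g :: m, List.pairwise_cons.2 ⟨fun a ha => ?_, hm⟩,
          fun a ha => List.mem_cons.1 ha, fun T _ t _ => by simp⟩
        rcases (hle a ha).lt_or_eq with h1 | h1
        · exact Or.inl h1
        · exact Or.inr ⟨h1, he⟩
      -- A repeated odd letter makes the product zero; the coefficient is `0` and the word is
      -- irrelevant.
      · refine ⟨0, [], List.Pairwise.nil, by simp, fun T _ t ht => ?_⟩
        rw [List.map_cons, List.prod_cons, ← mul_assoc, ht.sq g he, zero_mul, zero_smul]
    · obtain ⟨ε, m', h1, h2, h3⟩ := ih hm'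
      refine ⟨ksign (w g * w h) * ε, h :: m', List.pairwise_cons.2 ⟨fun a ha => ?_, h1⟩,
        fun a ha => ?_, fun T _ t ht => ?_⟩
      · rcases h2 a ha with rfl | ha
        · exact Or.inl hg
        · exact hh a ha
      · rcases List.mem_cons.1 ha with rfl | ha
        · exact Or.inr (by simp)
        · rcases h2 a ha with rfl | ha
          · exact Or.inl rfl
          · exact Or.inr (by simp [ha])
      · rw [List.map_cons, List.prod_cons, ← mul_assoc, ht.comm, smul_mul_assoc, mul_assoc, h3 T t ht,
          mul_smul_comm, smul_smul, List.map_cons, List.prod_cons]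

/-- Every word in graded-commuting elements is a multiple of a sorted monomial. -/
lemma exists_sorted (l : List G) :
    ∃ (ε : ℤ) (m : List G), m.Pairwise (fun a b => a < b ∨ (a = b ∧ Even (w a))) ∧
      ∀ (T : Type) [Ring T] (t : G → T), GradedCommuting w t →
        (l.map t).prod = ε • (m.map t).prod := by
  induction l with
  | nil => exact ⟨1, [], List.Pairwise.nil, fun T _ t _ => by simp⟩
  | cons g l ih =>
    obtain ⟨ε, m, h1, h2⟩ := ih
    obtain ⟨ε', m', h1', -, h2'⟩ := exists_sorted_insert g m h1
    refine ⟨ε * ε', m', h1', fun T _ t ht => ?_⟩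
    rw [List.map_cons, List.prod_cons, h2 T t ht, mul_smul_comm, h2' T t ht, smul_smul]

end NormalForm

/-! ### The universal property of free graded-commutative rings. -/

section FreeRing

variable {K : Type} [LinearOrder K] {P : K → Prop} {deg : K → ℤ} {A B : Type} [Ring A] [Ring B]
  {φ : A →+* B} {x : {g // P g} → B}

lemma IsLeftBasis.ring_induction
    (hb : IsLeftBasis φ fun l : SortedMon P deg => (l.1.map x).prod) {p : B → Prop}
    (base : ∀ a, p (φ a)) (gen : ∀ g, p (x g)) (mul : ∀ b b', p b → p b' → p (b * b'))
    (add : ∀ b b', p b → p b' → p (b + b')) (b : B) : p b := by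
  have h1 : p 1 := by simpa using base 1
  induction b using hb.induction with
  | zero => simpa using base 0
  | add b b' h h' => exact add _ _ h h'
  | mul a l =>
    refine mul _ _ (base a) ?_
    generalize l.1 = l
    induction l with
    | nil => exact h1
    | cons g l ih => rw [List.map_cons, List.prod_cons]; exact mul _ _ (gen g) ih

/-- The universal property of a free graded-commutative ring. -/
lemma IsLeftBasis.exists_ringHom
    (hb : IsLeftBasis φ fun l : SortedMon P deg => (l.1.map x).prod)
    (hx : GradedCommuting (fun g => deg g.1) x) (hφ : ∀ a b, φ a * b = b * φ a) {T : Type} [Ring T]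
    (f : A →+* T) (t : {g // P g} → T) (ht : GradedCommuting (fun g => deg g.1) t)
    (hf : ∀ a g, f a * t g = t g * f a) :
    ∃ F : B →+* T, (∀ a, F (φ a) = f a) ∧ ∀ g, F (x g) = t g := by
  let F : B →+ T := hb.lift fun l => (AddMonoidHom.mulRight (l.1.map t).prod).comp f.toAddMonoidHom
  have hF₀ : ∀ a (l : SortedMon P deg), F (φ a * (l.1.map x).prod) = f a * (l.1.map t).prod :=
    fun a l => hb.lift_mul _ a l
  -- The formula passes from sorted monomials to arbitrary words, because both sides are reordered
  -- with the same coefficient. Multiplicativity then amounts to concatenation of words.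
  have hF : ∀ a (l : List {g // P g}), F (φ a * (l.map x).prod) = f a * (l.map t).prod := by
    intro a l
    obtain ⟨ε, m, hm, h⟩ := exists_sorted (w := fun g : {g // P g} => deg g.1) l
    rw [h B x hx, h T t ht, mul_smul_comm, mul_smul_comm, map_zsmul]
    exact congrArg _ (hF₀ a ⟨m, hm.imp fun h => by
      rcases h with h | ⟨rfl, h⟩
      · exact Or.inl h
      · exact Or.inr ⟨rfl, h⟩⟩)
  have hft : ∀ a (l : List {g // P g}), f a * (l.map t).prod = (l.map t).prod * f a := by
    intro a l
    induction l with
    | nil => simp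
    | cons g l ih => rw [List.map_cons, List.prod_cons, ← mul_assoc, hf, mul_assoc, ih, mul_assoc]
  have h1 : F 1 = 1 := by simpa using hF 1 []
  have hmul : ∀ b b', F (b * b') = F b * F b' := by
    intro b b'
    induction b using hb.induction with
    | zero => simp
    | add b c h h' => rw [add_mul, map_add, map_add, h, h', add_mul]
    | mul a l =>
      induction b' using hb.induction with
      | zero => simp
      | add b c h h' => rw [mul_add, map_add, map_add, h, h', mul_add]
      | mul a' l' =>
        have e : φ a * (l.1.map x).prod * (φ a' * (l'.1.map x).prod) =
            φ (a * a') * ((l.1 ++ l'.1).map x).prod := by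
          rw [List.map_append, List.prod_append, map_mul, mul_assoc, ← mul_assoc _ (φ a'), ← hφ a']
          simp only [mul_assoc]
        rw [e, hF, hF, hF, List.map_append, List.prod_append, map_mul, mul_assoc,
          mul_assoc, ← mul_assoc (f a'), hft a']
        simp only [mul_assoc]
  refine ⟨{ F with map_one' := h1, map_mul' := hmul }, fun a => ?_, fun g => ?_⟩
  · simpa using hF a []
  · simpa using hF 1 [g]

end FreeRing

/-! ### Sign twists, and the universal property of the enveloping algebra. -/

section Twist

variable {R : DGAlg PUnit}

lemma DGAlg.eps_one : R.eps ⟨⟩ 1 = 1 := by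
  rw [R.eps_apply (R.one_mem ⟨⟩), ksign_zero, one_smul]

/-- The ring automorphism that multiplies an element of degree `j` by `(-1)^{nj}`. -/
def DGAlg.twist (R : DGAlg PUnit) (n : ℤ) : R.obj ⟨⟩ →+* R.obj ⟨⟩ :=
  open Classical in
  if Even n then RingHom.id _ else
    { R.eps ⟨⟩ with
      map_one' := DGAlg.eps_one
      map_mul' := R.eps_mul ⟨⟩ }

lemma ksign_mul_even {n : ℤ} (hn : Even n) (j : ℤ) : ksign (n * j) = 1 := by
  simp [ksign, Int.negOnePow_even _ (hn.mul_right j)]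

lemma ksign_mul_odd {n : ℤ} (hn : ¬ Even n) (j : ℤ) : ksign (n * j) = ksign j := by
  obtain ⟨k, rfl⟩ := Int.not_even_iff_odd.1 hn
  rw [add_mul, ksign_add, ksign_mul_even (even_two_mul k), one_mul, one_mul]

lemma DGAlg.twist_apply (n : ℤ) {j : ℤ} {b : R.obj ⟨⟩} (hb : b ∈ R.gr ⟨⟩ j) :
    R.twist n b = ksign (n * j) • b := by
  by_cases hn : Even n
  · rw [DGAlg.twist, if_pos hn, ksign_mul_even hn, one_smul]; rfl
  · rw [DGAlg.twist, if_neg hn, ksign_mul_odd hn]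
    exact R.eps_apply hb

lemma DGAlg.twist_zero (b : R.obj ⟨⟩) : R.twist 0 b = b := by
  rw [DGAlg.twist, if_pos Even.zero]; rfl

lemma DGAlg.mul_twist {i : ℤ} {a : R.obj ⟨⟩} (ha : a ∈ R.gr ⟨⟩ i) (b : R.obj ⟨⟩) :
    b * a = a * R.twist i b := by
  refine gr_induction (R.internal ⟨⟩) (p := fun b => b * a = a * R.twist i b) ?_ (by simp) ?_ b
  · intro j b hb
    rw [R.twist_apply i hb, mul_smul_comm, R.comm ⟨⟩ hb ha, mul_comm i j]
  · intro x y hx hy; rw [add_mul, map_add, mul_add, hx, hy]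

lemma DGAlg.twist_mul {i : ℤ} {a : R.obj ⟨⟩} (ha : a ∈ R.gr ⟨⟩ i) (b : R.obj ⟨⟩) :
    a * b = R.twist i b * a := by
  refine gr_induction (R.internal ⟨⟩) (p := fun b => a * b = R.twist i b * a) ?_ (by simp) ?_ b
  · intro j b hb
    rw [R.twist_apply i hb, smul_mul_assoc, R.comm ⟨⟩ ha hb]
  · intro x y hx hy; rw [mul_add, map_add, add_mul, hx, hy]

lemma DGAlg.Hom.map_twist {S : DGAlg PUnit} (f : DGAlg.Hom R S) (n : ℤ) (b : R.obj ⟨⟩) :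
    f.map ⟨⟩ (R.twist n b) = S.twist n (f.map ⟨⟩ b) := by
  refine gr_induction (R.internal ⟨⟩) (p := fun b => f.map ⟨⟩ (R.twist n b) =
    S.twist n (f.map ⟨⟩ b)) ?_ (by simp) ?_ b
  · intro j b hb
    rw [R.twist_apply n hb, map_zsmul, S.twist_apply n (f.map_mem ⟨⟩ hb)]
  · intro x y hx hy; simp only [map_add, hx, hy]

end Twist

namespace EnvData

variable {R S : DGAlg PUnit} {j₁ j₂ : DGAlg.Hom R S} (D : EnvData j₁ j₂)

lemma ind {p : S.obj ⟨⟩ → Prop} (zero : p 0) (mul : ∀ c a b, p (D.ι c * (j₁.map ⟨⟩ a * j₂.map ⟨⟩ b)))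
    (add : ∀ s s', p s → p s' → p (s + s')) (s : S.obj ⟨⟩) : p s := by
  induction s using D.basis.induction with
  | zero => exact zero
  | mul c k => exact mul c _ _
  | add s s' h h' => exact add _ _ h h'

/-- For `x` of odd degree, graded commutativity gives `x² = -x²`, and `2` is invertible in `O`. -/
lemma gradedCommuting : GradedCommuting (fun g => D.deg g.1) D.x where
  comm g h := R.comm ⟨⟩ (D.x_mem g) (D.x_mem h)
  sq g hg := by
    have h1 := R.comm ⟨⟩ (D.x_mem g) (D.x_mem g)
    rw [ksign_mul_odd hg, ← mul_one (D.deg g.1), ksign_mul_odd hg, ksign_one, neg_smul, one_smul] at h1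
    obtain ⟨u, hu⟩ := D.isUnit_two.exists_left_inv
    have h2 : D.o 2 * (D.x g * D.x g) = 0 := by
      rw [map_ofNat, two_mul]
      nth_rewrite 1 [h1]
      exact neg_add_cancel _
    rw [← one_mul (D.x g * D.x g), ← map_one D.o, ← hu, map_mul, mul_assoc, h2, mul_zero]

lemma o_comm (a : D.O) (b : R.obj ⟨⟩) : D.o a * b = b * D.o a := DGAlg.mul_comm_zero (D.o_mem a) b

lemma ι_comm (c : D.C) (s : S.obj ⟨⟩) : D.ι c * s = s * D.ι c := DGAlg.mul_comm_zero (D.ι_mem c) s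

/-- The universal property of the enveloping algebra. -/
lemma exists_ringHom {T : Type} [Ring T] (f : D.C →+* T) (F₁ F₂ : R.obj ⟨⟩ →+* T)
    (h₁ : ∀ a, F₁ (D.o a) = f (D.p a)) (h₂ : ∀ a, F₂ (D.o a) = f (D.p₂ a))
    (c₁ : ∀ c a, f c * F₁ a = F₁ a * f c) (c₂ : ∀ c a, f c * F₂ a = F₂ a * f c)
    (c₁₂ : ∀ i, ∀ a ∈ R.gr ⟨⟩ i, ∀ b, F₂ b * F₁ a = F₁ a * F₂ (R.twist i b)) :
    ∃ F : S.obj ⟨⟩ →+* T, (∀ c, F (D.ι c) = f c) ∧ (∀ a, F (j₁.map ⟨⟩ a) = F₁ a) ∧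
      ∀ b, F (j₂.map ⟨⟩ b) = F₂ b := by
  let F : S.obj ⟨⟩ →+ T := D.basis.lift fun l =>
    (AddMonoidHom.mulRight (F₁ (l.1.1.map D.x).prod * F₂ (l.2.1.map D.x).prod)).comp
      f.toAddMonoidHom
  have hF₀ : ∀ c (l : SortedMon D.P D.deg × SortedMon D.P D.deg),
      F (D.ι c * (j₁.map ⟨⟩ (l.1.1.map D.x).prod * j₂.map ⟨⟩ (l.2.1.map D.x).prod)) =
        f c * (F₁ (l.1.1.map D.x).prod * F₂ (l.2.1.map D.x).prod) :=
    fun c l => D.basis.lift_mul _ c l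
  -- From basis monomials to arbitrary `a`, `b`: coefficients from `O` move into `C` through `p` and
  -- `p₂`, compatibly by `h₁` and `h₂`.
  have hF : ∀ c a b, F (D.ι c * (j₁.map ⟨⟩ a * j₂.map ⟨⟩ b)) = f c * (F₁ a * F₂ b) := by
    intro c a b
    induction a using D.free.induction generalizing c with
    | zero => simp
    | add a a' h h' => simp only [map_add, add_mul, mul_add, h, h']
    | mul a l =>
      induction b using D.free.induction generalizing c with
      | zero => simp
      | add b b' h h' =>
        rw [map_add, mul_add, mul_add, map_add, h, h', map_add, mul_add, mul_add]
      | mul b l' =>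
        have e : D.ι c * (j₁.map ⟨⟩ (D.o a * (l.1.map D.x).prod) *
            j₂.map ⟨⟩ (D.o b * (l'.1.map D.x).prod)) = D.ι (c * D.p a * D.p₂ b) *
              (j₁.map ⟨⟩ (l.1.map D.x).prod * j₂.map ⟨⟩ (l'.1.map D.x).prod) := by
          rw [map_mul, map_mul, D.j₁_o, D.j₂_o, map_mul, map_mul, mul_assoc (D.ι (D.p a)),
            ← mul_assoc (j₁.map ⟨⟩ _) (D.ι _), ← D.ι_comm]
          simp only [mul_assoc]
        rw [e, hF₀ _ (l, l'), map_mul, map_mul, map_mul, map_mul, h₁, h₂, mul_assoc (f (D.p a)),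
          ← mul_assoc (F₁ _) (f _), ← c₁]
        simp only [mul_assoc]
  have h1 : F 1 = 1 := by simpa using hF 1 1 1
  have hmul : ∀ s s', F (s * s') = F s * F s' := by
    intro s s'
    induction s using D.ind with
    | zero => simp
    | add s t h h' => rw [add_mul, map_add, map_add, h, h', add_mul]
    | mul c a b =>
      induction s' using D.ind with
      | zero => simp
      | add s t h h' => rw [mul_add, map_add, map_add, h, h', mul_add]
      | mul c' a' b' =>
        refine gr_induction (R.internal ⟨⟩) (p := fun a' => F (D.ι c * (j₁.map ⟨⟩ a * j₂.map ⟨⟩ b) *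
          (D.ι c' * (j₁.map ⟨⟩ a' * j₂.map ⟨⟩ b'))) = F (D.ι c * (j₁.map ⟨⟩ a * j₂.map ⟨⟩ b)) *
            F (D.ι c' * (j₁.map ⟨⟩ a' * j₂.map ⟨⟩ b'))) (fun i a' ha' => ?_) (by simp)
            (fun x y hx hy => by
              rw [map_add, add_mul, mul_add, mul_add, map_add, hx, hy, map_add, mul_add]) a'
        -- The product is brought back to standard form by moving `a'` past `b`, which twists `b`;
        -- `c₁₂` says that `F₁`, `F₂` obey the same exchange rule.
        have e : D.ι c * (j₁.map ⟨⟩ a * j₂.map ⟨⟩ b) * (D.ι c' * (j₁.map ⟨⟩ a' * j₂.map ⟨⟩ b')) =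
            D.ι (c * c') * (j₁.map ⟨⟩ (a * a') * j₂.map ⟨⟩ (R.twist i b * b')) := by
          have h1 := DGAlg.mul_twist (j₁.map_mem ⟨⟩ ha') (j₂.map ⟨⟩ b)
          rw [← j₂.map_twist] at h1
          have h2 := D.ι_comm c' (j₁.map ⟨⟩ a * j₂.map ⟨⟩ b)
          simp only [map_mul, mul_assoc] at h1 h2 ⊢
          rw [← mul_assoc (j₂.map ⟨⟩ b) (D.ι c'), ← mul_assoc (j₁.map ⟨⟩ a), ← h2]
          simp only [mul_assoc]
          rw [← mul_assoc (j₂.map ⟨⟩ b) (j₁.map ⟨⟩ a'), h1]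
          simp only [mul_assoc]
        rw [e, hF, hF, hF]
        have h1 := c₁₂ i a' ha' b
        have h2 : f c' * (F₁ a * F₂ b) = F₁ a * F₂ b * f c' := by
          rw [← mul_assoc, c₁, mul_assoc, c₂, mul_assoc]
        simp only [map_mul, mul_assoc] at h1 h2 ⊢
        rw [← mul_assoc (F₂ b) (f c'), ← mul_assoc (F₁ a) (F₂ b * f c'), ← h2]
        simp only [mul_assoc]
        rw [← mul_assoc (F₂ b) (F₁ a'), h1]
        simp only [mul_assoc]
  refine ⟨{ F with map_one' := h1, map_mul' := hmul }, fun c => ?_, fun a => ?_, fun b => ?_⟩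
  · simpa using hF c 1 1
  · simpa using hF 1 a 1
  · simpa using hF 1 1 b

end EnvData

/-! ### Triangular matrices of size two. -/

section Triangular

variable {A : Type} [Ring A]

/-- An upper triangular matrix of size two. -/
def triangular (a b c : A) : Matrix (Fin 2) (Fin 2) A := !![a, b; 0, c]

lemma triangular_mul (a b c a' b' c' : A) : triangular a b c * triangular a' b' c' =
    triangular (a * a') (a * b' + b * c') (c * c') := by
  rw [triangular, triangular, Matrix.mul_fin_two]; simp [triangular]

lemma triangular_add (a b c a' b' c' : A) : triangular (a + a') (b + b') (c + c') =
    triangular a b c + triangular a' b' c' := by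
  ext i j; fin_cases i <;> fin_cases j <;> simp [triangular]

lemma triangular_zsmul (n : ℤ) (a b c : A) :
    n • triangular a b c = triangular (n • a) (n • b) (n • c) := by
  ext i j; fin_cases i <;> fin_cases j <;> simp [triangular]

lemma triangular_one : triangular (1 : A) 0 1 = 1 := Matrix.one_fin_two.symm

lemma triangular_zero : triangular (0 : A) 0 0 = 0 := by
  ext i j; fin_cases i <;> fin_cases j <;> rfl

end Triangular

/-! ### Coordinate functionals on the differentials, from triangular representations. -/

section Functionals

variable {R S : DGAlg PUnit} {j₁ j₂ : DGAlg.Hom R S}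

namespace EnvData

variable (D : EnvData j₁ j₂)

/-- The indices of a basis of the differentials: the relative coordinates and the generators. -/
abbrev Ind : Type := D.division.I ⊕ {g // D.P g}

/-- The degrees of the basis elements of the differentials. -/
def weight : D.Ind → ℤ := Sum.elim (fun _ => 0) fun g => D.deg g.1

/-- The elements of the ring whose differentials form a basis. -/
def elt : D.Ind → R.obj ⟨⟩ := Sum.elim (fun i => D.o (D.division.z i)) D.x

lemma weight_nonpos (k : D.Ind) : D.weight k ≤ 0 := by
  rcases k with i | g
  · exact le_rfl
  · exact (D.deg_neg g.1).le

lemma elt_mem (k : D.Ind) : D.elt k ∈ R.gr ⟨⟩ (D.weight k) := by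
  rcases k with i | g
  · exact D.o_mem _
  · exact D.x_mem g

/-- The element `1 ⊗ a - a ⊗ 1`. -/
def diff (k : D.Ind) : S.obj ⟨⟩ := j₂.map ⟨⟩ (D.elt k) - j₁.map ⟨⟩ (D.elt k)

lemma diff_mem (k : D.Ind) : D.diff k ∈ S.gr ⟨⟩ (D.weight k) :=
  sub_mem (j₂.map_mem ⟨⟩ (D.elt_mem k)) (j₁.map_mem ⟨⟩ (D.elt_mem k))

lemma diff_inl (i : D.division.I) :
    D.diff (Sum.inl i) = D.ι (D.p₂ (D.division.z i) - D.p (D.division.z i)) := by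
  rw [map_sub, ← D.j₁_o, ← D.j₂_o]; rfl

variable (μ : DGAlg.Hom S R) (h₁ : ∀ a, μ.map ⟨⟩ (j₁.map ⟨⟩ a) = a)
  (h₂ : ∀ a, μ.map ⟨⟩ (j₂.map ⟨⟩ a) = a)

/-- Restriction of functions to the diagonal. -/
def q : D.C →+* R.obj ⟨⟩ := (μ.map ⟨⟩).comp D.ι

lemma q_p (h₁ : ∀ a, μ.map ⟨⟩ (j₁.map ⟨⟩ a) = a) (a : D.O) : D.q μ (D.p a) = D.o a := by
  change μ.map ⟨⟩ (D.ι (D.p a)) = _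
  rw [← D.j₁_o, h₁]

lemma q_p₂ (h₂ : ∀ a, μ.map ⟨⟩ (j₂.map ⟨⟩ a) = a) (a : D.O) : D.q μ (D.p₂ a) = D.o a := by
  change μ.map ⟨⟩ (D.ι (D.p₂ a)) = _
  rw [← D.j₂_o, h₂]

lemma q_mem (c : D.C) : D.q μ c ∈ R.gr ⟨⟩ 0 := μ.map_mem ⟨⟩ (D.ι_mem c)

lemma q_comm (c : D.C) (a : R.obj ⟨⟩) : D.q μ c * a = a * D.q μ c :=
  DGAlg.mul_comm_zero (D.q_mem μ c) a

lemma q_diff (h₁ : ∀ a, μ.map ⟨⟩ (j₁.map ⟨⟩ a) = a) (h₂ : ∀ a, μ.map ⟨⟩ (j₂.map ⟨⟩ a) = a)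
    (a : D.O) : D.q μ (D.p₂ a - D.p a) = 0 := by
  rw [map_sub, D.q_p μ h₁, D.q_p₂ μ h₂, sub_self]

/-- Write `c = p(a) + ∑ t_j b_j`. On restriction to the diagonal the `t_j` vanish, so `δ_i(c c')`
becomes `a δ_i(c') + b_i c'`; taking `c' = 1` identifies `b_i` with `δ_i(c)` there. Thus a divided
difference becomes a derivation on the diagonal. -/
lemma q_δ_mul (h₁ : ∀ a, μ.map ⟨⟩ (j₁.map ⟨⟩ a) = a) (h₂ : ∀ a, μ.map ⟨⟩ (j₂.map ⟨⟩ a) = a)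
    (i : D.division.I) (c c' : D.C) : D.q μ (D.division.δ i (c * c')) =
      D.q μ c * D.q μ (D.division.δ i c') + D.q μ (D.division.δ i c) * D.q μ c' := by
  classical
  obtain ⟨a, b, rfl⟩ := D.division.gen c
  have key : ∀ c' : D.C, D.q μ (D.division.δ i ((D.p a +
      ∑ j, (D.p₂ (D.division.z j) - D.p (D.division.z j)) * b j) * c')) =
      D.o a * D.q μ (D.division.δ i c') + D.q μ (b i) * D.q μ c' := by
    intro c'
    rw [add_mul, map_add, D.division.δ_p, map_add, map_mul, D.q_p μ h₁, Finset.sum_mul, map_sum,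
      map_sum, Finset.sum_eq_single i]
    · rw [mul_assoc, D.division.δ_self, map_mul]
    · intro j _ hj
      rw [mul_assoc, D.division.δ_ne i j (Ne.symm hj), map_mul, D.q_diff μ h₁ h₂, zero_mul]
    · intro h; exact absurd (Finset.mem_univ i) h
  have h1 := key 1
  rw [mul_one, D.division.δ_one, map_zero, mul_zero, zero_add, map_one, mul_one] at h1
  have h0 : D.q μ (D.p a + ∑ j, (D.p₂ (D.division.z j) - D.p (D.division.z j)) * b j) = D.o a := by
    rw [map_add, D.q_p μ h₁, map_sum, Finset.sum_eq_zero, add_zero]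
    intro j _
    rw [map_mul, D.q_diff μ h₁ h₂, zero_mul]
  rw [key, h1, h0]

/-- The derivative of a function along the diagonal. -/
def dC (k : D.Ind) : D.C →+ R.obj ⟨⟩ :=
  Sum.elim (fun i => (D.q μ).toAddMonoidHom.comp (D.division.δ i)) (fun _ => 0) k

/-- The derivative of a generator. -/
def dX (k : D.Ind) (g : {g // D.P g}) : R.obj ⟨⟩ :=
  Sum.elim (fun _ => 0) (fun h => open Classical in if h = g then 1 else 0) k

lemma dX_cases (k : D.Ind) (g : {g // D.P g}) :
    D.dX k g = 0 ∨ (D.dX k g = 1 ∧ D.weight k = D.deg g.1) := by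
  classical
  rcases k with i | h
  · exact Or.inl rfl
  · by_cases e : h = g
    · exact Or.inr ⟨if_pos e, by subst e; rfl⟩
    · exact Or.inl (if_neg e)

lemma dC_mul (h₁ : ∀ a, μ.map ⟨⟩ (j₁.map ⟨⟩ a) = a) (h₂ : ∀ a, μ.map ⟨⟩ (j₂.map ⟨⟩ a) = a)
    (k : D.Ind) (c c' : D.C) :
    D.dC μ k (c * c') = D.q μ c * D.dC μ k c' + D.dC μ k c * D.q μ c' := by
  rcases k with i | g
  · exact D.q_δ_mul μ h₁ h₂ i c c'
  · simp [dC]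

lemma dC_one (k : D.Ind) : D.dC μ k 1 = 0 := by
  rcases k with i | g
  · exact (congrArg (D.q μ) (D.division.δ_one i)).trans (map_zero _)
  · rfl

lemma dC_p (k : D.Ind) (a : D.O) : D.dC μ k (D.p a) = 0 := by
  rcases k with i | g
  · refine (congrArg (D.q μ) ?_).trans (map_zero _)
    have := D.division.δ_p i a 1
    rwa [mul_one, D.division.δ_one, mul_zero] at this
  · rfl

lemma dC_comm (k : D.Ind) (c : D.C) (a : R.obj ⟨⟩) :
    D.dC μ k c * R.twist (D.weight k) a = a * D.dC μ k c := by
  rcases k with i | g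
  · rw [show D.weight (Sum.inl i) = 0 from rfl, R.twist_zero]
    exact D.q_comm μ _ a
  · simp [dC]

lemma dC_diff (i : D.division.I) (k : D.Ind) :
    D.dC μ k (D.p₂ (D.division.z i) - D.p (D.division.z i)) =
      (Finsupp.single (Sum.inl i) 1 : D.Ind →₀ R.obj ⟨⟩) k := by
  classical
  rcases k with j | g
  · change D.q μ (D.division.δ j _) = _
    by_cases e : j = i
    · subst e
      have := D.division.δ_self j 1
      rw [mul_one] at this
      rw [this, map_one, Finsupp.single_eq_same]
    · have := D.division.δ_ne j i e 1
      rw [mul_one, D.division.δ_one, mul_zero] at this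
      rw [this, map_zero, Finsupp.single_eq_of_ne]
      simpa using e
  · rw [Finsupp.single_eq_of_ne (by simp)]; rfl

lemma dX_eq (g : {g // D.P g}) (k : D.Ind) :
    D.dX k g = (Finsupp.single (Sum.inr g) 1 : D.Ind →₀ R.obj ⟨⟩) k := by
  classical
  rcases k with j | h
  · rw [Finsupp.single_eq_of_ne (by simp)]; rfl
  · change (if h = g then (1 : R.obj ⟨⟩) else 0) = _
    rw [Finsupp.single_apply]
    simp [eq_comm]

lemma twist_q (n : ℤ) (c : D.C) : R.twist n (D.q μ c) = D.q μ c := by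
  rw [R.twist_apply n (D.q_mem μ c), mul_zero, ksign_zero, one_smul]

/-- The functions on the diagonal, acting by triangular matrices. -/
def matC (h₁ : ∀ a, μ.map ⟨⟩ (j₁.map ⟨⟩ a) = a) (h₂ : ∀ a, μ.map ⟨⟩ (j₂.map ⟨⟩ a) = a) (k : D.Ind) :
    D.C →+* Matrix (Fin 2) (Fin 2) (R.obj ⟨⟩) where
  toFun c := triangular (D.q μ c) (D.dC μ k c) (D.q μ c)
  map_one' := by rw [map_one, D.dC_one, triangular_one]
  map_zero' := by rw [map_zero, map_zero, triangular_zero]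
  map_mul' c c' := by rw [triangular_mul, D.dC_mul μ h₁ h₂, map_mul]
  map_add' c c' := by rw [map_add, map_add, triangular_add]

/-- The left factor of the enveloping algebra, acting by diagonal matrices. -/
def matL (k : D.Ind) : R.obj ⟨⟩ →+* Matrix (Fin 2) (Fin 2) (R.obj ⟨⟩) where
  toFun a := triangular a 0 (R.twist (D.weight k) a)
  map_one' := by rw [map_one, triangular_one]
  map_zero' := by rw [map_zero, triangular_zero]
  map_mul' c c' := by rw [triangular_mul, mul_zero, zero_mul, add_zero, map_mul]
  map_add' c c' := by rw [map_add, ← triangular_add, add_zero]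

/-- The matrices of the generators. -/
def matX (k : D.Ind) (g : {g // D.P g}) : Matrix (Fin 2) (Fin 2) (R.obj ⟨⟩) :=
  triangular (D.x g) (D.dX k g) (R.twist (D.weight k) (D.x g))

/-- The diagonal entries inherit the relations from `R`. The off-diagonal entry is nonzero only if
the weight of `k` equals the degree of the generator, and then the twist in the lower right corner
contributes exactly the sign required. -/
lemma matX_comm (k : D.Ind) : GradedCommuting (fun g : {g // D.P g} => D.deg g.1) (D.matX k) where
  comm g h := by
    have e0 := D.gradedCommuting.comm g h
    have e1 : R.twist (D.weight k) (D.x g) * R.twist (D.weight k) (D.x h) =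
        ksign (D.deg g.1 * D.deg h.1) • (R.twist (D.weight k) (D.x h) *
          R.twist (D.weight k) (D.x g)) := by
      rw [← map_mul, ← map_mul, ← map_zsmul, ← e0]
    have e2 : D.x g * D.dX k h + D.dX k g * R.twist (D.weight k) (D.x h) =
        ksign (D.deg g.1 * D.deg h.1) •
          (D.x h * D.dX k g + D.dX k h * R.twist (D.weight k) (D.x g)) := by
      rw [R.twist_apply _ (D.x_mem g), R.twist_apply _ (D.x_mem h)]
      rcases D.dX_cases k g with eg | ⟨eg, hg⟩ <;> rcases D.dX_cases k h with eh | ⟨eh, hh⟩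
      · simp only [eg, eh, mul_zero, zero_mul, add_zero, smul_zero]
      · rw [eg, eh, hh, mul_one, zero_mul, mul_zero, add_zero, zero_add, one_mul, smul_smul,
          mul_comm (D.deg h.1), ksign_mul_self, one_smul]
      · rw [eg, eh, hg, mul_one, zero_mul, mul_zero, add_zero, zero_add, one_mul]
      · rw [eg, eh, mul_one, mul_one, one_mul, one_mul, smul_add, smul_smul, ← hg, ← hh,
          ksign_mul_self, one_smul, add_comm]
    rw [matX, matX, triangular_mul, triangular_mul, triangular_zsmul, e0, e1, e2]
  sq g hg := by
    have e0 := D.gradedCommuting.sq g hg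
    have e1 : R.twist (D.weight k) (D.x g) * R.twist (D.weight k) (D.x g) = 0 := by
      rw [← map_mul, e0, map_zero]
    have e2 : D.x g * D.dX k g + D.dX k g * R.twist (D.weight k) (D.x g) = 0 := by
      rw [R.twist_apply _ (D.x_mem g)]
      rcases D.dX_cases k g with eg | ⟨eg, hk⟩
      · rw [eg, mul_zero, zero_mul, add_zero]
      · rw [eg, hk, ksign_mul_odd hg, ← mul_one (D.deg g.1), ksign_mul_odd hg, ksign_one, mul_one,
          one_mul, neg_smul, one_smul, add_neg_cancel]
    rw [matX, triangular_mul, e0, e1, e2, triangular_zero]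

lemma matC_matL (k : D.Ind) (c : D.C) (a : R.obj ⟨⟩) :
    D.matC μ h₁ h₂ k c * D.matL k a = D.matL k a * D.matC μ h₁ h₂ k c := by
  change triangular _ _ _ * triangular _ _ _ = triangular _ _ _ * triangular _ _ _
  rw [triangular_mul, triangular_mul, D.q_comm μ c a, D.dC_comm, mul_zero, zero_mul, zero_add,
    add_zero, D.q_comm μ c]

lemma matC_matX (k : D.Ind) (c : D.C) (g : {g // D.P g}) :
    D.matC μ h₁ h₂ k c * D.matX k g = D.matX k g * D.matC μ h₁ h₂ k c := by
  change triangular _ _ _ * triangular _ _ _ = triangular _ _ _ * triangular _ _ _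
  rw [triangular_mul, triangular_mul, D.q_comm μ c, D.q_comm μ c, D.q_comm μ c, D.dC_comm, add_comm]

lemma matX_matL (k : D.Ind) (g : {g // D.P g}) {i : ℤ} {a : R.obj ⟨⟩} (ha : a ∈ R.gr ⟨⟩ i) :
    D.matX k g * D.matL k a = D.matL k a * (ksign (i * D.deg g.1) • D.matX k g) := by
  rw [mul_smul_comm]
  change triangular _ _ _ * triangular _ _ _ = _ • (triangular _ _ _ * triangular _ _ _)
  have e0 : D.x g * a = ksign (i * D.deg g.1) • (a * D.x g) := by
    rw [mul_comm i]; exact R.comm ⟨⟩ (D.x_mem g) ha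
  have e1 : R.twist (D.weight k) (D.x g) * R.twist (D.weight k) a = ksign (i * D.deg g.1) •
      (R.twist (D.weight k) a * R.twist (D.weight k) (D.x g)) := by
    rw [← map_mul, ← map_mul, ← map_zsmul, ← e0]
  have e2 : D.dX k g * R.twist (D.weight k) a = ksign (i * D.deg g.1) • (a * D.dX k g) := by
    rw [R.twist_apply _ ha]
    rcases D.dX_cases k g with eg | ⟨eg, hg⟩
    · rw [eg, zero_mul, mul_zero, smul_zero]
    · rw [eg, hg, one_mul, mul_one, mul_comm]
  rw [triangular_mul, triangular_mul, triangular_zsmul, e0, e1, mul_zero, zero_add, zero_mul,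
    add_zero, e2]

/-- The coordinate functional of a differential, as an entry of a triangular representation. -/
lemma exists_functional (h₁ : ∀ a, μ.map ⟨⟩ (j₁.map ⟨⟩ a) = a)
    (h₂ : ∀ a, μ.map ⟨⟩ (j₂.map ⟨⟩ a) = a) (k : D.Ind) : ∃ F : S.obj ⟨⟩ →+ R.obj ⟨⟩,
    (∀ s s', F (s * s') = μ.map ⟨⟩ s * F s' + F s * R.twist (D.weight k) (μ.map ⟨⟩ s')) ∧
    (∀ a, F (j₁.map ⟨⟩ a) = 0) ∧
    ∀ l, F (D.diff l) = (Finsupp.single l 1 : D.Ind →₀ R.obj ⟨⟩) k := by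
  let f := D.matC μ h₁ h₂ k
  let F₁ := D.matL k
  -- The right factor acts by an extension of the representation of functions along `p₂`, with
  -- prescribed matrices for the generators of `R`.
  obtain ⟨F₂, e₁, e₂⟩ := D.free.exists_ringHom D.gradedCommuting D.o_comm (f.comp D.p₂) (D.matX k)
    (D.matX_comm k) (fun a g => D.matC_matX μ h₁ h₂ k _ g)
  have hf₂ : ∀ c a, f c * F₂ a = F₂ a * f c := by
    intro c a
    induction a using D.free.ring_induction with
    | base a => rw [e₁, RingHom.comp_apply, ← map_mul, mul_comm, map_mul]
    | gen g => rw [e₂]; exact D.matC_matX μ h₁ h₂ k c g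
    | mul a b h h' => rw [map_mul, ← mul_assoc, h, mul_assoc, h', mul_assoc]
    | add a b h h' => rw [map_add, mul_add, h, h', add_mul]
  have c₁₂ : ∀ i, ∀ a ∈ R.gr ⟨⟩ i, ∀ b, F₂ b * F₁ a = F₁ a * F₂ (R.twist i b) := by
    intro i a ha b
    induction b using D.free.ring_induction with
    | base b =>
      rw [R.twist_apply i (D.o_mem b), mul_zero, ksign_zero, one_smul, e₁]
      exact D.matC_matL μ h₁ h₂ k _ a
    | gen g => rw [R.twist_apply i (D.x_mem g), map_zsmul, e₂]; exact D.matX_matL k g ha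
    | mul b b' h h' => rw [map_mul, mul_assoc, h', ← mul_assoc, h, map_mul, map_mul, mul_assoc]
    | add b b' h h' => rw [map_add, add_mul, h, h', map_add, map_add, mul_add]
  have h11 : ∀ a, F₁ (D.o a) = f (D.p a) := by
    intro a
    change triangular _ _ _ = triangular _ _ _
    rw [D.q_p μ h₁, D.dC_p, R.twist_apply _ (D.o_mem a), mul_zero, ksign_zero, one_smul]
  obtain ⟨F, g₀, g₁, g₂⟩ := D.exists_ringHom f F₁ F₂ h11 e₁ (D.matC_matL μ h₁ h₂ k) hf₂ c₁₂
  -- Proved together with the vanishing of the lower left entry: with all three statements the claim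
  -- is multiplicative, so it suffices to check generators.
  have diag : ∀ s, F s 0 0 = μ.map ⟨⟩ s ∧ F s 1 1 = R.twist (D.weight k) (μ.map ⟨⟩ s) := by
    have mul : ∀ s s', (F s 0 0 = μ.map ⟨⟩ s ∧ F s 1 0 = 0 ∧
          F s 1 1 = R.twist (D.weight k) (μ.map ⟨⟩ s)) →
        (F s' 0 0 = μ.map ⟨⟩ s' ∧ F s' 1 0 = 0 ∧
          F s' 1 1 = R.twist (D.weight k) (μ.map ⟨⟩ s')) →
        F (s * s') 0 0 = μ.map ⟨⟩ (s * s') ∧ F (s * s') 1 0 = 0 ∧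
          F (s * s') 1 1 = R.twist (D.weight k) (μ.map ⟨⟩ (s * s')) := by
      rintro s s' ⟨a, b, c⟩ ⟨a', b', c'⟩
      simp only [map_mul, Matrix.mul_apply, Fin.sum_univ_two, a, b, c, a', b', c', mul_zero,
        zero_mul, add_zero, zero_add, and_self]
    have h : ∀ s, F s 0 0 = μ.map ⟨⟩ s ∧ F s 1 0 = 0 ∧
        F s 1 1 = R.twist (D.weight k) (μ.map ⟨⟩ s) := by
      intro s
      induction s using D.ind with
      | zero => simp
      | add s s' h h' => simp only [map_add, Matrix.add_apply, h, h', add_zero, and_self]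
      | mul c a b =>
        refine mul _ _ ?_ (mul _ _ ?_ ?_)
        · rw [g₀]
          exact ⟨rfl, rfl, (D.twist_q μ _ c).symm⟩
        · rw [g₁, h₁]
          exact ⟨rfl, rfl, rfl⟩
        · induction b using D.free.ring_induction with
          | base a =>
            rw [g₂, e₁, D.j₂_o]
            exact ⟨rfl, rfl, (D.twist_q μ _ _).symm⟩
          | gen g =>
            rw [g₂, e₂, h₂]
            exact ⟨rfl, rfl, rfl⟩
          | mul b b' h h' => rw [map_mul]; exact mul _ _ h h'
          | add b b' h h' => simp only [map_add, Matrix.add_apply, h, h', add_zero, and_self]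
    exact fun s => ⟨(h s).1, (h s).2.2⟩
  -- The upper right entry. Multiplying triangular matrices gives the twisted Leibniz rule, and it
  -- vanishes on `R ⊗ 1`, which acts diagonally.
  refine ⟨AddMonoidHom.mk' (fun s => F s 0 1) (fun s s' => by rw [map_add]; rfl), fun s s' => ?_,
    fun a => ?_, fun l => ?_⟩
  · simp only [AddMonoidHom.mk'_apply, map_mul, Matrix.mul_apply, Fin.sum_univ_two, diag]
  · simp only [AddMonoidHom.mk'_apply, g₁]; rfl
  · rcases l with i | g
    · rw [D.diff_inl, ← D.dC_diff μ i k]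
      simp only [AddMonoidHom.mk'_apply, g₀]; rfl
    · rw [← D.dX_eq g k]
      change F (j₂.map ⟨⟩ (D.x g) - j₁.map ⟨⟩ (D.x g)) 0 1 = _
      rw [map_sub, g₂, e₂, g₁]
      exact sub_zero _

end EnvData

end Functionals

/-! ### Maps out of the conormal module. -/

section ConormalQuotient

variable {T : Type} [Preorder T] {R : DGAlg T}

lemma BiMod.mul_smul' (L : BiMod R) {t : T} (a b : R.obj t) (m : L.obj t) :
    (a * b) • m = a • (b • m) := mul_smul a b m

lemma BiMod.one_smul' (L : BiMod R) {t : T} (m : L.obj t) : (1 : R.obj t) • m = m := one_smul _ m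

lemma BiMod.smul_sum' (L : BiMod R) {t : T} {κ : Type} (a : R.obj t) (s : Finset κ)
    (f : κ → L.obj t) : a • ∑ k ∈ s, f k = ∑ k ∈ s, a • f k := Finset.smul_sum

variable {S : DGAlg T} (μ : DGAlg.Hom S R) {t : T}

/-- The additive map out of `I/I²` given by a map that vanishes on products. -/
def Conormal.desc {X : Type} [AddCommGroup X] (f : S.obj t →+ X)
    (hf : ∀ a ∈ Conormal.ideal μ t, ∀ b ∈ Conormal.ideal μ t, f (a * b) = 0) :
    Conormal.Obj μ t →+ X :=
  QuotientAddGroup.lift _ (f.comp (Conormal.ideal μ t).subtype) (by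
    have : Conormal.sq μ t ≤ f.ker := by
      rw [Conormal.sq, AddSubgroup.closure_le]
      rintro _ ⟨a, ha, b, hb, rfl⟩
      exact hf a ha b hb
    intro y hy
    exact this hy)

lemma Conormal.mk_eq_zero {x : S.obj t} (hx : x ∈ Conormal.ideal μ t) :
    Conormal.mk μ t ⟨x, hx⟩ = 0 ↔ x ∈ Conormal.sq μ t :=
  (QuotientAddGroup.eq_zero_iff _).trans Iff.rfl

end ConormalQuotient

/-! ### The differentials of coordinates and generators form a basis. -/

section ConormalBasis

/-- A basis of a bimodule as a left module gives coordinates. -/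
lemma BiBasis.nonempty_of_existsUnique {R : DGAlg PUnit} (L : BiMod R) {κ : Type} {e : κ → L.obj ⟨⟩}
    {deg : κ → ℤ} (deg_le : ∀ k, deg k ≤ 0) (e_mem : ∀ k, e k ∈ L.gr ⟨⟩ (deg k))
    (he : ∀ x, ∃! c : κ →₀ R.obj ⟨⟩, (c.sum fun k a => a • e k) = x) : Nonempty (BiBasis L) := by
  choose r hr hr' using he
  have sum_add (c c' : κ →₀ R.obj ⟨⟩) : ((c + c').sum fun k a => a • e k) =
      (c.sum fun k a => a • e k) + c'.sum fun k a => a • e k :=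
    Finsupp.sum_add_index' (fun _ => zero_smul _ _) (fun _ _ _ => add_smul _ _ _)
  refine ⟨
    { κ := κ
      e := e
      deg := deg
      deg_le := deg_le
      e_mem := e_mem
      repr := AddMonoidHom.mk' r fun x y => (hr' _ _ ?_).symm
      repr_smul := fun a x => (hr' _ _ ?_).symm
      repr_e := fun k => (hr' _ _ ?_).symm
      sum_repr := hr }⟩
  · exact (sum_add _ _).trans (congrArg₂ (· + ·) (hr x) (hr y))
  · change ((a • r x).sum fun k a => a • e k) = a • x
    refine (Finsupp.sum_smul_index' (h := fun k (a : R.obj ⟨⟩) => a • e k)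
      (fun _ => zero_smul _ _)).trans (Eq.trans ?_ (congrArg (a • ·) (hr x)))
    refine Eq.trans ?_ (L.smul_sum' a _ _).symm
    exact Finset.sum_congr rfl fun k _ => L.mul_smul' _ _ _
  · change ((Finsupp.single k 1).sum fun k a => a • e k) = e k
    exact (Finsupp.sum_single_index (h := fun k (a : R.obj ⟨⟩) => a • e k) (zero_smul _ _)).trans
      (L.one_smul' _)

variable {R S : DGAlg PUnit} {j₁ j₂ : DGAlg.Hom R S} (D : EnvData j₁ j₂) (μ : DGAlg.Hom S R)

/-- The elements of `I` that are combinations of the basis elements modulo `I²`. -/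
def EnvData.spanned : AddSubgroup (S.obj ⟨⟩) :=
  AddSubgroup.closure {y | ∃ a k, y = j₁.map ⟨⟩ a * D.diff k} ⊔ Conormal.sq μ ⟨⟩

variable (h₁ : ∀ a, μ.map ⟨⟩ (j₁.map ⟨⟩ a) = a) (h₂ : ∀ a, μ.map ⟨⟩ (j₂.map ⟨⟩ a) = a)

lemma EnvData.diff_mem_ideal (h₁ : ∀ a, μ.map ⟨⟩ (j₁.map ⟨⟩ a) = a)
    (h₂ : ∀ a, μ.map ⟨⟩ (j₂.map ⟨⟩ a) = a) (k : D.Ind) : D.diff k ∈ Conormal.ideal μ ⟨⟩ := by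
  rw [Conormal.mem_ideal, EnvData.diff, map_sub, h₁, h₂, sub_self]

lemma sub_mem_ideal (h₁ : ∀ a, μ.map ⟨⟩ (j₁.map ⟨⟩ a) = a) (s : S.obj ⟨⟩) :
    s - j₁.map ⟨⟩ (μ.map ⟨⟩ s) ∈ Conormal.ideal μ ⟨⟩ := by
  rw [Conormal.mem_ideal, map_sub, h₁, sub_self]

lemma EnvData.mul_diff_mem (a : R.obj ⟨⟩) (k : D.Ind) :
    j₁.map ⟨⟩ a * D.diff k ∈ D.spanned μ :=
  AddSubgroup.mem_sup_left (AddSubgroup.subset_closure ⟨a, k, rfl⟩)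

lemma EnvData.spanned_induction {p : S.obj ⟨⟩ → Prop} (zero : p 0)
    (mul : ∀ a k, p (j₁.map ⟨⟩ a * D.diff k))
    (sq : ∀ a ∈ Conormal.ideal μ ⟨⟩, ∀ b ∈ Conormal.ideal μ ⟨⟩, p (a * b))
    (add : ∀ s s', p s → p s' → p (s + s')) (neg : ∀ s, p s → p (-s)) {s : S.obj ⟨⟩}
    (hs : s ∈ D.spanned μ) : p s := by
  obtain ⟨x, hx, y, hy, rfl⟩ := AddSubgroup.mem_sup.1 hs
  clear hs
  refine add _ _ ?_ ?_
  · induction hx using AddSubgroup.closure_induction with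
    | mem x hx => obtain ⟨a, k, rfl⟩ := hx; exact mul a k
    | zero => exact zero
    | add x y _ _ h h' => exact add _ _ h h'
    | neg x _ h => exact neg _ h
  · induction hy using AddSubgroup.closure_induction with
    | mem x hx => obtain ⟨a, ha, b, hb, rfl⟩ := hx; exact sq a ha b hb
    | zero => exact zero
    | add x y _ _ h h' => exact add _ _ h h'
    | neg x _ h => exact neg _ h

/-- Modulo `I²`, an element `s` acts on `I` through `μ(s)`, since `s` and `j₁(μ(s))` differ by an
element of `I`. -/
lemma EnvData.mul_mem_spanned (h₁ : ∀ a, μ.map ⟨⟩ (j₁.map ⟨⟩ a) = a)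
    (h₂ : ∀ a, μ.map ⟨⟩ (j₂.map ⟨⟩ a) = a) (s : S.obj ⟨⟩) {y : S.obj ⟨⟩}
    (hy : y ∈ D.spanned μ) : s * y ∈ D.spanned μ := by
  refine D.spanned_induction μ (p := fun y => s * y ∈ D.spanned μ) ?_ (fun a k => ?_)
    (fun a ha b hb => ?_) (fun x y hx hy => ?_) (fun x hx => ?_) hy
  · rw [mul_zero]; exact zero_mem _
  · have e : s * (j₁.map ⟨⟩ a * D.diff k) = j₁.map ⟨⟩ (μ.map ⟨⟩ s * a) * D.diff k +
        (s - j₁.map ⟨⟩ (μ.map ⟨⟩ s)) * (j₁.map ⟨⟩ a * D.diff k) := by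
      rw [map_mul]; noncomm_ring
    rw [e]
    exact add_mem (D.mul_diff_mem μ _ k) (AddSubgroup.mem_sup_right (Conormal.prod_mem μ
      (sub_mem_ideal μ h₁ s) (Conormal.mul_ideal μ _ (D.diff_mem_ideal μ h₁ h₂ k))))
  · rw [← mul_assoc]
    exact AddSubgroup.mem_sup_right (Conormal.prod_mem μ (Conormal.mul_ideal μ s ha) hb)
  · rw [mul_add]; exact add_mem hx hy
  · rw [mul_neg]; exact neg_mem hx

/-- As for left multiplication, after moving `j₁(μ(s))` to the left of the differential, which
twists it by the degree of the differential. -/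
lemma EnvData.spanned_mul (h₁ : ∀ a, μ.map ⟨⟩ (j₁.map ⟨⟩ a) = a)
    (h₂ : ∀ a, μ.map ⟨⟩ (j₂.map ⟨⟩ a) = a) (s : S.obj ⟨⟩) {y : S.obj ⟨⟩}
    (hy : y ∈ D.spanned μ) : y * s ∈ D.spanned μ := by
  refine D.spanned_induction μ (p := fun y => y * s ∈ D.spanned μ) ?_ (fun a k => ?_)
    (fun a ha b hb => ?_) (fun x y hx hy => ?_) (fun x hx => ?_) hy
  · rw [zero_mul]; exact zero_mem _
  · have e : j₁.map ⟨⟩ a * D.diff k * s =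
        j₁.map ⟨⟩ (a * R.twist (D.weight k) (μ.map ⟨⟩ s)) * D.diff k +
        (j₁.map ⟨⟩ a * D.diff k) * (s - j₁.map ⟨⟩ (μ.map ⟨⟩ s)) := by
      rw [mul_sub, map_mul, j₁.map_twist, mul_assoc _ (S.twist _ _),
        ← DGAlg.twist_mul (D.diff_mem k)]
      noncomm_ring
    rw [e]
    exact add_mem (D.mul_diff_mem μ _ k) (AddSubgroup.mem_sup_right (Conormal.prod_mem μ
      (Conormal.mul_ideal μ _ (D.diff_mem_ideal μ h₁ h₂ k)) (sub_mem_ideal μ h₁ s)))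
  · rw [mul_assoc]
    exact AddSubgroup.mem_sup_right (Conormal.prod_mem μ ha (Conormal.ideal_mul μ hb s))
  · rw [add_mul]; exact add_mem hx hy
  · rw [neg_mul]; exact neg_mem hx

/-- The elements `s` with this property are closed under sums and products, because `spanned` is a
two-sided ideal. It remains to check functions on the fibre product, where Hadamard's lemma applies,
and the generators of `R` on either side. -/
lemma EnvData.sub_mem_spanned (h₁ : ∀ a, μ.map ⟨⟩ (j₁.map ⟨⟩ a) = a)
    (h₂ : ∀ a, μ.map ⟨⟩ (j₂.map ⟨⟩ a) = a) (s : S.obj ⟨⟩) :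
    s - j₁.map ⟨⟩ (μ.map ⟨⟩ s) ∈ D.spanned μ := by
  have mul : ∀ s s', s - j₁.map ⟨⟩ (μ.map ⟨⟩ s) ∈ D.spanned μ →
      s' - j₁.map ⟨⟩ (μ.map ⟨⟩ s') ∈ D.spanned μ →
      s * s' - j₁.map ⟨⟩ (μ.map ⟨⟩ (s * s')) ∈ D.spanned μ := by
    intro s s' h h'
    have e : s * s' - j₁.map ⟨⟩ (μ.map ⟨⟩ (s * s')) = s * (s' - j₁.map ⟨⟩ (μ.map ⟨⟩ s')) +
        (s - j₁.map ⟨⟩ (μ.map ⟨⟩ s)) * j₁.map ⟨⟩ (μ.map ⟨⟩ s') := by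
      rw [map_mul, map_mul]; noncomm_ring
    rw [e]
    exact add_mem (D.mul_mem_spanned μ h₁ h₂ _ h') (D.spanned_mul μ h₁ h₂ _ h)
  have add : ∀ s s', s - j₁.map ⟨⟩ (μ.map ⟨⟩ s) ∈ D.spanned μ →
      s' - j₁.map ⟨⟩ (μ.map ⟨⟩ s') ∈ D.spanned μ →
      s + s' - j₁.map ⟨⟩ (μ.map ⟨⟩ (s + s')) ∈ D.spanned μ := by
    intro s s' h h'
    rw [map_add, map_add, add_sub_add_comm]
    exact add_mem h h'
  have hι : ∀ c, D.ι c - j₁.map ⟨⟩ (μ.map ⟨⟩ (D.ι c)) ∈ D.spanned μ := by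
    intro c
    obtain ⟨a, b, rfl⟩ := D.division.gen c
    rw [map_add, ← D.j₁_o, map_add, map_add, h₁, map_sum, add_sub_add_left_eq_sub]
    have e : ∑ i, D.ι ((D.p₂ (D.division.z i) - D.p (D.division.z i)) * b i) =
        ∑ i, D.diff (Sum.inl i) * D.ι (b i) :=
      Finset.sum_congr rfl fun i _ => by rw [map_mul, D.diff_inl]
    have e' : μ.map ⟨⟩ (∑ i, D.diff (Sum.inl i) * D.ι (b i)) = 0 := by
      rw [map_sum]
      refine Finset.sum_eq_zero fun i _ => ?_
      rw [map_mul, Conormal.mem_ideal.1 (D.diff_mem_ideal μ h₁ h₂ _), zero_mul]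
    rw [e, e', map_zero, sub_zero]
    refine sum_mem fun i _ => D.spanned_mul μ h₁ h₂ _ ?_
    have := D.mul_diff_mem μ 1 (Sum.inl i)
    rwa [map_one, one_mul] at this
  induction s using D.ind with
  | zero => simp
  | add s s' h h' => exact add _ _ h h'
  | mul c a b =>
    refine mul _ _ (hι c) (mul _ _ ?_ ?_)
    · rw [h₁, sub_self]; exact zero_mem _
    · induction b using D.free.ring_induction with
      | base a => rw [D.j₂_o]; exact hι _
      | gen g =>
        rw [h₂]
        have := D.mul_diff_mem μ 1 (Sum.inr g)
        rwa [map_one, one_mul] at this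
      | mul b b' h h' => rw [map_mul]; exact mul _ _ h h'
      | add b b' h h' => rw [map_add]; exact add _ _ h h'

/-- The basis elements of `I/I²`. -/
def EnvData.diffClass (h₁ : ∀ a, μ.map ⟨⟩ (j₁.map ⟨⟩ a) = a) (h₂ : ∀ a, μ.map ⟨⟩ (j₂.map ⟨⟩ a) = a)
    (k : D.Ind) : (Conormal.bimod j₁ j₂ μ).obj ⟨⟩ :=
  Conormal.mk μ ⟨⟩ ⟨D.diff k, D.diff_mem_ideal μ h₁ h₂ k⟩

/-- The differentials of the coordinates and generators form a basis of `I/I²`. -/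
lemma EnvData.existsUnique_repr (h₁ : ∀ a, μ.map ⟨⟩ (j₁.map ⟨⟩ a) = a)
    (h₂ : ∀ a, μ.map ⟨⟩ (j₂.map ⟨⟩ a) = a) (x : (Conormal.bimod j₁ j₂ μ).obj ⟨⟩) :
    ∃! c : D.Ind →₀ R.obj ⟨⟩, (c.sum fun k a => a • D.diffClass μ h₁ h₂ k) = x := by
  let L := Conormal.bimod j₁ j₂ μ
  let e : D.Ind → L.obj ⟨⟩ := D.diffClass μ h₁ h₂
  change ∃! c : D.Ind →₀ R.obj ⟨⟩, (c.sum fun k a => a • e k) = x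
  choose F hF hF₁ hF₂ using D.exists_functional μ h₁ h₂
  -- By the Leibniz rule the functionals vanish on `I²`, so they descend to `I/I²`.
  have hF₀ : ∀ k, ∀ a ∈ Conormal.ideal μ ⟨⟩, ∀ b ∈ Conormal.ideal μ ⟨⟩, F k (a * b) = 0 := by
    intro k a ha b hb
    rw [hF, Conormal.mem_ideal.1 ha, Conormal.mem_ideal.1 hb, map_zero, zero_mul, mul_zero, add_zero]
  let F' : D.Ind → L.obj ⟨⟩ →+ R.obj ⟨⟩ := fun k =>
    Conormal.desc μ (F k) (hF₀ k)
  have hF' : ∀ k l (a : R.obj ⟨⟩), F' k (a • e l) = Finsupp.single l a k := by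
    classical
    intro k l a
    change F k (j₁.map ⟨⟩ a * D.diff l) = _
    rw [hF, h₁, hF₁, zero_mul, add_zero, hF₂, Finsupp.single_apply, Finsupp.single_apply]
    split_ifs
    · rw [mul_one]
    · rw [mul_zero]
  obtain ⟨⟨s, hs⟩, rfl⟩ := Conormal.mk_surj μ ⟨⟩ x
  have sum_add (c c' : D.Ind →₀ R.obj ⟨⟩) : ((c + c').sum fun k a => a • e k) =
      (c.sum fun k a => a • e k) + c'.sum fun k a => a • e k :=
    Finsupp.sum_add_index' (fun _ => zero_smul _ _) (fun _ _ _ => add_smul _ _ _)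
  have key : ∃ (c : D.Ind →₀ R.obj ⟨⟩) (h : s ∈ Conormal.ideal μ ⟨⟩),
      (c.sum fun k a => a • e k) = Conormal.mk μ ⟨⟩ ⟨s, h⟩ := by
    -- For `s` in `I` the correction `j₁(μ(s))` is zero, so `s` itself is spanned modulo `I²`.
    have hs' := D.sub_mem_spanned μ h₁ h₂ s
    rw [Conormal.mem_ideal.1 hs, map_zero, sub_zero] at hs'
    clear hs
    refine D.spanned_induction μ (p := fun s => ∃ (c : D.Ind →₀ R.obj ⟨⟩)
      (h : s ∈ Conormal.ideal μ ⟨⟩), (c.sum fun k a => a • e k) = Conormal.mk μ ⟨⟩ ⟨s, h⟩) ?_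
      (fun a k => ?_) (fun a ha b hb => ?_) ?_ ?_ hs'
    · exact ⟨0, zero_mem _, Finsupp.sum_zero_index.trans (map_zero (Conormal.mk μ ⟨⟩)).symm⟩
    · exact ⟨Finsupp.single k a, Conormal.mul_ideal μ _ (D.diff_mem_ideal μ h₁ h₂ k),
        Finsupp.sum_single_index (zero_smul _ _)⟩
    · exact ⟨0, Conormal.mul_ideal μ _ hb, Finsupp.sum_zero_index.trans
        ((Conormal.mk_eq_zero μ _).2 (Conormal.prod_mem μ ha hb)).symm⟩
    · rintro s s' ⟨c, hc, e1⟩ ⟨c', hc', e2⟩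
      exact ⟨c + c', add_mem hc hc', (sum_add c c').trans
        ((congrArg₂ (· + ·) e1 e2).trans (Conormal.mk_add μ hc hc').symm)⟩
    · rintro s ⟨c, hc, e1⟩
      refine ⟨-c, neg_mem hc, ?_⟩
      have h2 := sum_add (-c) c
      rw [neg_add_cancel, Finsupp.sum_zero_index] at h2
      exact (eq_neg_of_add_eq_zero_left h2.symm).trans
        ((congrArg Neg.neg e1).trans (map_neg (Conormal.mk μ ⟨⟩) ⟨s, hc⟩).symm)
  obtain ⟨c, _, hc⟩ := key
  refine ⟨c, hc, fun c' hc' => ?_⟩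
  -- The functionals recover the coefficients of a combination, hence uniqueness.
  have coord : ∀ (c : D.Ind →₀ R.obj ⟨⟩) k, F' k (c.sum fun k a => a • e k) = c k := by
    intro c k
    rw [Finsupp.sum, map_sum]
    simp only [hF']
    rw [← Finset.sum_apply']
    exact DFunLike.congr_fun (Finsupp.sum_single c) k
  ext k
  rw [← coord c', ← coord c]
  exact congrArg (F' k) (hc'.trans hc.symm)

end ConormalBasis

/-! ### Functoriality of the conormal module. -/

section ConormalMap

variable {T T' : Type} [Preorder T] [Preorder T'] {R S : DGAlg T} {R' S' : DGAlg T'}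
  (μ : DGAlg.Hom S R) (μ' : DGAlg.Hom S' R') {t : T} {t' : T'}

lemma Conormal.map_mem_sq (g : S.obj t →+* S'.obj t')
    (hg : ∀ x ∈ Conormal.ideal μ t, g x ∈ Conormal.ideal μ' t') {x : S.obj t}
    (hx : x ∈ Conormal.sq μ t) : g x ∈ Conormal.sq μ' t' := by
  induction hx using AddSubgroup.closure_induction with
  | mem x hx =>
    obtain ⟨a, ha, b, hb, rfl⟩ := hx
    rw [map_mul]
    exact Conormal.prod_mem μ' (hg a ha) (hg b hb)
  | zero => rw [map_zero]; exact zero_mem _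
  | add x y _ _ hx hy => rw [map_add]; exact add_mem hx hy
  | neg x _ hx => rw [map_neg]; exact neg_mem hx

/-- The map of conormal modules induced by a map of rings. -/
def Conormal.ringMap (g : S.obj t →+* S'.obj t')
    (hg : ∀ x ∈ Conormal.ideal μ t, g x ∈ Conormal.ideal μ' t') :
    Conormal.Obj μ t →+ Conormal.Obj μ' t' :=
  QuotientAddGroup.map _ _ ((g.toAddMonoidHom.comp (Conormal.ideal μ t).subtype).codRestrict
    (Conormal.ideal μ' t') (fun s => hg s s.2))
    (fun _ hx => Conormal.map_mem_sq μ μ' g hg hx)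

end ConormalMap

/-! ### The stalk of the conormal module. -/

section ConormalStalk

variable {T : Type} [Preorder T] {R S : DGAlg T} (j₁ j₂ : DGAlg.Hom R S) (μ : DGAlg.Hom S R)
  (σ : DirSys T)

lemma Conormal.germ_mem_ideal {i : σ.ι} {s : S.obj (σ.site i)} (hs : s ∈ Conormal.ideal μ _) :
    (show (S.stalk σ).obj ⟨⟩ from S.germ σ i s) ∈ Conormal.ideal (DGAlg.stalkHom μ σ) ⟨⟩ := by
  rw [Conormal.mem_ideal] at hs ⊢
  refine (congrArg (R.germ σ i) hs).trans (map_zero _)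

/-- If the germ of `μ(s)` vanishes, `μ(s)` vanishes on a smaller neighbourhood, over which `s` lies
in `I`. -/
lemma Conormal.exists_germ_ideal {x : (S.stalk σ).obj ⟨⟩}
    (hx : x ∈ Conormal.ideal (DGAlg.stalkHom μ σ) ⟨⟩) :
    ∃ i, ∃ s ∈ Conormal.ideal μ (σ.site i), x = S.germ σ i s := by
  induction x using DGAlg.germ_induction with
  | h i s =>
    obtain ⟨j, hij, e⟩ := DGAlg.germ_eq_zero (show R.germ σ i (μ.map _ s) = 0 from hx)
    exact ⟨j, S.res (σ.anti hij) s, (μ.map_res _ _).trans e, (DGAlg.germ_res hij s).symm⟩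

lemma Conormal.exists_germ_ideal_gr {n : ℤ} {x : (S.stalk σ).obj ⟨⟩}
    (hx : x ∈ Conormal.ideal (DGAlg.stalkHom μ σ) ⟨⟩) (hn : x ∈ (S.stalk σ).gr ⟨⟩ n) :
    ∃ i, ∃ s ∈ Conormal.ideal μ (σ.site i), s ∈ S.gr (σ.site i) n ∧ x = S.germ σ i s := by
  obtain ⟨i, s, hs, rfl⟩ := hn
  obtain ⟨j, hij, e⟩ := DGAlg.germ_eq_zero (show R.germ σ i (μ.map _ s) = 0 from hx)
  exact ⟨j, S.res (σ.anti hij) s, (μ.map_res _ _).trans e, S.res_mem _ hs,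
    (DGAlg.germ_res hij s).symm⟩

lemma Conormal.exists_germ_sq {x : (S.stalk σ).obj ⟨⟩}
    (hx : x ∈ Conormal.sq (DGAlg.stalkHom μ σ) ⟨⟩) :
    ∃ i, ∃ s ∈ Conormal.sq μ (σ.site i), x = S.germ σ i s := by
  induction hx using AddSubgroup.closure_induction with
  | mem x hx =>
    obtain ⟨a, ha, b, hb, rfl⟩ := hx
    obtain ⟨i, a, ha', rfl⟩ := Conormal.exists_germ_ideal μ σ ha
    obtain ⟨j, b, hb', rfl⟩ := Conormal.exists_germ_ideal μ σ hb
    obtain ⟨k, hi, hj⟩ := exists_ge_ge i j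
    refine ⟨k, _, Conormal.prod_mem μ (Conormal.res_ideal μ (σ.anti hi) ha')
      (Conormal.res_ideal μ (σ.anti hj) hb'), ?_⟩
    rw [map_mul, DGAlg.germ_res hi, DGAlg.germ_res hj]
    rfl
  | zero => exact ⟨Classical.arbitrary _, 0, zero_mem _, (map_zero _).symm⟩
  | add x y _ _ hx hy =>
    obtain ⟨i, a, ha, rfl⟩ := hx
    obtain ⟨j, b, hb, rfl⟩ := hy
    obtain ⟨k, hi, hj⟩ := exists_ge_ge i j
    refine ⟨k, _, add_mem
      (Conormal.map_mem_sq μ μ (S.res (σ.anti hi)) (fun _ => Conormal.res_ideal μ (σ.anti hi)) ha)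
      (Conormal.map_mem_sq μ μ (S.res (σ.anti hj)) (fun _ => Conormal.res_ideal μ (σ.anti hj)) hb),
      ?_⟩
    rw [map_add, DGAlg.germ_res hi, DGAlg.germ_res hj]
    rfl
  | neg x _ hx =>
    obtain ⟨i, a, ha, rfl⟩ := hx
    exact ⟨i, -a, neg_mem ha, (map_neg _ _).symm⟩

/-- The comparison of the stalk of `I/I²` with the quotient formed from the stalks. -/
def Conormal.ofStalk : ((Conormal.bimod j₁ j₂ μ).stalk σ).obj ⟨⟩ →+
    Conormal.Obj (DGAlg.stalkHom μ σ) ⟨⟩ :=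
  DGMod.stalkLift (M := (Conormal.bimod j₁ j₂ μ).toDGMod)
    (fun i => Conormal.ringMap μ (DGAlg.stalkHom μ σ) (S.germS σ i)
      (fun _ => Conormal.germ_mem_ideal μ σ))
    (fun i j h x => by
      obtain ⟨⟨s, hs⟩, rfl⟩ := Conormal.mk_surj μ _ x
      exact Conormal.mk_eq _ (DGAlg.germ_res h s)
        (Conormal.germ_mem_ideal μ σ (Conormal.res_ideal μ (σ.anti h) hs))
        (Conormal.germ_mem_ideal μ σ hs))

lemma Conormal.ofStalk_mk {i : σ.ι} {s : S.obj (σ.site i)} (hs : s ∈ Conormal.ideal μ _) :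
    Conormal.ofStalk j₁ j₂ μ σ ((Conormal.bimod j₁ j₂ μ).germS σ i (Conormal.mk μ _ ⟨s, hs⟩)) =
      Conormal.mk (DGAlg.stalkHom μ σ) ⟨⟩ ⟨S.germS σ i s, Conormal.germ_mem_ideal μ σ hs⟩ := rfl

/-- An element of `I²` formed from stalks is the germ of a section of `I²`, and germs that agree
come from sections that agree on a smaller neighbourhood. -/
lemma Conormal.ofStalk_injective : Function.Injective (Conormal.ofStalk j₁ j₂ μ σ) := by
  refine (injective_iff_map_eq_zero _).2 fun x hx => ?_
  induction x using DGMod.germ_induction with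
  | h i x =>
    obtain ⟨⟨s, hs⟩, rfl⟩ := Conormal.mk_surj μ _ x
    have h1 := (Conormal.ofStalk_mk j₁ j₂ μ σ hs).symm.trans hx
    replace h1 := (Conormal.mk_eq_zero _ _).1 h1
    obtain ⟨j, s', hs', e⟩ := Conormal.exists_germ_sq μ σ h1
    obtain ⟨k, hi, hj, e⟩ := (S.ringSys σ).inj s s' e
    refine (DGMod.germ_res hi _).symm.trans ?_
    refine (congrArg ((Conormal.bimod j₁ j₂ μ).germ σ k) ((Conormal.mk_eq_zero μ
      (Conormal.res_ideal μ (σ.anti hi) hs)).2 ?_)).trans (map_zero _)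
    rw [show S.res (σ.anti hi) s = S.res (σ.anti hj) s' from e]
    exact Conormal.map_mem_sq μ μ _ (fun _ => Conormal.res_ideal μ (σ.anti hj)) hs'

lemma Conormal.ofStalk_surjective_gr {n : ℤ} {y : Conormal.Obj (DGAlg.stalkHom μ σ) ⟨⟩}
    (hy : y ∈ (Conormal.bimod (DGAlg.stalkHom j₁ σ) (DGAlg.stalkHom j₂ σ)
      (DGAlg.stalkHom μ σ)).gr ⟨⟩ n) :
    ∃ x ∈ ((Conormal.bimod j₁ j₂ μ).stalk σ).gr ⟨⟩ n, Conormal.ofStalk j₁ j₂ μ σ x = y := by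
  obtain ⟨⟨s, hs⟩, hn, rfl⟩ := hy
  obtain ⟨i, s, hs', hn', rfl⟩ := Conormal.exists_germ_ideal_gr μ σ hs hn
  exact ⟨_, ⟨i, Conormal.mk μ _ ⟨s, hs'⟩, ⟨⟨s, hs'⟩, hn', rfl⟩, rfl⟩,
    Conormal.ofStalk_mk j₁ j₂ μ σ hs'⟩

lemma Conormal.ofStalk_smul (a : (R.stalk σ).obj ⟨⟩)
    (x : ((Conormal.bimod j₁ j₂ μ).stalk σ).obj ⟨⟩) :
    Conormal.ofStalk j₁ j₂ μ σ (a • x) = Conormal.lAct (DGAlg.stalkHom j₁ σ) (DGAlg.stalkHom μ σ)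
      ⟨⟩ a (Conormal.ofStalk j₁ j₂ μ σ x) := by
  induction x using DGMod.germ_induction with
  | h i x =>
    induction a using DGAlg.germ_induction with
    | h j a =>
      have key : ∀ (k : σ.ι) (a : R.obj (σ.site k)) (x : (Conormal.bimod j₁ j₂ μ).obj (σ.site k)),
          Conormal.ofStalk j₁ j₂ μ σ (R.germ σ k a • (Conormal.bimod j₁ j₂ μ).germ σ k x) =
          Conormal.lAct (DGAlg.stalkHom j₁ σ) (DGAlg.stalkHom μ σ) ⟨⟩ (R.germ σ k a)
            (Conormal.ofStalk j₁ j₂ μ σ ((Conormal.bimod j₁ j₂ μ).germ σ k x)) := by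
        intro k a x
        obtain ⟨⟨s, hs⟩, rfl⟩ := Conormal.mk_surj μ _ x
        refine (congrArg (Conormal.ofStalk j₁ j₂ μ σ) (BiMod.germ_lsmul k a _)).trans ?_
        exact Conormal.mk_eq _ (map_mul (S.germ σ k) _ _)
          (Conormal.germ_mem_ideal μ σ (Conormal.mul_ideal μ _ hs))
          (Conormal.mul_ideal _ _ (Conormal.germ_mem_ideal μ σ hs))
      obtain ⟨k, hi, hj⟩ := exists_ge_ge i j
      rw [← DGMod.germ_res hi x, ← DGAlg.germ_res hj a]
      exact key k _ _

/-- The stalk of the conormal module is free if the stalk of the enveloping algebra is standard. -/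
lemma EnvData.nonempty_biBasis_stalk (D : EnvData (DGAlg.stalkHom j₁ σ) (DGAlg.stalkHom j₂ σ))
    (h₁ : ∀ t a, μ.map t (j₁.map t a) = a) (h₂ : ∀ t a, μ.map t (j₂.map t a) = a) :
    Nonempty (BiBasis ((Conormal.bimod j₁ j₂ μ).stalk σ)) := by
  have h₁' : ∀ a, (DGAlg.stalkHom μ σ).map ⟨⟩ ((DGAlg.stalkHom j₁ σ).map ⟨⟩ a) = a := by
    intro a
    induction a using DGAlg.germ_induction with
    | h i a => exact congrArg (R.germ σ i) (h₁ _ a)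
  have h₂' : ∀ a, (DGAlg.stalkHom μ σ).map ⟨⟩ ((DGAlg.stalkHom j₂ σ).map ⟨⟩ a) = a := by
    intro a
    induction a using DGAlg.germ_induction with
    | h i a => exact congrArg (R.germ σ i) (h₂ _ a)
  let E := Conormal.ofStalk j₁ j₂ μ σ
  have he : ∀ k, ∃ x ∈ ((Conormal.bimod j₁ j₂ μ).stalk σ).gr ⟨⟩ (D.weight k),
      E x = D.diffClass (DGAlg.stalkHom μ σ) h₁' h₂' k := fun k =>
    Conormal.ofStalk_surjective_gr j₁ j₂ μ σ ⟨⟨D.diff k, D.diff_mem_ideal _ h₁' h₂' k⟩,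
      D.diff_mem k, rfl⟩
  choose e he hE using he
  refine BiBasis.nonempty_of_existsUnique _ D.weight_nonpos he fun x => ?_
  have hsum : ∀ c : D.Ind →₀ (R.stalk σ).obj ⟨⟩, E (c.sum fun k a => a • e k) =
      c.sum fun k a => a • D.diffClass (DGAlg.stalkHom μ σ) h₁' h₂' k := by
    intro c
    rw [Finsupp.sum, map_sum]
    refine Finset.sum_congr rfl fun k _ => ?_
    refine (Conormal.ofStalk_smul j₁ j₂ μ σ _ _).trans ?_
    exact congrArg (Conormal.lAct (DGAlg.stalkHom j₁ σ) (DGAlg.stalkHom μ σ) ⟨⟩ (c k)) (hE k)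
  obtain ⟨c, hc, huniq⟩ := D.existsUnique_repr (DGAlg.stalkHom μ σ) h₁' h₂' (E x)
  exact ⟨c, Conormal.ofStalk_injective j₁ j₂ μ σ ((hsum c).trans hc),
    fun c' hc' => huniq c' ((hsum c').symm.trans (congrArg E hc'))⟩

end ConormalStalk

end AtiyahDG

end

/-- Let `R` be a free DG algebra over the structure sheaf of a system `W` of spaces smooth over
`Y`, `S` its enveloping algebra restricted to the diagonal, `ν : B → R` a free DG algebra resolution
of `R` over `S` and `∇_B` a universal connection on `B`, with `At_B = [∂, ∇_B]`. For every right
DG module `M`, `id_M ⊗ At_B`, as a morphism of right modules, represents `At_M` in `D(R)`: the maps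
`id_M ⊗ ν` and `id_M ⊗ ν ⊗ id` are isomorphisms in `D(R)` that transform it into `At_M`. -/
theorem proposition4p2p3 {A : Type} [PartialOrder A] {𝒲 : AtiyahDG.SmoothSystem A}
    {ℛ : AtiyahDG.FreeAlg 𝒲} {𝒮 : AtiyahDG.Enveloping ℛ} (ℬ : AtiyahDG.FreeResolution 𝒮)
    (nablaB : ℬ.UnivConn) (M : AtiyahDG.DGMod ℛ.R) :
    IsIso ((AtiyahDG.Q ℛ.R).map (ℬ.idTensorNu M)) ∧
    IsIso ((AtiyahDG.Q ℛ.R).map (AtiyahDG.shiftMap (ℬ.idTensorNuTensor M))) ∧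
    ∀ α : (AtiyahDG.Q ℛ.R).obj M ⟶ (AtiyahDG.Q ℛ.R).obj (AtiyahDG.tensor M 𝒮.Ω).shift,
      AtiyahDG.IsAtiyahClass 𝒮.δ M α →
        (AtiyahDG.Q ℛ.R).map (ℬ.idTensorNu M) ≫ α =
          (AtiyahDG.Q ℛ.R).map (nablaB.idTensor M) ≫
            (AtiyahDG.Q ℛ.R).map (AtiyahDG.shiftMap (ℬ.idTensorNuTensor M)) :=
  ⟨AtiyahDG.isIso_Q_map (ℬ.isQuasiIso_idTensorNu M fun _ _ hx => ℬ.exists_koszulData hx),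
    ℬ.isIso_idTensorNuTensor M (ℬ.isQuasiIso_idTensorNu M fun _ _ hx => ℬ.exists_koszulData hx)
      fun _ _ hx => (𝒮.exists_envData hx).elim fun D =>
        AtiyahDG.EnvData.nonempty_biBasis_stalk 𝒮.j₁ 𝒮.j₂ 𝒮.μ _ D 𝒮.μ_j₁ 𝒮.μ_j₂,
    fun α hα => ℬ.idTensor_comp M nablaB
      (fun M => ℬ.isQuasiIso_idTensorNu M fun _ _ hx => ℬ.exists_koszulData hx) α hα⟩
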